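/- Let $k$ be a field and $V=\bigoplus_{i\in\mathbb Z}V_i$ a graded $k$-vector space, with suspension $(sV)_i=V_{i-1}$ and $s\colon V\to sV$ the identity on elements; $\mathrm{Hom}$ denotes graded $\mathrm{Hom}$ and $T^c(sV)=\bigoplus_{n\ge 0}(sV)^{\otimes n}$. Tensor products of maps are evaluated with the Koszul sign rule. **The graded space.** Put $$\mathcal C_{AvA}(V)=\mathcal C_A(V)\oplus \mathrm{Hom}(k,V)\oplus \mathrm{Hom}(sV,V)\oplus \mathcal C_r^{\ge2}\oplus \mathcal C_l^{\ge 2},$$ where $\mathcal C_A(V)=\mathrm{Hom}(T^c(sV),sV)$ and $\mathcal C_r^{\ge2}$, $\mathcal C_l^{\ge2}$ are two copies of $\mathrm{Hom}(\bigoplus_{n\ge2}(sV)^{\otimes n},V)$. Put $\mathcal C_{r}=\mathrm{Hom}(k,V)\oplus \mathrm{Hom}(sV,V)\oplus \mathcal C_r^{\ge2}$ and $\mathcal C_{l}=\mathrm{Hom}(k,V)\oplus \mathrm{Hom}(sV,V)\oplus \mathcal C_l^{\ge2}$. Elements of $\mathcal C_A(V)$ are written $sh$, with $h=s^{-1}\circ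 sh$ and $|sh|=|h|+1$. For homogeneous maps $f,g$ on $T^c(sV)$, $g$ with values in $sV$, let $$(f\bar\circ g)(w_1\otimes\cdots\otimes w_N)=\sum_{0\le i\le j\le N}(-1)^{|g|(|w_1|+\cdots+|w_i|)}f(w_1\otimes\cdots\otimes w_i\otimes g(w_{i+1}\otimes\cdots\otimes w_j)\otimes w_{j+1}\otimes\cdots\otimes w_N),$$ and, for $f,g\in\mathcal C_A(V)$, $[f,g]_G=f\bar\circ g-(-1)^{|f||g|}g\bar\circ f$. **Signs.** $\epsilon(\sigma;x_1,\dots,x_n)$ is the Koszul sign defined by $x_1\cdots x_n=\epsilon\, x_{\sigma(1)}\cdots x_{\sigma(n)}$ for graded-commuting variables, and $\chi(\sigma;x_1,\dots,x_n)=\mathrm{sgn}(\sigma)\,\epsilon(\sigma;x_1,\dots,x_n)$. **The operations.** Multilinear operations $l_n$ ($n\ge1$) on $\mathcal C_{AvA}(V)$ are given on homogeneous elements of the five summands as follows. 1. $l_1(sh)=h\in \mathrm{Hom}(k,V)$ for $sh\in \mathrm{Hom}(k,sV)\subset\mathcal C_A(V)$, and $l_1$ vanishes on $\mathrm{Hom}((sV)^{\otimes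 n},sV)$ for $n\ge1$ and on the other summands. 2. $l_2(sf\otimes sh)=[sf,sh]_G$ for $sf,sh\in\mathcal C_A(V)$. 3. For $n\ge1$, $sh\in\mathcal C_A(V)$ and $g_1,\dots,g_n\in\mathcal C_r$, each in one of the three summands of $\mathcal C_r$, $$l^r_{n+1}(sh\otimes g_1\otimes\cdots\otimes g_n)=\sum_{\sigma\in S_n}(-1)^{\varepsilon}\Big(h\circ(sg_{\sigma(1)}\otimes\cdots\otimes sg_{\sigma(n)})-(-1)^{\theta_p}\,g_{\sigma(p)}\bar\circ\big(sh\circ(sg_{\sigma(1)}\otimes\cdots\otimes sg_{\sigma(p-1)}\otimes \mathrm{id}_{sV}\otimes sg_{\sigma(p+1)}\otimes\cdots\otimes sg_{\sigma(n)})\big)\Big),$$ where only the component of $sh$ on $(sV)^{\otimes n}$ enters, $p=p(\sigma)$ is the first position with $g_{\sigma(p)}\notin \mathrm{Hom}(k,V)$ (the second term is absent if all $g_i\in \mathrm{Hom}(k,V)$), and $$(-1)^\varepsilon=\chi(\sigma;g_1,\dots,g_n)(-1)^{n(|h|+1)+\sum_{m=1}^{n-1}\sum_{j=1}^m|g_{\sigma(j)}|},\qquad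 \theta_p=(|g_{\sigma(p)}|+1)\Big(|h|+1+\sum_{j<p}(|g_{\sigma(j)}|+1)\Big).$$ 4. For $g_1,\dots,g_n\in\mathcal C_l$, $l^l_{n+1}(sh\otimes g_1\otimes\cdots\otimes g_n)$ is given by the same formula with $p$ replaced by the last position $q$ with $g_{\sigma(q)}\notin \mathrm{Hom}(k,V)$. 5. If all $g_i$ lie in $\mathrm{Hom}(k,V)\oplus \mathrm{Hom}(sV,V)$ and at most one of them lies in $\mathrm{Hom}(sV,V)$, then $l^r_{n+1}$ and $l^l_{n+1}$ agree on $sh\otimes g_1\otimes\cdots\otimes g_n$ and $l_{n+1}:=l^r_{n+1}=l^l_{n+1}$, with value in $\mathrm{Hom}(k,V)$ if no $g_i$ lies in $\mathrm{Hom}(sV,V)$ and in $\mathrm{Hom}(sV,V)$ if exactly one does. If at least two of them lie in $\mathrm{Hom}(sV,V)$, then $l_{n+1}:=(l^r_{n+1},l^l_{n+1})\in\mathcal C_r^{\ge2}\oplus\mathcal C_l^{\ge2}$. If all $g_i\in\mathcal C_r$ and some $g_i\in\mathcal C_r^{\ge2}$, then $l_{n+1}:=l_{n+1}^r\in\mathcal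 C_r^{\ge2}$; if all $g_i\in\mathcal C_l$ and some $g_i\in\mathcal C_l^{\ge2}$, then $l_{n+1}:=l_{n+1}^l\in\mathcal C_l^{\ge2}$. 6. $l_{n+1}(g_1\otimes\cdots\otimes g_i\otimes sh\otimes g_{i+1}\otimes\cdots\otimes g_n)=(-1)^{(|h|+1)(|g_1|+\cdots+|g_i|)+i}\,l_{n+1}(sh\otimes g_1\otimes\cdots\otimes g_n)$, and the operations vanish on all other combinations of summands. **Theorem.** These formulas determine well-defined multilinear operations $\{l_n\}_{n\ge1}$ on $\mathcal C_{AvA}(V)$, and $(\mathcal C_{AvA}(V),\{l_n\}_{n\ge1})$ is an $L_\infty$-algebra. That is, $l_n$ has degree $n-2$; for homogeneous $x_1,\dots,x_n$ and $\sigma\in S_n$ one has $l_n(x_{\sigma(1)}\otimes\cdots\otimes x_{\sigma(n)})=\chi(\sigma;x_1,\dots,x_n)\,l_n(x_1\otimes\cdots\otimes x_n)$; and for all $n\ge1$ $$\sum_{i=1}^n\ \sum_{\sigma\in S(i,n-i)}\chi(\sigma;x_1,\dots,x_n)(-1)^{i(n-i)}\,l_{n-i+1}\big(l_i(x_{\sigma(1)}\otimes\cdots\otimes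 x_{\sigma(i)})\otimes x_{\sigma(i+1)}\otimes\cdots\otimes x_{\sigma(n)}\big)=0,$$ where $S(i,n-i)$ is the set of permutations $\sigma\in S_n$ with $\sigma(1)<\cdots<\sigma(i)$ and $\sigma(i+1)<\cdots<\sigma(n)$. -/

import Mathlib

open scoped DirectSum

noncomputable section

/-! ### `L∞`-algebras -/

/-- The Koszul sign `ε(σ; t₁, …, tₙ)` for graded-commuting variables of degrees `dᵢ = |tᵢ|`, that is
`t₁ ⋯ tₙ = ε t_{σ(1)} ⋯ t_{σ(n)}`: one factor `(-1)^{|t||t'|}` for each pair that `σ` inverts. -/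
def koszulSign {n : ℕ} (σ : Equiv.Perm (Fin n)) (d : Fin n → ℤ) : ℤˣ :=
  ∏ p : Fin n × Fin n with p.1 < p.2 ∧ σ p.2 < σ p.1, (d (σ p.1) * d (σ p.2)).negOnePow

/-- `χ(σ; t₁, …, tₙ) = sgn(σ) ε(σ; t₁, …, tₙ)`. -/
def chiSign {n : ℕ} (σ : Equiv.Perm (Fin n)) (d : Fin n → ℤ) : ℤˣ :=
  Equiv.Perm.sign σ * koszulSign σ d

/-- `σ` is an `(i, n - i)`-shuffle: increasing on the first `i` positions and on the others. -/
def IsShuffle {n : ℕ} (i : ℕ) (σ : Equiv.Perm (Fin n)) : Prop :=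
  ∀ a b : Fin n, a < b → ((b : ℕ) < i ∨ i ≤ (a : ℕ)) → σ a < σ b

/-- The operations `l n : L^{⊗ n} → L` (`n ≥ 1`) make the graded space `L = ⨁ d, L d` an
`L∞`-algebra. Homogeneous elements `xᵢ` of degree `d i` are the `lof k ℤ L (d i) (x i)`. -/
structure IsLInfinityAlgebra (k : Type*) [Field k] (L : ℤ → Type*) [∀ d, AddCommGroup (L d)]
    [∀ d, Module k (L d)]
    (l : ∀ n : ℕ, MultilinearMap k (fun _ : Fin n => ⨁ d, L d) (⨁ d, L d)) : Prop where
  /-- `l n` has degree `n - 2`. -/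
  degree : ∀ (n : ℕ), 1 ≤ n → ∀ (d : Fin n → ℤ) (x : ∀ i, L (d i)),
    l n (fun i => DirectSum.lof k ℤ L (d i) (x i)) ∈
      LinearMap.range (DirectSum.lof k ℤ L (∑ i, d i + n - 2))
  /-- Graded skew-symmetry. -/
  antisymm : ∀ (n : ℕ), 1 ≤ n → ∀ (d : Fin n → ℤ) (x : ∀ i, L (d i)) (σ : Equiv.Perm (Fin n)),
    l n (fun i => DirectSum.lof k ℤ L (d (σ i)) (x (σ i))) =
      chiSign σ d • l n (fun i => DirectSum.lof k ℤ L (d i) (x i))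
  /-- The generalized Jacobi identity. -/
  jacobi : ∀ (n : ℕ), 1 ≤ n → ∀ (d : Fin n → ℤ) (x : ∀ i, L (d i)),
    open Classical in
    ∑ i ∈ Finset.univ.filter (fun i : Fin (n + 1) => 1 ≤ (i : ℕ)), ∑ σ : Equiv.Perm (Fin n) with IsShuffle i σ,
      (chiSign σ d * ((i : ℤ) * ((n : ℤ) - i)).negOnePow) •
        l (n - i + 1) (Fin.cons
          (l i fun a : Fin i => DirectSum.lof k ℤ L _ (x (σ (Fin.castLE i.is_le a))))
          fun b : Fin (n - i) =>
            DirectSum.lof k ℤ L _ (x (σ ⟨i + b, by omega⟩))) = 0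

/-! ### Graded spaces of multilinear cochains

The suspension `sV` of a graded space `V = ⨁ d, 𝒱 d` is `V` itself with the grading shifted,
`(sV)_j = V_{j-1}`, and `s : V → sV` is the identity on elements. The tensor `w₁ ⊗ ⋯ ⊗ wₙ` in
`T^c(sV) = ⨁ n, (sV)^{⊗ n}` is written as the word `[w₁, …, wₙ]`, so that a linear map on
`T^c(sV)` is a function on words which is multilinear on the words of each length. -/

section Cochains

variable {k : Type*} [Field k] {V : Type*} [AddCommGroup V] [Module k V]

/-- The grading of `sV`. -/
def suspension (𝒱 : ℤ → Submodule k V) : ℤ → Submodule k V := fun j => 𝒱 (j - 1)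

/-- `Hom(⨁_{n ∈ S} W^{⊗ n}, U)_d`: linear maps of degree `d`, where `W`, `U` are the
graded spaces with homogeneous components `𝒲 j`, `𝒰 j`. -/
def gradedHom (𝒲 𝒰 : ℤ → Submodule k V) (S : Set ℕ) (d : ℤ) : Submodule k (List V → V) where
  carrier := {f |
    (∀ n : ℕ, ∃ φ : MultilinearMap k (fun _ : Fin n => V) V, ∀ w, f (List.ofFn w) = φ w) ∧
    (∀ w : List V, w.length ∉ S → f w = 0) ∧
    ∀ (n : ℕ) (w : Fin n → V) (e : Fin n → ℤ), (∀ i, w i ∈ 𝒲 (e i)) →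
      f (List.ofFn w) ∈ 𝒰 (∑ i, e i + d)}
  add_mem' := by
    rintro f g ⟨hf, hf', hf''⟩ ⟨hg, hg', hg''⟩
    refine ⟨fun n => ?_, fun w hw => ?_, fun n w e h => ?_⟩
    · obtain ⟨φ, hφ⟩ := hf n
      obtain ⟨ψ, hψ⟩ := hg n
      exact ⟨φ + ψ, fun w => by simp [hφ, hψ]⟩
    · simp [hf' w hw, hg' w hw]
    · exact Submodule.add_mem _ (hf'' n w e h) (hg'' n w e h)
  zero_mem' := ⟨fun _ => ⟨0, fun _ => rfl⟩, fun _ _ => rfl, fun _ _ _ _ => Submodule.zero_mem _⟩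
  smul_mem' := by
    rintro c f ⟨hf, hf', hf''⟩
    refine ⟨fun n => ?_, fun w hw => ?_, fun n w e h => ?_⟩
    · obtain ⟨φ, hφ⟩ := hf n
      exact ⟨c • φ, fun w => by simp [hφ]⟩
    · simp [hf' w hw]
    · exact Submodule.smul_mem _ c (hf'' n w e h)

/-- The five direct summands of `C_AvA(V)`:
`alg` is `C_A(V) = Hom(T^c(sV), sV)`, `const` is `Hom(k, V)`, `lin` is `Hom(sV, V)`,
`right` is `C_AvO(V)_r^{≥ 2}` and `left` is `C_AvO(V)_l^{≥ 2}`. -/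
inductive Summand : Type
  | alg | const | lin | right | left
  deriving DecidableEq

/-- The tensor powers of `sV` on which the elements of a summand are defined. -/
def Summand.arities : Summand → Set ℕ
  | .alg => Set.univ
  | .const => {0}
  | .lin => {1}
  | .right => {n | 2 ≤ n}
  | .left => {n | 2 ≤ n}

/-- The grading of the target: `sV` for `C_A(V)`, and `V` for the other summands. -/
def Summand.target (𝒱 : ℤ → Submodule k V) : Summand → ℤ → Submodule k V
  | .alg => suspension 𝒱
  | _ => 𝒱

/-- The component of degree `d` of the graded space `C_AvA(V)`. -/
def AvA (𝒱 : ℤ → Submodule k V) (d : ℤ) : Submodule k (Summand → List V → V) :=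
  Submodule.pi Set.univ fun P => gradedHom (suspension 𝒱) (P.target 𝒱) P.arities d

/-! ### Compositions -/

section Compositions

variable (𝒱 : ℤ → Submodule k V) [DirectSum.Decomposition 𝒱]

/-- The linear map `w ↦ (-1)^{e |w|} w` on `sV`, where `|w| = j + 1` for `w ∈ 𝒱 j`. -/
def twist (e : ℤ) : V →ₗ[k] V :=
  (DirectSum.toModule k ℤ V fun j => (e * (j + 1)).negOnePow • (𝒱 j).subtype) ∘ₗ
    (DirectSum.decomposeLinearEquiv 𝒱).toLinearMap

/-- `f ∘ (g₁ ⊗ ⋯ ⊗ gₙ)`, for a list of maps `gᵢ : T^c(sV) → sV` together with their degrees.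
The sum is over all ways of cutting the word into `n` consecutive blocks, with the Koszul rule
`(g₁ ⊗ g)(u ⊗ v) = (-1)^{|g||u|} g₁(u) ⊗ g(v)`. -/
def compTensor (f : List V → V) : List (ℤ × (List V → V)) → List V → V
  | [], w => if w = [] then f [] else 0
  | (_, g) :: gs, w => ∑ i ∈ Finset.range (w.length + 1),
      compTensor
        (fun out => f (g ((w.take i).map (twist 𝒱 (gs.map Prod.fst).sum)) :: out)) gs (w.drop i)

/-- `f ∘̄ g` for `g` of degree `e`: the sum over all decompositions `w = u v z` of
`(-1)^{|g||u|} f(u ⊗ g(v) ⊗ z)`. -/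
def insertion (f : List V → V) (e : ℤ) (g : List V → V) (w : List V) : V :=
  ∑ i ∈ Finset.range (w.length + 1), ∑ j ∈ Finset.range (w.length - i + 1),
    f ((w.take i).map (twist 𝒱 e) ++ g ((w.drop i).take j) :: (w.drop i).drop j)

/-- The Gerstenhaber bracket of `f`, `g` of degrees `d`, `e`. -/
def gerstenhaber (d : ℤ) (f : List V → V) (e : ℤ) (g : List V → V) : List V → V :=
  insertion 𝒱 f e g - (d * e).negOnePow • insertion 𝒱 g d f

/-- The identity map of `sV`. -/
def idWord : List V → V
  | [w] => w
  | _ => 0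

/-! ### The operations

Below `c i` is the summand to which an argument belongs, `d i` is its degree in `C_AvA(V)`. For
`sh` in `C_A(V)` of degree `e`, `h = s⁻¹(sh)` has degree `e - 1`; for `g` of degree `d` in one of
the other summands, `sg` has degree `d + 1`. Since `s` is the identity on elements, `h` and `sh`
(`g` and `sg`) are the same functions on words. -/

/-- The sign `(-1)^ε` with `(-1)^ε = χ(σ; g₁, …, gₙ) (-1)^{n(|h|+1) + ∑_{k=1}^{n-1} ∑_{j≤k} |g_{σ(j)}|}`,
where `η = |h|`. -/
def epsSign {n : ℕ} (η : ℤ) (d : Fin n → ℤ) (σ : Equiv.Perm (Fin n)) : ℤˣ :=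
  chiSign σ d * (n * (η + 1) +
    ∑ m ∈ Finset.univ.filter (fun m : Fin n => (m : ℕ) + 1 < n),
      ∑ j : Fin n with j ≤ m, d (σ j)).negOnePow

/-- The summand for `σ = id` and the position `p` of the second kind of term in the higher brackets:
`(-1)^{(|g_p|+1)(|h|+1+∑_{j<p}(|g_j|+1))} g_p ∘̄ (sh ∘ (sg₁ ⊗ ⋯ ⊗ sg_{p-1} ⊗ id ⊗ sg_{p+1} ⊗ ⋯ ⊗ sgₙ))`,
where `η = |h|`. -/
def outerTerm {n : ℕ} (η : ℤ) (h : List V → V) (d : Fin n → ℤ) (g : Fin n → List V → V)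
    (p : Fin n) : List V → V :=
  ((d p + 1) * (η + 1 + ∑ j with j < p, (d j + 1))).negOnePow •
    insertion 𝒱 (g p) (η + 1 + ∑ j with j ≠ p, (d j + 1))
      (compTensor 𝒱 h (List.ofFn fun j => if j = p then (0, idWord) else (d j + 1, g j)))

/-- `l_{n+1}^r(sh ⊗ g₁ ⊗ ⋯ ⊗ gₙ)`. Here `p` is the position with `g_{σ(1)}, …, g_{σ(p-1)}` in
`Hom(k, V)` and `g_{σ(p)}` not in `Hom(k, V)`; if all the `gᵢ` are in `Hom(k, V)` there is no such
position and no second term. -/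
def rightBracket {n : ℕ} (η : ℤ) (h : List V → V) (c : Fin n → Summand) (d : Fin n → ℤ)
    (g : Fin n → List V → V) : List V → V :=
  ∑ σ : Equiv.Perm (Fin n), epsSign η d σ •
    (compTensor 𝒱 h (List.ofFn fun j => (d (σ j) + 1, g (σ j))) -
      ∑ p : Fin n with c (σ p) ≠ .const ∧ ∀ j < p, c (σ j) = .const,
        outerTerm 𝒱 η h (d ∘ σ) (g ∘ σ) p)

/-- `l_{n+1}^l(sh ⊗ g₁ ⊗ ⋯ ⊗ gₙ)`. Here `q` is the position with `g_{σ(q+1)}, …, g_{σ(n)}` in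
`Hom(k, V)` and `g_{σ(q)}` not in `Hom(k, V)`, if there is one. -/
def leftBracket {n : ℕ} (η : ℤ) (h : List V → V) (c : Fin n → Summand) (d : Fin n → ℤ)
    (g : Fin n → List V → V) : List V → V :=
  ∑ σ : Equiv.Perm (Fin n), epsSign η d σ •
    (compTensor 𝒱 h (List.ofFn fun j => (d (σ j) + 1, g (σ j))) -
      ∑ q : Fin n with c (σ q) ≠ .const ∧ ∀ j > q, c (σ j) = .const,
        outerTerm 𝒱 η h (d ∘ σ) (g ∘ σ) q)

/-- `l_{n+1}(sh ⊗ g₁ ⊗ ⋯ ⊗ gₙ)` for `gᵢ` in the summand `c i ≠ alg`, as an element of the direct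
sum of the five summands; `Pi.single P f` is `f` placed in the summand `P`. -/
def leadingBracket {n : ℕ} (η : ℤ) (h : List V → V) (c : Fin n → Summand) (d : Fin n → ℤ)
    (g : Fin n → List V → V) : Summand → List V → V :=
  if ∀ i, c i = .const ∨ c i = .lin then
    if ∀ i, c i = .const then
      Pi.single .const (rightBracket 𝒱 η h c d g)
    else if (Finset.univ.filter fun i => c i = .lin).card = 1 then
      Pi.single .lin (rightBracket 𝒱 η h c d g)
    else
      Pi.single .right (rightBracket 𝒱 η h c d g) + Pi.single .left (leftBracket 𝒱 η h c d g)
  else if ∀ i, c i = .const ∨ c i = .lin ∨ c i = .right then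
    Pi.single .right (rightBracket 𝒱 η h c d g)
  else if ∀ i, c i = .const ∨ c i = .lin ∨ c i = .left then
    Pi.single .left (leftBracket 𝒱 η h c d g)
  else 0

/-- The value of `l_{n+1}` on `n + 1` arguments exactly one of which, at position `j`, is in
`C_A(V)` (and `0` if that is not the case):
`l_{n+1}(g₁ ⊗ ⋯ ⊗ g_j ⊗ sh ⊗ g_{j+1} ⊗ ⋯ ⊗ gₙ) =
  (-1)^{(|h|+1)(|g₁|+⋯+|g_j|) + j} l_{n+1}(sh ⊗ g₁ ⊗ ⋯ ⊗ gₙ)`. -/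
def mixedBracket {n : ℕ} (c : Fin (n + 1) → Summand) (d : Fin (n + 1) → ℤ)
    (f : Fin (n + 1) → List V → V) : Summand → List V → V :=
  ∑ j : Fin (n + 1) with c j = .alg ∧ ∀ i : Fin n, c (j.succAbove i) ≠ .alg,
    (d j * (∑ i with i < j, d i) + (j : ℕ)).negOnePow •
      leadingBracket 𝒱 (d j - 1) (f j) (fun i => c (j.succAbove i)) (fun i => d (j.succAbove i))
        (fun i => f (j.succAbove i))

/-- The value `lₙ(f₁ ⊗ ⋯ ⊗ fₙ)` in `C_AvA(V)` of the `n`-th operation on homogeneous elements `fᵢ`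
of degree `d i` in the summand `c i`. -/
def averagingBracket : (n : ℕ) → (Fin n → Summand) → (Fin n → ℤ) → (Fin n → List V → V) →
    Summand → List V → V
  | 0, _, _, _ => 0
  | 1, c, _, f =>
      if c 0 = .alg then Pi.single .const fun w => if w = [] then f 0 [] else 0 else 0
  | 2, c, d, f =>
      if c 0 = .alg ∧ c 1 = .alg then Pi.single .alg (gerstenhaber 𝒱 (d 0) (f 0) (d 1) (f 1))
      else mixedBracket 𝒱 c d f
  | _ + 3, c, d, f => mixedBracket 𝒱 c d f

/-- The multilinear operations `l n` on `C_AvA(V) = ⨁ d, AvA 𝒱 d` are the ones given on homogeneous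
elements of the summands by `averagingBracket` (the values being elements of `C_AvA(V)` of degree
`|x₁| + ⋯ + |xₙ| + n - 2`). -/
def IsAveragingOperations
    (l : ∀ n : ℕ, MultilinearMap k (fun _ : Fin n => ⨁ d, AvA 𝒱 d) (⨁ d, AvA 𝒱 d)) : Prop :=
  ∀ (n : ℕ) (c : Fin n → Summand) (d : Fin n → ℤ) (x : ∀ i, AvA 𝒱 (d i)),
    (∀ i, ∀ P ≠ c i, (x i : Summand → List V → V) P = 0) →
    ∃ y : AvA 𝒱 (∑ i, d i + n - 2),
      (y : Summand → List V → V) =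
        averagingBracket 𝒱 n c d (fun i => (x i : Summand → List V → V) (c i)) ∧
      l n (fun i => DirectSum.lof k ℤ (fun d => AvA 𝒱 d) (d i) (x i)) =
        DirectSum.lof k ℤ (fun d => AvA 𝒱 d) _ y

end Compositions

end Cochains

end

open scoped DirectSum

noncomputable section

set_option linter.unusedSectionVars false

/-! ### Sums over decompositions of words -/

section Words

variable {α Y Z : Type*} [AddCommGroup Y] [AddCommGroup Z]

/-! The conceptual reason is that `C_A(V)`, with the Gerstenhaber bracket, is a graded Lie algebra
acting by formal vector fields on `C_r` and on `C_l`. For an operation `h` on the tensor coalgebra,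
the vector field on `C_r` has at `g` the value `h ∘ exp(g) - g ∘̄ (h ∘ (exp(g₋) ⊗ id ⊗ exp(g₊)))`,
where `exp(g)` is the sum of the tensor powers of `g`, `g₋` is the restriction of `g` to the empty
word and `g₊ = g`; on `C_l` the roles of the two sides are exchanged. The brackets of `sh` with `g₁,
…, gₙ` are the Taylor coefficients of this field, and `l₁` is its value at `g = 0`. A Lie algebra
acting by vector fields gives an `L∞`-algebra on the direct sum, and its Jacobi identity has two
kinds of nontrivial components: three arguments in the Lie algebra, where it is the Jacobi identity
of the Lie algebra, and two arguments in the Lie algebra, where it says that commutators go to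
commutators.

The heart of the proof is therefore `vectorField_commutator`, proved without signs and in polarised
form: instead of powers of one `g` there is a family `gₐ`, and everything is multilinear in the `gₐ`
with `a` in a finite set `S`. Derivatives become sums over decompositions of `S`. Two facts carry
it. First, the derivatives of `f ∘ exp(g)` and of `f ∘ (exp(g₋) ⊗ id ⊗ exp(g₊))` along the vector
field are computed in `partSum_expMidExp` and `partSum_expIdExp`; the latter applies because
truncation to the empty word is compatible with the field (`emptyPart_vectorField`). Second, the
remaining terms are symmetric in the two operations because insertion is a pre-Lie product
(`ins_assoc_symm`).

Koszul signs are restored by extension of scalars. Every argument and every letter is multiplied by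
its own graded-commuting symbol, so that everything becomes even; `Represents` says that an unsigned
operation on `Λ ⊗ V` restricts to a given signed one on `V`. By `WordLinear.eq_zero_of_letters`, an
identity of signed operations may be checked in `Λ ⊗ V`. The passage from the signs `χ`, in
unshifted degrees, to Koszul signs of the symbols is décalage: the two differ by a coboundary
(`chiSign_mul_koszulSign`), evaluated for one bracket in `represents_vectorField` and for two nested
brackets in `represents_pairField` and `represents_commutator`. Shuffles correspond to subsets of
the arguments (`sum_isShuffle`), and the terms of the Jacobi identity are grouped by the pair of
arguments taken from `C_A(V)`; each group cancels by the commutator formula, which gives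
`jacobi_mixedSum`.

It remains to compare with the stated formulas. Choosing the first position outside `Hom(k, V)` is
the same as summing over all positions while truncating the factors before it (`rightBracket_eq`,
`leftBracket_eq`). The right and left brackets agree on words of length at most one, so they glue to
one operation on the five summands whose projection to `C_r` or `C_l` is the corresponding bracket
(`sidePart_totalBracket`). This operation is the prescribed one on elements of the summands
(`totalBracket_eq_averagingBracket`), and multilinearity gives uniqueness. -/

/-- The sum of `F u v` over all decompositions `w = u ++ v`. -/
def splitSum : List α → (List α → List α → Y) → Y
  | [], F => F [] []
  | x :: w, F => F [] (x :: w) + splitSum w fun u v => F (x :: u) v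

@[simp] theorem splitSum_nil (F : List α → List α → Y) : splitSum [] F = F [] [] := rfl

theorem splitSum_cons (x : α) (w : List α) (F : List α → List α → Y) :
    splitSum (x :: w) F = F [] (x :: w) + splitSum w fun u v => F (x :: u) v := rfl

theorem splitSum_eq_sum_range (w : List α) (F : List α → List α → Y) :
    splitSum w F = ∑ i ∈ Finset.range (w.length + 1), F (w.take i) (w.drop i) := by
  induction w generalizing F with
  | nil => simp
  | cons x w ih =>
    rw [splitSum_cons, ih, List.length_cons, Finset.sum_range_succ' _ (w.length + 1), add_comm]
    simp

theorem splitSum_congr {w : List α} {F G : List α → List α → Y}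
    (h : ∀ u v, u ++ v = w → F u v = G u v) : splitSum w F = splitSum w G := by
  simp only [splitSum_eq_sum_range]
  exact Finset.sum_congr rfl fun i _ => h _ _ (List.take_append_drop i w)

theorem splitSum_eq_zero {w : List α} {F : List α → List α → Y}
    (h : ∀ u v, u ++ v = w → F u v = 0) : splitSum w F = 0 := by
  simp only [splitSum_eq_sum_range]
  exact Finset.sum_eq_zero fun i _ => h _ _ (List.take_append_drop i w)

@[simp] theorem splitSum_zero (w : List α) : splitSum w (fun _ _ => (0 : Y)) = 0 :=
  splitSum_eq_zero fun _ _ _ => rfl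

theorem splitSum_add (w : List α) (F G : List α → List α → Y) :
    splitSum w (fun u v => F u v + G u v) = splitSum w F + splitSum w G := by
  simp [splitSum_eq_sum_range, Finset.sum_add_distrib]

theorem splitSum_sub (w : List α) (F G : List α → List α → Y) :
    splitSum w (fun u v => F u v - G u v) = splitSum w F - splitSum w G := by
  simp [splitSum_eq_sum_range, Finset.sum_sub_distrib]

theorem splitSum_smul {R : Type*} [Monoid R] [DistribMulAction R Y] (c : R) (w : List α)
    (F : List α → List α → Y) :
    splitSum w (fun u v => c • F u v) = c • splitSum w F := by
  simp [splitSum_eq_sum_range, Finset.smul_sum]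

theorem splitSum_sum {ι : Type*} (s : Finset ι) (w : List α) (F : ι → List α → List α → Y) :
    splitSum w (fun u v => ∑ i ∈ s, F i u v) = ∑ i ∈ s, splitSum w (F i) := by
  simp only [splitSum_eq_sum_range]
  exact Finset.sum_comm

theorem splitSum_map (φ : Y →+ Z) (w : List α) (F : List α → List α → Y) :
    φ (splitSum w F) = splitSum w fun u v => φ (F u v) := by
  simp [splitSum_eq_sum_range]

theorem splitSum_comm {β : Type*} (w : List α) (w' : List β)
    (F : List α → List α → List β → List β → Y) :
    splitSum w (fun u v => splitSum w' (F u v)) =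
      splitSum w' fun u' v' => splitSum w fun u v => F u v u' v' := by
  simp only [splitSum_eq_sum_range]
  exact Finset.sum_comm

theorem splitSum_list_map {β : Type*} (f : β → α) (w : List β) (F : List α → List α → Y) :
    splitSum (w.map f) F = splitSum w fun u v => F (u.map f) (v.map f) := by
  simp [splitSum_eq_sum_range, List.map_take, List.map_drop]

theorem splitSum_assoc (w : List α) (F : List α → List α → List α → Y) :
    splitSum w (fun u z => splitSum u fun x y => F x y z) =
      splitSum w fun x t => splitSum t fun y z => F x y z := by
  induction w generalizing F with
  | nil => rfl
  | cons a w ih =>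
    simp only [splitSum_cons, splitSum_nil, splitSum_add]
    rw [ih fun x y z => F (a :: x) y z]
    abel

/-- The cut at the junction of `w` and `w'` is counted by both sums, whence the subtracted term. -/
theorem splitSum_append (w w' : List α) (F : List α → List α → Y) :
    splitSum (w ++ w') F =
      splitSum w (fun u v => F u (v ++ w')) + splitSum w' (fun u v => F (w ++ u) v) -
        F w w' := by
  induction w generalizing F with
  | nil => simp
  | cons a w ih =>
    simp only [splitSum_cons, List.cons_append, ih]
    abel

/-- A cut lies either to the left or to the right of the letter `m`, so here nothing is counted
twice. -/
theorem splitSum_insert (x z : List α) (m : α) (F : List α → List α → Y) :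
    splitSum (x ++ m :: z) F =
      splitSum x (fun u v => F u (v ++ m :: z)) +
        splitSum z fun u v => F (x ++ m :: u) v := by
  rw [splitSum_append, splitSum_cons]
  simp only [List.append_nil]
  abel

/-- The sum of `F u x v` over all decompositions `w = u ++ x :: v`. -/
def markSum : List α → (List α → α → List α → Y) → Y
  | [], _ => 0
  | x :: w, F => F [] x w + markSum w fun u => F (x :: u)

@[simp] theorem markSum_nil (F : List α → α → List α → Y) : markSum [] F = 0 := rfl

theorem markSum_cons (x : α) (w : List α) (F : List α → α → List α → Y) :
    markSum (x :: w) F = F [] x w + markSum w fun u => F (x :: u) := rfl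

theorem markSum_add (w : List α) (F G : List α → α → List α → Y) :
    markSum w (fun u x v => F u x v + G u x v) = markSum w F + markSum w G := by
  induction w generalizing F G with
  | nil => simp
  | cons a w ih => simp only [markSum_cons, ih]; abel

theorem markSum_map (φ : Y →+ Z) (w : List α) (F : List α → α → List α → Y) :
    φ (markSum w F) = markSum w fun u x v => φ (F u x v) := by
  induction w generalizing F with
  | nil => simp
  | cons a w ih => simp only [markSum_cons, map_add, ih]

theorem markSum_congr {w : List α} {F G : List α → α → List α → Y}
    (h : ∀ u x v, u ++ x :: v = w → F u x v = G u x v) : markSum w F = markSum w G := by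
  induction w generalizing F G with
  | nil => rfl
  | cons a w ih =>
    rw [markSum_cons, markSum_cons, h [] a w rfl]
    congr 1
    exact ih fun u x v huv => h _ _ _ (by simp [huv])

theorem markSum_splitSum_swap {β : Type*} (w : List α) (w' : List β)
    (F : List α → α → List α → List β → List β → Y) :
    markSum w (fun u x v => splitSum w' (F u x v)) =
      splitSum w' fun u' v' => markSum w fun u x v => F u x v u' v' := by
  induction w generalizing F with
  | nil => simp
  | cons a w ih => simp only [markSum_cons, ih, splitSum_add]

theorem markSum_sum {ι : Type*} (s : Finset ι) (w : List α) (F : ι → List α → α → List α → Y) :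
    markSum w (fun u x v => ∑ i ∈ s, F i u x v) = ∑ i ∈ s, markSum w (F i) := by
  induction w generalizing F with
  | nil => simp
  | cons a w ih => simp only [markSum_cons, ih, Finset.sum_add_distrib]

theorem markSum_insert (x z : List α) (m : α) (F : List α → α → List α → Y) :
    markSum (x ++ m :: z) F =
      markSum x (fun u a v => F u a (v ++ m :: z)) + F x m z +
        markSum z fun u a v => F (x ++ m :: u) a v := by
  induction x generalizing F with
  | nil => simp [markSum_cons]
  | cons a x ih =>
    simp only [List.cons_append, markSum_cons, ih]
    abel

/-- Marking a letter of the second of three factors. -/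
theorem splitSum_markSum_assoc (w : List α)
    (F : List α → List α → α → List α → List α → Y) :
    splitSum w (fun x t => splitSum t fun y z => markSum y fun u a v => F x u a v z) =
      markSum w fun s a t => splitSum s fun x u => splitSum t fun v z => F x u a v z := by
  induction w generalizing F with
  | nil => rfl
  | cons b w ih =>
    have h1 : ∀ (w : List α) (G : List α → α → List α → List α → Y),
        splitSum w (fun y z => markSum y fun u a v => G u a v z) =
          markSum w fun s a t => splitSum t fun v z => G s a v z := by
      intro w
      induction w with
      | nil => intro G; rfl
      | cons c w ihw =>
        intro G
        simp only [splitSum_cons, markSum_cons, markSum_nil, zero_add, splitSum_add, ihw]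
    simp only [splitSum_cons, markSum_cons, splitSum_nil, h1, markSum_add]
    rw [← ih, add_assoc]
    simp only [h1]

theorem markSum_splitSum_left (w : List α) (F : List α → List α → α → List α → Y) :
    markSum w (fun s a t => splitSum s fun x u => F x u a t) =
      splitSum w fun x r => markSum r fun u a t => F x u a t := by
  induction w generalizing F with
  | nil => rfl
  | cons b w ih => simp only [splitSum_cons, markSum_cons, splitSum_nil, markSum_add, ih]; abel

theorem markSum_splitSum_right (w : List α) (F : List α → α → List α → List α → Y) :
    markSum w (fun s a t => splitSum t fun v z => F s a v z) =
      splitSum w fun r z => markSum r fun s a v => F s a v z := by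
  induction w generalizing F with
  | nil => rfl
  | cons b w ih => simp only [splitSum_cons, markSum_cons, markSum_nil, zero_add, splitSum_add, ih]

end Words

/-! ### Sums over decompositions of finite sets -/

section Sets

variable {I Y : Type*} [DecidableEq I] [AddCommGroup Y]

/-- The sum of `F A B` over all decompositions `S = A ⊔ B`. -/
def partSum (S : Finset I) (F : Finset I → Finset I → Y) : Y :=
  ∑ A ∈ S.powerset, F A (S \ A)

theorem partSum_congr {S : Finset I} {F G : Finset I → Finset I → Y}
    (h : ∀ A ⊆ S, F A (S \ A) = G A (S \ A)) : partSum S F = partSum S G :=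
  Finset.sum_congr rfl fun A hA => h A (Finset.mem_powerset.1 hA)

theorem partSum_add (S : Finset I) (F G : Finset I → Finset I → Y) :
    partSum S (fun A B => F A B + G A B) = partSum S F + partSum S G :=
  Finset.sum_add_distrib

theorem partSum_sub (S : Finset I) (F G : Finset I → Finset I → Y) :
    partSum S (fun A B => F A B - G A B) = partSum S F - partSum S G :=
  Finset.sum_sub_distrib _ _

theorem partSum_swap (S : Finset I) (F : Finset I → Finset I → Y) :
    partSum S F = partSum S fun A B => F B A := by
  refine Finset.sum_nbij' (S \ ·) (S \ ·) ?_ ?_ ?_ ?_ ?_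
  · simp
  · simp
  · exact fun A hA => Finset.sdiff_sdiff_eq_self (Finset.mem_powerset.1 hA)
  · exact fun A hA => Finset.sdiff_sdiff_eq_self (Finset.mem_powerset.1 hA)
  · intro A hA
    simp only [Finset.sdiff_sdiff_eq_self (Finset.mem_powerset.1 hA)]

/-- Both sides run over the ordered decompositions of `S` into three parts. -/
theorem partSum_assoc (S : Finset I) (F : Finset I → Finset I → Finset I → Y) :
    partSum S (fun D C => partSum D fun A B => F A B C) =
      partSum S fun A D => partSum D fun B C => F A B C := by
  simp only [partSum, Finset.sum_sigma']
  refine Finset.sum_nbij' (fun x => ⟨x.2, x.1 \ x.2⟩) (fun x => ⟨x.1 ∪ x.2, x.1⟩) ?_ ?_ ?_ ?_ ?_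
  · rintro ⟨D, A⟩ h
    simp only [Finset.mem_sigma, Finset.mem_powerset] at h ⊢
    exact ⟨h.2.trans h.1, Finset.sdiff_subset_sdiff h.1 le_rfl⟩
  · rintro ⟨A, B⟩ h
    simp only [Finset.mem_sigma, Finset.mem_powerset] at h ⊢
    exact ⟨Finset.union_subset h.1 (h.2.trans Finset.sdiff_subset), Finset.subset_union_left⟩
  · rintro ⟨D, A⟩ h
    simp only [Finset.mem_sigma, Finset.mem_powerset] at h
    simp [Finset.union_eq_right.2 h.2]
  · rintro ⟨A, B⟩ h
    simp only [Finset.mem_sigma, Finset.mem_powerset] at h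
    simp only [Sigma.mk.injEq, heq_eq_eq, true_and]
    rw [Finset.union_sdiff_cancel_left]
    exact (Finset.disjoint_of_subset_left h.2 Finset.sdiff_disjoint).symm
  · rintro ⟨D, A⟩ h
    simp only [Finset.mem_sigma, Finset.mem_powerset] at h
    congr 1
    ext x
    have := @h.1 x
    have := @h.2 x
    simp only [Finset.mem_sdiff]
    tauto

theorem partSum_mem_left (S : Finset I) (F : I → Finset I → Finset I → Y) :
    partSum S (fun A B => ∑ a ∈ A, F a (A.erase a) B) =
      ∑ a ∈ S, partSum (S.erase a) (F a) := by
  simp only [partSum, Finset.sum_sigma']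
  refine Finset.sum_nbij' (fun x => ⟨x.2, x.1.erase x.2⟩) (fun x => ⟨insert x.1 x.2, x.1⟩)
    ?_ ?_ ?_ ?_ ?_
  · rintro ⟨A, a⟩ h
    simp only [Finset.mem_sigma, Finset.mem_powerset] at h ⊢
    exact ⟨h.1 h.2, Finset.erase_subset_erase _ h.1⟩
  · rintro ⟨a, A⟩ h
    simp only [Finset.mem_sigma, Finset.mem_powerset] at h ⊢
    exact ⟨Finset.insert_subset h.1 (h.2.trans (Finset.erase_subset _ _)),
      Finset.mem_insert_self _ _⟩
  · rintro ⟨A, a⟩ h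
    simp only [Finset.mem_sigma] at h
    simp [Finset.insert_erase h.2]
  · rintro ⟨a, A⟩ h
    simp only [Finset.mem_sigma, Finset.mem_powerset] at h
    simp only [Sigma.mk.injEq, heq_eq_eq, true_and]
    exact Finset.erase_insert fun h' => by simpa using h.2 h'
  · rintro ⟨A, a⟩ h
    simp only [Finset.mem_sigma, Finset.mem_powerset] at h
    congr 1
    ext x
    simp only [Finset.mem_sdiff, Finset.mem_erase]
    by_cases hx : x = a
    · subst hx; simp [h.2]
    · simp [hx]

theorem partSum_mem_right (S : Finset I) (F : I → Finset I → Finset I → Y) :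
    partSum S (fun A B => ∑ a ∈ B, F a A (B.erase a)) =
      ∑ a ∈ S, partSum (S.erase a) (F a) := by
  rw [partSum_swap, partSum_mem_left S fun a B A => F a A B]
  exact Finset.sum_congr rfl fun a _ => partSum_swap _ _

theorem partSum_insert {S : Finset I} {i : I} (hi : i ∉ S) (F : Finset I → Finset I → Y) :
    partSum (insert i S) F =
      partSum S (fun A B => F (insert i A) B) + partSum S fun A B => F A (insert i B) := by
  rw [partSum, Finset.sum_powerset_insert hi, add_comm]
  congr 1 <;> refine Finset.sum_congr rfl fun A hA => ?_
  · rw [Finset.mem_powerset] at hA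
    congr 1
    ext x
    by_cases hx : x = i
    · subst hx; simp [hi]
    · simp [hx]
  · rw [Finset.mem_powerset] at hA
    congr 1
    ext x
    by_cases hx : x = i
    · subst hx; simpa using fun h => hi (hA h)
    · simp [hx]

/-- Auxiliary recursion for `enumSum`. -/
def enumSumAux : ℕ → Finset I → (List I → Y) → Y
  | 0, _, F => F []
  | n + 1, S, F => ∑ a ∈ S, enumSumAux n (S.erase a) fun l => F (a :: l)

/-- The sum of `F l` over all enumerations `l` of the finite set `S`. -/
def enumSum (S : Finset I) (F : List I → Y) : Y := enumSumAux S.card S F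

/-- The fuel `S.card` of `enumSumAux` disappears here; what remains is recursion on the first entry
of the enumeration. -/
theorem enumSum_rec (S : Finset I) (F : List I → Y) :
    enumSum S F = (if S = ∅ then F [] else 0) +
      ∑ a ∈ S, enumSum (S.erase a) fun l => F (a :: l) := by
  rcases S.eq_empty_or_nonempty with rfl | h
  · simp [enumSum, enumSumAux]
  · obtain ⟨n, hn⟩ : ∃ n, S.card = n + 1 :=
      ⟨S.card - 1, by have := h.card_pos; omega⟩
    rw [if_neg h.ne_empty, zero_add, enumSum, hn, enumSumAux]
    refine Finset.sum_congr rfl fun a ha => ?_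
    rw [enumSum, Finset.card_erase_of_mem ha, hn, Nat.add_sub_cancel]

theorem enumSum_induction {motive : Finset I → Prop}
    (h : ∀ S, (∀ a ∈ S, motive (S.erase a)) → motive S) (S : Finset I) : motive S := by
  induction hn : S.card generalizing S with
  | zero =>
    obtain rfl := Finset.card_eq_zero.1 hn
    exact h _ (by simp)
  | succ n ih =>
    exact h _ fun a ha => ih _ (by rw [Finset.card_erase_of_mem ha, hn, Nat.add_sub_cancel])

theorem enumSum_congr' {S : Finset I} {F G : List I → Y}
    (h : ∀ l : List I, (∀ a ∈ l, a ∈ S) → l.length = S.card → F l = G l) :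
    enumSum S F = enumSum S G := by
  induction S using enumSum_induction generalizing F G with
  | h S ih =>
    rw [enumSum_rec, enumSum_rec S G]
    congr 1
    · split_ifs with hS
      · exact h [] (by simp) (by simp [hS])
      · rfl
    · refine Finset.sum_congr rfl fun a ha => ih a ha fun l hl hl' => h _ ?_ ?_
      · simp only [List.mem_cons, forall_eq_or_imp, ha, true_and]
        exact fun b hb => Finset.mem_of_mem_erase (hl b hb)
      · rw [List.length_cons, hl', Finset.card_erase_add_one ha]

theorem enumSum_congr {S : Finset I} {F G : List I → Y}
    (h : ∀ l : List I, (∀ a ∈ l, a ∈ S) → F l = G l) : enumSum S F = enumSum S G :=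
  enumSum_congr' fun l hl _ => h l hl

theorem enumSum_map {Z : Type*} [AddCommGroup Z] (φ : Y →+ Z) (S : Finset I) (F : List I → Y) :
    φ (enumSum S F) = enumSum S fun l => φ (F l) := by
  induction S using enumSum_induction generalizing F with
  | h S ih =>
    rw [enumSum_rec, enumSum_rec S fun l => φ (F l), map_add, map_sum]
    congr 1
    · split_ifs <;> simp
    · exact Finset.sum_congr rfl fun a ha => ih a ha _

theorem enumSum_add (S : Finset I) (F G : List I → Y) :
    enumSum S (fun l => F l + G l) = enumSum S F + enumSum S G := by
  induction S using enumSum_induction generalizing F G with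
  | h S ih =>
    rw [enumSum_rec, enumSum_rec S F, enumSum_rec S G,
      Finset.sum_congr rfl fun a ha => ih a ha _ _, Finset.sum_add_distrib]
    split_ifs <;> abel

theorem enumSum_zero (S : Finset I) : enumSum S (fun _ => (0 : Y)) = 0 := by
  simpa using (enumSum_add S (fun _ => (0 : Y)) fun _ => 0)

theorem enumSum_sum {ι : Type*} (s : Finset ι) (S : Finset I) (F : ι → List I → Y) :
    enumSum S (fun l => ∑ i ∈ s, F i l) = ∑ i ∈ s, enumSum S (F i) := by
  classical
  induction s using Finset.induction_on with
  | empty => simp [enumSum_zero]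
  | insert a s ha ih => simp only [Finset.sum_insert ha, enumSum_add, ih]

theorem enumSum_splitSum_comm {α : Type*} (S : Finset I) (w : List α)
    (F : List I → List α → List α → Y) :
    enumSum S (fun l => splitSum w (F l)) = splitSum w fun u v => enumSum S fun l => F l u v := by
  simp only [splitSum_eq_sum_range, enumSum_sum]

/-- Expansion by the first entry of the enumeration of `A`; the part `A = ∅` gives the isolated
term. -/
theorem partSum_enumSum_rec (S : Finset I) (G : Finset I → List I → Y) :
    partSum S (fun A B => enumSum A (G B)) =
      G S [] + ∑ a ∈ S, partSum (S.erase a) fun A B => enumSum A fun l => G B (a :: l) := by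
  rw [← partSum_mem_left S fun a A B => enumSum A fun l => G B (a :: l)]
  have h : (fun A B => enumSum A (G B)) = fun A B : Finset I =>
      (if A = ∅ then G B [] else 0) + ∑ a ∈ A, enumSum (A.erase a) fun l => G B (a :: l) :=
    funext₂ fun A B => enumSum_rec A (G B)
  rw [h, partSum_add]
  congr 1
  rw [partSum, Finset.sum_eq_single ∅]
  · simp
  · intro A _ hA; simp [hA]
  · simp

/-- Cutting an enumeration amounts to choosing the set of entries of its first piece and enumerating
both pieces independently. -/
theorem enumSum_splitSum (S : Finset I) (F : List I → List I → Y) :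
    enumSum S (fun l => splitSum l F) =
      partSum S fun A B => enumSum A fun l₁ => enumSum B fun l₂ => F l₁ l₂ := by
  induction S using enumSum_induction generalizing F with
  | h S ih =>
    rw [enumSum_rec]
    simp only [splitSum_cons, splitSum_nil, enumSum_add, Finset.sum_add_distrib]
    rw [← add_assoc, ← enumSum_rec, Finset.sum_congr rfl fun a ha => ih a ha _]
    exact (partSum_enumSum_rec S fun B l₁ => enumSum B fun l₂ => F l₁ l₂).symm

theorem enumSum_markSum (S : Finset I) (F : List I → I → List I → Y) :
    enumSum S (fun l => markSum l F) =
      ∑ a ∈ S, partSum (S.erase a) fun A B =>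
        enumSum A fun l₁ => enumSum B fun l₂ => F l₁ a l₂ := by
  induction S using enumSum_induction generalizing F with
  | h S ih =>
    rw [enumSum_rec]
    simp only [markSum_cons, markSum_nil, enumSum_add, Finset.sum_add_distrib, ite_self, zero_add]
    rw [Finset.sum_congr rfl fun a ha => ih a ha _]
    have key : ∀ a ∈ S, (partSum (S.erase a) fun A B =>
        enumSum A fun l₁ => enumSum B fun l₂ => F l₁ a l₂) =
        enumSum (S.erase a) (fun l₂ => F [] a l₂) + ∑ b ∈ S.erase a,
          partSum ((S.erase a).erase b) fun A B =>
            enumSum A fun l₁ => enumSum B fun l₂ => F (b :: l₁) a l₂ := by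
      intro a ha
      exact partSum_enumSum_rec (S.erase a) fun B l₁ => enumSum B fun l₂ => F l₁ a l₂
    rw [Finset.sum_congr rfl key, Finset.sum_add_distrib]
    congr 1
    -- One side chooses the leading entry before the marked one, the other side after it.
    rw [Finset.sum_sigma', Finset.sum_sigma']
    refine Finset.sum_nbij' (fun x => ⟨x.2, x.1⟩) (fun x => ⟨x.2, x.1⟩) ?_ ?_ ?_ ?_ ?_
    · rintro ⟨a, b⟩ h
      simp only [Finset.mem_sigma, Finset.mem_erase] at h ⊢
      exact ⟨h.2.2, h.2.1.symm, h.1⟩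
    · rintro ⟨a, b⟩ h
      simp only [Finset.mem_sigma, Finset.mem_erase] at h ⊢
      exact ⟨h.2.2, h.2.1.symm, h.1⟩
    · intros; rfl
    · intros; rfl
    · rintro ⟨a, b⟩ _
      simp only [Finset.erase_right_comm]

theorem enumSum_insert {S : Finset I} {i : I} (hi : i ∉ S) (F : List I → Y) :
    enumSum (insert i S) F =
      partSum S fun A B => enumSum A fun l₁ => enumSum B fun l₂ => F (l₁ ++ i :: l₂) := by
  induction S using enumSum_induction generalizing F with
  | h S ih =>
    rw [enumSum_rec, if_neg (Finset.insert_ne_empty _ _), zero_add, Finset.sum_insert hi,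
      Finset.erase_insert hi]
    have h1 : ∀ a ∈ S, enumSum ((insert i S).erase a) (fun l => F (a :: l)) =
        partSum (S.erase a) fun A B => enumSum A fun l₁ => enumSum B fun l₂ =>
          F (a :: (l₁ ++ i :: l₂)) := by
      intro a ha
      have hia : i ≠ a := fun h => hi (h ▸ ha)
      rw [Finset.erase_insert_of_ne hia, ih a ha (fun h => hi (Finset.mem_of_mem_erase h))]
    rw [Finset.sum_congr rfl h1]
    exact (partSum_enumSum_rec S fun B l₁ => enumSum B fun l₂ => F (l₁ ++ i :: l₂)).symm

end Sets

/-! ### Operations on words -/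

section Operations

variable (k : Type*) {M Y Z : Type*} [CommRing k] [AddCommGroup M] [Module k M]
  [AddCommGroup Y] [Module k Y] [AddCommGroup Z] [Module k Z]

/-- A function on words which is linear in each letter. -/
def WordLinear (f : List M → Y) : Prop :=
  ∀ u v, IsLinearMap k fun x => f (u ++ x :: v)

variable {k}

/-- A word-linear function as a linear function of one letter. -/
def WordLinear.letter {f : List M → Y} (hf : WordLinear k f) (u v : List M) : M →ₗ[k] Y :=
  (hf u v).mk' _

@[simp] theorem WordLinear.letter_apply {f : List M → Y} (hf : WordLinear k f) (u v : List M)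
    (x : M) : hf.letter u v x = f (u ++ x :: v) := rfl

theorem WordLinear.map_zero {f : List M → Y} (hf : WordLinear k f) (u v : List M) :
    f (u ++ 0 :: v) = 0 := (hf.letter u v).map_zero

theorem WordLinear.append {f : List M → Y} (hf : WordLinear k f) (p q : List M) :
    WordLinear k fun o => f (p ++ (o ++ q)) := by
  intro u v
  convert hf (p ++ u) (v ++ q) using 2
  simp

theorem WordLinear.append_left {f : List M → Y} (hf : WordLinear k f) (p : List M) :
    WordLinear k fun o => f (p ++ o) := by
  simpa using hf.append p []

theorem WordLinear.append_right {f : List M → Y} (hf : WordLinear k f) (q : List M) :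
    WordLinear k fun o => f (o ++ q) := by
  simpa using hf.append [] q

theorem WordLinear.cons {f : List M → Y} (hf : WordLinear k f) (x : M) :
    WordLinear k fun o => f (x :: o) := hf.append_left [x]

theorem isLinearMap_splitSum {α : Type*} (w : List α) {F : M → List α → List α → Y}
    (h : ∀ u v, IsLinearMap k fun x => F x u v) : IsLinearMap k fun x => splitSum w (F x) :=
  ⟨fun x y => by
    rw [← splitSum_add]; exact splitSum_congr fun u v _ => (h u v).map_add x y,
   fun c x => by
    rw [← splitSum_smul]; exact splitSum_congr fun u v _ => (h u v).map_smul c x⟩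

theorem isLinearMap_add {F G : M → Y} (hF : IsLinearMap k F) (hG : IsLinearMap k G) :
    IsLinearMap k fun x => F x + G x :=
  (hF.mk' _ + hG.mk' _).isLinear

theorem isLinearMap_sub {F G : M → Y} (hF : IsLinearMap k F) (hG : IsLinearMap k G) :
    IsLinearMap k fun x => F x - G x :=
  (hF.mk' _ - hG.mk' _).isLinear

theorem isLinearMap_sum {ι : Type*} (s : Finset ι) {F : ι → M → Y}
    (hF : ∀ i ∈ s, IsLinearMap k (F i)) : IsLinearMap k fun x => ∑ i ∈ s, F i x :=
  ⟨fun x y => by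
    rw [← Finset.sum_add_distrib]; exact Finset.sum_congr rfl fun i hi => (hF i hi).map_add x y,
   fun c x => by
    rw [Finset.smul_sum]; exact Finset.sum_congr rfl fun i hi => (hF i hi).map_smul c x⟩

theorem isLinearMap_comp {F : M → Y} {G : Y → Z} (hF : IsLinearMap k F) (hG : IsLinearMap k G) :
    IsLinearMap k fun x => G (F x) :=
  ((hG.mk' _).comp (hF.mk' _)).isLinear

theorem isLinearMap_zero : IsLinearMap k fun _ : M => (0 : Y) := (0 : M →ₗ[k] Y).isLinear

/-- The sum over all cuttings of a word into blocks `b₁, …, bₙ` of `f [g₁ b₁, …, gₙ bₙ]`. -/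
def tensorComp (f : List M → Y) : List (List M → M) → List M → Y
  | [], w => if w = [] then f [] else 0
  | g :: gs, w => splitSum w fun u v => tensorComp (fun o => f (g u :: o)) gs v

theorem tensorComp_cons (f : List M → Y) (g : List M → M) (gs : List (List M → M)) (w : List M) :
    tensorComp f (g :: gs) w = splitSum w fun u v => tensorComp (fun o => f (g u :: o)) gs v := rfl

theorem tensorComp_add (f f' : List M → Y) (gs : List (List M → M)) (w : List M) :
    tensorComp (fun o => f o + f' o) gs w = tensorComp f gs w + tensorComp f' gs w := by
  induction gs generalizing f f' w with
  | nil => simp only [tensorComp]; split_ifs <;> simp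
  | cons g gs ih => simp only [tensorComp_cons, ih, splitSum_add]

theorem tensorComp_zero (gs : List (List M → M)) (w : List M) :
    tensorComp (fun _ => (0 : Y)) gs w = 0 := by
  simpa using tensorComp_add (fun _ => (0 : Y)) (fun _ => 0) gs w

theorem tensorComp_map (φ : Y →+ Z) (f : List M → Y) (gs : List (List M → M)) (w : List M) :
    φ (tensorComp f gs w) = tensorComp (fun o => φ (f o)) gs w := by
  induction gs generalizing f w with
  | nil => simp only [tensorComp]; split_ifs <;> simp
  | cons g gs ih => simp only [tensorComp_cons, splitSum_map, ih]

theorem tensorComp_sum {ι : Type*} (s : Finset ι) (f : ι → List M → Y) (gs : List (List M → M))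
    (w : List M) :
    tensorComp (fun o => ∑ i ∈ s, f i o) gs w = ∑ i ∈ s, tensorComp (f i) gs w := by
  classical
  induction s using Finset.induction_on with
  | empty => simp [tensorComp_zero]
  | insert a s ha ih => simp only [Finset.sum_insert ha, tensorComp_add, ih]

theorem splitSum_tensorComp_nil (G : List M → List M → Y) (w : List M) :
    splitSum w (fun u v => tensorComp (fun o => G o v) [] u) = G [] w := by
  cases w with
  | nil => simp [tensorComp]
  | cons a w =>
    rw [splitSum_cons, splitSum_eq_zero]
    · simp [tensorComp]
    · intro u v _; simp [tensorComp]

theorem tensorComp_append (f : List M → Y) (gs gs' : List (List M → M)) (w : List M) :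
    tensorComp f (gs ++ gs') w = splitSum w fun u v =>
      tensorComp (fun o => tensorComp (fun o' => f (o ++ o')) gs' v) gs u := by
  induction gs generalizing f w with
  | nil => exact (splitSum_tensorComp_nil (fun o v => tensorComp (fun o' => f (o ++ o')) gs' v) w).symm
  | cons g gs ih =>
    simp only [List.cons_append, tensorComp_cons, ih]
    exact (splitSum_assoc w _).symm

/-- Each operation produces exactly one letter, so a cut of the output word is a cut of the list of
operations, and the input word is cut accordingly. -/
theorem tensorComp_splitSum (F : List M → List M → Y) (gs : List (List M → M)) (w : List M) :
    tensorComp (fun o => splitSum o F) gs w = splitSum gs fun l l' => splitSum w fun u v =>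
      tensorComp (fun o => tensorComp (F o) l' v) l u := by
  induction gs generalizing F w with
  | nil => exact (splitSum_tensorComp_nil (fun o v => tensorComp (F o) [] v) w).symm
  | cons g gs ih =>
    have h : ∀ w, tensorComp (F []) (g :: gs) w = splitSum w fun u v =>
        tensorComp (fun o => tensorComp (F o) (g :: gs) v) [] u := fun w =>
      (splitSum_tensorComp_nil (fun o v => tensorComp (F o) (g :: gs) v) w).symm
    rw [splitSum_cons, ← h]
    simp only [tensorComp_cons, splitSum_cons, tensorComp_add, splitSum_add, ih]
    congr 1
    rw [splitSum_comm]
    refine splitSum_congr fun l l' _ => ?_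
    exact (splitSum_assoc w _).symm

/-- A letter of the input lies in exactly one block; the mark is put on the operation `g` that acts
on this block. -/
theorem tensorComp_insert (f : List M → Y) (gs : List (List M → M)) (x z : List M) (m : M) :
    tensorComp f gs (x ++ m :: z) = markSum gs fun l g l' =>
      splitSum x fun x₁ x₂ => splitSum z fun z₁ z₂ =>
        tensorComp (fun o => tensorComp (fun o' => f (o ++ g (x₂ ++ m :: z₁) :: o')) l' z₂) l x₁ := by
  induction gs generalizing f x z with
  | nil => simp [tensorComp]
  | cons g gs ih =>
    rw [tensorComp_cons, splitSum_insert, markSum_cons, add_comm]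
    congr 1
    -- Here the head of the list is marked: no operation is left for the letters before its block,
    -- so `x₁` must be empty.
    · cases x with
      | nil => simp [tensorComp]
      | cons a x =>
        rw [splitSum_cons, splitSum_eq_zero (w := x)]
        · simp [tensorComp]
        · intro u v _
          exact splitSum_eq_zero fun _ _ _ => by simp [tensorComp]
    · simp only [ih, tensorComp_cons, List.cons_append]
      rw [← markSum_splitSum_swap]
      refine markSum_congr fun l g' l' _ => ?_
      simp only [splitSum_comm z]
      exact (splitSum_assoc x _).symm

end Operations

/-! ### Polarised exponentials of families of operations -/

section Exponential

variable {k I M Y Z : Type*} [CommRing k] [DecidableEq I] [AddCommGroup M] [Module k M]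
  [AddCommGroup Y] [Module k Y] [AddCommGroup Z] [Module k Z]

/-- The insertion `f ∘̄ g` without signs. -/
def ins (f : List M → Y) (g : List M → M) (w : List M) : Y :=
  splitSum w fun x t => splitSum t fun y z => f (x ++ g y :: z)

/-- The multilinear part `∑ f ∘ (g_{a₁} ⊗ ⋯ ⊗ g_{aₙ})` of `f ∘ exp(g)`, the sum being over all
enumerations `a₁, …, aₙ` of `S`. -/
def expComp (g : I → List M → M) (S : Finset I) (f : List M → Y) (w : List M) : Y :=
  enumSum S fun l => tensorComp f (l.map g) w

/-- `∑ f ∘ (exp(g₋) ⊗ id ⊗ exp(g₊))`, multilinear in the `gₐ` with `a ∈ S`. -/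
def expIdExp (gm gp : I → List M → M) (S : Finset I) (f : List M → Y) (w : List M) : Y :=
  markSum w fun u x v => partSum S fun A B =>
    expComp gm A (fun o => expComp gp B (fun o' => f (o ++ x :: o')) v) u

/-- `f ∘ (exp(g)_A ⊗ r ⊗ exp(g)_B)`. -/
def expMidExp (g : I → List M → M) (A : Finset I) (r : List M → M) (B : Finset I)
    (f : List M → Y) (w : List M) : Y :=
  splitSum w fun x t => splitSum t fun y z =>
    expComp g A (fun o => expComp g B (fun o' => f (o ++ r y :: o')) z) x

/-- The block consumed by `h` lies before, around or after the letter `x`. -/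
theorem ins_insert (f : List M → Y) (h : List M → M) (p q : List M) (x : M) :
    ins f h (p ++ x :: q) =
      ins (fun o => f (o ++ x :: q)) h p +
        splitSum p (fun p₁ p₂ => splitSum q fun q₁ q₂ => f (p₁ ++ h (p₂ ++ x :: q₁) :: q₂)) +
        ins (fun o => f (p ++ x :: o)) h q := by
  simp only [ins, splitSum_insert, splitSum_add, List.append_assoc, List.cons_append]

theorem expComp_map (φ : Y →+ Z) (g : I → List M → M) (S : Finset I) (f : List M → Y)
    (w : List M) : φ (expComp g S f w) = expComp g S (fun o => φ (f o)) w := by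
  simp only [expComp, enumSum_map, tensorComp_map]

theorem expComp_add (g : I → List M → M) (S : Finset I) (f f' : List M → Y) (w : List M) :
    expComp g S (fun o => f o + f' o) w = expComp g S f w + expComp g S f' w := by
  simp only [expComp, tensorComp_add, enumSum_add]

theorem expComp_sum {ι : Type*} (s : Finset ι) (g : I → List M → M) (S : Finset I)
    (f : ι → List M → Y) (w : List M) :
    expComp g S (fun o => ∑ i ∈ s, f i o) w = ∑ i ∈ s, expComp g S (f i) w := by
  simp only [expComp, tensorComp_sum, enumSum_sum]

theorem expComp_neg (g : I → List M → M) (S : Finset I) (f : List M → Y) (w : List M) :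
    expComp g S (fun o => -f o) w = -expComp g S f w :=
  (expComp_map (-AddMonoidHom.id Y) g S f w).symm

theorem expComp_sub (g : I → List M → M) (S : Finset I) (f f' : List M → Y) (w : List M) :
    expComp g S (fun o => f o - f' o) w = expComp g S f w - expComp g S f' w := by
  simp only [sub_eq_add_neg, expComp_add, expComp_neg]

theorem expComp_splitSum_comm {α : Type*} (g : I → List M → M) (S : Finset I) (w' : List α)
    (F : List M → List α → List α → Y) (w : List M) :
    expComp g S (fun o => splitSum w' (F o)) w =
      splitSum w' fun u v => expComp g S (fun o => F o u v) w := by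
  simp only [splitSum_eq_sum_range, expComp_sum]

theorem expComp_partSum (g : I → List M → M) (S T : Finset I)
    (F : List M → Finset I → Finset I → Y) (w : List M) :
    expComp g S (fun o => partSum T (F o)) w =
      partSum T fun A B => expComp g S (fun o => F o A B) w := by
  simp only [partSum, expComp_sum]

theorem expComp_enumSum (g : I → List M → M) (S T : Finset I) (F : List M → List I → Y)
    (w : List M) :
    expComp g S (fun o => enumSum T (F o)) w =
      enumSum T fun l => expComp g S (fun o => F o l) w := by
  induction T using enumSum_induction generalizing F with
  | h T ih =>
    have h : (fun o => enumSum T (F o)) = fun o => (if T = ∅ then F o [] else 0) +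
      ∑ a ∈ T, enumSum (T.erase a) fun l => F o (a :: l) := funext fun o => enumSum_rec T (F o)
    rw [h, enumSum_rec, expComp_add, expComp_sum]
    congr 1
    · split_ifs
      · rfl
      · simp [expComp, tensorComp_zero, enumSum_zero]
    · exact Finset.sum_congr rfl fun a ha => ih a ha _

theorem tensorComp_enumSum (gs : List (List M → M)) (T : Finset I) (F : List M → List I → Y)
    (w : List M) :
    tensorComp (fun o => enumSum T (F o)) gs w =
      enumSum T fun l => tensorComp (fun o => F o l) gs w := by
  induction gs generalizing F w with
  | nil => simp only [tensorComp]; split_ifs <;> simp [enumSum_zero]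
  | cons g gs ih => simp only [tensorComp_cons, ih, enumSum_splitSum_comm]

theorem expComp_congr {g g' : I → List M → M} {S : Finset I} (h : ∀ a ∈ S, g a = g' a)
    (f : List M → Y) (w : List M) : expComp g S f w = expComp g' S f w :=
  enumSum_congr fun l hl => by rw [List.map_congr_left fun a ha => h a (hl a ha)]

theorem expComp_splitSum (g : I → List M → M) (S : Finset I) (F : List M → List M → Y)
    (w : List M) :
    expComp g S (fun o => splitSum o F) w = partSum S fun A B => splitSum w fun u v =>
      expComp g A (fun o => expComp g B (F o) v) u := by
  simp only [expComp, tensorComp_splitSum, splitSum_list_map, enumSum_splitSum,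
    enumSum_splitSum_comm, tensorComp_enumSum]

theorem expComp_insert_letter (g : I → List M → M) (S : Finset I) (f : List M → Y)
    (x z : List M) (m : M) :
    expComp g S f (x ++ m :: z) = ∑ a ∈ S, partSum (S.erase a) fun A B =>
      splitSum x fun x₁ x₂ => splitSum z fun z₁ z₂ =>
        expComp g A (fun o => expComp g B (fun o' => f (o ++ g a (x₂ ++ m :: z₁) :: o')) z₂) x₁ := by
  have h : ∀ (l : List I) (F : List (List M → M) → (List M → M) → List (List M → M) → Y),
      markSum (l.map g) F = markSum l fun u a v => F (u.map g) (g a) (v.map g) := by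
    intro l
    induction l with
    | nil => intro F; rfl
    | cons a l ih => intro F; simp only [List.map_cons, List.map_nil, markSum_cons, ih]
  simp only [expComp, tensorComp_insert, h, enumSum_markSum, enumSum_splitSum_comm,
    tensorComp_enumSum]

/-- The left side is the part of `f ∘ exp(g)` linear in a new variable `i`, with `r` substituted for
it. It is thus the polarised derivative of `f ∘ exp(g)` in the direction `r`. -/
theorem expComp_insert (g : I → List M → M) {S : Finset I} {i : I} (hi : i ∉ S)
    (r : List M → M) (f : List M → Y) (w : List M) :
    expComp (Function.update g i r) (insert i S) f w =
      partSum S fun A B => expMidExp g A r B f w := by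
  rw [expComp, enumSum_insert hi]
  refine partSum_congr fun A hA => ?_
  rw [enumSum_congr (G := fun l₁ => enumSum (S \ A) fun l₂ =>
    tensorComp f (l₁.map g ++ r :: l₂.map g) w)]
  · simp only [expMidExp, expComp, tensorComp_append, tensorComp_cons, enumSum_splitSum_comm,
      tensorComp_enumSum]
    refine splitSum_congr fun u v _ => ?_
    have h : ∀ (gs : List (List M → M)) (G : List M → List M → List M → Y),
        tensorComp (fun o => splitSum v (G o)) gs u =
          splitSum v fun y z => tensorComp (fun o => G o y z) gs u := by
      intro gs G
      simp only [splitSum_eq_sum_range, tensorComp_sum]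
    simp only [h, enumSum_splitSum_comm]
  · intro l₁ hl₁
    refine enumSum_congr fun l₂ hl₂ => ?_
    have h : ∀ l : List I, (∀ a ∈ l, a ∈ S) → l.map (Function.update g i r) = l.map g := by
      intro l hl
      refine List.map_congr_left fun a ha => Function.update_of_ne ?_ _ _
      rintro rfl
      exact hi (hl _ ha)
    rw [List.map_append, List.map_cons, Function.update_self, h l₁ fun a ha => hA (hl₁ a ha),
      h l₂ fun a ha => Finset.sdiff_subset (hl₂ a ha)]

/-- `expMidExp` as a function of the letter in the middle. -/
def expLetter (g : I → List M → M) (A B : Finset I) {f : List M → Y} (hf : WordLinear k f)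
    (x z : List M) : M →+ Y where
  toFun m := expComp g A (fun o => expComp g B (fun o' => f (o ++ m :: o')) z) x
  map_zero' := by
    simp only [hf.map_zero]
    simp [expComp, tensorComp_zero, enumSum_zero]
  map_add' m m' := by
    simp only [(hf _ _).map_add, expComp_add]

theorem expMidExp_eq (g : I → List M → M) (A B : Finset I) {f : List M → Y} (hf : WordLinear k f)
    (r : List M → M) (w : List M) :
    expMidExp g A r B f w =
      splitSum w fun x t => splitSum t fun y z => expLetter g A B hf x z (r y) := rfl

theorem expMidExp_sub (g : I → List M → M) (A B : Finset I) {f : List M → Y}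
    (hf : WordLinear k f) (r r' : List M → M) (w : List M) :
    expMidExp g A (fun y => r y - r' y) B f w = expMidExp g A r B f w - expMidExp g A r' B f w := by
  simp only [expMidExp_eq g A B hf, map_sub, splitSum_sub]

theorem expMidExp_sum {ι : Type*} (s : Finset ι) (g : I → List M → M) (A B : Finset I)
    {f : List M → Y} (hf : WordLinear k f) (r : ι → List M → M) (w : List M) :
    expMidExp g A (fun y => ∑ i ∈ s, r i y) B f w = ∑ i ∈ s, expMidExp g A (r i) B f w := by
  simp only [expMidExp_eq g A B hf, map_sum, splitSum_sum]

/-- `exp(g)` is a morphism of coalgebras. -/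
theorem expComp_ins (g : I → List M → M) (S : Finset I) {f : List M → Y} (hf : WordLinear k f)
    (h : List M → M) (w : List M) :
    expComp g S (ins f h) w = partSum S fun A D => partSum D fun B C =>
      expMidExp g A (expComp g B h) C f w := by
  have h1 : ins f h = fun o => splitSum o fun x t => splitSum t fun y z => f (x ++ h y :: z) := rfl
  rw [h1, expComp_splitSum]
  refine partSum_congr fun A _ => ?_
  simp only [expComp_splitSum, expComp_partSum, expComp_splitSum_comm]
  simp only [partSum, splitSum_sum]
  refine Finset.sum_congr rfl fun B _ => ?_
  rw [expMidExp_eq g _ _ hf]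
  refine splitSum_congr fun x t _ => splitSum_congr fun y z _ => ?_
  simp only [expLetter, AddMonoidHom.coe_mk, ZeroHom.coe_mk]
  congr 1
  funext o
  let φ : M →+ Y :=
    { toFun := fun m => expComp g ((S \ A) \ B) (fun o' => f (o ++ m :: o')) z
      map_zero' := by
        simp only [hf.map_zero]
        simp [expComp, tensorComp_zero, enumSum_zero]
      map_add' := fun m m' => by simp only [(hf _ _).map_add, expComp_add] }
  exact (expComp_map φ g B h y).symm

/-- Both sides cut `w` into five consecutive factors, bracketed as `(x₁ x₂) y (z₁ z₂)` on the left
and as `x₁ (x₂ y z₁) z₂` on the right. -/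
theorem splitSum_five (w : List M) (F : List M → List M → List M → List M → List M → Y) :
    (splitSum w fun x t => splitSum t fun y z => splitSum x fun x₁ x₂ => splitSum z fun z₁ z₂ =>
      F x₁ x₂ y z₁ z₂) =
    splitSum w fun x₁ t => splitSum t fun mid z₂ => splitSum mid fun x₂ t' => splitSum t' fun y z₁ =>
      F x₁ x₂ y z₁ z₂ := by
  have h : ∀ x₁ t, (splitSum t fun mid z₂ => splitSum mid fun x₂ t' => splitSum t' fun y z₁ =>
      F x₁ x₂ y z₁ z₂) = splitSum t fun x₂ t' => splitSum t' fun y z => splitSum z fun z₁ z₂ =>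
      F x₁ x₂ y z₁ z₂ := by
    intro x₁ t
    rw [splitSum_assoc t fun x₂ t' z₂ => splitSum t' fun y z₁ => F x₁ x₂ y z₁ z₂]
    refine splitSum_congr fun x₂ t' _ => ?_
    rw [splitSum_assoc t' fun y z₁ z₂ => F x₁ x₂ y z₁ z₂]
  simp only [h]
  rw [← splitSum_assoc w fun x₁ x₂ t => splitSum t fun y z => splitSum z fun z₁ z₂ =>
      F x₁ x₂ y z₁ z₂]
  refine splitSum_congr fun x t _ => ?_
  simp only [splitSum_comm x]

/-- The letter produced by `φ` falls into the block of exactly one `g a`, and turns this factor into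
`g a ∘̄ φ`. -/
theorem ins_expComp (g : I → List M → M) (S : Finset I) {f : List M → Y} (hf : WordLinear k f)
    (φ : List M → M) (w : List M) :
    ins (expComp g S f) φ w = ∑ a ∈ S, partSum (S.erase a) fun A B =>
      expMidExp g A (ins (g a) φ) B f w := by
  simp only [ins, expComp_insert_letter, splitSum_sum]
  refine Finset.sum_congr rfl fun a _ => ?_
  simp only [partSum, splitSum_sum]
  refine Finset.sum_congr rfl fun A _ => ?_
  rw [splitSum_five w fun x₁ x₂ y z₁ z₂ => expComp g A (fun o => expComp g (S.erase a \ A)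
    (fun o' => f (o ++ g a (x₂ ++ φ y :: z₁) :: o')) z₂) x₁, expMidExp_eq g _ _ hf]
  simp only [ins, splitSum_map]
  rfl

theorem partSum_rotate (S : Finset I) (F : Finset I → Finset I → Finset I → Y) :
    (partSum S fun A D => partSum D fun B C => F A B C) =
      partSum S fun D B => partSum D fun A C => F A B C := by
  rw [partSum_assoc S fun A C B => F A B C]
  exact partSum_congr fun A _ => partSum_swap _ _

/-- The derivative of `exp(g)` in the direction of `g ↦ exp(g) h - g ∘̄ φ`. -/
theorem partSum_expMidExp (g : I → List M → M) (S : Finset I) {f : List M → Y}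
    (hf : WordLinear k f) (h : List M → M) (φ : Finset I → List M → M)
    (r : Finset I → List M → M)
    (hr : ∀ B, r B = fun y => expComp g B h y - ∑ a ∈ B, ins (g a) (φ (B.erase a)) y)
    (w : List M) :
    (partSum S fun A D => partSum D fun B C => expMidExp g A (r B) C f w) =
      expComp g S (ins f h) w - partSum S fun A B => ins (expComp g A f) (φ B) w := by
  simp only [hr, expMidExp_sub g _ _ hf, expMidExp_sum _ g _ _ hf, partSum_sub,
    expComp_ins g S hf, ins_expComp g _ hf]
  congr 1
  have h1 : ∀ A D, (partSum D fun B C => ∑ a ∈ B, expMidExp g A (ins (g a) (φ (B.erase a))) C f w)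
      = ∑ a ∈ D, partSum (D.erase a) fun B C => expMidExp g A (ins (g a) (φ B)) C f w :=
    fun A D => partSum_mem_left D fun a B C => expMidExp g A (ins (g a) (φ B)) C f w
  simp only [h1]
  -- Both sides sum over an index `a` and a decomposition of the other indices into three parts;
  -- only the order of the choices differs.
  rw [partSum_mem_right S fun a A D => partSum D fun B C => expMidExp g A (ins (g a) (φ B)) C f w,
    partSum_mem_left S fun a A' B => partSum A' fun A C => expMidExp g A (ins (g a) (φ B)) C f w]
  exact Finset.sum_congr rfl fun a _ =>
    partSum_rotate _ fun A B C => expMidExp g A (ins (g a) (φ B)) C f w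

end Exponential

/-! ### The derivative of `exp(g₋) ⊗ id ⊗ exp(g₊)` -/

section Variation

variable {k I M Y Z : Type*} [CommRing k] [DecidableEq I] [AddCommGroup M] [Module k M]
  [AddCommGroup Y] [Module k Y] [AddCommGroup Z] [Module k Z]

theorem partSum_exchange (S : Finset I) (F : Finset I → Finset I → Finset I → Y) :
    (partSum S fun T A => partSum A fun C D => F T C D) =
      partSum S fun C E => partSum E fun T D => F T C D := by
  rw [← partSum_assoc S fun T C D => F T C D, ← partSum_assoc S fun C T D => F T C D]
  exact partSum_congr fun A _ => partSum_swap _ _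

theorem partSum_comm (S T : Finset I) (F : Finset I → Finset I → Finset I → Finset I → Y) :
    (partSum S fun A B => partSum T fun C D => F A B C D) =
      partSum T fun C D => partSum S fun A B => F A B C D :=
  Finset.sum_comm

theorem partSum_four (S : Finset I) (F : Finset I → Finset I → Finset I → Finset I → Y) :
    (partSum S fun A B => partSum A fun A₁ B₂ => partSum B fun A₂ B₁ => F A₁ A₂ B₁ B₂) =
      partSum S fun A B => partSum A fun A₁ A₂ => partSum B fun B₁ B₂ => F A₁ A₂ B₁ B₂ := by
  rw [partSum_assoc S fun A₁ B₂ B => partSum B fun A₂ B₁ => F A₁ A₂ B₁ B₂,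
    partSum_assoc S fun A₁ A₂ B => partSum B fun B₁ B₂ => F A₁ A₂ B₁ B₂]
  refine partSum_congr fun A₁ _ => ?_
  rw [partSum_exchange]
  exact partSum_congr fun A₂ _ => partSum_swap _ _

theorem partSum_map (φ : Y →+ Z) (S : Finset I) (F : Finset I → Finset I → Y) :
    φ (partSum S F) = partSum S fun A B => φ (F A B) := by
  simp [partSum]

theorem markSum_partSum {α : Type*} (w : List α) (S : Finset I)
    (F : Finset I → Finset I → List α → α → List α → Y) :
    markSum w (fun u x v => partSum S fun A B => F A B u x v) =
      partSum S fun A B => markSum w (F A B) := by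
  simp only [partSum, markSum_sum]

theorem splitSum_partSum {α : Type*} (w : List α) (S : Finset I)
    (F : Finset I → Finset I → List α → List α → Y) :
    splitSum w (fun u v => partSum S fun A B => F A B u v) =
      partSum S fun A B => splitSum w (F A B) := by
  simp only [partSum, splitSum_sum]

theorem expComp_tensorComp_comm (g : I → List M → M) (S : Finset I) (gs : List (List M → M))
    (F : List M → List M → Y) (w v : List M) :
    expComp g S (fun o => tensorComp (F o) gs v) w =
      tensorComp (fun o' => expComp g S (fun o => F o o') w) gs v := by
  induction gs generalizing F v with
  | nil =>
    simp only [tensorComp]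
    split_ifs
    · rfl
    · simp [expComp, tensorComp_zero, enumSum_zero]
  | cons g gs ih => simp only [tensorComp_cons, expComp_splitSum_comm, ih]

theorem expComp_comm (g g' : I → List M → M) (S T : Finset I) (F : List M → List M → Y)
    (w v : List M) :
    expComp g S (fun o => expComp g' T (F o) v) w =
      expComp g' T (fun o' => expComp g S (fun o => F o o') w) v := by
  have h : ∀ f : List M → Y, expComp g' T f v = enumSum T fun l => tensorComp f (l.map g') v :=
    fun _ => rfl
  simp only [h, expComp_enumSum, expComp_tensorComp_comm]

theorem isLinearMap_expComp (g : I → List M → M) (S : Finset I) {F : Z → List M → Y}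
    (hF : ∀ o, IsLinearMap k fun m => F m o) (w : List M) :
    IsLinearMap k fun m => expComp g S (F m) w where
  map_add x y := by
    rw [← expComp_add]
    exact congrArg (fun f => expComp g S f w) (funext fun o => (hF o).map_add x y)
  map_smul c x := by
    refine Eq.trans ?_ (expComp_map (DistribSMul.toAddMonoidHom Y c) g S (F x) w).symm
    exact congrArg (fun f => expComp g S f w) (funext fun o => (hF o).map_smul c x)

theorem WordLinear.expComp_right {f : List M → Y} (hf : WordLinear k f) (g : I → List M → M)
    (S : Finset I) (x : M) (v : List M) :
    WordLinear k fun o => expComp g S (fun o' => f (o ++ x :: o')) v := fun p q =>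
  isLinearMap_expComp g S (F := fun m o' => f ((p ++ m :: q) ++ x :: o'))
    (fun o' => by simpa using hf p (q ++ x :: o')) v

theorem expIdExp_insert (gm gp : I → List M → M) {S : Finset I} {i : I} (hi : i ∉ S)
    (rm rp : List M → M) (f : List M → Y) (w : List M) :
    expIdExp (Function.update gm i rm) (Function.update gp i rp) (insert i S) f w =
      markSum w (fun u x v => partSum S fun T B => partSum T fun C C' =>
        expMidExp gm C rm C' (fun o => expComp gp B (fun o' => f (o ++ x :: o')) v) u) +
      markSum w (fun u x v => partSum S fun A T => expComp gm A (fun o => partSum T fun C C' =>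
        expMidExp gp C rp C' (fun o' => f (o ++ x :: o')) v) u) := by
  rw [expIdExp, ← markSum_add]
  refine markSum_congr fun u x v _ => ?_
  have hupd : ∀ (g : I → List M → M) (r : List M → M) (A : Finset I), A ⊆ S → ∀ (f : List M → Y)
      (w : List M), expComp (Function.update g i r) A f w = expComp g A f w := by
    intro g r A hA f w
    refine expComp_congr (fun a ha => Function.update_of_ne ?_ _ _) f w
    rintro rfl
    exact hi (hA ha)
  rw [partSum_insert hi]
  congr 1
  · refine partSum_congr fun A hA => ?_
    rw [expComp_insert gm (fun h => hi (hA h))]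
    simp only [hupd gp rp (S \ A) Finset.sdiff_subset]
  · refine partSum_congr fun A hA => ?_
    rw [hupd gm rm A hA]
    simp only [expComp_insert gp (fun h => hi (Finset.sdiff_subset h) : i ∉ S \ A)]

/-- The three sums come from `ins_insert`: relative to the letter kept by the identity factor, the
block of `h` lies before it, contains it, or lies after it. -/
theorem expIdExp_ins (gm gp : I → List M → M) (S : Finset I) (f : List M → Y)
    (h : List M → M) (w : List M) :
    expIdExp gm gp S (ins f h) w =
      markSum w (fun u x v => partSum S fun A B => expComp gm A
        (ins (fun o => expComp gp B (fun o' => f (o ++ x :: o')) v) h) u) +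
      markSum w (fun u x v => splitSum u fun u₁ u₂ => splitSum v fun v₁ v₂ =>
        partSum S fun A B => partSum A fun A₁ A₂ => partSum B fun B₁ B₂ =>
          expComp gm A₁ (fun p₁ => expComp gm A₂ (fun p₂ => expComp gp B₁ (fun q₁ =>
            expComp gp B₂ (fun q₂ => f (p₁ ++ h (p₂ ++ x :: q₁) :: q₂)) v₂) v₁) u₂) u₁) +
      markSum w (fun u x v => partSum S fun A B => expComp gm A
        (fun o => expComp gp B (ins (fun o' => f (o ++ x :: o')) h) v) u) := by
  rw [expIdExp, ← markSum_add, ← markSum_add]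
  refine markSum_congr fun u x v _ => ?_
  simp only [ins_insert, expComp_add, partSum_add]
  congr 2
  · refine partSum_congr fun A _ => ?_
    change _ = expComp gm A (fun o' => ins _ h o') u
    simp only [ins, expComp_splitSum_comm, List.append_assoc, List.cons_append]
  · simp only [expComp_splitSum_comm, expComp_splitSum, expComp_partSum, splitSum_partSum]
    exact partSum_congr fun A _ => partSum_comm _ _ _

theorem expIdExp_letter (gm gp : I → List M → M) (A : Finset I) (f : List M → Y) (x z : List M)
    (m : M) :
    expIdExp gm gp A f (x ++ m :: z) =
      markSum x (fun u a v => partSum A fun A₁ A₂ => expComp gm A₁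
        (fun o => expComp gp A₂ (fun o' => f (o ++ a :: o')) (v ++ m :: z)) u) +
      partSum A (fun A₁ A₂ => expComp gm A₁ (fun o => expComp gp A₂ (fun o' => f (o ++ m :: o')) z) x) +
      markSum z fun u a v => partSum A fun A₁ A₂ => expComp gm A₁
        (fun o => expComp gp A₂ (fun o' => f (o ++ a :: o')) v) (x ++ m :: u) := by
  rw [expIdExp, markSum_insert]

/-- The letter kept by the outer identity factor lies after the output of the inner operation, is
this output, or lies before it. The middle sum is exactly the middle sum of `expIdExp_ins`. -/
theorem ins_expIdExp (gm gp : I → List M → M) (S : Finset I) {f : List M → Y}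
    (hf : WordLinear k f) (h : List M → M) (w : List M) :
    (partSum S fun A B => ins (expIdExp gm gp A f) (expIdExp gm gp B h) w) =
      markSum w (fun u x v => partSum S fun D B => partSum D fun A T => ins (expComp gm A
        (fun o => expComp gp B (fun o' => f (o ++ x :: o')) v)) (expIdExp gm gp T h) u) +
      markSum w (fun u x v => splitSum u fun u₁ u₂ => splitSum v fun v₁ v₂ =>
        partSum S fun A B => partSum A fun A₁ A₂ => partSum B fun B₁ B₂ =>
          expComp gm A₁ (fun p₁ => expComp gm A₂ (fun p₂ => expComp gp B₁ (fun q₁ =>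
            expComp gp B₂ (fun q₂ => f (p₁ ++ h (p₂ ++ x :: q₁) :: q₂)) v₂) v₁) u₂) u₁) +
      markSum w (fun u x v => partSum S fun A E => expComp gm A (fun o => partSum E fun B T =>
        ins (expComp gp B (fun o' => f (o ++ x :: o'))) (expIdExp gm gp T h) v) u) := by
  simp only [ins, expIdExp_letter gm gp _ f, splitSum_add, partSum_add]
  rw [add_comm (markSum w _ + markSum w _), add_comm (markSum w _) (markSum w _), ← add_assoc]
  congr 2
  · have e : ∀ A B, (splitSum w fun x t => splitSum t fun y z => markSum x fun u a v =>
        partSum A fun A₁ A₂ => expComp gm A₁ (fun o => expComp gp A₂ (fun o' => f (o ++ a :: o'))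
          (v ++ expIdExp gm gp B h y :: z)) u) = markSum w fun u a r => splitSum r fun v t =>
        splitSum t fun y z => partSum A fun A₁ A₂ => expComp gm A₁ (fun o => expComp gp A₂
          (fun o' => f (o ++ a :: o')) (v ++ expIdExp gm gp B h y :: z)) u := by
      intro A B
      rw [markSum_splitSum_right w fun u a v t => splitSum t fun y z =>
        partSum A fun A₁ A₂ => expComp gm A₁ (fun o => expComp gp A₂ (fun o' => f (o ++ a :: o'))
          (v ++ expIdExp gm gp B h y :: z)) u]
      simp only [markSum_splitSum_swap]
    simp only [e]
    simp only [splitSum_partSum, markSum_partSum, expComp_partSum, expComp_splitSum_comm]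
    exact partSum_assoc S _
  · have e : ∀ A B, (splitSum w fun x t => splitSum t fun y z => partSum A fun A₁ B₂ =>
        expComp gm A₁ (fun o => expComp gp B₂ (fun o' => f (o ++ expIdExp gm gp B h y :: o')) z) x) =
        partSum A fun A₁ B₂ => partSum B fun A₂ B₁ => markSum w fun u x v =>
          splitSum u fun u₁ u₂ => splitSum v fun v₁ v₂ =>
          expComp gm A₁ (fun p₁ => expComp gm A₂ (fun p₂ => expComp gp B₁ (fun q₁ =>
            expComp gp B₂ (fun q₂ => f (p₁ ++ h (p₂ ++ x :: q₁) :: q₂)) v₂) v₁) u₂) u₁ := by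
      intro A B
      simp only [splitSum_partSum]
      refine partSum_congr fun A₁ _ => ?_
      rw [← markSum_partSum]
      simp only [← splitSum_partSum]
      rw [← splitSum_markSum_assoc w fun u₁ u₂ x v₁ v₂ => partSum B fun A₂ B₁ =>
          expComp gm A₁ (fun p₁ => expComp gm A₂ (fun p₂ => expComp gp B₁ (fun q₁ =>
            expComp gp (A \ A₁) (fun q₂ => f (p₁ ++ h (p₂ ++ x :: q₁) :: q₂)) v₂) v₁) u₂) u₁]
      refine splitSum_congr fun x t _ => splitSum_congr fun y z _ => ?_
      -- The outer composition is additive in its middle letter, so it passes through the inner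
      -- exponentials; the four independent exponentials may then be reordered.
      let φ : M →+ Y := (IsLinearMap.mk' _ (isLinearMap_expComp (k := k) gm A₁
        (F := fun m o => expComp gp (A \ A₁) (fun o' => f (o ++ m :: o')) z)
        (fun o => isLinearMap_expComp gp (A \ A₁) (F := fun m o' => f (o ++ m :: o'))
          (fun o' => hf o o') z) x)).toAddMonoidHom
      have h1 : φ (expIdExp gm gp B h y) = markSum y fun u a v => partSum B fun A₂ B₁ =>
          expComp gm A₂ (fun o => expComp gp B₁ (fun o' => φ (h (o ++ a :: o'))) v) u := by
        rw [expIdExp, markSum_map]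
        simp only [partSum_map, expComp_map]
      refine h1.trans (markSum_congr fun u a v _ => partSum_congr fun A₂ _ => ?_)
      have h2 : ∀ o, expComp gp (B \ A₂) (fun o' => φ (h (o ++ a :: o'))) v =
          expComp gm A₁ (fun p₁ => expComp gp (B \ A₂) (fun q₁ => expComp gp (A \ A₁)
            (fun q₂ => f (p₁ ++ h (o ++ a :: q₁) :: q₂)) z) v) x := fun o =>
        expComp_comm _ _ _ _ _ _ _
      simp only [h2]
      exact expComp_comm _ _ _ _ _ _ _
    simp only [e]
    simp only [splitSum_partSum, markSum_partSum]
    exact partSum_four S _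
  · have e : ∀ A B, (splitSum w fun x t => splitSum t fun y z => markSum z fun u a v =>
        partSum A fun A₁ A₂ => expComp gm A₁ (fun o => expComp gp A₂ (fun o' => f (o ++ a :: o')) v)
          (x ++ expIdExp gm gp B h y :: u)) = markSum w fun r a v => splitSum r fun x t =>
        splitSum t fun y u => partSum A fun A₁ A₂ => expComp gm A₁ (fun o => expComp gp A₂
          (fun o' => f (o ++ a :: o')) v) (x ++ expIdExp gm gp B h y :: u) := by
      intro A B
      rw [markSum_splitSum_left w fun x t a v => splitSum t fun y u =>
        partSum A fun A₁ A₂ => expComp gm A₁ (fun o => expComp gp A₂ (fun o' => f (o ++ a :: o')) v)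
          (x ++ expIdExp gm gp B h y :: u)]
      refine splitSum_congr fun x t _ => ?_
      rw [markSum_splitSum_left]
    simp only [e]
    simp only [splitSum_partSum, markSum_partSum]
    rw [partSum_assoc S, partSum_assoc S]
    exact partSum_congr fun A _ => partSum_swap _ _

/-- The derivative of `exp(g₋) ⊗ id ⊗ exp(g₊)`. -/
theorem partSum_expIdExp (gm gp : I → List M → M) {S : Finset I} {i : I} (hi : i ∉ S)
    {f : List M → Y} (hf : WordLinear k f) (h : List M → M) (rm rp : Finset I → List M → M)
    (hrm : ∀ T, rm T = fun y => expComp gm T h y -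
      ∑ a ∈ T, ins (gm a) (expIdExp gm gp (T.erase a) h) y)
    (hrp : ∀ T, rp T = fun y => expComp gp T h y -
      ∑ a ∈ T, ins (gp a) (expIdExp gm gp (T.erase a) h) y) (w : List M) :
    (partSum S fun T B => expIdExp (Function.update gm i (rm T)) (Function.update gp i (rp T))
      (insert i B) f w) = expIdExp gm gp S (ins f h) w -
        partSum S fun A B => ins (expIdExp gm gp A f) (expIdExp gm gp B h) w := by
  have h1 : (partSum S fun T B => expIdExp (Function.update gm i (rm T))
      (Function.update gp i (rp T)) (insert i B) f w) = partSum S fun T B =>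
      markSum w (fun u x v => partSum B fun A B' => partSum A fun C C' =>
        expMidExp gm C (rm T) C' (fun o => expComp gp B' (fun o' => f (o ++ x :: o')) v) u) +
      markSum w (fun u x v => partSum B fun A A' => expComp gm A (fun o => partSum A' fun C C' =>
        expMidExp gp C (rp T) C' (fun o' => f (o ++ x :: o')) v) u) :=
    partSum_congr fun T _ => expIdExp_insert gm gp
      (fun h => hi (Finset.sdiff_subset h) : i ∉ S \ T) (rm T) (rp T) f w
  rw [h1, partSum_add, ins_expIdExp gm gp S hf, expIdExp_ins]
  -- `c` is the term with the kept letter inside `h`. It occurs in both expansions and cancels; the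
  -- outer terms are handled on each side of the kept letter by `partSum_expMidExp`.
  have e : ∀ a b c d e : Y, (a + c + d) - (b + c + e) = (a - b) + (d - e) := by intros; abel
  rw [e]
  simp only [← markSum_partSum]
  congr 1
  · rw [eq_sub_iff_add_eq, ← markSum_add]
    refine markSum_congr fun u x v _ => ?_
    rw [← partSum_assoc S fun T A B => partSum A fun C C' => expMidExp gm C (rm T) C'
      (fun o => expComp gp B (fun o' => f (o ++ x :: o')) v) u, ← partSum_add]
    refine partSum_congr fun D _ => ?_
    rw [partSum_exchange, partSum_expMidExp gm D (hf.expComp_right gp _ x v) h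
      (fun B => expIdExp gm gp B h) rm hrm, sub_add_cancel]
  · rw [eq_sub_iff_add_eq, ← markSum_add]
    refine markSum_congr fun u x v _ => ?_
    rw [partSum_exchange, ← partSum_add]
    refine partSum_congr fun D _ => ?_
    rw [← expComp_partSum, ← expComp_add]
    refine congrArg (fun f => expComp gm D f u) (funext fun o => ?_)
    have hf' : WordLinear k fun o' => f (o ++ x :: o') := by
      simpa using hf.append_left (o ++ [x])
    rw [partSum_exchange, partSum_expMidExp gp (S \ D) hf' h
      (fun B => expIdExp gm gp B h) rp hrp, sub_add_cancel]

end Variation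

/-! ### The vector fields and their commutators -/

section Action

variable {k I M : Type*} [CommRing k] [DecidableEq I] [AddCommGroup M] [Module k M]

/-- The restriction of `f` to the empty word, if `b` holds, and `f` otherwise. -/
def emptyPart (b : Bool) (f : List M → M) (w : List M) : M :=
  if b = true ∧ w ≠ [] then 0 else f w

@[simp] theorem emptyPart_nil (b : Bool) (f : List M → M) : emptyPart b f [] = f [] := by
  simp [emptyPart]

@[simp] theorem emptyPart_false (f : List M → M) : emptyPart false f = f := by
  funext w; simp [emptyPart]

theorem emptyPart_true {w : List M} (hw : w ≠ []) (f : List M → M) :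
    emptyPart true f w = 0 := by simp [emptyPart, hw]

/-- The vector field `g ↦ h ∘ exp(g) - g ∘̄ (h ∘ (exp(g₋) ⊗ id ⊗ exp(g₊)))` defined by `h`,
multilinear in the `gₐ` with `a ∈ S`. -/
def vectorField (b b' : Bool) (g : I → List M → M) (S : Finset I) (h : List M → M)
    (w : List M) : M :=
  expComp g S h w - ∑ a ∈ S, ins (g a)
    (expIdExp (fun a => emptyPart b (g a)) (fun a => emptyPart b' (g a)) (S.erase a) h) w

theorem ins_sub_right {f : List M → M} (hf : WordLinear k f) (g g' : List M → M) (w : List M) :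
    ins f (fun v => g v - g' v) w = ins f g w - ins f g' w := by
  simp only [ins, (hf _ _).map_sub, splitSum_sub]

theorem ins_partSum_right {f : List M → M} (hf : WordLinear k f) (S : Finset I)
    (g : Finset I → Finset I → List M → M) (w : List M) :
    ins f (fun v => partSum S fun A B => g A B v) w = partSum S fun A B => ins f (g A B) w := by
  have h : ∀ u v (G : Finset I → Finset I → M), f (u ++ partSum S G :: v) =
      partSum S fun A B => f (u ++ G A B :: v) := fun u v G => map_sum (hf.letter u v) _ _
  simp only [ins, h, splitSum_partSum]

theorem ins_sub_left (f f' : List M → M) (g : List M → M) (w : List M) :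
    ins (fun v => f v - f' v) g w = ins f g w - ins f' g w := by
  simp only [ins, splitSum_sub]

theorem ins_sum_left {ι : Type*} (s : Finset ι) (f : ι → List M → M) (g : List M → M)
    (w : List M) : ins (fun v => ∑ i ∈ s, f i v) g w = ∑ i ∈ s, ins (f i) g w := by
  simp only [ins, splitSum_sum]

theorem expIdExp_sub (gm gp : I → List M → M) (S : Finset I) (f f' : List M → M) (w : List M) :
    expIdExp gm gp S (fun o => f o - f' o) w =
      expIdExp gm gp S f w - expIdExp gm gp S f' w := by
  rw [eq_sub_iff_add_eq, expIdExp, expIdExp, expIdExp, ← markSum_add]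
  simp only [expComp_sub, ← partSum_add, sub_add_cancel]

theorem vectorField_sub (b b' : Bool) {g : I → List M → M} (hg : ∀ a, WordLinear k (g a))
    (S : Finset I) (h h' : List M → M) (w : List M) :
    vectorField b b' g S (fun o => h o - h' o) w =
      vectorField b b' g S h w - vectorField b b' g S h' w := by
  have e : ∀ S, expIdExp (fun a => emptyPart b (g a)) (fun a => emptyPart b' (g a)) S
      (fun o => h o - h' o) = fun w =>
      expIdExp (fun a => emptyPart b (g a)) (fun a => emptyPart b' (g a)) S h w -
      expIdExp (fun a => emptyPart b (g a)) (fun a => emptyPart b' (g a)) S h' w :=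
    fun S => funext fun w => expIdExp_sub _ _ _ _ _ _
  simp only [vectorField, expComp_sub, e, ins_sub_right (hg _), Finset.sum_sub_distrib]
  abel

/-- The insertion operation is a pre-Lie product. -/
theorem ins_assoc_symm {f : List M → M} (hf : WordLinear k f) (g h : List M → M) (w : List M) :
    ins (ins f g) h w - ins f (ins g h) w = ins (ins f h) g w - ins f (ins h g) w := by
  -- The associator keeps only the insertions of `g` and `h` at disjoint places, in either order;
  -- this is visibly symmetric.
  have key : ∀ g h : List M → M, ins (ins f g) h w - ins f (ins g h) w =
      (splitSum w fun a t => splitSum t fun y t => splitSum t fun c t => splitSum t fun z e =>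
        f (a ++ g y :: (c ++ h z :: e))) +
      splitSum w fun a t => splitSum t fun y t => splitSum t fun c t => splitSum t fun z e =>
        f (a ++ h y :: (c ++ g z :: e)) := by
    intro g h
    have h1 : ins (ins f g) h w = splitSum w fun x t => splitSum t fun y z =>
        ins f g (x ++ h y :: z) := rfl
    rw [h1, sub_eq_iff_eq_add]
    simp only [ins_insert, splitSum_add]
    rw [add_right_comm]
    congr 1
    · congr 1
      · simp only [ins]
        have e : ∀ u v : List M, (splitSum v fun y' z' => splitSum u fun x r => splitSum r fun y z =>
            f (x ++ g y :: z ++ h y' :: z')) = splitSum u fun x r => splitSum r fun y z =>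
            splitSum v fun y' z' => f (x ++ g y :: z ++ h y' :: z') := by
          intro u v
          rw [splitSum_comm v]
          exact splitSum_congr fun x r _ => splitSum_comm _ _ _
        simp only [e]
        rw [splitSum_assoc w fun x r t => splitSum r fun y z => splitSum t fun y' z' =>
          f (x ++ g y :: z ++ h y' :: z')]
        refine splitSum_congr fun x t _ => ?_
        rw [splitSum_assoc t fun y z t => splitSum t fun y' z' => f (x ++ g y :: z ++ h y' :: z')]
        simp only [List.append_assoc, List.cons_append]
    · rw [splitSum_five w fun x₁ x₂ y z₁ z₂ => f (x₁ ++ g (x₂ ++ h y :: z₁) :: z₂)]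
      refine splitSum_congr fun x t _ => splitSum_congr fun m z _ => ?_
      have h2 := fun (m : List M) F => splitSum_map (hf.letter x z).toAddMonoidHom m F
      simp only [LinearMap.toAddMonoidHom_coe, WordLinear.letter_apply] at h2
      simp only [ins, h2]
  rw [key g h, key h g, add_comm]

/-- Operations that vanish on nonempty words leave no place for the letters of `w`. -/
theorem tensorComp_eq_zero {f : List M → M} (hf : WordLinear k f) (gs : List (List M → M))
    (w : List M) (h : ∀ g ∈ gs, ∀ w, w ≠ [] → g w = 0) (hw : w ≠ []) : tensorComp f gs w = 0 := by
  induction gs generalizing f w with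
  | nil => simp [tensorComp, hw]
  | cons g gs ih =>
    rw [tensorComp_cons]
    refine splitSum_eq_zero fun u v huv => ?_
    by_cases hu : u = []
    · refine ih (hf.cons _) _ (fun g' hg' => h g' (List.mem_cons_of_mem _ hg')) ?_
      rintro rfl
      simp only [hu, List.append_nil] at huv
      exact hw huv.symm
    · rw [h g List.mem_cons_self u hu]
      simp [show ∀ o, f (0 :: o) = 0 from fun o => hf.map_zero [] o, tensorComp_zero]

theorem tensorComp_nil_congr (f : List M → M) (gs gs' : List (List M → M))
    (h : gs.map (fun g => g []) = gs'.map fun g => g []) :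
    tensorComp f gs [] = tensorComp f gs' [] := by
  induction gs generalizing f gs' with
  | nil => cases gs' <;> simp_all
  | cons g gs ih =>
    cases gs' with
    | nil => simp at h
    | cons g' gs' =>
      simp only [List.map_cons, List.cons.injEq] at h
      simp only [tensorComp_cons, splitSum_nil, h.1]
      exact ih _ _ h.2

/-- Truncation commutes with the vector field: the truncated family moves by the same formula, with
the inner exponentials unchanged. On a nonempty word both sides vanish. On the empty word the inner
operation vanishes, as it has no letter for its identity factor. This is the hypothesis on the
directions `rm` and `rp` in `partSum_expIdExp`. -/
theorem emptyPart_vectorField (b₀ b b' : Bool) {g : I → List M → M}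
    (hg : ∀ a, WordLinear k (g a)) (S : Finset I) {h : List M → M} (hh : WordLinear k h) :
    emptyPart b₀ (vectorField b b' g S h) = fun y =>
      expComp (fun a => emptyPart b₀ (g a)) S h y - ∑ a ∈ S, ins (emptyPart b₀ (g a))
        (expIdExp (fun a => emptyPart b (g a)) (fun a => emptyPart b' (g a)) (S.erase a) h) y := by
  funext y
  cases b₀ with
  | false => simp [vectorField]
  | true =>
    by_cases hy : y = []
    · subst hy
      rw [emptyPart_nil, vectorField]
      congr 1
      · refine enumSum_congr fun l _ => tensorComp_nil_congr _ _ _ ?_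
        simp
      · refine Finset.sum_congr rfl fun a _ => ?_
        simp only [ins, splitSum_nil, expIdExp, markSum_nil]
        rw [(hg a).map_zero, emptyPart_true (by simp)]
    · rw [emptyPart_true hy, expComp, enumSum_congr (G := fun _ => 0), enumSum_zero,
        Finset.sum_eq_zero, sub_zero]
      · intro a _
        refine splitSum_eq_zero fun u t _ => splitSum_eq_zero fun v z _ => ?_
        exact emptyPart_true (by simp) _
      · intro l _
        refine tensorComp_eq_zero hh _ _ ?_ hy
        simp only [List.mem_map, forall_exists_index, and_imp]
        rintro _ a _ rfl w hw
        exact emptyPart_true hw _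

/-- The left side is the derivative of the vector field of `h` along that of `h'`. It splits into
the variation of `h ∘ exp(g)` (`t1`), of the outer factor `g a` (`t2`) and of the inner factor with
its identity slot (`t3`). The result is arranged so that everything except the field of `h ∘̄ h'`
turns out to be symmetric in `h` and `h'`. -/
theorem partSum_vectorField (b b' : Bool) {g : I → List M → M} (hg : ∀ a, WordLinear k (g a))
    {S : Finset I} {i : I} (hi : i ∉ S) {h h' : List M → M} (hh : WordLinear k h)
    (hh' : WordLinear k h') (w : List M) :
    (partSum S fun A C =>
      vectorField b b' (Function.update g i (vectorField b b' g A h')) (insert i C) h w) =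
    vectorField b b' g S (ins h h') w +
      ((∑ a ∈ S, partSum (S.erase a) fun A C => ins (ins (g a)
        (expIdExp (fun a => emptyPart b (g a)) (fun a => emptyPart b' (g a)) A h'))
        (expIdExp (fun a => emptyPart b (g a)) (fun a => emptyPart b' (g a)) C h) w) +
      (∑ a ∈ S, partSum (S.erase a) fun A C => ins (g a)
        (ins (expIdExp (fun a => emptyPart b (g a)) (fun a => emptyPart b' (g a)) A h)
        (expIdExp (fun a => emptyPart b (g a)) (fun a => emptyPart b' (g a)) C h')) w) -
      ((partSum S fun A C => ins (expComp g A h)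
        (expIdExp (fun a => emptyPart b (g a)) (fun a => emptyPart b' (g a)) C h') w) +
      (partSum S fun A C => ins (expComp g A h')
        (expIdExp (fun a => emptyPart b (g a)) (fun a => emptyPart b' (g a)) C h) w))) := by
  set K := expIdExp (Y := M) (fun a => emptyPart b (g a)) (fun a => emptyPart b' (g a)) with hK
  set r := fun A => vectorField b b' g A h' with hr
  have hr' : ∀ A, r A = fun y => expComp g A h' y - ∑ a ∈ A, ins (g a) (K (A.erase a) h') y :=
    fun A => rfl
  have hupd : ∀ A a, a ∈ S → Function.update g i (r A) a = g a := by
    intro A a ha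
    refine Function.update_of_ne ?_ _ _
    rintro rfl
    exact hi ha
  have h1 : ∀ A C : Finset I, C ⊆ S →
      vectorField b b' (Function.update g i (r A)) (insert i C) h w =
      expComp (Function.update g i (r A)) (insert i C) h w - ins (r A) (K C h) w -
        ∑ a ∈ C, ins (g a) (expIdExp
          (Function.update (fun a => emptyPart b (g a)) i (emptyPart b (r A)))
          (Function.update (fun a => emptyPart b' (g a)) i (emptyPart b' (r A)))
          (insert i (C.erase a)) h) w := by
    intro A C hC
    have hiC : i ∉ C := fun h => hi (hC h)
    have e : ∀ b, (fun a => emptyPart b (Function.update g i (r A) a)) =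
        Function.update (fun a => emptyPart b (g a)) i (emptyPart b (r A)) := by
      intro b
      funext a
      by_cases ha : a = i
      · subst ha; simp
      · simp [ha]
    rw [vectorField, Finset.sum_insert hiC, Function.update_self, Finset.erase_insert hiC, ← sub_sub,
      e, e]
    congr 1
    · congr 2
      funext y
      refine markSum_congr fun u x v _ => partSum_congr fun D hD => ?_
      have e' : ∀ b, ∀ a ∈ C, Function.update (fun a => emptyPart b (g a)) i
          (emptyPart b (r A)) a = emptyPart b (g a) := by
        intro b a ha
        refine Function.update_of_ne ?_ _ _
        rintro rfl
        exact hiC ha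
      rw [expComp_congr fun a ha => e' b a (hD ha)]
      refine congrArg (fun f => expComp _ D f u) (funext fun o => ?_)
      rw [expComp_congr fun a ha => e' b' a (Finset.sdiff_subset ha)]
    · refine Finset.sum_congr rfl fun a ha => ?_
      rw [hupd A a (hC ha), Finset.erase_insert_of_ne]
      rintro rfl
      exact hiC ha
  rw [partSum_congr (G := fun A C => expComp (Function.update g i (r A)) (insert i C) h w -
    ins (r A) (K C h) w - ∑ a ∈ C, ins (g a) (expIdExp
          (Function.update (fun a => emptyPart b (g a)) i (emptyPart b (r A)))
          (Function.update (fun a => emptyPart b' (g a)) i (emptyPart b' (r A)))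
          (insert i (C.erase a)) h) w) fun A hA => h1 A _ Finset.sdiff_subset, partSum_sub, partSum_sub]
  have t1 : (partSum S fun A C => expComp (Function.update g i (r A)) (insert i C) h w) =
      expComp g S (ins h h') w - partSum S fun A C => ins (expComp g A h) (K C h') w := by
    rw [← partSum_expMidExp g S hh h' (fun B => K B h') r hr' w, ← partSum_exchange]
    exact partSum_congr fun A hA =>
      expComp_insert g (fun h => hi (Finset.sdiff_subset h) : i ∉ S \ A) (r A) h w
  have t2 : (partSum S fun A C => ins (r A) (K C h) w) =
      (partSum S fun A C => ins (expComp g A h') (K C h) w) -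
        ∑ a ∈ S, partSum (S.erase a) fun A C => ins (ins (g a) (K A h')) (K C h) w := by
    simp only [hr', ins_sub_left, ins_sum_left, partSum_sub]
    rw [partSum_mem_left S fun a A C => ins (ins (g a) (K A h')) (K C h) w]
  have t3 : (partSum S fun A C => ∑ a ∈ C, ins (g a) (expIdExp
          (Function.update (fun a => emptyPart b (g a)) i (emptyPart b (r A)))
          (Function.update (fun a => emptyPart b' (g a)) i (emptyPart b' (r A)))
          (insert i (C.erase a)) h) w) = (∑ a ∈ S, ins (g a) (K (S.erase a) (ins h h')) w) -
        ∑ a ∈ S, partSum (S.erase a) fun A C => ins (g a) (ins (K A h) (K C h')) w := by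
    rw [partSum_mem_right S fun a A C => ins (g a) (expIdExp
          (Function.update (fun a => emptyPart b (g a)) i (emptyPart b (r A)))
          (Function.update (fun a => emptyPart b' (g a)) i (emptyPart b' (r A)))
          (insert i C) h) w, ← Finset.sum_sub_distrib]
    refine Finset.sum_congr rfl fun a ha => ?_
    -- The sum over decompositions is moved inside the insertion, where the variation formula
    -- `partSum_expIdExp` applies.
    rw [← ins_partSum_right (hg a), ← ins_partSum_right (hg a), ← ins_sub_right (hg a)]
    refine congrArg (fun f => ins (g a) f w) (funext fun v => ?_)
    exact partSum_expIdExp _ _ (fun h => hi (Finset.mem_of_mem_erase h) : i ∉ S.erase a) hh h'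
      (fun A => emptyPart b (r A)) (fun A => emptyPart b' (r A))
      (fun T => emptyPart_vectorField b b b' hg T hh')
      (fun T => emptyPart_vectorField b' b b' hg T hh') v
  rw [t1, t2, t3, vectorField]
  abel

/-- The vector fields defined by `h` and `h'` have as their commutator the one defined by the
commutator of `h` and `h'`. -/
theorem vectorField_commutator (b b' : Bool) {g : I → List M → M} (hg : ∀ a, WordLinear k (g a))
    {S : Finset I} {i : I} (hi : i ∉ S) {h h' : List M → M} (hh : WordLinear k h)
    (hh' : WordLinear k h') (w : List M) :
    vectorField b b' g S (fun v => ins h h' v - ins h' h v) w =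
    (partSum S fun A C =>
      vectorField b b' (Function.update g i (vectorField b b' g A h')) (insert i C) h w) -
    partSum S fun A C =>
      vectorField b b' (Function.update g i (vectorField b b' g A h)) (insert i C) h' w := by
  rw [partSum_vectorField b b' hg hi hh hh', partSum_vectorField b b' hg hi hh' hh,
    vectorField_sub b b' hg]
  set K := expIdExp (Y := M) (fun a => emptyPart b (g a)) (fun a => emptyPart b' (g a)) with hK
  -- The terms with two nested or successive insertions into `g a` are symmetric by the pre-Lie
  -- identity; the remaining ones only change places.
  have e : (∑ a ∈ S, partSum (S.erase a) fun A C => ins (ins (g a) (K A h')) (K C h) w) +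
      (∑ a ∈ S, partSum (S.erase a) fun A C => ins (g a) (ins (K A h) (K C h')) w) =
      (∑ a ∈ S, partSum (S.erase a) fun A C => ins (ins (g a) (K A h)) (K C h') w) +
      (∑ a ∈ S, partSum (S.erase a) fun A C => ins (g a) (ins (K A h') (K C h)) w) := by
    rw [← sub_eq_sub_iff_add_eq_add, ← Finset.sum_sub_distrib, ← Finset.sum_sub_distrib]
    refine Finset.sum_congr rfl fun a _ => ?_
    rw [partSum_swap (S.erase a) fun A C => ins (ins (g a) (K A h)) (K C h') w,
      partSum_swap (S.erase a) fun A C => ins (g a) (ins (K A h) (K C h')) w, ← partSum_sub,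
      ← partSum_sub]
    exact partSum_congr fun A _ => ins_assoc_symm (hg a) _ _ _
  rw [e, add_comm (partSum S fun A C => ins (expComp g A h') (K C h) w)]
  abel

end Action

/-! ### Removing the Koszul signs -/

section Twisted

variable {J : Type*} [LinearOrder J]

/-- The number of odd crossings of two products of symbols, weighted by the degrees. -/
def crossing (p : J → ℤ) (a b : Multiset J) : ℤ :=
  (a.map fun i => (b.map fun j => if j < i then p i * p j else 0).sum).sum

theorem crossing_add_left (p : J → ℤ) (a a' b : Multiset J) :
    crossing p (a + a') b = crossing p a b + crossing p a' b := by
  simp [crossing]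

theorem crossing_add_right (p : J → ℤ) (a b b' : Multiset J) :
    crossing p a (b + b') = crossing p a b + crossing p a b' := by
  simp [crossing, Multiset.sum_map_add]

@[simp] theorem crossing_zero_left (p : J → ℤ) (b : Multiset J) : crossing p 0 b = 0 := by
  simp [crossing]

@[simp] theorem crossing_zero_right (p : J → ℤ) (a : Multiset J) : crossing p a 0 = 0 := by
  simp [crossing]

/-- Two distinct symbols cross in exactly one of the two orders. Disjointness is needed because
`crossing` does not count pairs of equal symbols. -/
theorem crossing_add_crossing (p : J → ℤ) {a b : Multiset J} (h : Disjoint a b) :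
    crossing p a b + crossing p b a = (a.map p).sum * (b.map p).sum := by
  induction a using Multiset.induction_on with
  | empty => simp
  | cons i a ih =>
    rw [Multiset.disjoint_cons_left] at h
    rw [← Multiset.singleton_add, crossing_add_left, crossing_add_right, Multiset.map_add,
      Multiset.sum_add, add_mul, ← ih h.2]
    have h1 : crossing p {i} b + crossing p b {i} = p i * (b.map p).sum := by
      have hi := h.1
      clear h ih
      induction b using Multiset.induction_on with
      | empty => simp
      | cons j b ih =>
        rw [Multiset.mem_cons, not_or] at hi
        rw [← Multiset.singleton_add, crossing_add_left, crossing_add_right, Multiset.map_add,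
          Multiset.sum_add, mul_add, ← ih hi.2]
        have h2 : crossing p {i} {j} + crossing p {j} {i} = p i * p j := by
          rcases lt_or_gt_of_ne hi.1 with h | h
          · simp [crossing, h, h.le, mul_comm]
          · simp [crossing, h, h.le]
        simp only [Multiset.map_singleton, Multiset.sum_singleton, ← h2]
        ring
    simp only [Multiset.map_singleton, Multiset.sum_singleton, ← h1]
    ring

/-- Signed products of graded-commuting symbols of degrees `p i`. -/
@[ext] structure SignedMonomial (p : J → ℤ) where
  /-- The sign. -/
  sgn : ℤˣ
  /-- The factors. -/
  supp : Multiset J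

namespace SignedMonomial

variable {p : J → ℤ}

/-- Associativity is the biadditivity of `crossing`. Repeated symbols are admitted and their
products are not set to zero, so graded commutativity holds only for products without repetition;
this is the origin of the `Nodup` hypotheses below. -/
instance : Monoid (SignedMonomial p) where
  mul x y := ⟨x.sgn * y.sgn * (crossing p x.supp y.supp).negOnePow, x.supp + y.supp⟩
  one := ⟨1, 0⟩
  mul_assoc x y z := by
    refine SignedMonomial.ext ?_ (add_assoc _ _ _)
    change x.sgn * y.sgn * (crossing p x.supp y.supp).negOnePow * z.sgn *
      (crossing p (x.supp + y.supp) z.supp).negOnePow = x.sgn * (y.sgn * z.sgn *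
      (crossing p y.supp z.supp).negOnePow) * (crossing p x.supp (y.supp + z.supp)).negOnePow
    rw [crossing_add_left, crossing_add_right, Int.negOnePow_add, Int.negOnePow_add]
    simp only [mul_assoc, mul_comm, mul_left_comm]
  one_mul x := by
    refine SignedMonomial.ext ?_ (zero_add _)
    change 1 * x.sgn * (crossing p 0 x.supp).negOnePow = x.sgn
    simp
  mul_one x := by
    refine SignedMonomial.ext ?_ (add_zero _)
    change x.sgn * 1 * (crossing p x.supp 0).negOnePow = x.sgn
    simp

theorem mul_sgn (x y : SignedMonomial p) :
    (x * y).sgn = x.sgn * y.sgn * (crossing p x.supp y.supp).negOnePow := rfl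

@[simp] theorem supp_mul (x y : SignedMonomial p) : (x * y).supp = x.supp + y.supp := rfl

@[simp] theorem sgn_one : (1 : SignedMonomial p).sgn = 1 := rfl

/-- The degree. -/
def deg (x : SignedMonomial p) : ℤ := (x.supp.map p).sum

@[simp] theorem deg_mul (x y : SignedMonomial p) : (x * y).deg = x.deg + y.deg := by
  simp [deg]

theorem deg_prod (l : List (SignedMonomial p)) : l.prod.deg = (l.map deg).sum := by
  induction l with
  | nil => rfl
  | cons x l ih => simp [ih]

variable {V : Type*} [AddCommGroup V]

/-- The tensor product of a symbol and a vector. -/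
def tmul (x : SignedMonomial p) (v : V) : Multiset J →₀ V := x.sgn • Finsupp.single x.supp v

theorem tmul_smul (s : ℤˣ) (x : SignedMonomial p) (v : V) : x.tmul (s • v) = s • x.tmul v := by
  rw [tmul, tmul, ← Finsupp.smul_single, smul_comm]

@[simp] theorem tmul_zero (x : SignedMonomial p) : x.tmul (0 : V) = 0 := by simp [tmul]

theorem tmul_add (x : SignedMonomial p) (v w : V) : x.tmul (v + w) = x.tmul v + x.tmul w := by
  simp [tmul]

/-- `tmul` as a homomorphism. -/
def tmulHom (x : SignedMonomial p) : V →+ (Multiset J →₀ V) where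
  toFun := x.tmul
  map_zero' := x.tmul_zero
  map_add' := x.tmul_add

/-- Tensoring with a symbol loses nothing, so identities proved in `Λ ⊗ V` descend to `V`. -/
theorem tmul_injective (x : SignedMonomial p) {v w : V} (h : x.tmul v = x.tmul w) : v = w := by
  have h' : Finsupp.single x.supp v = Finsupp.single x.supp w := by
    have := congrArg (x.sgn⁻¹ • ·) h
    simpa only [tmul, inv_smul_smul] using this
  exact Finsupp.single_injective _ h'

theorem tmul_swap (x a b y : SignedMonomial p) (h : (a * b).supp.Nodup) (v : V) :
    (x * (a * b) * y).tmul v = (a.deg * b.deg).negOnePow • (x * (b * a) * y).tmul v := by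
  rw [supp_mul, Multiset.nodup_add] at h
  have h1 : (a * b).supp = (b * a).supp := add_comm _ _
  have h2 : (a * b).sgn = (a.deg * b.deg).negOnePow * (b * a).sgn := by
    rw [mul_sgn, mul_sgn, deg, deg, ← crossing_add_crossing p h.2.2, Int.negOnePow_add,
      mul_comm b.sgn]
    calc a.sgn * b.sgn * (crossing p a.supp b.supp).negOnePow
        = (crossing p a.supp b.supp).negOnePow * (a.sgn * b.sgn) *
          ((crossing p b.supp a.supp).negOnePow * (crossing p b.supp a.supp).negOnePow) := by
          rw [Int.units_mul_self, mul_one, mul_comm]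
      _ = _ := by simp only [mul_assoc, mul_left_comm]
  have h3 : (x * (a * b) * y).sgn = (a.deg * b.deg).negOnePow * (x * (b * a) * y).sgn := by
    rw [mul_sgn, mul_sgn, mul_sgn (x * (b * a)), mul_sgn x (b * a), supp_mul x, supp_mul x, h1, h2]
    simp only [mul_assoc, mul_left_comm]
  have h4 : (x * (a * b) * y).supp = (x * (b * a) * y).supp := by
    rw [supp_mul, supp_mul x, h1]; rfl
  rw [tmul, tmul, h3, h4, smul_smul]

end SignedMonomial

end Twisted

/-! ### Extension of operations from `V` to `Λ ⊗ V` -/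

section Lift

variable {J k V : Type*} [LinearOrder J] [Field k] [AddCommGroup V] [Module k V]

theorem map_units_smul' {A B : Type*} [AddCommGroup A] [AddCommGroup B] (φ : A →+ B) (s : ℤˣ)
    (x : A) : φ (s • x) = s • φ x := by
  rw [Units.smul_def, Units.smul_def, map_zsmul]

theorem WordLinear.map_units_smul {M Y : Type*} [AddCommGroup M] [Module k M] [AddCommGroup Y]
    [Module k Y] {f : List M → Y} (hf : WordLinear k f) (u v : List M) (s : ℤˣ) (x : M) :
    f (u ++ (s • x) :: v) = s • f (u ++ x :: v) :=
  map_units_smul' (hf.letter u v).toAddMonoidHom s x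

/-- The extension of an operation `γ ⊗ f` from words in `V` to words in `Λ ⊗ V`, where `Λ` is the
algebra of graded-commuting symbols. -/
def liftOp (p : J → ℤ) (f : List V → V) (γ : Multiset J) :
    List (Multiset J →₀ V) → (Multiset J →₀ V)
  | [] => Finsupp.single γ (f [])
  | m :: ms => m.sum fun a v =>
      (crossing p γ a).negOnePow • liftOp p (fun o => f (v :: o)) (γ + a) ms

theorem liftOp_add (p : J → ℤ) (f f' : List V → V) (γ : Multiset J)
    (w : List (Multiset J →₀ V)) :
    liftOp p (fun o => f o + f' o) γ w = liftOp p f γ w + liftOp p f' γ w := by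
  induction w generalizing f f' γ with
  | nil => simp [liftOp]
  | cons m ms ih => simp only [liftOp, ih, smul_add, Finsupp.sum_add]

theorem liftOp_smul (p : J → ℤ) (c : k) (f : List V → V) (γ : Multiset J)
    (w : List (Multiset J →₀ V)) :
    liftOp p (fun o => c • f o) γ w = c • liftOp p f γ w := by
  induction w generalizing f γ with
  | nil => simp [liftOp]
  | cons m ms ih =>
    simp only [liftOp, ih, Finsupp.smul_sum]
    refine Finsupp.sum_congr fun a _ => smul_comm _ _ _

theorem liftOp_zero (p : J → ℤ) (γ : Multiset J) (w : List (Multiset J →₀ V)) :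
    liftOp p (fun _ => (0 : V)) γ w = 0 := by
  simpa using liftOp_add p (fun _ => (0 : V)) (fun _ => 0) γ w

/-- `liftOp` as a homomorphism. -/
def liftOpHom (p : J → ℤ) (γ : Multiset J) (w : List (Multiset J →₀ V)) :
    (List V → V) →+ (Multiset J →₀ V) where
  toFun f := liftOp p f γ w
  map_zero' := liftOp_zero p γ w
  map_add' f f' := liftOp_add p f f' γ w

theorem isLinearMap_liftOp (p : J → ℤ) {f : V → List V → V} (hf : ∀ o, IsLinearMap k fun v => f v o)
    (γ : Multiset J) (w : List (Multiset J →₀ V)) : IsLinearMap k fun v => liftOp p (f v) γ w where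
  map_add x y := by
    rw [← liftOp_add]
    exact congrArg (fun f => liftOp p f γ w) (funext fun o => (hf o).map_add x y)
  map_smul c x := by
    rw [← liftOp_smul]
    exact congrArg (fun f => liftOp p f γ w) (funext fun o => (hf o).map_smul c x)

theorem wordLinear_liftOp (p : J → ℤ) {f : List V → V} (hf : WordLinear k f) (γ : Multiset J) :
    WordLinear k (liftOp p f γ) := by
  intro u v
  induction u generalizing f γ with
  | nil =>
    have h : ∀ a, IsLinearMap k fun x : V =>
        (crossing p γ a).negOnePow • liftOp p (fun o => f (x :: o)) (γ + a) v := fun a =>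
      isLinearMap_comp (isLinearMap_liftOp p (fun o => hf [] o) _ _)
        ⟨fun x y => smul_add _ x y, fun c x => smul_comm _ c x⟩
    constructor
    · intro x y
      simp only [List.nil_append, liftOp]
      exact Finsupp.sum_add_index' (fun a => (h a).map_zero) fun a => (h a).map_add
    · intro c x
      simp only [List.nil_append, liftOp]
      rw [Finsupp.sum_smul_index' fun a => (h a).map_zero, Finsupp.smul_sum]
      exact Finsupp.sum_congr fun a _ => (h a).map_smul c _
  | cons m u ih =>
    have h : ∀ a b, IsLinearMap k fun x : Multiset J →₀ V =>
        (crossing p γ a).negOnePow • liftOp p (fun o => f (b :: o)) (γ + a) (u ++ x :: v) :=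
      fun a b => isLinearMap_comp (ih (hf.cons b) (γ + a))
        ⟨fun x y => smul_add _ x y, fun c x => smul_comm _ c x⟩
    exact isLinearMap_sum m.support fun a _ => h a (m a)

/-- The convention is `(γ ⊗ f)(x ⊗ v) = γx ⊗ f(v)`: the symbols are multiplied in their order of
appearance, and `f` itself passes them without a sign. -/
theorem liftOp_map_tmul (p : J → ℤ) {f : List V → V} (hf : WordLinear k f)
    (γ : SignedMonomial p) (L : List (SignedMonomial p × V)) :
    γ.sgn • liftOp p f γ.supp (L.map fun x => x.1.tmul x.2) =
      (γ * (L.map Prod.fst).prod).tmul (f (L.map Prod.snd)) := by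
  induction L generalizing f γ with
  | nil => simp [liftOp, SignedMonomial.tmul]
  | cons x L ih =>
    obtain ⟨x, v⟩ := x
    have h := ih (hf.cons v) (γ * x)
    simp only [List.map_cons, List.prod_cons, ← mul_assoc] at h ⊢
    rw [← h, liftOp, SignedMonomial.tmul, Finsupp.smul_single, Finsupp.sum_single_index]
    · rw [show (fun o => f ((x.sgn • v) :: o)) = x.sgn • fun o => f (v :: o) from
        funext fun o => hf.map_units_smul [] o x.sgn v]
      have e := map_units_smul' (liftOpHom p (γ.supp + x.supp)
        (L.map fun x => x.1.tmul x.2)) x.sgn fun o => f (v :: o)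
      simp only [liftOpHom, AddMonoidHom.coe_mk, ZeroHom.coe_mk] at e
      rw [e, SignedMonomial.mul_sgn, SignedMonomial.supp_mul, smul_smul, smul_smul]
      congr 1
      exact mul_right_comm _ _ _
    · rw [show (fun o => f ((0 : V) :: o)) = fun _ => 0 from funext fun o => hf.map_zero [] o,
        liftOp_zero, smul_zero]

end Lift

/-! ### Signed operations represented by unsigned ones -/

section Graded

variable {k V : Type*} [Field k] [AddCommGroup V] [Module k V] (𝒱 : ℤ → Submodule k V)

/-- `f` is an operation `T^c(sV) → sV` of degree `e`. -/
structure IsOperation (e : ℤ) (f : List V → V) : Prop where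
  /-- Linearity in each letter. -/
  linear : WordLinear k f
  /-- Homogeneity. -/
  mem : ∀ L : List (ℤ × V), (∀ x ∈ L, x.2 ∈ suspension 𝒱 x.1) →
    f (L.map Prod.snd) ∈ suspension 𝒱 (e + (L.map Prod.fst).sum)

variable [DirectSum.Decomposition 𝒱]

theorem twist_apply_of_mem (e : ℤ) {j : ℤ} {v : V} (hv : v ∈ suspension 𝒱 j) :
    twist 𝒱 e v = (e * j).negOnePow • v := by
  have hv' : v ∈ 𝒱 (j - 1) := hv
  rw [twist, LinearMap.comp_apply, LinearEquiv.coe_coe, DirectSum.decomposeLinearEquiv_apply,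
    DirectSum.decompose_of_mem 𝒱 hv', ← DirectSum.lof_eq_of k, DirectSum.toModule_lof]
  simp

theorem WordLinear.map_twist {Y : Type*} [AddCommGroup Y] [Module k Y] {f : List V → Y}
    (hf : WordLinear k f) (e : ℤ) (L : List (ℤ × V))
    (hL : ∀ x ∈ L, x.2 ∈ suspension 𝒱 x.1) (z : List V) :
    f ((L.map Prod.snd).map (twist 𝒱 e) ++ z) =
      (e * (L.map Prod.fst).sum).negOnePow • f (L.map Prod.snd ++ z) := by
  induction L generalizing f with
  | nil => simp
  | cons x L ih =>
    simp only [List.map_cons, List.sum_cons, List.cons_append]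
    rw [ih (hf.cons _) fun y hy => hL y (List.mem_cons_of_mem _ hy),
      twist_apply_of_mem 𝒱 e (hL x List.mem_cons_self)]
    have h := hf.map_units_smul [] (L.map Prod.snd ++ z) (e * x.1).negOnePow x.2
    simp only [List.nil_append] at h
    rw [h, smul_smul, mul_add, Int.negOnePow_add, mul_comm]

theorem insertion_eq (f : List V → V) (e : ℤ) (g : List V → V) (w : List V) :
    insertion 𝒱 f e g w = splitSum w fun x t => splitSum t fun y z =>
      f (x.map (twist 𝒱 e) ++ g y :: z) := by
  rw [insertion, splitSum_eq_sum_range]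
  refine Finset.sum_congr rfl fun i _ => ?_
  rw [splitSum_eq_sum_range, List.length_drop]

/-- The operations `gᵢ`, twisted by the degrees of their successors. -/
def twistOps : List (ℤ × (List V → V)) → List (List V → V)
  | [] => []
  | (_, g) :: gs => (fun w => g (w.map (twist 𝒱 (gs.map Prod.fst).sum))) :: twistOps gs

theorem compTensor_eq (f : List V → V) (gs : List (ℤ × (List V → V))) (w : List V) :
    compTensor 𝒱 f gs w = tensorComp f (twistOps 𝒱 gs) w := by
  induction gs generalizing f w with
  | nil => rfl
  | cons x gs ih =>
    rw [compTensor, twistOps, tensorComp_cons, splitSum_eq_sum_range]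
    exact Finset.sum_congr rfl fun i _ => ih _ _

variable {J : Type*} [LinearOrder J] {p : J → ℤ}

/-- The operation `F` on words in `Λ ⊗ V` is given on decomposable words of even degree by the
operation `t ⊗ f`. -/
def Represents (F : List (Multiset J →₀ V) → (Multiset J →₀ V)) (t : SignedMonomial p)
    (f : List V → V) : Prop :=
  ∀ L : List (SignedMonomial p × V), (∀ x ∈ L, x.2 ∈ suspension 𝒱 x.1.deg) →
    (t * (L.map Prod.fst).prod).supp.Nodup →
      F (L.map fun x => x.1.tmul x.2) = (t * (L.map Prod.fst).prod).tmul (f (L.map Prod.snd))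

theorem represents_liftOp {f : List V → V} (hf : WordLinear k f) (γ : Multiset J) :
    Represents 𝒱 (liftOp p f γ) (⟨1, γ⟩ : SignedMonomial p) f := fun L _ _ => by
  rw [← liftOp_map_tmul p hf, one_smul]

variable {𝒱}

theorem IsOperation.mem_deg {f : List V → V} {e : ℤ} (hf : IsOperation 𝒱 e f)
    {L : List (SignedMonomial p × V)} (hL : ∀ x ∈ L, x.2 ∈ suspension 𝒱 x.1.deg) :
    f (L.map Prod.snd) ∈ suspension 𝒱 (e + (L.map Prod.fst).prod.deg) := by
  have h := hf.mem (L.map fun x => (x.1.deg, x.2)) (by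
    simp only [List.mem_map, forall_exists_index, and_imp]
    rintro _ x hx rfl
    exact hL x hx)
  simp only [List.map_map] at h
  rw [SignedMonomial.deg_prod, List.map_map]
  exact h

theorem map_twist_append {f : List V → V} (hf : WordLinear k f) (e : ℤ)
    {L : List (SignedMonomial p × V)} (hL : ∀ x ∈ L, x.2 ∈ suspension 𝒱 x.1.deg) (z : List V) :
    f ((L.map Prod.snd).map (twist 𝒱 e) ++ z) =
      (e * (L.map Prod.fst).prod.deg).negOnePow • f (L.map Prod.snd ++ z) := by
  have h := hf.map_twist 𝒱 e (L.map fun x => (x.1.deg, x.2)) (by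
    simp only [List.mem_map, forall_exists_index, and_imp]
    rintro _ x hx rfl
    exact hL x hx) z
  rw [SignedMonomial.deg_prod]
  simp only [List.map_map] at h ⊢
  exact h

theorem Represents.cons {F : List (Multiset J →₀ V) → (Multiset J →₀ V)} {t : SignedMonomial p}
    {f : List V → V} (hF : Represents 𝒱 F t f) {s : SignedMonomial p} {v : V}
    (hv : v ∈ suspension 𝒱 s.deg) :
    Represents 𝒱 (fun o => F (s.tmul v :: o)) (t * s) fun o => f (v :: o) := by
  intro L hL hN
  rw [mul_assoc] at hN ⊢
  exact hF ((s, v) :: L) (by simpa using ⟨hv, fun a b h => hL (a, b) h⟩) (by simpa using hN)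

/-- On a word cut as `A B C` the unsigned insertion yields the symbols `t A u B C`. Moving `u` in
front of `A` costs the sign that `twist` puts on the letters before the insertion. -/
theorem Represents.ins {F G : List (Multiset J →₀ V) → (Multiset J →₀ V)}
    {t u : SignedMonomial p} {f g : List V → V} (hF : Represents 𝒱 F t f)
    (hG : Represents 𝒱 G u g) (hf : WordLinear k f) (hg : IsOperation 𝒱 u.deg g) :
    Represents 𝒱 (ins F G) (t * u) (insertion 𝒱 f u.deg g) := by
  intro L hL hN
  rw [insertion_eq, _root_.ins, splitSum_list_map, splitSum_list_map]
  have e := fun (w : List (SignedMonomial p × V))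
      (F : List (SignedMonomial p × V) → List (SignedMonomial p × V) → V) =>
    splitSum_map (t * u * (L.map Prod.fst).prod).tmulHom w F
  simp only [SignedMonomial.tmulHom, AddMonoidHom.coe_mk, ZeroHom.coe_mk] at e
  rw [e]
  refine splitSum_congr fun A r hAr => ?_
  rw [splitSum_list_map, splitSum_list_map, e]
  refine splitSum_congr fun B C hBC => ?_
  subst hBC
  subst hAr
  have hA : ∀ x ∈ A, x.2 ∈ suspension 𝒱 x.1.deg := fun x hx => hL x (by simp [hx])
  have hB : ∀ x ∈ B, x.2 ∈ suspension 𝒱 x.1.deg := fun x hx => hL x (by simp [hx])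
  have hC : ∀ x ∈ C, x.2 ∈ suspension 𝒱 x.1.deg := fun x hx => hL x (by simp [hx])
  simp only [List.map_append, List.prod_append, SignedMonomial.supp_mul] at hN ⊢
  have hN' : (t.supp + ((A.map Prod.fst).prod.supp + (u.supp + (B.map Prod.fst).prod.supp +
      (C.map Prod.fst).prod.supp))).Nodup := by
    convert hN using 1
    abel
  rw [hG B hB (by
    refine Multiset.nodup_of_le ?_ hN'
    rw [SignedMonomial.supp_mul]
    refine le_trans ?_ (Multiset.le_add_left _ _)
    exact le_trans (Multiset.le_add_right _ _) (Multiset.le_add_left _ _))]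
  have h := hF (A ++ (u * (B.map Prod.fst).prod, g (B.map Prod.snd)) :: C) (by
    simp only [List.mem_append, List.mem_cons]
    rintro x (hx | rfl | hx)
    · exact hA x hx
    · simpa using hg.mem_deg hB
    · exact hC x hx) (by simpa using hN')
  simp only [List.map_append, List.map_cons, List.prod_append, List.prod_cons] at h
  rw [h, map_twist_append hf _ hA, SignedMonomial.tmul_smul, mul_comm u.deg]
  have h1 := SignedMonomial.tmul_swap t (A.map Prod.fst).prod u
    ((B.map Prod.fst).prod * (C.map Prod.fst).prod) (by
      refine Multiset.nodup_of_le ?_ hN'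
      rw [SignedMonomial.supp_mul]
      refine le_trans ?_ (Multiset.le_add_left _ _)
      refine add_le_add_right ?_ _
      exact le_trans (Multiset.le_add_right _ _) (Multiset.le_add_right _ _))
    (f (A.map Prod.snd ++ g (B.map Prod.snd) :: C.map Prod.snd))
  simp only [mul_assoc] at h1 ⊢
  exact h1

/-- The first operation yields the symbols `u A`, followed by those of the remaining operations,
with product `P`. Moving `P` in front of `A` costs the sign that `twistOps` puts on the first block.
-/
theorem represents_tensorComp {F : List (Multiset J →₀ V) → (Multiset J →₀ V)}
    {t : SignedMonomial p} {f : List V → V} (hF : Represents 𝒱 F t f) (hf : WordLinear k f)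
    (gs : List ((List (Multiset J →₀ V) → (Multiset J →₀ V)) × SignedMonomial p × (List V → V)))
    (hgs : ∀ x ∈ gs, Represents 𝒱 x.1 x.2.1 x.2.2 ∧ IsOperation 𝒱 x.2.1.deg x.2.2) :
    Represents 𝒱 (tensorComp F (gs.map Prod.fst)) (t * (gs.map fun x => x.2.1).prod)
      (compTensor 𝒱 f (gs.map fun x => (x.2.1.deg, x.2.2))) := by
  induction gs generalizing F f t with
  | nil =>
    intro L hL hN
    cases L with
    | nil => simpa [tensorComp, compTensor] using hF [] (by simp) (by simpa using hN)
    | cons x L => simp [tensorComp, compTensor]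
  | cons x gs ih =>
    obtain ⟨G, u, g⟩ := x
    have hG : Represents 𝒱 G u g := (hgs _ List.mem_cons_self).1
    have hg : IsOperation 𝒱 u.deg g := (hgs _ List.mem_cons_self).2
    intro L hL hN
    have e := fun (w : List (SignedMonomial p × V))
      (F : List (SignedMonomial p × V) → List (SignedMonomial p × V) → V) =>
      splitSum_map (t * ((G, u, g) :: gs |>.map fun x => x.2.1).prod *
        (L.map Prod.fst).prod).tmulHom w F
    simp only [SignedMonomial.tmulHom, AddMonoidHom.coe_mk, ZeroHom.coe_mk] at e
    simp only [compTensor_eq] at ih ⊢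
    have htw : twistOps 𝒱 (((G, u, g) :: gs).map fun x => (x.2.1.deg, x.2.2)) =
        (fun w => g (w.map (twist 𝒱 ((gs.map fun x => (x.2.1.deg, x.2.2)).map Prod.fst).sum))) ::
          twistOps 𝒱 (gs.map fun x => (x.2.1.deg, x.2.2)) := rfl
    rw [htw, List.map_cons, tensorComp_cons, splitSum_list_map, tensorComp_cons,
      splitSum_list_map, e]
    refine splitSum_congr fun A B hAB => ?_
    subst hAB
    have hA : ∀ x ∈ A, x.2 ∈ suspension 𝒱 x.1.deg := fun x hx => hL x (by simp [hx])
    have hB : ∀ x ∈ B, x.2 ∈ suspension 𝒱 x.1.deg := fun x hx => hL x (by simp [hx])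
    simp only [List.map_append, List.prod_append, List.map_cons, List.prod_cons,
      SignedMonomial.supp_mul] at hN ⊢
    set P := (gs.map fun x => x.2.1).prod with hP
    have hN' : (t.supp + (u.supp + (A.map Prod.fst).prod.supp) + P.supp +
        (B.map Prod.fst).prod.supp).Nodup := by
      convert hN using 1
      abel
    rw [hG A hA (by
      refine Multiset.nodup_of_le ?_ hN'
      rw [SignedMonomial.supp_mul, add_assoc, add_assoc]
      exact le_trans (Multiset.le_add_right _ _) (Multiset.le_add_left _ _))]
    have h := ih (hF.cons (s := u * (A.map Prod.fst).prod) (v := g (A.map Prod.snd))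
      (by simpa using hg.mem_deg hA)) (hf.cons _)
      (fun x hx => hgs x (List.mem_cons_of_mem _ hx)) B hB (by
        simpa only [SignedMonomial.supp_mul] using hN')
    rw [h, compTensor_eq]
    have hdeg : ((gs.map fun x => (x.2.1.deg, x.2.2)).map Prod.fst).sum = P.deg := by
      rw [hP, SignedMonomial.deg_prod, List.map_map, List.map_map]
      rfl
    have h1 := map_twist_append hg.linear P.deg hA []
    rw [List.append_nil, List.append_nil] at h1
    have h2 : (fun o => f (((P.deg * (A.map Prod.fst).prod.deg).negOnePow •
        g (A.map Prod.snd)) :: o)) = fun o => (P.deg * (A.map Prod.fst).prod.deg).negOnePow •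
        f (g (A.map Prod.snd) :: o) := funext fun o => hf.map_units_smul [] o _ _
    have h3 : ∀ (s : ℤˣ) (f : List V → V) gs w, tensorComp (fun o => s • f o) gs w =
        s • tensorComp f gs w := fun s f gs w =>
      (tensorComp_map (DistribSMul.toAddMonoidHom V s) f gs w).symm
    rw [hdeg, h1, h2, h3, SignedMonomial.tmul_smul, mul_comm P.deg]
    have h4 := SignedMonomial.tmul_swap (t * u) (A.map Prod.fst).prod P (B.map Prod.fst).prod (by
      refine Multiset.nodup_of_le ?_ hN'
      rw [SignedMonomial.supp_mul]
      refine le_trans ?_ (Multiset.le_add_right _ _)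
      exact add_le_add_left (le_trans (Multiset.le_add_left _ _) (Multiset.le_add_left _ _)) _)
      (tensorComp (fun o => f (g (A.map Prod.snd) :: o))
        (twistOps 𝒱 (gs.map fun x => (x.2.1.deg, x.2.2))) (B.map Prod.snd))
    simp only [mul_assoc] at h4 ⊢
    exact h4

end Graded

/-! ### Signs of permutations -/

section Pairs

/-- `∑_{i < j} F xᵢ xⱼ` over the pairs of entries of a list. -/
def pairSum {α : Type*} (F : α → α → ℤ) : List α → ℤ
  | [] => 0
  | x :: l => (l.map (F x)).sum + pairSum F l

theorem pairSum_append {α : Type*} (F : α → α → ℤ) (l l' : List α) :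
    pairSum F (l ++ l') =
      pairSum F l + (l.map fun x => (l'.map (F x)).sum).sum + pairSum F l' := by
  induction l with
  | nil => simp [pairSum]
  | cons x l ih =>
    simp only [List.cons_append, pairSum, List.map_append, List.sum_append, ih, List.map_cons,
      List.sum_cons]
    ring

theorem pairSum_ofFn {α : Type*} (F : α → α → ℤ) {n : ℕ} (x : Fin n → α) :
    pairSum F (List.ofFn x) = ∑ q : Fin n × Fin n with q.1 < q.2, F (x q.1) (x q.2) := by
  rw [Finset.sum_filter, Fintype.sum_prod_type]
  induction n with
  | zero => simp [pairSum]
  | succ n ih =>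
    rw [List.ofFn_succ, pairSum, ih, Fin.sum_univ_succ, Fin.sum_univ_succ]
    congr 1
    · simp [List.map_ofFn, List.sum_ofFn]
    · refine Finset.sum_congr rfl fun i _ => ?_
      rw [Fin.sum_univ_succ]
      simp

variable {n : ℕ}

/-- A permutation permutes the unordered pairs; `φ σ` sends the increasing representative of a pair
to that of its image. -/
theorem prod_pairs_symm {R : Type*} [CommMonoid R] (σ : Equiv.Perm (Fin n))
    (G : Fin n → Fin n → R) (hG : ∀ a b, G a b = G b a) :
    ∏ q : Fin n × Fin n with q.1 < q.2, G (σ q.1) (σ q.2) =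
      ∏ q : Fin n × Fin n with q.1 < q.2, G q.1 q.2 := by
  let φ : Equiv.Perm (Fin n) → Fin n × Fin n → Fin n × Fin n := fun σ q =>
    if σ q.1 < σ q.2 then (σ q.1, σ q.2) else (σ q.2, σ q.1)
  have h1 : ∀ (σ : Equiv.Perm (Fin n)) (q : Fin n × Fin n), q.1 < q.2 → (φ σ q).1 < (φ σ q).2 := by
    intro σ q hq
    have hne : σ q.1 ≠ σ q.2 := fun h => hq.ne (σ.injective h)
    dsimp only [φ]
    split_ifs with h
    · exact h
    · exact lt_of_le_of_ne (not_lt.mp h) hne.symm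
  have h2 : ∀ (σ τ : Equiv.Perm (Fin n)) (q : Fin n × Fin n), (∀ a, τ (σ a) = a) → q.1 < q.2 →
      φ τ (φ σ q) = q := by
    intro σ τ q h hq
    dsimp only [φ]
    split_ifs with h3 h4 h4 <;> simp_all [lt_asymm hq]
  refine Finset.prod_nbij' (φ σ) (φ σ⁻¹) ?_ ?_ ?_ ?_ ?_
  · intro q hq
    simpa using h1 σ q (by simpa using hq)
  · intro q hq
    simpa using h1 σ⁻¹ q (by simpa using hq)
  · intro q hq
    exact h2 σ σ⁻¹ q (by simp) (by simpa using hq)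
  · intro q hq
    exact h2 σ⁻¹ σ q (by simp) (by simpa using hq)
  · intro q _
    dsimp only [φ]
    split_ifs
    · rfl
    · exact hG _ _

/-- Only inverted pairs change their order. For these `F (σ q.1) (σ q.2)` replaces the opposite
value, which is its own inverse. -/
theorem prod_pairs_perm (σ : Equiv.Perm (Fin n)) (F : Fin n → Fin n → ℤˣ) :
    ∏ q : Fin n × Fin n with q.1 < q.2, F (σ q.1) (σ q.2) =
      (∏ q : Fin n × Fin n with q.1 < q.2 ∧ σ q.2 < σ q.1,
        F (σ q.1) (σ q.2) * F (σ q.2) (σ q.1)) *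
      ∏ q : Fin n × Fin n with q.1 < q.2, F q.1 q.2 := by
  have h := prod_pairs_symm σ (fun a b => if a < b then F a b else F b a) (by
    intro a b
    rcases lt_trichotomy a b with h | h | h
    · simp [h, h.not_gt]
    · simp [h]
    · simp [h, h.not_gt])
  have h' : ∏ q : Fin n × Fin n with q.1 < q.2, (if q.1 < q.2 then F q.1 q.2 else F q.2 q.1) =
      ∏ q : Fin n × Fin n with q.1 < q.2, F q.1 q.2 :=
    Finset.prod_congr rfl fun q hq => if_pos (by simpa using hq)
  rw [← h', ← h, ← Finset.filter_filter, Finset.prod_filter (fun q : Fin n × Fin n => σ q.2 < σ q.1),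
    ← Finset.prod_mul_distrib]
  refine Finset.prod_congr rfl fun q hq => ?_
  have hq : q.1 < q.2 := by simpa using hq
  rcases lt_or_gt_of_ne fun h => hq.ne (σ.injective h) with h | h
  · simp [h, h.not_gt]
  · rw [if_pos h, if_neg h.not_gt, mul_assoc, Int.units_mul_self, mul_one]

theorem sign_eq_prod_inversions (σ : Equiv.Perm (Fin n)) :
    Equiv.Perm.sign σ = ∏ q : Fin n × Fin n with q.1 < q.2 ∧ σ q.2 < σ q.1, (-1 : ℤˣ) := by
  rw [σ.sign_eq_prod_prod_Ioi, ← Finset.filter_filter, Finset.prod_filter, Finset.prod_filter,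
    Fintype.prod_prod_type]
  refine Finset.prod_congr rfl fun i _ => ?_
  rw [← Finset.prod_filter]
  refine Finset.prod_congr (by ext; simp) fun j hj => ?_
  have hj : i < j := by simpa using hj
  rcases lt_or_gt_of_ne fun h => hj.ne (σ.injective h) with h | h
  · simp [h, h.not_gt]
  · simp [h, h.not_gt]

theorem negOnePow_sum {ι : Type*} (s : Finset ι) (f : ι → ℤ) :
    (∑ i ∈ s, f i).negOnePow = ∏ i ∈ s, (f i).negOnePow := by
  classical
  induction s using Finset.induction_on with
  | empty => simp
  | insert a s ha ih => rw [Finset.sum_insert ha, Finset.prod_insert ha, Int.negOnePow_add, ih]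

theorem negOnePow_pairSum_perm (F : Fin n → Fin n → ℤ) (σ : Equiv.Perm (Fin n)) :
    (pairSum F (List.ofFn σ)).negOnePow =
      (∏ q : Fin n × Fin n with q.1 < q.2 ∧ σ q.2 < σ q.1,
        (F (σ q.1) (σ q.2) + F (σ q.2) (σ q.1)).negOnePow) *
      (pairSum F (List.ofFn id)).negOnePow := by
  simp only [pairSum_ofFn, negOnePow_sum, Int.negOnePow_add, id]
  exact prod_pairs_perm σ fun a b => (F a b).negOnePow

/-- The sign `χ` is the Koszul sign for other degrees up to a coboundary. -/
theorem chiSign_mul_koszulSign (σ : Equiv.Perm (Fin n)) {d p : Fin n → ℤ}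
    {F : Fin n → Fin n → ℤ}
    (hF : ∀ a b, a ≠ b → Even (F a b + F b a + (d a * d b + p a * p b + 1))) :
    chiSign σ d * koszulSign σ p =
      (pairSum F (List.ofFn σ)).negOnePow * (pairSum F (List.ofFn id)).negOnePow := by
  rw [negOnePow_pairSum_perm, mul_assoc, Int.units_mul_self, mul_one, chiSign, koszulSign,
    koszulSign, sign_eq_prod_inversions, ← Finset.prod_mul_distrib, ← Finset.prod_mul_distrib]
  refine Finset.prod_congr rfl fun q hq => ?_
  have hq : q.1 < q.2 := by simp at hq; exact hq.1
  rw [← Int.negOnePow_one, ← Int.negOnePow_add, ← Int.negOnePow_add, Int.negOnePow_eq_iff]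
  have h := hF (σ q.1) (σ q.2) fun h => hq.ne (σ.injective h)
  rw [Int.even_iff] at h ⊢
  omega

/-- The degree `d j` occurs once for each `m` from `j` to the last position but one, that is, once
for each position after `j`. -/
theorem sum_partial_sums (d : Fin n → ℤ) :
    ∑ m ∈ Finset.univ.filter (fun m : Fin n => (m : ℕ) + 1 < n), ∑ j : Fin n with j ≤ m, d j =
      pairSum (fun a _ => d a) (List.ofFn id) := by
  rw [pairSum_ofFn]
  cases n with
  | zero => simp
  | succ n =>
    simp only [Finset.sum_filter, id]
    rw [Fin.sum_univ_castSucc, Fintype.sum_prod_type]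
    conv_rhs => rw [Finset.sum_comm, Fin.sum_univ_succ]
    simp [Fin.le_castSucc_iff]

/-- This is décalage: the partial sums of degrees in `ε` form a coboundary that turns `χ` for the
degrees of the `gᵢ` into the Koszul sign for the degrees of the `sgᵢ`. The remaining factor does not
depend on `σ`. -/
theorem epsSign_eq (η : ℤ) (d : Fin n → ℤ) (σ : Equiv.Perm (Fin n)) :
    epsSign η d σ = (n * (η + 1) + pairSum (fun a _ => d a) (List.ofFn id)).negOnePow *
      koszulSign σ fun i => d i + 1 := by
  have h := chiSign_mul_koszulSign σ (d := d) (p := fun i => d i + 1) (F := fun a _ => d a) (by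
    intro a b _
    refine ⟨d a * d b + d a + d b + 1, by ring⟩)
  rw [epsSign, sum_partial_sums fun j => d (σ j), Int.negOnePow_add, Int.negOnePow_add]
  have h1 : pairSum (fun a _ => d (σ a)) (List.ofFn id) = pairSum (fun a _ => d a) (List.ofFn σ) := by
    rw [pairSum_ofFn, pairSum_ofFn]; rfl
  rw [h1]
  calc _ = chiSign σ d * koszulSign σ (fun i => d i + 1) * koszulSign σ (fun i => d i + 1) *
        ((n * (η + 1)).negOnePow * (pairSum (fun a _ => d a) (List.ofFn σ)).negOnePow) := by
        rw [mul_assoc (chiSign σ d), Int.units_mul_self, mul_one]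
    _ = _ := by
        rw [h]
        rcases Int.units_eq_one_or (pairSum (fun a _ => d a) (List.ofFn σ)).negOnePow with h | h <;>
          simp only [h, mul_one, one_mul, mul_neg, neg_mul, neg_neg, mul_comm, mul_left_comm]

end Pairs

/-! ### Reordering products of symbols -/

namespace SignedMonomial

variable {J : Type*} [LinearOrder J] {p : J → ℤ}

instance : MulAction ℤˣ (SignedMonomial p) where
  smul u x := ⟨u * x.sgn, x.supp⟩
  one_smul _ := SignedMonomial.ext (one_mul _) rfl
  mul_smul _ _ _ := SignedMonomial.ext (mul_assoc _ _ _) rfl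

@[simp] theorem smul_sgn (u : ℤˣ) (x : SignedMonomial p) : (u • x).sgn = u * x.sgn := rfl

@[simp] theorem smul_supp (u : ℤˣ) (x : SignedMonomial p) : (u • x).supp = x.supp := rfl

@[simp] theorem smul_deg (u : ℤˣ) (x : SignedMonomial p) : (u • x).deg = x.deg := rfl

theorem smul_mul (u : ℤˣ) (x y : SignedMonomial p) : (u • x) * y = u • (x * y) :=
  SignedMonomial.ext (by simp only [mul_sgn, smul_sgn, smul_supp, mul_assoc]) rfl

theorem mul_smul' (u : ℤˣ) (x y : SignedMonomial p) : x * (u • y) = u • (x * y) :=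
  SignedMonomial.ext (by
    simp only [mul_sgn, smul_sgn, smul_supp]
    rw [mul_left_comm x.sgn u, mul_assoc u]) rfl

theorem smul_tmul {V : Type*} [AddCommGroup V] (u : ℤˣ) (x : SignedMonomial p) (v : V) :
    (u • x).tmul v = u • x.tmul v := by
  rw [tmul, tmul, smul_sgn, smul_supp, smul_smul]

theorem mul_eq_smul_mul {a b : SignedMonomial p} (h : (a * b).supp.Nodup) :
    a * b = (a.deg * b.deg).negOnePow • (b * a) := by
  rw [supp_mul, Multiset.nodup_add] at h
  refine SignedMonomial.ext ?_ (add_comm _ _)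
  rw [mul_sgn, smul_sgn, mul_sgn, deg, deg, ← crossing_add_crossing p h.2.2, Int.negOnePow_add,
    mul_comm b.sgn]
  calc a.sgn * b.sgn * (crossing p a.supp b.supp).negOnePow
      = (crossing p a.supp b.supp).negOnePow * (a.sgn * b.sgn) *
        ((crossing p b.supp a.supp).negOnePow * (crossing p b.supp a.supp).negOnePow) := by
        rw [Int.units_mul_self, mul_one, mul_comm]
    _ = _ := by simp only [mul_assoc, mul_left_comm]

theorem supp_prod (l : List (SignedMonomial p)) : l.prod.supp = (l.map supp).sum := by
  induction l with
  | nil => rfl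
  | cons x l ih => simp [ih]

theorem crossing_list_sum (a : Multiset J) (l : List (Multiset J)) :
    crossing p a l.sum = (l.map (crossing p a)).sum := by
  induction l with
  | nil => simp
  | cons b l ih => simp [crossing_add_right, ih]

theorem sgn_prod (l : List (SignedMonomial p)) : l.prod.sgn =
    (l.map sgn).prod * (pairSum (fun x y => crossing p x.supp y.supp) l).negOnePow := by
  induction l with
  | nil => simp [pairSum]
  | cons x l ih =>
    rw [List.prod_cons, mul_sgn, ih, pairSum, Int.negOnePow_add, List.map_cons, List.prod_cons,
      supp_prod, crossing_list_sum, List.map_map]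
    simp only [mul_assoc, mul_left_comm, mul_comm]
    rfl

/-- Reordering a product of symbols produces the Koszul sign. -/
theorem prod_perm {n : ℕ} (x : Fin n → SignedMonomial p) (σ : Equiv.Perm (Fin n))
    (h : (List.ofFn x).prod.supp.Nodup) :
    (List.ofFn fun i => x (σ i)).prod = koszulSign σ (fun i => (x i).deg) • (List.ofFn x).prod := by
  have hs : (List.ofFn fun i => x (σ i)).prod.supp = (List.ofFn x).prod.supp := by
    rw [supp_prod, supp_prod, List.map_ofFn, List.map_ofFn, List.sum_ofFn, List.sum_ofFn]
    exact Equiv.sum_comp σ fun i => (x i).supp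
  refine SignedMonomial.ext ?_ hs
  rw [smul_sgn, sgn_prod, sgn_prod, List.map_ofFn, List.map_ofFn, List.prod_ofFn, List.prod_ofFn]
  have h1 : ∏ i, (sgn ∘ fun i => x (σ i)) i = ∏ i, (sgn ∘ x) i :=
    Equiv.prod_comp σ fun i => (x i).sgn
  have h2 : ∀ τ : Fin n → Fin n, pairSum (fun x y => crossing p x.supp y.supp)
      (List.ofFn fun i => x (τ i)) =
      pairSum (fun a b => crossing p (x a).supp (x b).supp) (List.ofFn τ) := fun τ => by
    rw [pairSum_ofFn, pairSum_ofFn]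
  have h3 := h2 σ
  have h4 := h2 id
  simp only [id] at h4
  rw [h1, h3, h4, negOnePow_pairSum_perm, mul_left_comm]
  congr 1
  refine Finset.prod_congr rfl fun q hq => ?_
  have hq : q.1 < q.2 := by simp at hq; exact hq.1
  have hne : σ q.1 ≠ σ q.2 := fun h => hq.ne (σ.injective h)
  congr 1
  -- An inverted pair contributes both crossings, whose sum is the product of the degrees because
  -- factors of a product without repetition have disjoint supports.
  refine crossing_add_crossing p ?_
  rw [supp_prod, List.map_ofFn, List.sum_ofFn, ← Finset.add_sum_erase _ _ (Finset.mem_univ (σ q.1)),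
    ← Finset.add_sum_erase _ _ (Finset.mem_erase.2 ⟨hne.symm, Finset.mem_univ (σ q.2)⟩),
    ← add_assoc] at h
  exact (Multiset.nodup_add.1 (Multiset.nodup_of_le (Multiset.le_add_right _ _) h)).2.2

end SignedMonomial

/-! ### Enumerations of finite sets as permutations -/

section Enumerations

variable {I Y : Type*} [DecidableEq I] [AddCommGroup Y]

/-- Under `Equiv.Perm.decomposeFin`, the first entry of the enumeration is a free choice `a`, and
the other entries are enumerated through `succ` followed by the transposition of `0` and `a`. -/
theorem enumSum_univ_map {n : ℕ} (s : Fin n ↪ I) (F : List I → Y) :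
    enumSum (Finset.univ.map s) F = ∑ σ : Equiv.Perm (Fin n), F (List.ofFn fun i => s (σ i)) := by
  induction n generalizing F with
  | zero => rw [enumSum_rec]; simp
  | succ n ih =>
    rw [enumSum_rec, if_neg (by simp [Finset.eq_empty_iff_forall_notMem]), zero_add,
      Finset.sum_map, ← Equiv.sum_comp (Equiv.Perm.decomposeFin (n := n)).symm,
      Fintype.sum_prod_type]
    refine Finset.sum_congr rfl fun a _ => ?_
    have h : (Finset.univ.map s).erase (s a) =
        Finset.univ.map (((Fin.succEmb n).trans (Equiv.swap 0 a).toEmbedding).trans s) := by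
      ext b
      simp only [Finset.mem_erase, Finset.mem_map, Finset.mem_univ, true_and,
        Function.Embedding.trans_apply, Equiv.coe_toEmbedding, Fin.coe_succEmb]
      constructor
      · rintro ⟨hb, c, rfl⟩
        have hc : (Equiv.swap 0 a) c ≠ 0 := fun h => hb (by
          rw [Equiv.swap_apply_eq_iff, Equiv.swap_apply_left] at h
          rw [h])
        obtain ⟨c', hc'⟩ := Fin.exists_succ_eq.2 hc
        exact ⟨c', by rw [hc', Equiv.swap_apply_self]⟩
      · rintro ⟨c, rfl⟩
        refine ⟨fun h => ?_, _, rfl⟩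
        have h := s.injective h
        rw [Equiv.swap_apply_eq_iff, Equiv.swap_apply_right] at h
        exact Fin.succ_ne_zero c h
    rw [h, ih]
    refine Finset.sum_congr rfl fun e _ => ?_
    rw [List.ofFn_succ, Equiv.Perm.decomposeFin_symm_apply_zero]
    simp only [Equiv.Perm.decomposeFin_symm_apply_succ]
    rfl

theorem markSum_ofFn {α : Type*} {n : ℕ} (x : Fin n → α) (F : List α → α → List α → Y) :
    markSum (List.ofFn x) F =
      ∑ q : Fin n, F ((List.ofFn x).take q) (x q) ((List.ofFn x).drop (q + 1)) := by
  induction n generalizing F with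
  | zero => simp
  | succ n ih =>
    rw [List.ofFn_succ, markSum_cons, ih, Fin.sum_univ_succ]
    simp

end Enumerations

/-! ### Closure properties of operations -/

section WordLinearity

variable {k M N Y : Type*} [CommRing k] [AddCommGroup M] [Module k M] [AddCommGroup N] [Module k N]
  [AddCommGroup Y] [Module k Y]

theorem WordLinear.splitSum {F : List M → List M → Y} (h : ∀ v, WordLinear k fun u => F u v)
    (h' : ∀ u, WordLinear k (F u)) : WordLinear k fun w => splitSum w F := by
  intro x z
  simp only [splitSum_insert]
  exact isLinearMap_add
    (isLinearMap_splitSum (F := fun m u v => F u (v ++ m :: z)) x fun u v => h' u v z)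
    (isLinearMap_splitSum (F := fun m u v => F (x ++ m :: u) v) z fun u v => h v x u)

theorem WordLinear.comp_map {f : List M → Y} (hf : WordLinear k f) (φ : N →ₗ[k] M) :
    WordLinear k fun w => f (w.map φ) := by
  intro u v
  simp only [List.map_append, List.map_cons]
  exact isLinearMap_comp (G := fun m => f (u.map φ ++ m :: v.map φ)) φ.isLinear (hf _ _)

theorem WordLinear.comp_letter {f : List M → Y} (hf : WordLinear k f) {g : List N → M}
    (hg : WordLinear k g) (x y : List M) : WordLinear k fun w => f (x ++ g w :: y) :=
  fun u v => isLinearMap_comp (G := fun m => f (x ++ m :: y)) (hg u v) (hf x y)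

theorem wordLinear_zero : WordLinear k fun _ : List M => (0 : Y) := fun _ _ => isLinearMap_zero

theorem WordLinear.sub {f g : List M → Y} (hf : WordLinear k f) (hg : WordLinear k g) :
    WordLinear k (f - g) := fun u v => isLinearMap_sub (hf u v) (hg u v)

theorem WordLinear.add {f g : List M → Y} (hf : WordLinear k f) (hg : WordLinear k g) :
    WordLinear k (f + g) := fun u v => isLinearMap_add (hf u v) (hg u v)

theorem WordLinear.sum {ι : Type*} (s : Finset ι) {f : ι → List M → Y}
    (hf : ∀ i ∈ s, WordLinear k (f i)) : WordLinear k (∑ i ∈ s, f i) := by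
  intro u v
  simp only [Finset.sum_apply]
  exact isLinearMap_sum s fun i hi => hf i hi u v

theorem WordLinear.units_smul {f : List M → Y} (hf : WordLinear k f) (s : ℤˣ) :
    WordLinear k (s • f) := fun u v =>
  isLinearMap_comp (G := fun y : Y => s • y) (hf u v)
    ⟨fun x y => smul_add s x y, fun c x => smul_comm s c x⟩

theorem isLinearMap_tensorComp {Z : Type*} [AddCommGroup Z] [Module k Z] {F : Z → List M → Y}
    (gs : List (List M → M)) (hF : ∀ o, IsLinearMap k fun m => F m o) (w : List M) :
    IsLinearMap k fun m => tensorComp (F m) gs w where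
  map_add x y := by
    rw [← tensorComp_add]
    exact congrArg (fun f => tensorComp f gs w) (funext fun o => (hF o).map_add x y)
  map_smul c x := by
    refine Eq.trans ?_ (tensorComp_map (DistribSMul.toAddMonoidHom Y c) (F x) gs w).symm
    exact congrArg (fun f => tensorComp f gs w) (funext fun o => (hF o).map_smul c x)

theorem WordLinear.tensorComp {f : List M → Y} (hf : WordLinear k f) {gs : List (List M → M)}
    (hgs : ∀ g ∈ gs, WordLinear k g) : WordLinear k (tensorComp f gs) := by
  induction gs generalizing f with
  | nil =>
    intro u v
    have h : ∀ x, _root_.tensorComp f [] (u ++ x :: v) = 0 := fun x => by simp [_root_.tensorComp]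
    simp only [h]
    exact isLinearMap_zero
  | cons g gs ih =>
    refine WordLinear.splitSum (F := fun u v => _root_.tensorComp (fun o => f (g u :: o)) gs v)
      (fun v => ?_) fun u => ?_
    · intro x z
      exact isLinearMap_tensorComp (F := fun m o => f (g (x ++ m :: z) :: o)) gs
        (fun o => isLinearMap_comp (G := fun m => f (m :: o)) (hgs g List.mem_cons_self x z)
          (hf [] o)) v
    · exact ih (hf.cons _) fun g' hg' => hgs g' (List.mem_cons_of_mem _ hg')

theorem WordLinear.emptyPart {f : List M → M} (hf : WordLinear k f) (b : Bool) :
    WordLinear k (emptyPart b f) := by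
  cases b with
  | false => simpa using hf
  | true =>
    intro u v
    have h : ∀ x, _root_.emptyPart true f (u ++ x :: v) = 0 := fun x =>
      emptyPart_true (by simp) f
    simp only [h]
    exact isLinearMap_zero

theorem wordLinear_idWord : WordLinear k (idWord : List M → M) := by
  intro u v
  rcases u with _ | ⟨a, _ | ⟨b, u⟩⟩
  · rcases v with _ | ⟨c, v⟩
    · exact (LinearMap.id : M →ₗ[k] M).isLinear
    · exact isLinearMap_zero
  · exact isLinearMap_zero
  · exact isLinearMap_zero

end WordLinearity

section Closure

variable {k V : Type*} [Field k] [AddCommGroup V] [Module k V] {𝒱 : ℤ → Submodule k V}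

theorem suspension_units_smul {j : ℤ} {v : V} (s : ℤˣ) (hv : v ∈ suspension 𝒱 j) :
    s • v ∈ suspension 𝒱 j := by
  rw [Units.smul_def, ← Int.cast_smul_eq_zsmul k]
  exact Submodule.smul_mem _ _ hv

theorem splitSum_mem {α : Type*} (N : Submodule k V) {w : List α} {F : List α → List α → V}
    (h : ∀ u v, u ++ v = w → F u v ∈ N) : splitSum w F ∈ N := by
  rw [splitSum_eq_sum_range]
  exact Submodule.sum_mem _ fun i _ => h _ _ (List.take_append_drop i w)

namespace IsOperation

variable {d e : ℤ} {f g : List V → V}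

theorem units_smul (hf : IsOperation 𝒱 e f) (s : ℤˣ) : IsOperation 𝒱 e (s • f) where
  linear := hf.linear.units_smul s
  mem L hL := suspension_units_smul s (hf.mem L hL)

theorem sub (hf : IsOperation 𝒱 e f) (hg : IsOperation 𝒱 e g) : IsOperation 𝒱 e (f - g) where
  linear := hf.linear.sub hg.linear
  mem L hL := Submodule.sub_mem _ (hf.mem L hL) (hg.mem L hL)

theorem add (hf : IsOperation 𝒱 e f) (hg : IsOperation 𝒱 e g) : IsOperation 𝒱 e (f + g) where
  linear := hf.linear.add hg.linear
  mem L hL := Submodule.add_mem _ (hf.mem L hL) (hg.mem L hL)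

theorem zero : IsOperation 𝒱 e 0 where
  linear := wordLinear_zero
  mem _ _ := Submodule.zero_mem _

theorem sum {ι : Type*} (s : Finset ι) {f : ι → List V → V}
    (hf : ∀ i ∈ s, IsOperation 𝒱 e (f i)) : IsOperation 𝒱 e (∑ i ∈ s, f i) where
  linear := WordLinear.sum s fun i hi => (hf i hi).linear
  mem L hL := by
    rw [Finset.sum_apply]
    exact Submodule.sum_mem _ fun i hi => (hf i hi).mem L hL

theorem emptyPart (hf : IsOperation 𝒱 e f) (b : Bool) : IsOperation 𝒱 e (emptyPart b f) where
  linear := hf.linear.emptyPart b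
  mem L hL := by
    unfold _root_.emptyPart
    split_ifs
    · exact Submodule.zero_mem _
    · exact hf.mem L hL

theorem idWord : IsOperation 𝒱 0 idWord where
  linear := wordLinear_idWord
  mem L hL := by
    rcases L with _ | ⟨x, _ | ⟨y, L⟩⟩
    · exact Submodule.zero_mem _
    · simpa [_root_.idWord] using hL x List.mem_cons_self
    · exact Submodule.zero_mem _

theorem letter (hf : IsOperation 𝒱 e f) {v : V} {j : ℤ} (hv : v ∈ suspension 𝒱 j) :
    IsOperation 𝒱 (e + j) fun o => f (v :: o) where
  linear := hf.linear.cons v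
  mem L hL := by
    have h := hf.mem ((j, v) :: L) (by
      rintro x (_ | ⟨_, hx⟩)
      · exact hv
      · exact hL x hx)
    rwa [List.map_cons, List.map_cons, List.sum_cons, ← add_assoc] at h

variable [DirectSum.Decomposition 𝒱]

theorem mem_twist (hf : IsOperation 𝒱 e f) {L : List (ℤ × V)}
    (hL : ∀ x ∈ L, x.2 ∈ suspension 𝒱 x.1) (c : ℤ) :
    f ((L.map Prod.snd).map (twist 𝒱 c)) ∈ suspension 𝒱 (e + (L.map Prod.fst).sum) := by
  have h := hf.linear.map_twist 𝒱 c L hL []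
  rw [List.append_nil, List.append_nil] at h
  rw [h]
  exact suspension_units_smul _ (hf.mem L hL)

theorem insertion (hf : IsOperation 𝒱 d f) (hg : IsOperation 𝒱 e g) :
    IsOperation 𝒱 (d + e) (insertion 𝒱 f e g) where
  linear := by
    have h : _root_.insertion 𝒱 f e g = fun w => splitSum w fun x t => splitSum t fun y z =>
      f (x.map (twist 𝒱 e) ++ g y :: z) := funext (insertion_eq 𝒱 f e g)
    rw [h]
    refine WordLinear.splitSum (F := fun x t => splitSum t fun y z =>
      f (x.map (twist 𝒱 e) ++ g y :: z)) (fun t => ?_) fun x => ?_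
    · intro u v
      refine isLinearMap_splitSum (F := fun m y z => f ((u ++ m :: v).map (twist 𝒱 e) ++ g y :: z))
        t fun y z => ?_
      exact (hf.linear.append_right (g y :: z)).comp_map (twist 𝒱 e) u v
    · refine WordLinear.splitSum (F := fun y z => f (x.map (twist 𝒱 e) ++ g y :: z))
        (fun z => ?_) fun y => ?_
      · exact hf.linear.comp_letter hg.linear _ z
      · exact (hf.linear.append_left (x.map (twist 𝒱 e))).cons (g y)
  mem L hL := by
    rw [insertion_eq, splitSum_list_map]
    refine splitSum_mem _ fun A r hAr => ?_
    rw [splitSum_list_map]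
    refine splitSum_mem _ fun B C hBC => ?_
    subst hBC
    subst hAr
    have hA : ∀ x ∈ A, x.2 ∈ suspension 𝒱 x.1 := fun x hx => hL x (by simp [hx])
    have hB : ∀ x ∈ B, x.2 ∈ suspension 𝒱 x.1 := fun x hx => hL x (by simp [hx])
    have hC : ∀ x ∈ C, x.2 ∈ suspension 𝒱 x.1 := fun x hx => hL x (by simp [hx])
    rw [hf.linear.map_twist 𝒱 e A hA]
    refine suspension_units_smul _ ?_
    have h := hf.mem (A ++ (e + (B.map Prod.fst).sum, g (B.map Prod.snd)) :: C) (by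
      simp only [List.mem_append, List.mem_cons]
      rintro x (hx | rfl | hx)
      · exact hA x hx
      · exact hg.mem B hB
      · exact hC x hx)
    simp only [List.map_append, List.map_cons, List.sum_append, List.sum_cons] at h ⊢
    convert h using 2
    ring

theorem compTensor (hf : IsOperation 𝒱 e f) (gs : List (ℤ × (List V → V)))
    (hgs : ∀ x ∈ gs, IsOperation 𝒱 x.1 x.2) :
    IsOperation 𝒱 (e + (gs.map Prod.fst).sum) (compTensor 𝒱 f gs) where
  linear := by
    have h : _root_.compTensor 𝒱 f gs = tensorComp f (twistOps 𝒱 gs) :=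
      funext (compTensor_eq 𝒱 f gs)
    rw [h]
    refine hf.linear.tensorComp ?_
    clear h
    induction gs with
    | nil => simp [twistOps]
    | cons x gs ih =>
      simp only [twistOps, List.mem_cons]
      rintro g (rfl | hg)
      · exact (hgs x List.mem_cons_self).linear.comp_map _
      · exact ih (fun y hy => hgs y (List.mem_cons_of_mem _ hy)) g hg
  mem L hL := by
    induction gs generalizing e f L with
    | nil =>
      rw [_root_.compTensor]
      split_ifs with h
      · rw [List.map_eq_nil_iff] at h
        subst h
        simpa using hf.mem [] hL
      · exact Submodule.zero_mem _
    | cons x gs ih =>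
      rw [compTensor_eq, twistOps, tensorComp_cons, splitSum_list_map]
      refine splitSum_mem _ fun A B hAB => ?_
      subst hAB
      have hA : ∀ x ∈ A, x.2 ∈ suspension 𝒱 x.1 := fun x hx => hL x (by simp [hx])
      have hB : ∀ x ∈ B, x.2 ∈ suspension 𝒱 x.1 := fun x hx => hL x (by simp [hx])
      rw [← compTensor_eq]
      have h := ih (hf.letter ((hgs x List.mem_cons_self).mem_twist hA (gs.map Prod.fst).sum))
        (fun y hy => hgs y (List.mem_cons_of_mem _ hy)) B hB
      simp only [List.map_append, List.map_cons, List.sum_append, List.sum_cons] at h ⊢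
      convert h using 2
      ring

end IsOperation

end Closure

/-! ### Closure properties of represented operations -/

section Represents

variable {k V : Type*} [Field k] [AddCommGroup V] [Module k V] {𝒱 : ℤ → Submodule k V}
  [DirectSum.Decomposition 𝒱] {J : Type*} [LinearOrder J] {p : J → ℤ}

namespace Represents

variable {F G : List (Multiset J →₀ V) → (Multiset J →₀ V)} {t t' : SignedMonomial p}
  {f g : List V → V}

theorem sub (hF : Represents 𝒱 F t f) (hG : Represents 𝒱 G t g) :
    Represents 𝒱 (fun w => F w - G w) t (f - g) := fun L hL hN => by
  dsimp only
  rw [hF L hL hN, hG L hL hN, Pi.sub_apply]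
  exact (map_sub (t * (L.map Prod.fst).prod).tmulHom (f (L.map Prod.snd)) _).symm

theorem sum {ι : Type*} (s : Finset ι) {F : ι → List (Multiset J →₀ V) → (Multiset J →₀ V)}
    {f : ι → List V → V} (h : ∀ i ∈ s, Represents 𝒱 (F i) t (f i)) :
    Represents 𝒱 (fun w => ∑ i ∈ s, F i w) t (∑ i ∈ s, f i) := fun L hL hN => by
  dsimp only
  rw [Finset.sum_congr rfl fun i hi => h i hi L hL hN, Finset.sum_apply]
  exact (map_sum ((t * (L.map Prod.fst).prod).tmulHom (V := V)) (fun i => f i (L.map Prod.snd)) s).symm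

/-- Rearranging the symbols of an operation passes the sign of the rearrangement to the operation on
`V`. It suffices to know this sign for symbols without repetition, since `Represents` tests nothing
else. -/
theorem of_smul {u : ℤˣ} (h : t.supp.Nodup → t' = u • t) (hs : t'.supp = t.supp)
    (hF : Represents 𝒱 F t' f) : Represents 𝒱 F t (u • f) := fun L hL hN => by
  have hN' := hN
  rw [SignedMonomial.supp_mul] at hN'
  have ht := h (Multiset.nodup_of_le (Multiset.le_add_right _ _) hN')
  rw [hF L hL (by rwa [SignedMonomial.supp_mul, hs]), ht, SignedMonomial.smul_mul,
    SignedMonomial.smul_tmul, Pi.smul_apply, SignedMonomial.tmul_smul]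

theorem units_smul (hF : Represents 𝒱 F t f) (u : ℤˣ) : Represents 𝒱 F (u • t) (u • f) :=
  of_smul (t := u • t) (t' := t) (fun _ => by rw [smul_smul, Int.units_mul_self, one_smul]) rfl hF

theorem emptyPart (hF : Represents 𝒱 F t f) (b : Bool) :
    Represents 𝒱 (emptyPart b F) t (emptyPart b f) := fun L hL hN => by
  unfold _root_.emptyPart
  by_cases h : L = []
  · subst h
    simpa using hF [] hL hN
  · cases b
    · simpa using hF L hL hN
    · simp [h]

theorem idWord : Represents 𝒱 idWord (1 : SignedMonomial p) idWord := fun L _ _ => by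
  rcases L with _ | ⟨x, _ | ⟨y, L⟩⟩
  · simp [_root_.idWord]
  · simp [_root_.idWord]
  · simp [_root_.idWord]

end Represents

end Represents

/-! ### The brackets as vector fields -/

section Lists

variable {α β Y Z : Type*} [AddCommGroup Y] [AddCommGroup Z]

theorem ofFn_eq_append {n : ℕ} (x : Fin n → α) (q : Fin n) :
    List.ofFn x = (List.ofFn x).take q ++ x q :: (List.ofFn x).drop (q + 1) := by
  conv_lhs => rw [← List.take_append_drop q (List.ofFn x)]
  rw [List.drop_eq_getElem_cons (by simp), List.getElem_ofFn]

theorem ofFn_eq_map_append {n : ℕ} {x : Fin n → α} {y : Fin n → β} {q : Fin n} {f g : α → β}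
    (hf : ∀ j < q, y j = f (x j)) (hg : ∀ j, q < j → y j = g (x j)) :
    List.ofFn y = ((List.ofFn x).take q).map f ++ y q :: ((List.ofFn x).drop (q + 1)).map g := by
  rw [ofFn_eq_append y q]
  congr 2
  · refine List.ext_getElem (by simp) fun i h1 h2 => ?_
    simp only [List.getElem_take, List.getElem_ofFn, List.getElem_map]
    exact hf _ (Fin.lt_def.2 (by simp at h1; omega))
  · refine List.ext_getElem (by simp) fun i h1 h2 => ?_
    simp only [List.getElem_drop, List.getElem_ofFn, List.getElem_map]
    exact hg _ (Fin.lt_def.2 (by simp; omega))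

theorem markSum_enumSum {I : Type*} [DecidableEq I] (w : List α) (S : Finset I)
    (F : List I → List α → α → List α → Y) :
    markSum w (fun u x v => enumSum S fun l => F l u x v) =
      enumSum S fun l => markSum w (F l) := by
  induction w generalizing F with
  | nil => simp [enumSum_zero]
  | cons a w ih => simp only [markSum_cons, enumSum_add, ih]

theorem splitSum_idWord_cons {M : Type*} [AddCommGroup M] {K : M → List M → Y}
    (hK : ∀ z, K 0 z = 0) (x : M) (w : List M) :
    splitSum w (fun y z => K (idWord (x :: y)) z) = K x w := by
  cases w with
  | nil => rfl
  | cons a w =>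
    rw [splitSum_cons, splitSum_eq_zero, add_zero]
    · rfl
    · exact fun u v _ => hK v

/-- `idWord` kills every block that is not a single letter, so cutting out its block is the same as
marking a letter. -/
theorem splitSum_idWord {M : Type*} [AddCommGroup M] {K : List M → M → List M → Y}
    (hK : ∀ u z, K u 0 z = 0) (w : List M) :
    splitSum w (fun u t => splitSum t fun y z => K u (idWord y) z) = markSum w K := by
  induction w generalizing K with
  | nil => exact hK [] []
  | cons x w ih =>
    rw [splitSum_cons, splitSum_cons, markSum_cons, ← ih fun u z => hK (x :: u) z,
      splitSum_idWord_cons (hK [])]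
    simp [idWord, hK]

end Lists

/-! ### Vector fields as sums over permutations -/

section VectorField

variable {k I M : Type*} [CommRing k] [DecidableEq I] [AddCommGroup M] [Module k M]

theorem tensorComp_splitSum_comm {α : Type*} (gs : List (List M → M)) (t : List α)
    (F : List M → List α → List α → M) (w : List M) :
    tensorComp (fun o => splitSum t (F o)) gs w =
      splitSum t fun y z => tensorComp (fun o => F o y z) gs w := by
  simp only [splitSum_eq_sum_range, tensorComp_sum]

/-- Writing the identity factor as `idWord` makes it an ordinary entry of a tensor product of
operations, as in the formula for the brackets. -/
theorem expIdExp_eq (gm gp : I → List M → M) (S : Finset I) {h : List M → M}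
    (hh : WordLinear k h) (w : List M) :
    expIdExp gm gp S h w = partSum S fun A B => enumSum A fun l₁ => enumSum B fun l₂ =>
      tensorComp h (l₁.map gm ++ idWord :: l₂.map gp) w := by
  simp only [expIdExp, expComp, tensorComp_enumSum, markSum_partSum, markSum_enumSum]
  refine partSum_congr fun A _ => enumSum_congr fun l₁ _ => enumSum_congr fun l₂ _ => ?_
  rw [tensorComp_append]
  simp only [tensorComp_cons]
  have h := splitSum_idWord (K := fun u x z =>
    tensorComp (fun o => tensorComp (fun o' => h (o ++ x :: o')) (l₂.map gp) z) (l₁.map gm) u)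
    (fun u z => by simp only [hh.map_zero, tensorComp_zero]) w
  rw [← h]
  refine splitSum_congr fun u v _ => ?_
  exact (tensorComp_splitSum_comm _ _ _ _).symm

theorem ins_enumSum_right {f : List M → M} (hf : WordLinear k f) (S : Finset I)
    (G : List I → List M → M) (w : List M) :
    ins f (fun y => enumSum S fun l => G l y) w = enumSum S fun l => ins f (G l) w := by
  have h : (fun y => enumSum S fun l => G l y) = enumSum S G := funext fun y =>
    (enumSum_map (Pi.evalAddMonoidHom (fun _ => M) y) S G).symm
  let φ : (List M → M) →+ M :=
    { toFun := fun g => ins f g w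
      map_zero' := by
        refine splitSum_eq_zero fun _ _ _ => splitSum_eq_zero fun _ _ _ => hf.map_zero _ _
      map_add' := fun g g' => by
        simp only [ins, ← splitSum_add]
        exact splitSum_congr fun _ _ _ => splitSum_congr fun _ _ _ => (hf _ _).map_add _ _ }
  rw [h]
  exact enumSum_map φ S G

/-- The family `g`, restricted to the empty word before the position `q` if `b` holds, and after
the position `q` if `b'` holds. -/
def truncate (b b' : Bool) {n : ℕ} (g : Fin n → List M → M) (q j : Fin n) : List M → M :=
  if j < q then emptyPart b (g j) else if q < j then emptyPart b' (g j) else g j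

/-- Enumerating the index set brings the field into the shape of the brackets: a sum over
permutations, with a second sum over the position `q` of the outer factor. The truncations `g₋` and
`g₊` fall on the factors before and after `q`. -/
theorem vectorField_univ_map (b b' : Bool) {n : ℕ} (s : Fin n ↪ I) {G : I → List M → M}
    (hG : ∀ a, WordLinear k (G a)) {h : List M → M} (hh : WordLinear k h) (w : List M) :
    vectorField b b' G (Finset.univ.map s) h w = ∑ σ : Equiv.Perm (Fin n),
      (tensorComp h (List.ofFn fun j => G (s (σ j))) w -
        ∑ q, ins (G (s (σ q))) (tensorComp h (List.ofFn fun j =>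
          if j = q then idWord else truncate b b' (fun j => G (s (σ j))) q j)) w) := by
  have h2 : ∑ a ∈ Finset.univ.map s, ins (G a) (expIdExp (fun a => emptyPart b (G a))
      (fun a => emptyPart b' (G a)) ((Finset.univ.map s).erase a) h) w =
      enumSum (Finset.univ.map s) fun l => markSum l fun l₁ a l₂ => ins (G a) (tensorComp h
        (l₁.map (fun a => emptyPart b (G a)) ++ idWord :: l₂.map fun a => emptyPart b' (G a))) w := by
    rw [enumSum_markSum]
    refine Finset.sum_congr rfl fun a _ => ?_
    have e : expIdExp (fun a => emptyPart b (G a)) (fun a => emptyPart b' (G a))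
        ((Finset.univ.map s).erase a) h = _ := funext fun y => expIdExp_eq _ _ _ hh y
    rw [e, ins_partSum_right (hG a)]
    simp only [ins_enumSum_right (hG a)]
  rw [vectorField, h2, expComp, enumSum_univ_map, enumSum_univ_map, ← Finset.sum_sub_distrib]
  refine Finset.sum_congr rfl fun σ _ => ?_
  rw [List.map_ofFn, markSum_ofFn]
  congr 1
  refine Finset.sum_congr rfl fun q _ => ?_
  rw [ofFn_eq_map_append (x := fun i => s (σ i)) (q := q) (f := fun a => emptyPart b (G a))
    (g := fun a => emptyPart b' (G a))
    (y := fun j => if j = q then idWord else truncate b b' (fun j => G (s (σ j))) q j)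
    (fun j hj => by simp [hj.ne, truncate, hj])
    (fun j hj => by simp [hj.ne', truncate, hj, hj.not_gt]), if_pos rfl]

end VectorField

/-! ### Representation of a bracket with `sh` in front -/

section Brackets

variable {k V : Type*} [Field k] [AddCommGroup V] [Module k V] (𝒱 : ℤ → Submodule k V)
  [DirectSum.Decomposition 𝒱]

/-- The brackets `l^r` (for `(b, b') = (true, false)`) and `l^l` (for `(b, b') = (false, true)`). -/
def signedBracket (b b' : Bool) {n : ℕ} (η : ℤ) (h : List V → V) (d : Fin n → ℤ)
    (g : Fin n → List V → V) : List V → V :=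
  ∑ σ : Equiv.Perm (Fin n), epsSign η d σ •
    (compTensor 𝒱 h (List.ofFn fun j => (d (σ j) + 1, g (σ j))) -
      ∑ q, outerTerm 𝒱 η h (d ∘ σ) (truncate b b' (g ∘ σ) q) q)

variable {𝒱}

theorem isOperation_truncate (b b' : Bool) {n : ℕ} {d : Fin n → ℤ} {g : Fin n → List V → V}
    (hg : ∀ j, IsOperation 𝒱 (d j) (g j)) (q j : Fin n) :
    IsOperation 𝒱 (d j) (truncate b b' g q j) := by
  unfold truncate
  split_ifs
  · exact (hg j).emptyPart b
  · exact (hg j).emptyPart b'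
  · exact hg j

theorem sum_ite_zero_eq {n : ℕ} (f : Fin n → ℤ) (q : Fin n) :
    ∑ j, (if j = q then 0 else f j) = ∑ j with j ≠ q, f j := by
  rw [Finset.sum_filter]
  exact Finset.sum_congr rfl fun j _ => by by_cases h : j = q <;> simp [h]

theorem isOperation_compTensor_hole {n : ℕ} {η : ℤ} {h : List V → V} {d : Fin n → ℤ}
    {g : Fin n → List V → V} (hh : IsOperation 𝒱 (η + 1) h)
    (hg : ∀ j, IsOperation 𝒱 (d j + 1) (g j)) (q : Fin n) :
    IsOperation 𝒱 (η + 1 + ∑ j with j ≠ q, (d j + 1))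
      (compTensor 𝒱 h (List.ofFn fun j => if j = q then (0, idWord) else (d j + 1, g j))) := by
  have h1 := hh.compTensor (List.ofFn fun j => if j = q then (0, idWord) else (d j + 1, g j)) (by
    simp only [List.mem_ofFn, forall_exists_index]
    rintro x j rfl
    split_ifs
    · exact IsOperation.idWord
    · exact hg j)
  rw [List.map_ofFn, List.sum_ofFn] at h1
  rw [← sum_ite_zero_eq]
  convert h1 using 4 with j
  simp only [Function.comp_apply]
  split_ifs <;> rfl

theorem isOperation_signedBracket (b b' : Bool) {n : ℕ} {η : ℤ} {h : List V → V} {d : Fin n → ℤ}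
    {g : Fin n → List V → V} (hh : IsOperation 𝒱 (η + 1) h)
    (hg : ∀ j, IsOperation 𝒱 (d j + 1) (g j)) :
    IsOperation 𝒱 (η + 1 + ∑ j, (d j + 1)) (signedBracket 𝒱 b b' η h d g) := by
  refine IsOperation.sum _ fun σ _ => IsOperation.units_smul (IsOperation.sub ?_ ?_) _
  · have h1 := hh.compTensor (List.ofFn fun j => (d (σ j) + 1, g (σ j))) (by
      simp only [List.mem_ofFn, forall_exists_index]
      rintro x j rfl
      exact hg _)
    rw [List.map_ofFn, List.sum_ofFn] at h1
    rw [← Equiv.sum_comp σ]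
    exact h1
  · refine IsOperation.sum _ fun q _ => IsOperation.units_smul ?_ _
    have h1 := isOperation_truncate b b' (g := g ∘ σ) (d := fun j => d (σ j) + 1) (fun j => hg _) q
    have h2 := (h1 q).insertion (isOperation_compTensor_hole (d := d ∘ σ) hh h1 q)
    have h3 : d (σ q) + 1 + (η + 1 + ∑ j with j ≠ q, ((d ∘ σ) j + 1)) =
        η + 1 + ∑ j, (d j + 1) := by
      rw [← Equiv.sum_comp σ (fun j => d j + 1), ← Finset.add_sum_erase _ _ (Finset.mem_univ q),
        Finset.filter_ne']
      simp only [Function.comp_apply]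
      ring
    rw [h3] at h2
    exact h2

variable {I J : Type*} [DecidableEq I] [LinearOrder J] {p : J → ℤ}

theorem Represents.truncate (b b' : Bool) {n : ℕ}
    {G : Fin n → List (Multiset J →₀ V) → (Multiset J →₀ V)} {x : Fin n → SignedMonomial p}
    {g : Fin n → List V → V} (hG : ∀ j, Represents 𝒱 (G j) (x j) (g j)) (q j : Fin n) :
    Represents 𝒱 (truncate b b' G q j) (x j) (truncate b b' g q j) := by
  unfold _root_.truncate
  split_ifs
  · exact (hG j).emptyPart b
  · exact (hG j).emptyPart b'
  · exact hG j

theorem represents_tensorComp_ofFn {H : List (Multiset J →₀ V) → (Multiset J →₀ V)}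
    {x₀ : SignedMonomial p} {h : List V → V} (hH : Represents 𝒱 H x₀ h) (hh : WordLinear k h)
    {n : ℕ} {G : Fin n → List (Multiset J →₀ V) → (Multiset J →₀ V)} {x : Fin n → SignedMonomial p}
    {g : Fin n → List V → V} (hG : ∀ j, Represents 𝒱 (G j) (x j) (g j))
    (hg : ∀ j, IsOperation 𝒱 (x j).deg (g j)) :
    Represents 𝒱 (tensorComp H (List.ofFn G)) (x₀ * (List.ofFn x).prod)
      (compTensor 𝒱 h (List.ofFn fun j => ((x j).deg, g j))) := by
  have h1 := represents_tensorComp hH hh (List.ofFn fun j => (G j, x j, g j)) (by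
    simp only [List.mem_ofFn, forall_exists_index]
    rintro y j rfl
    exact ⟨hG j, hg j⟩)
  simp only [List.map_ofFn] at h1
  exact h1

theorem deg_take_prod {n : ℕ} (x : Fin n → SignedMonomial p) (q : Fin n) :
    ((List.ofFn x).take q).prod.deg = ∑ j with j < q, (x j).deg := by
  rw [SignedMonomial.deg_prod, List.map_take, List.map_ofFn, List.sum_take_ofFn]
  rfl

/-- The unsigned composition carries the symbol of `g q` in front of `x₀` and of the symbols with
index below `q`. Moving it to its own place gives the sign in `outerTerm`. -/
theorem represents_outer {H : List (Multiset J →₀ V) → (Multiset J →₀ V)}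
    {x₀ : SignedMonomial p} {h : List V → V} {η : ℤ} (hη : x₀.deg = η + 1)
    (hH : Represents 𝒱 H x₀ h) (hh : IsOperation 𝒱 (η + 1) h)
    {n : ℕ} {G : Fin n → List (Multiset J →₀ V) → (Multiset J →₀ V)} {x : Fin n → SignedMonomial p}
    {d : Fin n → ℤ} (hd : ∀ j, (x j).deg = d j + 1)
    {g : Fin n → List V → V} (hG : ∀ j, Represents 𝒱 (G j) (x j) (g j))
    (hg : ∀ j, IsOperation 𝒱 (d j + 1) (g j)) (q : Fin n) :
    Represents 𝒱 (ins (G q) (tensorComp H (List.ofFn fun j => if j = q then idWord else G j)))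
      (x₀ * (List.ofFn x).prod) (outerTerm 𝒱 η h d g q) := by
  -- The identity factor carries the symbol `1`: the symbol of `g q` belongs to the outer operation.
  have h1 := represents_tensorComp_ofFn hH hh.linear
    (G := fun j => if j = q then idWord else G j) (x := fun j => if j = q then 1 else x j)
    (g := fun j => if j = q then idWord else g j)
    (fun j => by
      split_ifs
      · exact Represents.idWord
      · exact hG j)
    (fun j => by
      split_ifs
      · exact IsOperation.idWord
      · rw [hd]; exact hg j)
  have h2 : (List.ofFn fun j => ((if j = q then (1 : SignedMonomial p) else x j).deg,
      if j = q then idWord else g j)) =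
      List.ofFn fun j => if j = q then (0, idWord) else (d j + 1, g j) := by
    congr 1
    funext j
    split_ifs
    · rfl
    · rw [hd]
  have h3 : (List.ofFn fun j => if j = q then (1 : SignedMonomial p) else x j) =
      (List.ofFn x).take q ++ 1 :: (List.ofFn x).drop (q + 1) := by
    rw [ofFn_eq_map_append (x := x) (q := q) (f := id) (g := id)
      (y := fun j => if j = q then (1 : SignedMonomial p) else x j)
      (fun j hj => by simp [hj.ne]) (fun j hj => by simp [hj.ne']), if_pos rfl, List.map_id,
      List.map_id]
  have h4 : (x₀ * (List.ofFn fun j => if j = q then (1 : SignedMonomial p) else x j).prod).deg =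
      η + 1 + ∑ j with j ≠ q, (d j + 1) := by
    rw [SignedMonomial.deg_mul, hη, SignedMonomial.deg_prod, List.map_ofFn, List.sum_ofFn,
      ← sum_ite_zero_eq]
    congr 1
    refine Finset.sum_congr rfl fun j _ => ?_
    simp only [Function.comp_apply]
    split_ifs
    · rfl
    · exact hd j
  rw [h2] at h1
  have h5 := isOperation_compTensor_hole hh hg q
  rw [← h4] at h5
  have h6 := (hG q).ins h1 (hg q).linear h5
  rw [h4] at h6
  rw [h3, List.prod_append, List.prod_cons, one_mul] at h6
  have h7 : (List.ofFn x).prod =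
      ((List.ofFn x).take q).prod * (x q * ((List.ofFn x).drop (q + 1)).prod) := by
    conv_lhs => rw [ofFn_eq_append x q]
    rw [List.prod_append, List.prod_cons]
  have h8 := deg_take_prod x q
  rw [h7]
  generalize ((List.ofFn x).take q).prod = A at *
  generalize ((List.ofFn x).drop (q + 1)).prod = B at *
  refine Represents.of_smul (fun hN => ?_) ?_ h6
  · have e := SignedMonomial.mul_eq_smul_mul (a := x q) (b := x₀ * A) (by
      refine Multiset.nodup_of_le (Multiset.le_add_right _ B.supp) ?_
      convert hN using 1
      simp only [SignedMonomial.supp_mul]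
      abel)
    rw [← mul_assoc x₀, ← mul_assoc (x q), e, SignedMonomial.smul_mul, SignedMonomial.deg_mul,
      h8, hη, hd]
    simp only [hd, mul_assoc]
  · simp only [SignedMonomial.supp_mul]
    abel

/-- The summand of `σ` has its symbols in the order given by `σ`, so restoring the order yields a
Koszul sign in shifted degrees; by `epsSign_eq` this is `ε` up to the global sign in the statement.
-/
theorem represents_vectorField_first (b b' : Bool)
    {H : List (Multiset J →₀ V) → (Multiset J →₀ V)}
    {x₀ : SignedMonomial p} {h : List V → V} {η : ℤ} (hη : x₀.deg = η + 1)
    (hH : Represents 𝒱 H x₀ h) (hHlin : WordLinear k H) (hh : IsOperation 𝒱 (η + 1) h)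
    {n : ℕ} (s : Fin n ↪ I) {G : I → List (Multiset J →₀ V) → (Multiset J →₀ V)}
    (hGlin : ∀ a, WordLinear k (G a)) {x : Fin n → SignedMonomial p}
    {d : Fin n → ℤ} (hd : ∀ j, (x j).deg = d j + 1)
    {g : Fin n → List V → V} (hG : ∀ j, Represents 𝒱 (G (s j)) (x j) (g j))
    (hg : ∀ j, IsOperation 𝒱 (d j + 1) (g j)) :
    Represents 𝒱 (vectorField b b' G (Finset.univ.map s) H) (x₀ * (List.ofFn x).prod)
      ((n * (η + 1) + pairSum (fun a _ => d a) (List.ofFn id)).negOnePow •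
        signedBracket 𝒱 b b' η h d g) := by
  have h1 : vectorField b b' G (Finset.univ.map s) H = _ :=
    funext fun w => vectorField_univ_map b b' s hGlin hHlin w
  have h2 : (n * (η + 1) + pairSum (fun a _ => d a) (List.ofFn id)).negOnePow •
      signedBracket 𝒱 b b' η h d g = ∑ σ : Equiv.Perm (Fin n), koszulSign σ (fun i => d i + 1) •
    (compTensor 𝒱 h (List.ofFn fun j => (d (σ j) + 1, g (σ j))) -
      ∑ q, outerTerm 𝒱 η h (d ∘ σ) (truncate b b' (g ∘ σ) q) q) := by
    rw [signedBracket, Finset.smul_sum]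
    refine Finset.sum_congr rfl fun σ _ => ?_
    rw [smul_smul, epsSign_eq, ← mul_assoc, Int.units_mul_self, one_mul]
  rw [h1, h2]
  refine Represents.sum _ fun σ _ => Represents.of_smul
    (t' := x₀ * (List.ofFn fun j => x (σ j)).prod) (fun hN => ?_) ?_ (Represents.sub ?_ ?_)
  · rw [SignedMonomial.supp_mul, Multiset.nodup_add] at hN
    rw [SignedMonomial.prod_perm x σ hN.2.1, SignedMonomial.mul_smul']
    simp only [hd]
  · simp only [SignedMonomial.supp_mul, SignedMonomial.supp_prod, List.map_ofFn, List.sum_ofFn]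
    congr 1
    exact Equiv.sum_comp σ fun j => (x j).supp
  · have h3 := represents_tensorComp_ofFn hH hh.linear (fun j => hG (σ j))
      (fun j => by rw [hd]; exact hg (σ j))
    simp only [hd] at h3
    exact h3
  · refine Represents.sum _ fun q _ => ?_
    have h4 := represents_outer hη hH hh (d := d ∘ σ) (fun j => hd (σ j))
      (fun j => Represents.truncate b b' (fun j => hG (σ j)) q j)
      (fun j => isOperation_truncate b b' (d := fun j => d (σ j) + 1) (fun j => hg (σ j)) q j) q
    have h5 : truncate b b' (fun j => G (s (σ j))) q q = G (s (σ q)) := by simp [_root_.truncate]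
    rw [h5] at h4
    exact h4

end Brackets

section Lists

theorem pairSum_congr {α : Type*} {F G : α → α → ℤ} {l : List α}
    (h : ∀ i ∈ l, ∀ j ∈ l, F i j = G i j) : pairSum F l = pairSum G l := by
  induction l with
  | nil => rfl
  | cons x l ih =>
    simp only [pairSum]
    rw [ih fun i hi j hj => h i (List.mem_cons_of_mem _ hi) j (List.mem_cons_of_mem _ hj),
      List.map_congr_left fun j hj => h x List.mem_cons_self j (List.mem_cons_of_mem _ hj)]

theorem ofFn_succAbove {n : ℕ} (a : Fin (n + 1)) :
    List.ofFn a.succAbove = (List.ofFn id).take a ++ (List.ofFn id).drop (a + 1) := by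
  have ha := a.is_lt
  refine List.ext_getElem ?_ fun i h1 h2 => ?_
  · simp; omega
  · simp only [List.length_ofFn] at h1
    rw [List.getElem_ofFn, List.getElem_append]
    split_ifs with h
    · simp only [List.length_take, List.length_ofFn, lt_inf_iff] at h
      rw [List.getElem_take, List.getElem_ofFn, Fin.succAbove_of_castSucc_lt a ⟨i, by omega⟩ (Fin.lt_def.2 h.1)]
      rfl
    · simp only [List.length_take, List.length_ofFn, lt_inf_iff, not_and, not_lt] at h
      rw [List.getElem_drop, List.getElem_ofFn,
        Fin.succAbove_of_le_castSucc a ⟨i, by omega⟩ (Fin.le_def.2 (by simp; omega))]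
      refine Fin.ext ?_
      simp
      omega

theorem sum_map_const_add {α : Type*} (l : List α) (f : α → ℤ) (c : ℤ) :
    (l.map fun i => f i + c).sum = (l.map f).sum + l.length * c := by
  induction l with
  | nil => simp
  | cons x l ih => simp [ih]; ring

end Lists

/-! ### Brackets with the element of `C_A(V)` at an arbitrary position -/

section MixedTerm

variable {k V : Type*} [Field k] [AddCommGroup V] [Module k V] (𝒱 : ℤ → Submodule k V)
  [DirectSum.Decomposition 𝒱]

/-- The bracket of `h`, at the position `a`, and of the `gᵢ` at the other positions. -/
def mixedTerm (b b' : Bool) : (n : ℕ) → Fin n → (Fin n → ℤ) → (List V → V) →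
    (Fin n → List V → V) → List V → V
  | 0, a, _, _, _ => a.elim0
  | _ + 1, a, d, h, g => (d a * (∑ i with i < a, d i) + (a : ℕ)).negOnePow •
      signedBracket 𝒱 b b' (d a - 1) h (fun i => d (a.succAbove i)) fun i => g (a.succAbove i)

/-- The exponent of the sign that relates the bracket to the vector field. -/
def bracketExponent {n : ℕ} (d : Fin n → ℤ) (a i j : Fin n) : ℤ :=
  d i + if j = a then d i + 1 else 0

variable {𝒱}

theorem isOperation_mixedTerm (b b' : Bool) {n : ℕ} (a : Fin n) {d : Fin n → ℤ} {h : List V → V}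
    {g : Fin n → List V → V} (hh : IsOperation 𝒱 (d a) h)
    (hg : ∀ j, j ≠ a → IsOperation 𝒱 (d j + 1) (g j)) :
    IsOperation 𝒱 (∑ j, d j + n - 1) (mixedTerm 𝒱 b b' n a d h g) := by
  cases n with
  | zero => exact a.elim0
  | succ n =>
    refine IsOperation.units_smul ?_ _
    have h1 := isOperation_signedBracket b b' (η := d a - 1) (d := fun i => d (a.succAbove i))
      (g := fun i => g (a.succAbove i)) (by simpa using hh)
      (fun j => hg _ (Fin.succAbove_ne a j))
    convert h1 using 1
    rw [Fin.sum_univ_succAbove _ a, Finset.sum_add_distrib]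
    simp
    ring

variable {I J : Type*} [DecidableEq I] [LinearOrder J] {p : J → ℤ}

/-- Besides `represents_vectorField_first`, the symbol `x a` has to be moved from the front to
position `a`. All signs together depend only on the ordered pairs of arguments, through
`bracketExponent`; this form makes them easy to permute and to split into blocks. -/
theorem represents_vectorField (b b' : Bool)
    {H : List (Multiset J →₀ V) → (Multiset J →₀ V)} {n : ℕ} {a : Fin n} {h : List V → V}
    {x : Fin n → SignedMonomial p} {d : Fin n → ℤ} (hη : (x a).deg = d a)
    (hH : Represents 𝒱 H (x a) h) (hHlin : WordLinear k H) (hh : IsOperation 𝒱 (d a) h)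
    (s : Fin n ↪ I) {G : I → List (Multiset J →₀ V) → (Multiset J →₀ V)}
    (hGlin : ∀ i, WordLinear k (G i)) (hd : ∀ j, j ≠ a → (x j).deg = d j + 1)
    {g : Fin n → List V → V} (hG : ∀ j, j ≠ a → Represents 𝒱 (G (s j)) (x j) (g j))
    (hg : ∀ j, j ≠ a → IsOperation 𝒱 (d j + 1) (g j)) :
    Represents 𝒱 (vectorField b b' G ((Finset.univ.erase a).map s) H) (List.ofFn x).prod
      ((pairSum (bracketExponent d a) (List.ofFn id)).negOnePow •
        mixedTerm 𝒱 b b' n a d h g) := by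
  cases n with
  | zero => exact a.elim0
  | succ n =>
    have h1 := represents_vectorField_first b b' (x₀ := x a) (η := d a - 1) (by simpa using hη) hH
      hHlin (by simpa using hh) (a.succAboveEmb.trans s) hGlin (x := fun i => x (a.succAbove i))
      (d := fun i => d (a.succAbove i)) (fun j => hd _ (Fin.succAbove_ne a j))
      (g := fun i => g (a.succAbove i)) (fun j => hG _ (Fin.succAbove_ne a j))
      (fun j => hg _ (Fin.succAbove_ne a j))
    have h2 : (Finset.univ : Finset (Fin n)).map (a.succAboveEmb.trans s) =
        (Finset.univ.erase a).map s := by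
      rw [← Finset.map_map]
      congr 1
      ext j
      simp [Fin.exists_succAbove_eq_iff]
    rw [h2] at h1
    have hA := ofFn_eq_append id a
    have hAB := ofFn_succAbove a
    have hlA : ((List.ofFn (id : Fin (n + 1) → Fin (n + 1))).take a).length = a := by simp
    have hlB : ((List.ofFn (id : Fin (n + 1) → Fin (n + 1))).drop (a + 1)).length = n - a := by simp
    have hsA : (((List.ofFn (id : Fin (n + 1) → Fin (n + 1))).take a).map d).sum =
        ∑ i with i < a, d i := by
      rw [List.map_take, List.map_ofFn, List.sum_take_ofFn]
      rfl
    have hnd : (List.ofFn (id : Fin (n + 1) → Fin (n + 1))).Nodup :=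
      List.nodup_ofFn.2 Function.injective_id
    have e1 : (List.ofFn fun i => x (a.succAbove i)) = (List.ofFn a.succAbove).map x := by
      rw [List.map_ofFn]; rfl
    have e2 : List.ofFn x = (List.ofFn id).map x := by rw [List.map_ofFn]; rfl
    have e3 : pairSum (fun i _ => d (a.succAbove i)) (List.ofFn id) =
        pairSum (fun i _ => d i) (List.ofFn a.succAbove) := by
      rw [pairSum_ofFn, pairSum_ofFn]
      rfl
    rw [e1, e3, hAB] at h1
    rw [e2, hA]
    rw [hA] at hnd
    rw [id] at hnd ⊢
    generalize (List.ofFn (id : Fin (n + 1) → Fin (n + 1))).take a = A at *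
    generalize (List.ofFn (id : Fin (n + 1) → Fin (n + 1))).drop (a + 1) = B at *
    rw [List.nodup_append] at hnd
    have hndA : a ∉ A := fun h => hnd.2.2 a h a List.mem_cons_self rfl
    have hndB : a ∉ B := (List.nodup_cons.1 hnd.2.1).1
    have hne : ∀ (l : List (Fin (n + 1))), a ∉ l → ∀ j ∈ l, j ≠ a := fun l hl j hj h => hl (h ▸ hj)
    have hdegA : (A.map x).prod.deg = (A.map d).sum + A.length := by
      rw [SignedMonomial.deg_prod, List.map_map,
        List.map_congr_left (f := SignedMonomial.deg ∘ x) (g := fun j => d j + 1)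
          fun j hj => hd j (hne A hndA j hj),
        sum_map_const_add, mul_one]
    have hcong : ∀ l : List (Fin (n + 1)), a ∉ l → pairSum (bracketExponent d a) l = pairSum (fun i _ => d i) l :=
      fun l hl => pairSum_congr fun i _ j hj => by simp [bracketExponent, hne l hl j hj]
    have hsum : ∀ i, ∀ l : List (Fin (n + 1)), a ∉ l → (l.map (bracketExponent d a i)).sum = l.length * d i := by
      intro i l hl
      rw [List.map_congr_left (g := fun _ => d i) fun j hj => by
        simp [bracketExponent, hne l hl j hj]]
      simp
    -- An entry `i` before `a` contributes `d i` for each entry of `B` and `d i + (d i + 1)` for `a`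
    -- itself; `a` contributes `d a` for each entry of `B`.
    have hexp : pairSum (bracketExponent d a) (A ++ a :: B) =
        pairSum (fun i _ => d i) A + ((B.length + 2) * (A.map d).sum + A.length) +
          (B.length * d a + pairSum (fun i _ => d i) B) := by
      rw [pairSum_append, pairSum, hcong A hndA, hcong B hndB, hsum a B hndB]
      congr 2
      have h3 : ∀ i, ((a :: B).map (bracketExponent d a i)).sum =
          (B.length + 2) * d i + 1 := fun i => by
        rw [List.map_cons, List.sum_cons, hsum i B hndB, bracketExponent, if_pos rfl]
        ring
      simp only [h3]
      rw [sum_map_const_add, List.sum_map_mul_left]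
      ring
    have hexp' : pairSum (fun i _ => d i) (A ++ B) = pairSum (fun i _ => d i) A +
        B.length * (A.map d).sum + pairSum (fun i _ => d i) B := by
      rw [pairSum_append]
      simp [List.sum_map_mul_left]
    have hswap : (A.map x ++ x a :: B.map x).prod.supp.Nodup → x a * ((A.map x).prod * (B.map x).prod) =
        (d a * ((A.map d).sum + A.length)).negOnePow • (A.map x ++ x a :: B.map x).prod := by
      intro hN
      have e := SignedMonomial.mul_eq_smul_mul (a := x a) (b := (A.map x).prod) (by
        refine Multiset.nodup_of_le (Multiset.le_add_right _ (B.map x).prod.supp) ?_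
        convert hN using 1
        simp only [SignedMonomial.supp_mul, List.prod_append, List.prod_cons]
        abel)
      rw [← mul_assoc, e, SignedMonomial.smul_mul, hη, hdegA, List.prod_append, List.prod_cons,
        mul_assoc]
    rw [List.map_append, List.prod_append] at h1
    rw [List.map_append, List.map_cons]
    have h4 := Represents.of_smul hswap (by
      simp only [SignedMonomial.supp_mul, List.prod_append, List.prod_cons]
      abel) h1
    convert h4 using 1
    rw [mixedTerm, smul_smul, smul_smul, ← Int.negOnePow_add, ← Int.negOnePow_add, hexp, hexp', hsA]
    congr 1
    rw [Int.negOnePow_eq_iff]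
    have hla : ((a : ℕ) : ℤ) = A.length := by rw [hlA]
    have hlb : (n : ℤ) = A.length + B.length := by
      have := a.is_lt
      rw [hlA, hlB]; omega
    rw [hla, hlb, ← hsA]
    generalize pairSum _ A = u
    generalize pairSum _ B = v
    generalize (A.map d).sum = w
    generalize (A.length : ℤ) = m
    generalize (B.length : ℤ) = n
    -- Half of the difference of the two exponents.
    refine ⟨w + m - m * d a, ?_⟩
    ring

end MixedTerm

/-! ### Independent symbols for arguments and letters -/

section Letters

variable {k V : Type*} [Field k] [AddCommGroup V] [Module k V] {𝒱 : ℤ → Submodule k V}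

/-- The symbols `0, …, n - 1` are reserved for the arguments, with degrees `e`; the letter in place
`i` gets the symbol `n + i`, whose degree is that of the letter. -/
theorem exists_letters (e : ℕ → ℤ) (n : ℕ) (w : List (ℤ × V)) :
    ∃ p : ℕ → ℤ, (∀ i < n, p i = e i) ∧ ∃ L : List (SignedMonomial p × V),
      (L.map fun x => (x.1.deg, x.2)) = w ∧
        (Multiset.range n + (L.map Prod.fst).prod.supp).Nodup := by
  -- Symbols after the last letter never occur; their degree `0` is arbitrary.
  let p : ℕ → ℤ := fun i => if i < n then e i else ((w.map Prod.fst)[i - n]?).getD 0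
  refine ⟨p, fun i hi => if_pos hi,
    List.ofFn fun i : Fin w.length => ((⟨1, {n + (i : ℕ)}⟩ : SignedMonomial p), w[i].2), ?_, ?_⟩
  · refine List.ext_getElem (by simp) fun i h1 h2 => ?_
    simp only [List.getElem_map, List.getElem_ofFn]
    refine Prod.ext ?_ rfl
    simp [SignedMonomial.deg, p, h2]
  · have h : ((List.ofFn fun i : Fin w.length =>
        ((⟨1, {n + (i : ℕ)}⟩ : SignedMonomial p), w[i].2)).map Prod.fst).prod.supp =
        (Multiset.range w.length).map fun i => n + i := by
      rw [SignedMonomial.supp_prod, List.map_map, List.map_ofFn, List.sum_ofFn]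
      simp only [Function.comp_apply]
      rw [Fin.sum_univ_eq_sum_range (fun i => ({n + i} : Multiset ℕ))]
      change (Multiset.map _ (Multiset.range w.length)).sum = _
      exact Multiset.sum_map_singleton ((Multiset.range w.length).map fun i => n + i) ▸ by
        rw [Multiset.map_map]; rfl
    rw [h, ← Multiset.range_add]
    exact Multiset.nodup_range _

theorem WordLinear.eq_zero [DirectSum.Decomposition 𝒱] {Y : Type*} [AddCommGroup Y] [Module k Y]
    {f : List V → Y} (hf : WordLinear k f)
    (h : ∀ L : List (ℤ × V), (∀ x ∈ L, x.2 ∈ suspension 𝒱 x.1) → f (L.map Prod.snd) = 0) :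
    f = 0 := by
  funext w
  induction w generalizing f with
  | nil => exact h [] (by simp)
  | cons m w ih =>
    refine DirectSum.Decomposition.inductionOn 𝒱 (motive := fun m => f (m :: w) = 0) ?_ ?_ ?_ m
    · exact hf.map_zero [] w
    · intro i v
      refine ih (hf.cons (v : V)) fun L hL => h ((i + 1, (v : V)) :: L) ?_
      rintro x (_ | ⟨_, hx⟩)
      · simp [suspension]
      · exact hL x hx
    · intro v v' hv hv'
      have e := (hf [] w).map_add v v'
      simp only [List.nil_append] at e
      rw [e, hv, hv', add_zero]

/-- The symbol with index `i`. -/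
def symbol (p : ℕ → ℤ) (i : ℕ) : SignedMonomial p := ⟨1, {i}⟩

@[simp] theorem symbol_deg (p : ℕ → ℤ) (i : ℕ) : (symbol p i).deg = p i := by
  simp [symbol, SignedMonomial.deg]

theorem supp_prod_symbol (p : ℕ → ℤ) (n : ℕ) :
    (List.ofFn fun i : Fin n => symbol p i).prod.supp = Multiset.range n := by
  rw [SignedMonomial.supp_prod, List.map_ofFn, List.sum_ofFn]
  simp only [Function.comp_apply, symbol]
  rw [Fin.sum_univ_eq_sum_range (fun i => ({i} : Multiset ℕ))]
  change (Multiset.map _ (Multiset.range n)).sum = _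
  simp

theorem represents_symbol [DirectSum.Decomposition 𝒱] {f : List V → V} (hf : WordLinear k f)
    (p : ℕ → ℤ) (i : ℕ) : Represents 𝒱 (liftOp p f {i}) (symbol p i) f :=
  represents_liftOp 𝒱 hf {i}

/-- An identity between operations may be checked on words in letters with independent symbols. -/
theorem WordLinear.eq_zero_of_letters [DirectSum.Decomposition 𝒱] {f : List V → V}
    (hf : WordLinear k f) (e : ℕ → ℤ) (n : ℕ)
    (h : ∀ p : ℕ → ℤ, (∀ i < n, p i = e i) → ∀ L : List (SignedMonomial p × V),
      (∀ x ∈ L, x.2 ∈ suspension 𝒱 x.1.deg) →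
      ((List.ofFn fun i : Fin n => symbol p i).prod * (L.map Prod.fst).prod).supp.Nodup →
      ((List.ofFn fun i : Fin n => symbol p i).prod * (L.map Prod.fst).prod).tmul
        (f (L.map Prod.snd)) = 0) : f = 0 := by
  refine hf.eq_zero (𝒱 := 𝒱) fun w hw => ?_
  obtain ⟨p, hp, L, rfl, hN⟩ := exists_letters e n w
  have hL : ∀ x ∈ L, x.2 ∈ suspension 𝒱 x.1.deg := fun x hx =>
    hw (x.1.deg, x.2) (List.mem_map_of_mem (f := fun x => (x.1.deg, x.2)) hx)
  have h1 := h p hp L hL (by rwa [SignedMonomial.supp_mul, supp_prod_symbol])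
  rw [← SignedMonomial.tmul_zero] at h1
  rw [List.map_map]
  exact SignedMonomial.tmul_injective _ h1

end Letters

/-! ### Graded skew-symmetry of the mixed brackets -/

section Antisymmetry

variable {k V : Type*} [Field k] [AddCommGroup V] [Module k V] {𝒱 : ℤ → Submodule k V}
  [DirectSum.Decomposition 𝒱]

/-- This is the coboundary condition of `chiSign_mul_koszulSign`, where the symbol of the argument
in `C_A(V)` has its degree and the symbols of the others have degree raised by one. -/
theorem bracketExponent_even {n : ℕ} (d : Fin n → ℤ) (a i j : Fin n) (hij : i ≠ j) :
    Even (bracketExponent d a i j + bracketExponent d a j i + (d i * d j +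
      (if i = a then d i else d i + 1) * (if j = a then d j else d j + 1) + 1)) := by
  unfold bracketExponent
  split_ifs with h1 h2 h3
  · exact absurd (h2.trans h1.symm) hij
  · exact ⟨d i * d j + d i + d j + 1, by ring⟩
  · exact ⟨d i * d j + d i + d j + 1, by ring⟩
  · exact ⟨d i * d j + d i + d j + 1, by ring⟩

/-- The polarised vector field depends only on the set of indices, so it represents both brackets.
They differ by the Koszul sign of the symbols and by two values of the exponent, which combine to
`χ`. -/
theorem mixedTerm_perm (b b' : Bool) {n : ℕ} (σ : Equiv.Perm (Fin n)) (a : Fin n) {d : Fin n → ℤ}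
    {h : List V → V} {g : Fin n → List V → V} (hh : IsOperation 𝒱 (d (σ a)) h)
    (hg : ∀ j, IsOperation 𝒱 (d j + 1) (g j)) :
    mixedTerm 𝒱 b b' n a (fun i => d (σ i)) h (fun i => g (σ i)) =
      chiSign σ d • mixedTerm 𝒱 b b' n (σ a) d h g := by
  have lin1 := (isOperation_mixedTerm b b' a (d := fun i => d (σ i)) (g := fun i => g (σ i)) hh
    fun j _ => hg _).linear
  have lin2 := (isOperation_mixedTerm b b' (σ a) hh fun j _ => hg j).linear
  refine sub_eq_zero.1 ((lin1.sub (lin2.units_smul _)).eq_zero_of_letters (𝒱 := 𝒱)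
    (fun i => if hi : i < n then (if ⟨i, hi⟩ = σ a then d ⟨i, hi⟩ else d ⟨i, hi⟩ + 1) else 0) n
    fun p hp L hL hN => ?_)
  have hp' : ∀ i : Fin n, p i = if i = σ a then d i else d i + 1 := fun i => by
    rw [hp i i.is_lt, dif_pos i.is_lt]
  have r1 := represents_vectorField b b' (x := fun i => symbol p (σ i)) (a := a)
    (d := fun i => d (σ i)) (s := σ.toEmbedding) (by rw [symbol_deg, hp', if_pos rfl])
    (represents_symbol hh.linear p (σ a)) (wordLinear_liftOp p hh.linear _) hh
    (G := fun i => liftOp p (g i) {(i : ℕ)}) (fun i => wordLinear_liftOp p (hg i).linear _)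
    (fun j hj => by rw [symbol_deg, hp', if_neg fun h => hj (σ.injective h)])
    (g := fun i => g (σ i)) (fun j _ => represents_symbol (hg _).linear p _) (fun j _ => hg _)
  have r2 := represents_vectorField b b' (x := fun i : Fin n => symbol p i) (a := σ a)
    (d := d) (s := Function.Embedding.refl _) (by rw [symbol_deg, hp', if_pos rfl])
    (represents_symbol hh.linear p (σ a)) (wordLinear_liftOp p hh.linear _) hh
    (G := fun i => liftOp p (g i) {(i : ℕ)}) (fun i => wordLinear_liftOp p (hg i).linear _)
    (fun j hj => by rw [symbol_deg, hp', if_neg hj])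
    (g := g) (fun j _ => represents_symbol (hg _).linear p _) (fun j _ => hg _)
  -- The two vector fields coincide because their index sets do.
  have hset : (Finset.univ.erase a).map σ.toEmbedding =
      (Finset.univ.erase (σ a)).map (Function.Embedding.refl _) := by
    ext j
    simp
  rw [hset] at r1
  have hN' : (List.ofFn fun i : Fin n => symbol p i).prod.supp.Nodup :=
    Multiset.nodup_of_le (Multiset.le_add_right _ _) hN
  have hperm := SignedMonomial.prod_perm (fun i : Fin n => symbol p i) σ hN'
  simp only [symbol_deg, hp'] at hperm
  have e1 := r1 L hL (by rw [hperm]; exact hN)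
  rw [r2 L hL hN, hperm, SignedMonomial.smul_mul, SignedMonomial.smul_tmul,
    ← SignedMonomial.tmul_smul] at e1
  have e2 := SignedMonomial.tmul_injective _ e1
  have e3 : pairSum (bracketExponent (fun i => d (σ i)) a) (List.ofFn id) =
      pairSum (bracketExponent d (σ a)) (List.ofFn σ) := by
    rw [pairSum_ofFn, pairSum_ofFn]
    refine Finset.sum_congr rfl fun q _ => ?_
    simp [bracketExponent]
  have e4 := chiSign_mul_koszulSign σ (d := d) (F := bracketExponent d (σ a))
    (p := fun i => if i = σ a then d i else d i + 1) (bracketExponent_even d (σ a))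
  rw [Pi.smul_apply, Pi.smul_apply, smul_smul, e3] at e2
  rw [Pi.sub_apply, Pi.smul_apply]
  have e5 : chiSign σ d = koszulSign σ (fun i => if i = σ a then d i else d i + 1) *
      (pairSum (bracketExponent d (σ a)) (List.ofFn σ)).negOnePow *
      (pairSum (bracketExponent d (σ a)) (List.ofFn id)).negOnePow := by
    rw [mul_assoc, ← e4, mul_comm (chiSign σ d), ← mul_assoc, Int.units_mul_self, one_mul]
  rw [e5, mul_smul, e2, smul_smul, Int.units_mul_self, one_smul, sub_self,
    SignedMonomial.tmul_zero]

end Antisymmetry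

/-! ### Multilinearity of the brackets -/

section Multilinearity

variable {k V : Type*} [Field k] [AddCommGroup V] [Module k V] {𝒱 : ℤ → Submodule k V}
  [DirectSum.Decomposition 𝒱] {Z : Type*} [AddCommGroup Z] [Module k Z]

theorem isLinearMap_units_smul {Y : Type*} [AddCommGroup Y] [Module k Y] {F : Z → Y}
    (h : IsLinearMap k F) (s : ℤˣ) : IsLinearMap k fun z => s • F z :=
  isLinearMap_comp (G := fun y : Y => s • y) h
    ⟨fun x y => smul_add s x y, fun c x => smul_comm s c x⟩

theorem isLinearMap_insertion_left {F : Z → List V → V} (hF : ∀ w, IsLinearMap k fun z => F z w)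
    (e : ℤ) (g : List V → V) (w : List V) :
    IsLinearMap k fun z => insertion 𝒱 (F z) e g w :=
  isLinearMap_sum _ fun _ _ => isLinearMap_sum _ fun _ _ => hF _

theorem isLinearMap_insertion_right {f : List V → V} (hf : WordLinear k f) {G : Z → List V → V}
    (hG : ∀ w, IsLinearMap k fun z => G z w) (e : ℤ) (w : List V) :
    IsLinearMap k fun z => insertion 𝒱 f e (G z) w :=
  isLinearMap_sum _ fun i _ => isLinearMap_sum _ fun j _ =>
    isLinearMap_comp (G := fun m => f ((w.take i).map (twist 𝒱 e) ++ m :: (w.drop i).drop j))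
      (hG _) (hf _ _)

theorem isLinearMap_compTensor_left {F : Z → List V → V} (hF : ∀ w, IsLinearMap k fun z => F z w)
    (gs : List (ℤ × (List V → V))) (w : List V) :
    IsLinearMap k fun z => compTensor 𝒱 (F z) gs w := by
  simp only [compTensor_eq]
  exact isLinearMap_tensorComp (twistOps 𝒱 gs) hF w

/-- Linearity in one slot is stated for families depending on a parameter `z`; the slots other than
`j` do not depend on it, and their value is recorded as `g 0`. -/
theorem isLinearMap_compTensor_slot {f : List V → V} (hf : WordLinear k f) {n : ℕ} (e : Fin n → ℤ)
    {g : Z → Fin n → List V → V} {j : Fin n} (hj : ∀ w, IsLinearMap k fun z => g z j w)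
    (hg : ∀ i, i ≠ j → ∀ z, g z i = g 0 i) (w : List V) :
    IsLinearMap k fun z => compTensor 𝒱 f (List.ofFn fun i => (e i, g z i)) w := by
  induction n generalizing f w with
  | zero => exact j.elim0
  | succ n ih =>
    simp only [List.ofFn_succ, compTensor]
    refine isLinearMap_sum _ fun m _ => ?_
    have hsum : ∀ z, ((List.ofFn fun i : Fin n => (e i.succ, g z i.succ)).map Prod.fst).sum =
        ∑ i : Fin n, e i.succ := fun z => by rw [List.map_ofFn, List.sum_ofFn]; rfl
    simp only [hsum]
    rcases Fin.eq_zero_or_eq_succ j with rfl | ⟨j, rfl⟩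
    · have h : ∀ z, (List.ofFn fun i : Fin n => (e i.succ, g z i.succ)) =
          List.ofFn fun i : Fin n => (e i.succ, g 0 i.succ) := fun z => by
        congr 1
        funext i
        rw [hg _ (Fin.succ_ne_zero i) z]
      simp only [h]
      exact isLinearMap_compTensor_left
        (F := fun z out => f (g z 0 ((w.take m).map (twist 𝒱 (∑ i : Fin n, e i.succ))) :: out))
        (fun o => isLinearMap_comp (G := fun x => f (x :: o)) (hj _) (hf [] o)) _ _
    · have h : ∀ z, g z 0 = g 0 0 := fun z => hg 0 (Fin.succ_ne_zero j).symm z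
      simp only [h]
      exact ih (hf.cons _) (fun i => e i.succ) (g := fun z i => g z i.succ) hj
        (fun i hi z => hg _ (fun h => hi (Fin.succ_injective _ h)) z) _

theorem isLinearMap_compTensor_slot' {f : List V → V} (hf : WordLinear k f) {n : ℕ}
    {y : Z → Fin n → ℤ × (List V → V)} {j : Fin n} (hj : ∀ w, IsLinearMap k fun z => (y z j).2 w)
    (hy : ∀ i, i ≠ j → ∀ z, y z i = y 0 i) (he : ∀ z, (y z j).1 = (y 0 j).1) (w : List V) :
    IsLinearMap k fun z => compTensor 𝒱 f (List.ofFn (y z)) w := by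
  have h : ∀ z, List.ofFn (y z) = List.ofFn fun i => ((y 0 i).1, (y z i).2) := fun z => by
    congr 1
    funext i
    by_cases hi : i = j
    · subst hi; rw [← he z]
    · rw [hy i hi z]
  simp only [h]
  exact isLinearMap_compTensor_slot hf (fun i => (y 0 i).1) (g := fun z i => (y z i).2) hj
    (fun i hi z => by rw [hy i hi z]) w

theorem isLinearMap_outerTerm_left {n : ℕ} (η : ℤ) {H : Z → List V → V}
    (hH : ∀ w, IsLinearMap k fun z => H z w) (d : Fin n → ℤ) {g : Fin n → List V → V}
    (hg : ∀ i, WordLinear k (g i)) (q : Fin n) (w : List V) :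
    IsLinearMap k fun z => outerTerm 𝒱 η (H z) d g q w :=
  isLinearMap_units_smul (isLinearMap_insertion_right (hg q)
    (isLinearMap_compTensor_left hH _) _ w) _

theorem isLinearMap_outerTerm_slot {n : ℕ} (η : ℤ) {h : List V → V} (hh : WordLinear k h)
    (d : Fin n → ℤ) {g : Z → Fin n → List V → V} {j : Fin n}
    (hj : ∀ w, IsLinearMap k fun z => g z j w) (hg : ∀ i, i ≠ j → ∀ z, g z i = g 0 i)
    (hlin : ∀ i, i ≠ j → WordLinear k (g 0 i)) (q : Fin n) (w : List V) :
    IsLinearMap k fun z => outerTerm 𝒱 η h d (g z) q w := by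
  refine isLinearMap_units_smul ?_ _
  -- The varying slot is either the outer operation of the insertion or one of the factors of the
  -- inner composition.
  by_cases hq : q = j
  · subst hq
    have e : ∀ z, (List.ofFn fun i => if i = q then (0, idWord) else (d i + 1, g z i)) =
        List.ofFn fun i => if i = q then (0, idWord) else (d i + 1, g 0 i) := fun z => by
      congr 1
      funext i
      split_ifs with hi
      · rfl
      · rw [hg i hi z]
    simp only [e]
    exact isLinearMap_insertion_left hj _ _ w
  · simp only [hg q hq]
    refine isLinearMap_insertion_right (hlin q hq) (fun w => ?_) _ w
    refine isLinearMap_compTensor_slot' hh (j := j)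
      (y := fun z i => if i = q then (0, idWord) else (d i + 1, g z i)) (fun w => ?_) ?_ ?_ w
    · simp only [if_neg (Ne.symm hq)]
      exact hj w
    · intro i hi z
      rw [hg i hi z]
    · intro z
      simp only [if_neg (Ne.symm hq)]

theorem isLinearMap_emptyPart {F : Z → List V → V} (hF : ∀ w, IsLinearMap k fun z => F z w)
    (b : Bool) (w : List V) : IsLinearMap k fun z => emptyPart b (F z) w := by
  unfold emptyPart
  split_ifs
  · exact isLinearMap_zero
  · exact hF w

theorem isLinearMap_truncate (b b' : Bool) {n : ℕ} {g : Z → Fin n → List V → V} {j : Fin n}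
    (hj : ∀ w, IsLinearMap k fun z => g z j w) (q : Fin n) (w : List V) :
    IsLinearMap k fun z => truncate b b' (g z) q j w := by
  unfold truncate
  split_ifs
  · exact isLinearMap_emptyPart hj b w
  · exact isLinearMap_emptyPart hj b' w
  · exact hj w

theorem wordLinear_truncate (b b' : Bool) {n : ℕ} {g : Fin n → List V → V} {j : Fin n}
    (hj : WordLinear k (g j)) (q : Fin n) : WordLinear k (truncate b b' g q j) := by
  unfold truncate
  split_ifs
  · exact hj.emptyPart b
  · exact hj.emptyPart b'
  · exact hj

theorem isLinearMap_signedBracket_left (b b' : Bool) {n : ℕ} (η : ℤ) {H : Z → List V → V}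
    (hH : ∀ w, IsLinearMap k fun z => H z w) (d : Fin n → ℤ) {g : Fin n → List V → V}
    (hg : ∀ i, WordLinear k (g i)) (w : List V) :
    IsLinearMap k fun z => signedBracket 𝒱 b b' η (H z) d g w := by
  simp only [signedBracket, Finset.sum_apply, Pi.smul_apply, Pi.sub_apply]
  refine isLinearMap_sum _ fun σ _ => isLinearMap_units_smul (isLinearMap_sub
    (isLinearMap_compTensor_left (𝒱 := 𝒱) hH _ w) (isLinearMap_sum _ fun q _ => ?_)) _
  exact isLinearMap_outerTerm_left (𝒱 := 𝒱) η hH (d ∘ σ) (g := truncate b b' (g ∘ σ) q)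
    (fun i => wordLinear_truncate b b' (g := g ∘ σ) (hg (σ i)) q) q w

theorem isLinearMap_signedBracket_slot (b b' : Bool) {n : ℕ} (η : ℤ) {h : List V → V}
    (hh : WordLinear k h) (d : Fin n → ℤ) {g : Z → Fin n → List V → V} {j : Fin n}
    (hj : ∀ w, IsLinearMap k fun z => g z j w) (hg : ∀ i, i ≠ j → ∀ z, g z i = g 0 i)
    (hlin : ∀ i, i ≠ j → WordLinear k (g 0 i)) (w : List V) :
    IsLinearMap k fun z => signedBracket 𝒱 b b' η h d (g z) w := by
  simp only [signedBracket, Finset.sum_apply, Pi.smul_apply, Pi.sub_apply]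
  refine isLinearMap_sum _ fun σ _ => isLinearMap_units_smul (isLinearMap_sub ?_
    (isLinearMap_sum _ fun q _ => ?_)) _
  · refine isLinearMap_compTensor_slot hh (fun i => d (σ i) + 1) (g := fun z i => g z (σ i))
      (j := σ.symm j) (by simpa using hj) (fun i hi z => hg _ (fun h => hi ?_) z) w
    rw [← h, Equiv.symm_apply_apply]
  · have hne : ∀ i, i ≠ σ.symm j → σ i ≠ j := fun i hi h => hi (by
      rw [← h, Equiv.symm_apply_apply])
    refine isLinearMap_outerTerm_slot η hh _ (j := σ.symm j) (fun w => ?_) (fun i hi z => ?_)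
      (fun i hi => ?_) q w
    · exact isLinearMap_truncate b b' (g := fun z => g z ∘ σ) (by simpa using hj) q w
    · simp only [truncate, Function.comp_apply, hg _ (hne i hi) z]
    · exact wordLinear_truncate b b' (g := g 0 ∘ σ) (hlin _ (hne i hi)) q

theorem isLinearMap_mixedTerm_left (b b' : Bool) {n : ℕ} (a : Fin n) (d : Fin n → ℤ)
    {H : Z → List V → V} (hH : ∀ w, IsLinearMap k fun z => H z w) {g : Fin n → List V → V}
    (hg : ∀ i, i ≠ a → WordLinear k (g i)) (w : List V) :
    IsLinearMap k fun z => mixedTerm 𝒱 b b' n a d (H z) g w := by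
  cases n with
  | zero => exact a.elim0
  | succ n => exact isLinearMap_units_smul (isLinearMap_signedBracket_left b b' _ hH _
      (fun i => hg _ (Fin.succAbove_ne a i)) w) _

theorem isLinearMap_mixedTerm_slot (b b' : Bool) {n : ℕ} {a : Fin n} (d : Fin n → ℤ)
    {h : List V → V} (hh : WordLinear k h) {g : Z → Fin n → List V → V} {j : Fin n} (hja : j ≠ a)
    (hj : ∀ w, IsLinearMap k fun z => g z j w)
    (hg : ∀ i, i ≠ a → i ≠ j → ∀ z, g z i = g 0 i)
    (hlin : ∀ i, i ≠ a → i ≠ j → WordLinear k (g 0 i)) (w : List V) :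
    IsLinearMap k fun z => mixedTerm 𝒱 b b' n a d h (g z) w := by
  cases n with
  | zero => exact a.elim0
  | succ n =>
    obtain ⟨j, rfl⟩ := Fin.exists_succAbove_eq hja
    have hne : ∀ i, i ≠ j → a.succAbove i ≠ a.succAbove j := fun i hi h =>
      hi (Fin.succAbove_right_injective h)
    exact isLinearMap_units_smul (isLinearMap_signedBracket_slot b b' _ hh _
      (g := fun z i => g z (a.succAbove i)) hj
      (fun i hi z => hg _ (Fin.succAbove_ne a i) (hne i hi) z)
      (fun i hi => hlin _ (Fin.succAbove_ne a i) (hne i hi)) w) _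

/-- The entry of the family at the position occupied by `h` is a placeholder. -/
theorem mixedTerm_congr (b b' : Bool) {n : ℕ} (a : Fin n) (d : Fin n → ℤ) (h : List V → V)
    {g g' : Fin n → List V → V} (hg : ∀ i, i ≠ a → g i = g' i) :
    mixedTerm 𝒱 b b' n a d h g = mixedTerm 𝒱 b b' n a d h g' := by
  cases n with
  | zero => exact a.elim0
  | succ n =>
    have e : (fun i => g (a.succAbove i)) = fun i => g' (a.succAbove i) :=
      funext fun i => hg _ (Fin.succAbove_ne a i)
    rw [mixedTerm, mixedTerm, e]

end Multilinearity

/-! ### The compositions of two brackets -/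

section WordLinearity

variable {k I M : Type*} [CommRing k] [DecidableEq I] [AddCommGroup M] [Module k M]

theorem WordLinear.enumSum (S : Finset I) {F : List I → List M → M} (h : ∀ l, WordLinear k (F l)) :
    WordLinear k fun w => enumSum S fun l => F l w := fun u v =>
  { map_add := fun x y => by
      rw [← enumSum_add]
      exact congrArg (_root_.enumSum S) (funext fun l => (h l u v).map_add x y)
    map_smul := fun c x => by
      refine Eq.trans ?_ (enumSum_map (DistribSMul.toAddMonoidHom M c) S _).symm
      exact congrArg (_root_.enumSum S) (funext fun l => (h l u v).map_smul c x) }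

theorem WordLinear.ins {f g : List M → M} (hf : WordLinear k f) (hg : WordLinear k g) :
    WordLinear k (ins f g) := by
  refine WordLinear.splitSum (F := fun x t => _root_.splitSum t fun y z => f (x ++ g y :: z))
    (fun t => ?_) fun x => ?_
  · intro u v
    exact isLinearMap_splitSum (F := fun m y z => f ((u ++ m :: v) ++ g y :: z)) t fun y z =>
      (hf.append_right (g y :: z)) u v
  · exact WordLinear.splitSum (F := fun y z => f (x ++ g y :: z))
      (fun z => hf.comp_letter hg x z) fun y => (hf.append_left x).cons (g y)

theorem wordLinear_vectorField (b b' : Bool) {g : I → List M → M} (hg : ∀ a, WordLinear k (g a))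
    {h : List M → M} (hh : WordLinear k h) (S : Finset I) :
    WordLinear k (vectorField b b' g S h) := by
  refine WordLinear.sub (f := expComp g S h)
    (g := fun w => ∑ a ∈ S, _root_.ins (g a) (expIdExp (fun a => emptyPart b (g a))
      (fun a => emptyPart b' (g a)) (S.erase a) h) w) ?_ ?_
  · refine WordLinear.enumSum S fun l => hh.tensorComp ?_
    simp only [List.mem_map]
    rintro _ ⟨a, _, rfl⟩
    exact hg a
  · intro u v
    refine isLinearMap_sum S fun a _ => ((hg a).ins ?_) u v
    intro u v
    simp only [expIdExp_eq _ _ _ hh, partSum]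
    refine isLinearMap_sum _ fun A _ => WordLinear.enumSum A (F := fun l₁ w =>
      _root_.enumSum (S.erase a \ A) fun l₂ => tensorComp h
        (l₁.map (fun a => emptyPart b (g a)) ++ idWord :: l₂.map fun a => emptyPart b' (g a)) w)
      (fun l₁ => WordLinear.enumSum _ fun l₂ => hh.tensorComp ?_) u v
    simp only [List.mem_append, List.mem_map, List.mem_cons]
    rintro _ (⟨a, _, rfl⟩ | rfl | ⟨a, _, rfl⟩)
    · exact (hg a).emptyPart b
    · exact wordLinear_idWord
    · exact (hg a).emptyPart b'

end WordLinearity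

section Compositions

variable {k V : Type*} [Field k] [AddCommGroup V] [Module k V] {𝒱 : ℤ → Submodule k V}
  [DirectSum.Decomposition 𝒱]

/-- The exponent of the sign in the Jacobi identity for two arguments `α`, `β` in `C_A(V)`. -/
def jacobiExponent {n : ℕ} (d : Fin n → ℤ) (α β i j : Fin n) : ℤ :=
  d i + (if j = α ∨ j = β then d i + 1 else 0) + if i = α ∧ j = β then 1 else 0

/-- The degrees of the symbols when the arguments `α`, `β` are in `C_A(V)`. -/
def symbolDegree {n : ℕ} (d : Fin n → ℤ) (α β i : Fin n) : ℤ :=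
  if i = α ∨ i = β then d i else d i + 1

theorem symbolDegree_left {n : ℕ} (d : Fin n → ℤ) (α β : Fin n) :
    symbolDegree d α β α = d α := by simp [symbolDegree]

theorem symbolDegree_right {n : ℕ} (d : Fin n → ℤ) (α β : Fin n) :
    symbolDegree d α β β = d β := by simp [symbolDegree]

theorem symbolDegree_of_ne {n : ℕ} (d : Fin n → ℤ) {α β i : Fin n} (h : i ≠ α) (h' : i ≠ β) :
    symbolDegree d α β i = d i + 1 := by simp [symbolDegree, h, h']

/-- Both arguments in `C_A(V)` keep their degrees as symbol degrees, so for this pair the sign of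
the permutation is not absorbed. The extra `1` at `(α, β)`, and not at `(β, α)`, compensates for it;
it produces the minus sign of the commutator. -/
theorem jacobiExponent_even {n : ℕ} (d : Fin n → ℤ) {α β : Fin n} (hαβ : α ≠ β) (i j : Fin n)
    (hij : i ≠ j) : Even (jacobiExponent d α β i j + jacobiExponent d α β j i +
      (d i * d j + symbolDegree d α β i * symbolDegree d α β j + 1)) := by
  unfold jacobiExponent symbolDegree
  by_cases h1 : i = α <;> by_cases h2 : i = β <;> by_cases h3 : j = α <;> by_cases h4 : j = β <;>
    first
    | exact absurd (h1.symm.trans h2) hαβ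
    | exact absurd (h3.symm.trans h4) hαβ
    | exact absurd (h1.trans h3.symm) hij
    | exact absurd (h2.trans h4.symm) hij
    | (simp only [h1, h2, h3, h4, hαβ, hαβ.symm, or_true, or_false, and_true,
        and_false, if_true, if_false]
       first
       | exact ⟨d i * d j + d i + d j + 1, by subst_vars; ring1⟩
       | exact ⟨d i * d j + d i + d j + 2, by subst_vars; ring1⟩)

/-- The embedding `0 ↦ none`, `j + 1 ↦ r j`. -/
def consNone {m : ℕ} {I : Type*} (r : Fin m ↪ I) : Fin (m + 1) ↪ Option I where
  toFun := Fin.cons none fun j => some (r j)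
  inj' := by
    intro x y
    refine Fin.cases ?_ (fun x => ?_) x <;> refine Fin.cases ?_ (fun y => ?_) y
    · simp
    · simp
    · simp
    · simp

@[simp] theorem consNone_zero {m : ℕ} {I : Type*} (r : Fin m ↪ I) : consNone r 0 = none := rfl

@[simp] theorem consNone_succ {m : ℕ} {I : Type*} (r : Fin m ↪ I) (j : Fin m) :
    consNone r j.succ = some (r j) := rfl

theorem map_consNone_erase_succ {m : ℕ} {I : Type*} [DecidableEq I] (r : Fin m ↪ I) (b : Fin m) :
    (Finset.univ.erase b.succ).map (consNone r) =
      insert none (((Finset.univ.map r).erase (r b)).map Function.Embedding.some) := by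
  rw [Finset.map_erase, Fin.univ_succ, Finset.map_cons, Finset.cons_eq_insert, Finset.map_map,
    consNone_zero, consNone_succ, Finset.erase_insert_of_ne (by simp), Finset.map_erase,
    Finset.map_map]
  rfl

theorem map_consNone_erase_zero {m : ℕ} {I : Type*} [DecidableEq I] (r : Fin m ↪ I) :
    (Finset.univ.erase 0).map (consNone r) =
      (Finset.univ.map r).map Function.Embedding.some := by
  rw [Finset.map_erase, Fin.univ_succ, Finset.map_cons, Finset.cons_eq_insert, Finset.map_map,
    Finset.erase_insert, Finset.map_map]
  · rfl
  · simp

/-- The double vector field. -/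
def pairField {n : ℕ} {M : Type*} [AddCommGroup M] (b b' : Bool)
    (G : Option (Fin n) → List M → M) (u v : Fin n)
    (X X' : List M → M) (S : Finset (Fin n)) : List M → M :=
  vectorField b b' (Function.update G none (vectorField b b' G
    ((S.erase u).map Function.Embedding.some) X))
    (insert none ((Sᶜ.erase v).map Function.Embedding.some)) X'

theorem pairSum_bracketExponent_comp {n i : ℕ} (d : Fin n → ℤ) (l : Fin i ↪ Fin n) (a : Fin i) :
    pairSum (bracketExponent (fun j => d (l j)) a) (List.ofFn id) =
      pairSum (bracketExponent d (l a)) (List.ofFn l) := by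
  rw [pairSum_ofFn, pairSum_ofFn]
  refine Finset.sum_congr rfl fun q _ => ?_
  simp [bracketExponent]

/-- The inner bracket, of degree `D` at position `0`, contributes `D` for each of the `m` later
arguments and `D + 1` more for the one in `C_A(V)`. -/
theorem pairSum_bracketExponent_cons_succ {m : ℕ} (D : ℤ) (d : Fin m → ℤ) (b : Fin m) :
    pairSum (bracketExponent (Fin.cons D d : Fin (m + 1) → ℤ) b.succ) (List.ofFn id) =
      m * D + D + 1 + pairSum (bracketExponent d b) (List.ofFn id) := by
  rw [pairSum_ofFn, pairSum_ofFn, Finset.sum_filter, Finset.sum_filter, Fintype.sum_prod_type,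
    Fintype.sum_prod_type, Fin.sum_univ_succ]
  congr 1
  · rw [Fin.sum_univ_succ]
    simp [bracketExponent, Finset.sum_add_distrib]
    ring
  · refine Finset.sum_congr rfl fun x _ => ?_
    rw [Fin.sum_univ_succ]
    simp [bracketExponent]

theorem pairSum_bracketExponent_cons_zero {m : ℕ} (D : ℤ) (d : Fin m → ℤ) :
    pairSum (bracketExponent (Fin.cons D d : Fin (m + 1) → ℤ) 0) (List.ofFn id) =
      m * D + pairSum (fun i _ => d i) (List.ofFn id) := by
  rw [pairSum_ofFn, pairSum_ofFn, Finset.sum_filter, Finset.sum_filter, Fintype.sum_prod_type,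
    Fintype.sum_prod_type, Fin.sum_univ_succ]
  congr 1
  · rw [Fin.sum_univ_succ]
    simp [bracketExponent]
  · refine Finset.sum_congr rfl fun x _ => ?_
    rw [Fin.sum_univ_succ]
    simp [bracketExponent]

theorem sum_map_jacobiExponent {n m : ℕ} (d : Fin n → ℤ) {α β u v : Fin n}
    (huv : (u = α ∧ v = β) ∨ (u = β ∧ v = α)) (r : Fin m ↪ Fin n) (b : Fin m) (hb : r b = v)
    (hu : ∀ j, r j ≠ u) (x : Fin n) (hx : x ≠ v) :
    ((List.ofFn r).map (jacobiExponent d α β x)).sum =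
      m * d x + d x + 1 + if x = α ∧ v = β then 1 else 0 := by
  rw [List.map_ofFn, List.sum_ofFn]
  have h : ∀ j, (jacobiExponent d α β x ∘ r) j = d x +
      if j = b then (d x + 1 + if x = α ∧ v = β then 1 else 0) else 0 := by
    intro j
    have hj : r j = v ↔ j = b := by rw [← hb]; exact r.injective.eq_iff
    have hju := hu j
    simp only [Function.comp_apply, jacobiExponent]
    by_cases h : j = b
    · subst h
      rw [hb]
      rcases huv with ⟨rfl, rfl⟩ | ⟨rfl, rfl⟩
      · simp; ring
      · simp [hx]
    · have hjv : r j ≠ v := fun h' => h (hj.1 h')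
      rcases huv with ⟨rfl, rfl⟩ | ⟨rfl, rfl⟩
      · simp [hju, hjv, h]
      · simp [hju, hjv, h]
  rw [Finset.sum_congr rfl fun j _ => h j, Finset.sum_add_distrib, Finset.sum_ite_eq']
  simp
  ring

/-- A list without `v` contains at most one of the two arguments `α` and `β`, namely `u`, and then
the two exponents agree. -/
theorem pairSum_jacobiExponent {n : ℕ} (d : Fin n → ℤ) {α β u v : Fin n} (hne : α ≠ β)
    (huv : (u = α ∧ v = β) ∨ (u = β ∧ v = α)) (l : List (Fin n)) (hl : v ∉ l) :
    pairSum (jacobiExponent d α β) l = pairSum (bracketExponent d u) l := by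
  refine pairSum_congr fun i hi j hj => ?_
  have hi' : i ≠ v := fun h => hl (h ▸ hi)
  have hj' : j ≠ v := fun h => hl (h ▸ hj)
  rcases huv with ⟨rfl, rfl⟩ | ⟨rfl, rfl⟩
  · simp [jacobiExponent, bracketExponent, hj']
  · simp [jacobiExponent, bracketExponent, hi', hj']

/-- The inner bracket is represented by a vector field whose symbol is the product of the symbols on
the left of the shuffle. This field is substituted for the extra variable `none` of the outer one.
The total sign is that of the Jacobi identity up to a factor common to all shuffles and a sign that
distinguishes which of `α` and `β` is inside. -/
theorem represents_pairField (b b' : Bool) {n i m : ℕ} (σ : Equiv.Perm (Fin n))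
    {l : Fin i ↪ Fin n} {r : Fin m ↪ Fin n} (hσ : List.ofFn σ = List.ofFn l ++ List.ofFn r)
    {S : Finset (Fin n)} (hl : Finset.univ.map l = S) (hr : Finset.univ.map r = Sᶜ)
    {d : Fin n → ℤ} {α β u v : Fin n} (hαβ : α ≠ β)
    (huv : (u = α ∧ v = β) ∨ (u = β ∧ v = α)) {h h' : List V → V} {g : Fin n → List V → V}
    (hh : IsOperation 𝒱 (d u) h) (hh' : IsOperation 𝒱 (d v) h')
    (hg : ∀ j, IsOperation 𝒱 (d j + 1) (g j)) {a : Fin i} {c : Fin m} (ha : l a = u) (hc : r c = v)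
    {p : ℕ → ℤ} (hp : ∀ i : Fin n, p i = symbolDegree d α β i)
    {G : Option (Fin n) → List (Multiset ℕ →₀ V) → (Multiset ℕ →₀ V)}
    (hG : ∀ j : Fin n, G (some j) = liftOp p (g j) {(j : ℕ)}) (hG0 : WordLinear k (G none)) :
    Represents 𝒱 (pairField b b' G u v (liftOp p h {(u : ℕ)}) (liftOp p h' {(v : ℕ)}) S)
      (List.ofFn fun j : Fin n => symbol p j).prod
      (((pairSum (jacobiExponent d α β) (List.ofFn id)).negOnePow *
        (if u = α then 1 else -1) * (chiSign σ d * ((i : ℤ) * m).negOnePow)) •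
        mixedTerm 𝒱 b b' (m + 1) c.succ
          (Fin.cons (∑ j, d (l j) + i - 2) fun j => d (r j)) h'
          (Fin.cons (mixedTerm 𝒱 b b' i a (fun j => d (l j)) h fun j => g (l j))
            fun j => g (r j))) := by
  have hlr : ∀ x y, l x ≠ r y := fun x y e => by
    have h1 : l x ∈ S := by rw [← hl]; simp
    have h2 : r y ∈ Sᶜ := by rw [← hr]; simp
    rw [Finset.mem_compl, ← e] at h2
    exact h2 h1
  have hu : ∀ j, r j ≠ u := fun j e => hlr a j (ha.trans e.symm)
  have hv : ∀ j, l j ≠ v := fun j e => hlr j c (e.trans hc.symm)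
  have hpu : p u = d u := by
    rw [hp]; rcases huv with ⟨rfl, rfl⟩ | ⟨rfl, rfl⟩
    · exact symbolDegree_left _ _ _
    · exact symbolDegree_right _ _ _
  have hpv : p v = d v := by
    rw [hp]; rcases huv with ⟨rfl, rfl⟩ | ⟨rfl, rfl⟩
    · exact symbolDegree_right _ _ _
    · exact symbolDegree_left _ _ _
  have hpj : ∀ j : Fin n, j ≠ u → j ≠ v → p j = d j + 1 := fun j h1 h2 => by
    rw [hp]; rcases huv with ⟨rfl, rfl⟩ | ⟨rfl, rfl⟩
    · exact symbolDegree_of_ne d h1 h2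
    · exact symbolDegree_of_ne d h2 h1
  have hGlin : ∀ j, WordLinear k (G j) := fun j => by
    cases j with
    | none => exact hG0
    | some j => rw [hG]; exact wordLinear_liftOp p (hg j).linear _
  have hXlin := wordLinear_liftOp p hh.linear {(u : ℕ)}
  have hXlin' := wordLinear_liftOp p hh'.linear {(v : ℕ)}
  have opIn := isOperation_mixedTerm b b' a (d := fun j => d (l j)) (h := h) (g := fun j => g (l j))
    (by rw [ha]; exact hh) fun j _ => hg _
  have rIn := represents_vectorField (𝒱 := 𝒱) b b' (H := liftOp p h {(u : ℕ)}) (a := a) (h := h)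
    (x := fun j => symbol p (l j)) (d := fun j => d (l j)) (by rw [symbol_deg, ha, hpu])
    (by rw [ha]; exact represents_symbol hh.linear p u) hXlin (by rw [ha]; exact hh)
    (l.trans Function.Embedding.some) hGlin
    (fun j hj => by
      rw [symbol_deg, hpj _ (fun e => hj (l.injective (e.trans ha.symm))) (hv j)])
    (g := fun j => g (l j))
    (fun j _ => by
      change Represents 𝒱 (G (some (l j))) _ _
      rw [hG]
      exact represents_symbol (hg _).linear p _) fun j _ => hg _
  have hset : (Finset.univ.erase a).map (l.trans Function.Embedding.some) =
      (S.erase u).map Function.Embedding.some := by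
    rw [← Finset.map_map, Finset.map_erase, hl, ha]
  rw [hset, pairSum_bracketExponent_comp, ha] at rIn
  -- The sign of the inner bracket is transferred to its symbol, so that the bracket itself can be
  -- an argument of the outer one.
  have rIn' := rIn.units_smul (pairSum (bracketExponent d u) (List.ofFn l)).negOnePow
  rw [smul_smul, Int.units_mul_self, one_smul] at rIn'
  have hdegl : (List.ofFn fun j => symbol p (l j)).prod.deg = ∑ j, d (l j) + i - 1 := by
    rw [SignedMonomial.deg_prod, List.map_ofFn, List.sum_ofFn]
    simp only [Function.comp_apply, symbol_deg]
    rw [← Finset.add_sum_erase _ _ (Finset.mem_univ a), ha, hpu,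
      Finset.sum_congr rfl fun j hj => hpj (l j)
        (fun e => Finset.ne_of_mem_erase hj (l.injective (e.trans ha.symm))) (hv j),
      ← Finset.add_sum_erase _ _ (Finset.mem_univ a), ha, Finset.sum_add_distrib,
      Finset.sum_const, Finset.card_erase_of_mem (Finset.mem_univ a), Finset.card_univ,
      Fintype.card_fin]
    have hi : 0 < i := a.pos
    simp only [nsmul_eq_mul, mul_one]
    push_cast [Nat.cast_sub (Nat.one_le_iff_ne_zero.2 hi.ne')]
    ring
  -- The inner bracket is the argument at position `0`; its degree is the sum of the degrees plus `i
  -- - 2`, one less than the degree of its symbol.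
  have rOut := represents_vectorField (𝒱 := 𝒱) b b' (H := liftOp p h' {(v : ℕ)}) (a := c.succ) (h := h')
    (x := Fin.cons ((pairSum (bracketExponent d u) (List.ofFn l)).negOnePow •
      (List.ofFn fun j => symbol p (l j)).prod) fun j => symbol p (r j))
    (d := Fin.cons (∑ j, d (l j) + i - 2) fun j => d (r j))
    (by simp [hc, hpv])
    (by simp only [Fin.cons_succ, hc]; exact represents_symbol hh'.linear p v) hXlin'
    (by simpa [hc] using hh') (consNone r)
    (G := Function.update G none (vectorField b b' G
      ((S.erase u).map Function.Embedding.some) (liftOp p h {(u : ℕ)})))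
    (fun j => by
      cases j with
      | none => 
        rw [Function.update_self]
        exact wordLinear_vectorField b b' hGlin hXlin _
      | some j => rw [Function.update_of_ne (by simp)]; exact hGlin _)
    (fun j => by
      refine Fin.cases ?_ (fun j => ?_) j
      · intro _
        simp only [Fin.cons_zero, SignedMonomial.smul_deg, hdegl]
        ring
      · intro hj
        simp only [Fin.cons_succ, symbol_deg]
        exact hpj _ (hu j) fun e => hj (congrArg Fin.succ (r.injective (e.trans hc.symm))))
    (g := Fin.cons (mixedTerm 𝒱 b b' i a (fun j => d (l j)) h fun j => g (l j)) fun j => g (r j))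
    (fun j => by
      refine Fin.cases ?_ (fun j => ?_) j
      · intro _
        rw [consNone_zero, Function.update_self]
        exact rIn'
      · intro _
        rw [consNone_succ, Function.update_of_ne (by simp), hG]
        exact represents_symbol (hg _).linear p _)
    (fun j => by
      refine Fin.cases ?_ (fun j => ?_) j
      · intro _
        simp only [Fin.cons_zero]
        convert opIn using 1
        ring
      · intro _
        exact hg _)
  rw [map_consNone_erase_succ, hr, hc, pairSum_bracketExponent_cons_succ,
    pairSum_bracketExponent_comp, hc] at rOut
  have hprod : (List.ofFn (Fin.cons ((pairSum (bracketExponent d u) (List.ofFn l)).negOnePow •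
      (List.ofFn fun j => symbol p (l j)).prod) fun j => symbol p (r j) :
        Fin (m + 1) → SignedMonomial p)).prod =
      (pairSum (bracketExponent d u) (List.ofFn l)).negOnePow •
        (List.ofFn fun j => symbol p (σ j)).prod := by
    have e : (List.ofFn fun j => symbol p (σ j)) = (List.ofFn σ).map fun j : Fin n => symbol p j := by
      rw [List.map_ofFn]; rfl
    rw [List.ofFn_succ, List.prod_cons]
    simp only [Fin.cons_zero, Fin.cons_succ]
    rw [SignedMonomial.smul_mul, e, hσ, List.map_append, List.prod_append, List.map_ofFn,
      List.map_ofFn]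
    rfl
  rw [hprod] at rOut
  -- The symbols stand in the order of the shuffle; restoring their natural order gives the Koszul
  -- sign.
  have rFin := Represents.of_smul (t := (List.ofFn fun j : Fin n => symbol p j).prod)
    (u := (pairSum (bracketExponent d u) (List.ofFn l)).negOnePow *
      koszulSign σ (symbolDegree d α β)) (fun hN => by
      rw [SignedMonomial.prod_perm (fun j : Fin n => symbol p j) σ hN, smul_smul]
      simp only [symbol_deg, hp]) (by
      rw [SignedMonomial.smul_supp, SignedMonomial.supp_prod, SignedMonomial.supp_prod,
        List.map_ofFn, List.map_ofFn, List.sum_ofFn, List.sum_ofFn]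
      exact Equiv.sum_comp σ fun j => (symbol p j).supp) rOut
  unfold pairField
  convert rFin using 1
  rw [smul_smul]
  congr 1
  have hchi := chiSign_mul_koszulSign σ (d := d) (F := jacobiExponent d α β)
    (p := symbolDegree d α β) (jacobiExponent_even d hαβ)
  have hkos : koszulSign σ (symbolDegree d α β) = chiSign σ d *
      ((pairSum (jacobiExponent d α β) (List.ofFn σ)).negOnePow *
        (pairSum (jacobiExponent d α β) (List.ofFn id)).negOnePow) := by
    rw [← hchi, ← mul_assoc, Int.units_mul_self, one_mul]
  -- The exponent splits into pairs inside the inner bracket, pairs inside the outer one and mixed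
  -- pairs. The first two sums are the exponents of the two brackets, whose signs cancel against
  -- them.
  have hexp : pairSum (jacobiExponent d α β) (List.ofFn σ) =
      pairSum (bracketExponent d u) (List.ofFn l) + ((m + 1) * ∑ j, d (l j) + i +
        if u = α then 1 else 0) + pairSum (bracketExponent d v) (List.ofFn r) := by
    rw [hσ, pairSum_append, pairSum_jacobiExponent d hαβ huv _ (by
      simp only [List.mem_ofFn, not_exists]; exact hv),
      pairSum_jacobiExponent d hαβ (u := v) (v := u) (by tauto) _ (by
      simp only [List.mem_ofFn, not_exists]; exact hu)]
    congr 2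
    rw [List.map_ofFn, List.sum_ofFn]
    have e : ∀ j, ((fun x => ((List.ofFn r).map (jacobiExponent d α β x)).sum) ∘ l) j =
        (m + 1) * d (l j) + 1 + if j = a then (if u = α then 1 else 0) else 0 := by
      intro j
      rw [Function.comp_apply, sum_map_jacobiExponent d huv r c hc hu _ (hv j)]
      have hj : l j = u ↔ j = a := by rw [← ha]; exact l.injective.eq_iff
      have h1 : (l j = α ∧ v = β) ↔ (j = a ∧ u = α) := by
        rcases huv with ⟨rfl, rfl⟩ | ⟨rfl, rfl⟩
        · simp [hj]
        · simp [hαβ, hαβ.symm]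
      simp only [h1]
      by_cases h2 : j = a
      · simp [h2]; ring
      · simp [h2]; ring
    rw [Finset.sum_congr rfl fun j _ => e j, Finset.sum_add_distrib, Finset.sum_ite_eq',
      Finset.sum_add_distrib, ← Finset.mul_sum]
    simp
  rw [hkos, hexp]
  have hsgn : (if u = α then 1 else -1 : ℤˣ) = (1 + if u = α then 1 else 0 : ℤ).negOnePow := by
    split_ifs
    · exact (Int.negOnePow_even (1 + 1) ⟨1, rfl⟩).symm
    · simp
  rw [hsgn]
  simp only [Int.negOnePow_add]
  generalize pairSum (bracketExponent d u) (List.ofFn l) = A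
  generalize pairSum (bracketExponent d v) (List.ofFn r) = B
  generalize pairSum (jacobiExponent d α β) (List.ofFn id) = C
  generalize ∑ j, d (l j) = s
  generalize (if u = α then 1 else 0 : ℤ) = e
  rw [← mul_one (chiSign σ d)]
  generalize chiSign σ d = χ
  -- What is left of the mixed pairs and of the position of the inner bracket is the sign `(-1)^{i
  -- m}` of the Jacobi identity, up to a global minus.
  have key : ((i : ℤ) * m).negOnePow * (1 : ℤ).negOnePow =
      ((m + 1) * s : ℤ).negOnePow * (i : ℤ).negOnePow *
      (((m : ℤ) * (s + i - 2)).negOnePow * (s + i - 2).negOnePow * (1 : ℤ).negOnePow) := by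
    simp only [← Int.negOnePow_add]
    rw [Int.negOnePow_eq_iff]
    exact ⟨m + 1 - (m + 1) * s - i, by ring⟩
  calc _ = C.negOnePow * e.negOnePow * χ * (((i : ℤ) * m).negOnePow * (1 : ℤ).negOnePow) := by
        simp only [mul_one, mul_assoc, mul_comm, mul_left_comm]
    _ = C.negOnePow * e.negOnePow * χ * (((m + 1) * s : ℤ).negOnePow * (i : ℤ).negOnePow *
      (((m : ℤ) * (s + i - 2)).negOnePow * (s + i - 2).negOnePow * (1 : ℤ).negOnePow)) *
      ((A.negOnePow * A.negOnePow) * (B.negOnePow * B.negOnePow)) := by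
        rw [key, Int.units_mul_self, Int.units_mul_self, mul_one, mul_one]
    _ = _ := by simp only [mul_one, mul_assoc, mul_comm, mul_left_comm]

/-- The second insertion carries the symbols `u t`; exchanging them gives the sign of the
Gerstenhaber bracket. -/
theorem represents_gerstenhaber {J : Type*} [LinearOrder J] {p : J → ℤ}
    {F G : List (Multiset J →₀ V) → (Multiset J →₀ V)} {t u : SignedMonomial p}
    {f g : List V → V} {e e' : ℤ} (hF : Represents 𝒱 F t f) (hG : Represents 𝒱 G u g)
    (ht : t.deg = e) (hu : u.deg = e') (hf : IsOperation 𝒱 e f) (hg : IsOperation 𝒱 e' g) :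
    Represents 𝒱 (fun w => ins F G w - ins G F w) (t * u) (gerstenhaber 𝒱 e f e' g) := by
  subst ht hu
  exact (hF.ins hG hf.linear hg).sub (Represents.of_smul (t := t * u)
    (u := (t.deg * u.deg).negOnePow) (fun hN => by
      rw [SignedMonomial.mul_eq_smul_mul (by rwa [SignedMonomial.supp_mul, add_comm] at hN),
        mul_comm u.deg])
    (by simp only [SignedMonomial.supp_mul, add_comm]) (hG.ins hF hg.linear hf))

theorem IsOperation.gerstenhaber {f g : List V → V} {e e' : ℤ} (hf : IsOperation 𝒱 e f)
    (hg : IsOperation 𝒱 e' g) : IsOperation 𝒱 (e + e') (gerstenhaber 𝒱 e f e' g) :=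
  (hf.insertion hg).sub ((add_comm e' e ▸ hg.insertion hf).units_smul _)

/-- The product of the symbols of `α` and `β` serves as one symbol for their Gerstenhaber bracket at
position `0`. The family `g'` is prescribed only at successors, since its entry at `0` is not used.
-/
theorem represents_commutator (b b' : Bool) {n m : ℕ} (σ : Equiv.Perm (Fin n))
    {α β : Fin n} {r : Fin m ↪ Fin n} (hσ : List.ofFn σ = [α, β] ++ List.ofFn r)
    {S : Finset (Fin n)} (hr : Finset.univ.map r = S)
    {d : Fin n → ℤ} (hαβ : α ≠ β) {h h' : List V → V} {g : Fin n → List V → V}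
    {g' : Fin (m + 1) → List V → V} (hg' : ∀ j, g' j.succ = g (r j))
    (hh : IsOperation 𝒱 (d α) h) (hh' : IsOperation 𝒱 (d β) h')
    (hg : ∀ j, IsOperation 𝒱 (d j + 1) (g j))
    {p : ℕ → ℤ} (hp : ∀ i : Fin n, p i = symbolDegree d α β i)
    {G : Option (Fin n) → List (Multiset ℕ →₀ V) → (Multiset ℕ →₀ V)}
    (hG : ∀ j : Fin n, G (some j) = liftOp p (g j) {(j : ℕ)}) (hG0 : WordLinear k (G none)) :
    Represents 𝒱 (vectorField b b' G (S.map Function.Embedding.some) fun w =>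
        ins (liftOp p h {(α : ℕ)}) (liftOp p h' {(β : ℕ)}) w -
          ins (liftOp p h' {(β : ℕ)}) (liftOp p h {(α : ℕ)}) w)
      (List.ofFn fun j : Fin n => symbol p j).prod
      (((pairSum (jacobiExponent d α β) (List.ofFn id)).negOnePow * chiSign σ d) •
        mixedTerm 𝒱 b b' (m + 1) 0 (Fin.cons (d α + d β) fun j => d (r j))
          (gerstenhaber 𝒱 (d α) h (d β) h') g') := by
  have hnd : (List.ofFn σ).Nodup := List.nodup_ofFn.2 σ.injective
  rw [hσ, List.nodup_append] at hnd
  have hα : ∀ j, r j ≠ α := fun j e =>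
    hnd.2.2 α (by simp) (r j) (by simp [List.mem_ofFn]) e.symm
  have hβ : ∀ j, r j ≠ β := fun j e =>
    hnd.2.2 β (by simp) (r j) (by simp [List.mem_ofFn]) e.symm
  have hpα : p α = d α := by rw [hp, symbolDegree_left]
  have hpβ : p β = d β := by rw [hp, symbolDegree_right]
  have hpj : ∀ j, p (r j) = d (r j) + 1 := fun j => by
    rw [hp, symbolDegree_of_ne d (hα j) (hβ j)]
  have hGlin : ∀ j, WordLinear k (G j) := fun j => by
    cases j with
    | none => exact hG0
    | some j => rw [hG]; exact wordLinear_liftOp p (hg j).linear _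
  have hX := wordLinear_liftOp p hh.linear {(α : ℕ)}
  have hX' := wordLinear_liftOp p hh'.linear {(β : ℕ)}
  have rα := represents_symbol (𝒱 := 𝒱) hh.linear p α
  have rβ := represents_symbol (𝒱 := 𝒱) hh'.linear p β
  have rcomm := represents_gerstenhaber rα rβ (by rw [symbol_deg, hpα]) (by rw [symbol_deg, hpβ]) hh hh'
  have opG := hh.gerstenhaber hh'
  have rOut := represents_vectorField (𝒱 := 𝒱) b b' (H := fun w =>
      ins (liftOp p h {(α : ℕ)}) (liftOp p h' {(β : ℕ)}) w -
        ins (liftOp p h' {(β : ℕ)}) (liftOp p h {(α : ℕ)}) w) (a := 0)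
    (h := gerstenhaber 𝒱 (d α) h (d β) h')
    (x := Fin.cons (symbol p α * symbol p β) fun j => symbol p (r j))
    (d := Fin.cons (d α + d β) fun j => d (r j)) (by simp [hpα, hpβ]) rcomm
    ((hX.ins hX').sub (hX'.ins hX)) opG (consNone r) (G := G) hGlin
    (fun j => by
      refine Fin.cases (fun h => absurd rfl h) (fun j _ => ?_) j
      simp only [Fin.cons_succ, symbol_deg, hpj])
    (g := g')
    (fun j => by
      refine Fin.cases (fun h => absurd rfl h) (fun j _ => ?_) j
      rw [consNone_succ, hG, hg']
      exact represents_symbol (hg _).linear p _)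
    (fun j => by
      refine Fin.cases (fun h => absurd rfl h) (fun j _ => ?_) j
      rw [hg']
      exact hg _)
  rw [map_consNone_erase_zero, hr, pairSum_bracketExponent_cons_zero] at rOut
  have hprod : (List.ofFn (Fin.cons (symbol p α * symbol p β) fun j => symbol p (r j) :
      Fin (m + 1) → SignedMonomial p)).prod = (List.ofFn fun j => symbol p (σ j)).prod := by
    have e : (List.ofFn fun j => symbol p (σ j)) =
        (List.ofFn σ).map fun j : Fin n => symbol p j := by
      rw [List.map_ofFn]; rfl
    rw [List.ofFn_succ, List.prod_cons]
    simp only [Fin.cons_zero, Fin.cons_succ]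
    rw [e, hσ, List.map_append, List.prod_append, List.map_ofFn]
    simp only [List.map_cons, List.map_nil, List.prod_cons, List.prod_nil, mul_one]
    rfl
  rw [hprod] at rOut
  have rFin := Represents.of_smul (t := (List.ofFn fun j : Fin n => symbol p j).prod)
    (u := koszulSign σ (symbolDegree d α β)) (fun hN => by
      rw [SignedMonomial.prod_perm (fun j : Fin n => symbol p j) σ hN]
      simp only [symbol_deg, hp]) (by
      rw [SignedMonomial.supp_prod, SignedMonomial.supp_prod,
        List.map_ofFn, List.map_ofFn, List.sum_ofFn, List.sum_ofFn]
      exact Equiv.sum_comp σ fun j => (symbol p j).supp) rOut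
  convert rFin using 1
  rw [smul_smul]
  congr 1
  have hchi := chiSign_mul_koszulSign σ (d := d) (F := jacobiExponent d α β)
    (p := symbolDegree d α β) (jacobiExponent_even d hαβ)
  have hkos : koszulSign σ (symbolDegree d α β) = chiSign σ d *
      ((pairSum (jacobiExponent d α β) (List.ofFn σ)).negOnePow *
        (pairSum (jacobiExponent d α β) (List.ofFn id)).negOnePow) := by
    rw [← hchi, ← mul_assoc, Int.units_mul_self, one_mul]
  have hF : ∀ x j, jacobiExponent d α β x (r j) = d x := fun x j => by
    simp [jacobiExponent, hα j, hβ j]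
  have hexp : pairSum (jacobiExponent d α β) (List.ofFn σ) =
      2 * d α + 2 + m * (d α + d β) + pairSum (fun i _ => d i) (List.ofFn r) := by
    rw [hσ, pairSum_append]
    congr 1
    · simp only [pairSum, List.map_cons, List.map_nil, List.sum_cons, List.sum_nil, List.map_ofFn,
        List.sum_ofFn, Function.comp_def, hF, Finset.sum_const, Finset.card_univ, Fintype.card_fin,
        nsmul_eq_mul]
      simp only [jacobiExponent, or_true, if_true, and_self]
      ring
    · refine pairSum_congr fun i _ j hj => ?_
      obtain ⟨j, rfl⟩ := List.mem_ofFn.1 hj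
      exact hF i j
  have hd : pairSum (fun i _ => d (r i)) (List.ofFn (id : Fin m → Fin m)) =
      pairSum (fun i _ => d i) (List.ofFn r) := by
    rw [pairSum_ofFn, pairSum_ofFn]
    rfl
  rw [hkos, hexp, hd]
  generalize pairSum (jacobiExponent d α β) (List.ofFn id) = C
  have key : (2 * d α + 2 + m * (d α + d β) + pairSum (fun i _ => d i) (List.ofFn r)).negOnePow =
      (m * (d α + d β) + pairSum (fun i _ => d i) (List.ofFn r)).negOnePow := by
    rw [Int.negOnePow_eq_iff]
    exact ⟨d α + 1, by ring⟩
  rw [key]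
  generalize (m * (d α + d β) + pairSum (fun i _ => d i) (List.ofFn r)).negOnePow = A
  rcases Int.units_eq_one_or A with rfl | rfl
  · rw [one_mul, mul_one, mul_comm]
  · simp [mul_comm]

end Compositions

/-! ### The commutator formula summed over subsets -/

section Cancellation

variable {k M : Type*} [CommRing k] [AddCommGroup M] [Module k M] {Y : Type*} [AddCommGroup Y]

theorem partSum_map_embedding {I K : Type*} [DecidableEq I] [DecidableEq K] (f : I ↪ K)
    (S : Finset I) (F : Finset K → Finset K → Y) :
    partSum (S.map f) F = partSum S fun A B => F (A.map f) (B.map f) := by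
  have h : (S.map f).powerset = S.powerset.map (Finset.mapEmbedding f).toEmbedding := by
    ext A
    simp only [Finset.mem_powerset, Finset.mem_map]
    constructor
    · intro hA
      obtain ⟨B, hB, rfl⟩ := Finset.subset_map_iff.1 hA
      exact ⟨B, hB, rfl⟩
    · rintro ⟨B, hB, rfl⟩
      exact Finset.map_subset_map.2 hB
  rw [partSum, partSum, h, Finset.sum_map]
  refine Finset.sum_congr rfl fun A _ => ?_
  simp only [RelEmbedding.coe_toEmbedding, Finset.mapEmbedding_apply, Finset.map_sdiff]

theorem sum_filter_mem_notMem {I : Type*} [Fintype I] [DecidableEq I] {u v : I} (h : u ≠ v)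
    (f : Finset I → Y) :
    ∑ S : Finset I with u ∈ S ∧ v ∉ S, f S =
      partSum ((Finset.univ.erase u).erase v) fun A _ => f (insert u A) := by
  rw [partSum]
  refine Finset.sum_nbij' (fun S => S.erase u) (fun A => insert u A) ?_ ?_ ?_ ?_ ?_
  · intro S hS
    simp only [Finset.mem_filter, Finset.mem_univ, true_and] at hS
    rw [Finset.mem_powerset]
    intro x hx
    rw [Finset.mem_erase] at hx
    simp only [Finset.mem_erase, Finset.mem_univ, and_true]
    exact ⟨fun e => hS.2 (e ▸ hx.2), hx.1⟩
  · intro A hA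
    rw [Finset.mem_powerset] at hA
    simp only [Finset.mem_filter, Finset.mem_univ, true_and, Finset.mem_insert, true_or, not_or]
    exact ⟨h.symm, fun hv => by simpa using hA hv⟩
  · intro S hS
    simp only [Finset.mem_filter, Finset.mem_univ, true_and] at hS
    exact Finset.insert_erase hS.1
  · intro A hA
    rw [Finset.mem_powerset] at hA
    exact Finset.erase_insert fun hu => by simpa using hA hu
  · intro S hS
    simp only [Finset.mem_filter, Finset.mem_univ, true_and] at hS
    simp only [Finset.insert_erase hS.1]

/-- With `u` inside and `v` outside, a subset amounts to a decomposition of the remaining indices.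
The index `none` is the new variable for which the inner field is substituted in
`vectorField_commutator`. -/
theorem sum_pairField_eq {n : ℕ} {u v : Fin n} (huv : u ≠ v) (b b' : Bool)
    (G : Option (Fin n) → List M → M) (X X' : List M → M) (w : List M) :
    ∑ S : Finset (Fin n) with u ∈ S ∧ v ∉ S, pairField b b' G u v X X' S w =
      partSum ((((Finset.univ.erase u).erase v)).map Function.Embedding.some) fun A C =>
        vectorField b b' (Function.update G none (vectorField b b' G A X)) (insert none C) X' w := by
  rw [sum_filter_mem_notMem huv, partSum_map_embedding]
  refine partSum_congr fun A hA => ?_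
  have hu : u ∉ A := fun h => by simpa using hA h
  have e : (insert u A)ᶜ.erase v = (Finset.univ.erase u).erase v \ A := by
    ext x
    simp only [Finset.mem_erase, Finset.mem_compl, Finset.mem_insert, Finset.mem_sdiff,
      Finset.mem_univ, and_true]
    tauto
  simp only [pairField, Finset.erase_insert hu, e]

/-- The contributions to the Jacobi identity of two arguments in `C_A(V)` cancel. -/
theorem vectorField_commutator_eq_sum {n : ℕ} {α β : Fin n} (hαβ : α ≠ β) (b b' : Bool)
    {G : Option (Fin n) → List M → M} (hG : ∀ j, WordLinear k (G j)) {X X' : List M → M}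
    (hX : WordLinear k X) (hX' : WordLinear k X') (w : List M) :
    vectorField b b' G ((({α, β} : Finset (Fin n))ᶜ).map Function.Embedding.some)
        (fun v => ins X X' v - ins X' X v) w =
      ∑ S : Finset (Fin n) with β ∈ S ∧ α ∉ S, pairField b b' G β α X' X S w -
        ∑ S : Finset (Fin n) with α ∈ S ∧ β ∉ S, pairField b b' G α β X X' S w := by
  have e1 : ({α, β} : Finset (Fin n))ᶜ = (Finset.univ.erase α).erase β := by
    ext x; simp; tauto
  have e2 : (Finset.univ.erase β).erase α = (Finset.univ.erase α).erase β := Finset.erase_right_comm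
  rw [sum_pairField_eq hαβ, sum_pairField_eq hαβ.symm, e1, e2]
  exact vectorField_commutator b b' hG (by simp) hX hX' w

end Cancellation

/-! ### Sums over shuffles -/

section Shuffles

variable {n i : ℕ}

/-- The first `i` values of a permutation. -/
def shuffleLeft (hi : i ≤ n) (σ : Equiv.Perm (Fin n)) : Fin i ↪ Fin n :=
  (Fin.castLEEmb hi).trans σ.toEmbedding

/-- The last `n - i` values of a permutation. -/
def shuffleRight (hi : i ≤ n) (σ : Equiv.Perm (Fin n)) : Fin (n - i) ↪ Fin n where
  toFun b := σ ⟨i + b, by omega⟩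
  inj' a b h := by
    have := σ.injective h
    simp only [Fin.mk.injEq] at this
    exact Fin.ext (by omega)

theorem shuffleLeft_apply (hi : i ≤ n) (σ : Equiv.Perm (Fin n)) (a : Fin i) :
    shuffleLeft hi σ a = σ (Fin.castLE hi a) := rfl

theorem shuffleRight_apply (hi : i ≤ n) (σ : Equiv.Perm (Fin n)) (b : Fin (n - i)) :
    shuffleRight hi σ b = σ ⟨i + b, by omega⟩ := rfl

theorem ofFn_shuffle (hi : i ≤ n) (σ : Equiv.Perm (Fin n)) :
    List.ofFn σ = List.ofFn (shuffleLeft hi σ) ++ List.ofFn (shuffleRight hi σ) := by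
  refine List.ext_getElem (by simp; omega) fun j h1 h2 => ?_
  rw [List.getElem_ofFn, List.getElem_append]
  split_ifs with h
  · rw [List.getElem_ofFn]; rfl
  · rw [List.getElem_ofFn, shuffleRight_apply]
    congr 2
    simp at h ⊢
    omega

theorem map_shuffleRight (hi : i ≤ n) (σ : Equiv.Perm (Fin n)) :
    Finset.univ.map (shuffleRight hi σ) = (Finset.univ.map (shuffleLeft hi σ))ᶜ := by
  ext x
  obtain ⟨y, rfl⟩ := σ.surjective x
  simp only [Finset.mem_map, Finset.mem_univ, true_and, Finset.mem_compl, shuffleLeft_apply,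
    shuffleRight_apply, σ.injective.eq_iff, not_exists]
  constructor
  · rintro ⟨b, rfl⟩ a h
    have := congrArg Fin.val h
    simp at this
    omega
  · intro h
    have hy : i ≤ y := by
      by_contra hlt
      exact h ⟨y, by omega⟩ rfl
    exact ⟨⟨y - i, by omega⟩, Fin.ext (by simp; omega)⟩

theorem isShuffle_iff (hi : i ≤ n) (σ : Equiv.Perm (Fin n)) :
    IsShuffle i σ ↔ StrictMono (shuffleLeft hi σ) ∧ StrictMono (shuffleRight hi σ) := by
  constructor
  · refine fun h => ⟨fun a b hab => h _ _ (Fin.lt_def.2 hab) (Or.inl b.is_lt),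
      fun a b hab => h _ _ (Fin.lt_def.2 ?_) (Or.inr ?_)⟩
    · simpa using hab
    · simp
  · rintro ⟨h1, h2⟩ a b hab (h | h)
    · exact h1 (a := ⟨a, (Fin.lt_def.1 hab).trans h⟩) (b := ⟨b, h⟩) hab
    · have hb : i ≤ b := h.trans (Fin.lt_def.1 hab).le
      have := @h2 ⟨a - i, by omega⟩ ⟨b - i, by omega⟩ (Fin.lt_def.2 (by
        have := Fin.lt_def.1 hab
        simp; omega))
      simpa only [shuffleRight_apply, Nat.add_sub_cancel' h, Nat.add_sub_cancel' hb] using this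

theorem shuffle_ext (hi : i ≤ n) {σ τ : Equiv.Perm (Fin n)}
    (hl : ∀ a, shuffleLeft hi σ a = shuffleLeft hi τ a)
    (hr : ∀ b, shuffleRight hi σ b = shuffleRight hi τ b) : σ = τ := by
  ext x
  by_cases hx : (x : ℕ) < i
  · exact congrArg Fin.val (hl ⟨x, hx⟩)
  · have := hr ⟨x - i, by omega⟩
    simp only [shuffleRight_apply, Nat.add_sub_cancel' (not_lt.1 hx)] at this
    exact congrArg Fin.val this

/-- A strictly increasing enumeration is determined by its image, and the second block enumerates
the complement of the first. -/
theorem isShuffle_eq (hi : i ≤ n) {σ τ : Equiv.Perm (Fin n)} (hσ : IsShuffle i σ)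
    (hτ : IsShuffle i τ)
    (h : Finset.univ.map (shuffleLeft hi σ) = Finset.univ.map (shuffleLeft hi τ)) : σ = τ := by
  rw [isShuffle_iff hi] at hσ hτ
  have h' : Finset.univ.map (shuffleRight hi σ) = Finset.univ.map (shuffleRight hi τ) := by
    rw [map_shuffleRight, map_shuffleRight, h]
  have key : ∀ {m : ℕ} {f g : Fin m ↪ Fin n}, StrictMono f → StrictMono g →
      Finset.univ.map f = Finset.univ.map g → ∀ a, f a = g a := by
    intro m f g hf hg e a
    have hc : (Finset.univ.map g).card = m := by simp
    rw [Finset.orderEmbOfFin_unique hc (f := f) (fun x => by rw [← e]; simp) hf,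
      Finset.orderEmbOfFin_unique hc (f := g) (fun x => by simp) hg]
  exact shuffle_ext hi (key hσ.1 hτ.1 h) (key hσ.2 hτ.2 h')

theorem exists_isShuffle (hi : i ≤ n) {S : Finset (Fin n)} (hS : S.card = i) :
    ∃ σ, IsShuffle i σ ∧ Finset.univ.map (shuffleLeft hi σ) = S := by
  have hS' : Sᶜ.card = n - i := by rw [Finset.card_compl, Fintype.card_fin, hS]
  let σ : Equiv.Perm (Fin n) := (finCongr (Nat.add_sub_cancel' hi).symm).trans
    (finSumFinEquiv.symm.trans (finSumEquivOfFinset hS hS'))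
  have hl : ∀ a, shuffleLeft hi σ a = S.orderEmbOfFin hS a := by
    intro a
    have e : finCongr (Nat.add_sub_cancel' hi).symm (Fin.castLE hi a) = Fin.castAdd (n - i) a :=
      rfl
    simp only [shuffleLeft_apply, σ, Equiv.trans_apply, e, finSumFinEquiv_symm_apply_castAdd,
      finSumEquivOfFinset_inl]
  have hr : ∀ b, shuffleRight hi σ b = Sᶜ.orderEmbOfFin hS' b := by
    intro b
    have e : finCongr (Nat.add_sub_cancel' hi).symm ⟨i + b, by omega⟩ = Fin.natAdd i b := rfl
    simp only [shuffleRight_apply, σ, Equiv.trans_apply, e, finSumFinEquiv_symm_apply_natAdd,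
      finSumEquivOfFinset_inr]
  refine ⟨σ, (isShuffle_iff hi σ).2 ⟨fun a b h => ?_, fun a b h => ?_⟩, ?_⟩
  · rw [hl, hl]; exact (S.orderEmbOfFin hS).strictMono h
  · rw [hr, hr]; exact (Sᶜ.orderEmbOfFin hS').strictMono h
  · ext x
    simp only [Finset.mem_map, Finset.mem_univ, true_and, hl]
    rw [← Set.mem_range (f := S.orderEmbOfFin hS), Finset.range_orderEmbOfFin, Finset.mem_coe]

-- A shuffle is determined by the set of its first `i` values, and every set occurs. The restriction
-- `1 ≤ i` excludes the empty set, whence the hypothesis `h0`.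
open Classical in
theorem sum_isShuffle {Y : Type*} [AddCommMonoid Y] (f : Finset (Fin n) → Y) (h0 : f ∅ = 0) :
    ∑ i ∈ Finset.univ.filter (fun i : Fin (n + 1) => 1 ≤ (i : ℕ)), ∑ σ : Equiv.Perm (Fin n) with IsShuffle i σ,
      f (Finset.univ.map (shuffleLeft i.is_le σ)) = ∑ S, f S := by
  rw [Finset.sum_sigma', ← Finset.sum_filter_add_sum_filter_not Finset.univ (fun S => S = ∅) f,
    Finset.filter_eq' _ ∅, if_pos (Finset.mem_univ _), Finset.sum_singleton, h0, zero_add]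
  have hcard : ∀ (i : Fin (n + 1)) (σ : Equiv.Perm (Fin n)),
      (Finset.univ.map (shuffleLeft i.is_le σ)).card = i := fun i σ => by simp
  refine Finset.sum_bij (fun x _ => Finset.univ.map (shuffleLeft x.1.is_le x.2)) ?_ ?_ ?_ ?_
  · rintro ⟨i, σ⟩ h
    simp only [Finset.mem_sigma, Finset.mem_filter, Finset.mem_univ, true_and] at h ⊢
    intro e
    have := hcard i σ
    rw [e, Finset.card_empty] at this
    omega
  · rintro ⟨i, σ⟩ h ⟨j, τ⟩ h' e
    simp only [Finset.mem_sigma, Finset.mem_filter, Finset.mem_univ, true_and] at h h' e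
    have hij : i = j := Fin.ext (by rw [← hcard i σ, e, hcard j τ])
    subst hij
    rw [isShuffle_eq i.is_le h.2 h'.2 e]
  · intro S hS
    simp only [Finset.mem_filter, Finset.mem_univ, true_and] at hS
    have hle : S.card ≤ n := by simpa using S.card_le_univ
    obtain ⟨σ, hσ, e⟩ := exists_isShuffle hle (S := S) rfl
    refine ⟨⟨⟨S.card, by omega⟩, σ⟩, ?_, e⟩
    simp only [Finset.mem_sigma, Finset.mem_filter, Finset.mem_univ, true_and]
    exact ⟨Finset.card_pos.2 (Finset.nonempty_iff_ne_empty.2 hS), hσ⟩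
  · exact fun _ _ => rfl

end Shuffles

/-! ### The Jacobi identity for the mixed brackets -/

theorem sum_sum_eq_sum_lt {n : ℕ} {Y : Type*} [AddCommMonoid Y] (f : Fin n → Fin n → Y)
    (h : ∀ u, f u u = 0) :
    ∑ u, ∑ v, f u v = ∑ x : Fin n × Fin n with x.1 < x.2, (f x.1 x.2 + f x.2 x.1) := by
  have e : ∀ x : Fin n × Fin n, f x.1 x.2 =
      (if x.1 < x.2 then f x.1 x.2 else 0) + if x.2 < x.1 then f x.1 x.2 else 0 := by
    rintro ⟨u, v⟩
    rcases lt_trichotomy u v with h' | rfl | h'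
    · simp [h', h'.not_gt]
    · simp [h]
    · simp [h', h'.not_gt]
  rw [← Fintype.sum_prod_type', Finset.sum_congr rfl fun x _ => e x, Finset.sum_add_distrib,
    Finset.sum_filter, ← Equiv.sum_comp (Equiv.prodComm _ _) fun x : Fin n × Fin n =>
      if x.2 < x.1 then f x.1 x.2 else 0, ← Finset.sum_add_distrib]
  refine Finset.sum_congr rfl fun x _ => ?_
  change (if x.1 < x.2 then f x.1 x.2 else 0) + (if x.1 < x.2 then f x.2 x.1 else 0) = _
  by_cases hx : x.1 < x.2 <;> simp [hx]

section Jacobi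

variable {k V : Type*} [Field k] [AddCommGroup V] [Module k V] (𝒱 : ℤ → Submodule k V)
  [DirectSum.Decomposition 𝒱]

/-- The component of the brackets in `C_A(V)`. -/
def algBracket : (n : ℕ) → (Fin n → ℤ) → (Fin n → List V → V) → List V → V
  | 2, d, X => gerstenhaber 𝒱 (d 0) (X 0) (d 1) (X 1)
  | _, _, _ => 0

/-- The sum over all arguments of the bracket of its component `X a` in `C_A(V)` with the components
`g` of the other arguments. -/
def mixedSum (b b' : Bool) (n : ℕ) (d : Fin n → ℤ) (X g : Fin n → List V → V) : List V → V :=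
  ∑ a, mixedTerm 𝒱 b b' n a d (X a) g

variable {𝒱}

theorem algBracket_of_ne {n : ℕ} (hn : n ≠ 2) (d : Fin n → ℤ) (X : Fin n → List V → V) :
    algBracket 𝒱 n d X = 0 := by
  unfold algBracket
  split
  · exact absurd rfl hn
  · rfl

theorem isOperation_algBracket {n : ℕ} {d : Fin n → ℤ} {X : Fin n → List V → V}
    (hX : ∀ j, IsOperation 𝒱 (d j) (X j)) :
    IsOperation 𝒱 (∑ j, d j + n - 2) (algBracket 𝒱 n d X) := by
  by_cases hn : n = 2
  · subst hn
    have h := (hX 0).gerstenhaber (hX 1)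
    rw [Fin.sum_univ_two]
    have e : d 0 + d 1 + (2 : ℕ) - 2 = d 0 + d 1 := by push_cast; ring
    rw [e]
    exact h
  · rw [algBracket_of_ne hn]; exact IsOperation.zero

theorem isOperation_mixedSum (b b' : Bool) {n : ℕ} {d : Fin n → ℤ} {X g : Fin n → List V → V}
    (hX : ∀ j, IsOperation 𝒱 (d j) (X j)) (hg : ∀ j, IsOperation 𝒱 (d j + 1) (g j)) :
    IsOperation 𝒱 (∑ j, d j + n - 1) (mixedSum 𝒱 b b' n d X g) :=
  IsOperation.sum _ fun a _ => isOperation_mixedTerm b b' a (hX a) fun j _ => hg j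

theorem mixedTerm_cons_sum (b b' : Bool) {m : ℕ} (c : Fin m) (d : Fin (m + 1) → ℤ) {h : List V → V}
    (hh : WordLinear k h) {ι : Type*} (s : Finset ι) (f : ι → List V → V) {g : Fin m → List V → V}
    (hg : ∀ j, WordLinear k (g j)) :
    mixedTerm 𝒱 b b' (m + 1) c.succ d h (Fin.cons (∑ a ∈ s, f a) g) =
      ∑ a ∈ s, mixedTerm 𝒱 b b' (m + 1) c.succ d h (Fin.cons (f a) g) := by
  funext w
  have lin := isLinearMap_mixedTerm_slot (𝒱 := 𝒱) b b' (a := c.succ) d hh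
    (g := fun z : List V → V => (Fin.cons z g : Fin (m + 1) → List V → V)) (j := 0)
    (Fin.succ_ne_zero c).symm (fun w => ⟨fun _ _ => rfl, fun _ _ => rfl⟩)
    (fun i _ h0 z => by
      obtain ⟨i, rfl⟩ := Fin.exists_succ_eq.2 h0
      rfl)
    (fun i _ h0 => by
      obtain ⟨i, rfl⟩ := Fin.exists_succ_eq.2 h0
      exact hg i) w
  rw [Finset.sum_apply]
  exact map_sum (lin.mk' _) f s

/-- The part of the Jacobi identity in which `X u` is in the inner and `X v` in the outer
bracket. -/
def pairTerm (𝒱 : ℤ → Submodule k V) [DirectSum.Decomposition 𝒱] (b b' : Bool) {n i m : ℕ}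
    (d : Fin n → ℤ) (X g : Fin n → List V → V) (l : Fin i ↪ Fin n)
    (r : Fin m ↪ Fin n) (u v : Fin n) : List V → V :=
  ∑ a, ∑ c, if l a = u ∧ r c = v then
    mixedTerm 𝒱 b b' (m + 1) c.succ (Fin.cons (∑ j, d (l j) + i - 2) fun j => d (r j)) (X v)
      (Fin.cons (mixedTerm 𝒱 b b' i a (fun j => d (l j)) (X u) fun j => g (l j)) fun j => g (r j))
    else 0

/-- The part of the Jacobi identity in which the inner bracket is in `C_A(V)`. -/
def commTerm (𝒱 : ℤ → Submodule k V) [DirectSum.Decomposition 𝒱] (b b' : Bool) {n i m : ℕ}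
    (d : Fin n → ℤ) (X g : Fin n → List V → V) (l : Fin i ↪ Fin n)
    (r : Fin m ↪ Fin n) : List V → V :=
  mixedTerm 𝒱 b b' (m + 1) 0 (Fin.cons (∑ j, d (l j) + i - 2) fun j => d (r j))
    (algBracket 𝒱 i (fun j => d (l j)) fun j => X (l j)) (Fin.cons 0 fun j => g (r j))

section

variable {n i m : ℕ} {d : Fin n → ℤ} {X g : Fin n → List V → V} {l : Fin i ↪ Fin n}
  {r : Fin m ↪ Fin n}

theorem pairTerm_apply (b b' : Bool) (a : Fin i) (c : Fin m) :
    pairTerm 𝒱 b b' d X g l r (l a) (r c) =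
      mixedTerm 𝒱 b b' (m + 1) c.succ (Fin.cons (∑ j, d (l j) + i - 2) fun j => d (r j)) (X (r c))
        (Fin.cons (mixedTerm 𝒱 b b' i a (fun j => d (l j)) (X (l a)) fun j => g (l j))
          fun j => g (r j)) := by
  rw [pairTerm, Finset.sum_eq_single a, Finset.sum_eq_single c, if_pos ⟨rfl, rfl⟩]
  · exact fun c' _ h => if_neg fun h' => h (r.injective h'.2)
  · simp
  · exact fun a' _ h => Finset.sum_eq_zero fun c' _ => if_neg fun h' => h (l.injective h'.1)
  · simp

theorem pairTerm_eq_zero (b b' : Bool) {u v : Fin n} (h : ∀ a c, l a = u → r c = v → False) :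
    pairTerm 𝒱 b b' d X g l r u v = 0 :=
  Finset.sum_eq_zero fun a _ => Finset.sum_eq_zero fun c _ => if_neg fun h' => h a c h'.1 h'.2

theorem sum_pairTerm (b b' : Bool) :
    ∑ u, ∑ v, pairTerm 𝒱 b b' d X g l r u v =
      ∑ a, ∑ c, pairTerm 𝒱 b b' d X g l r (l a) (r c) := by
  simp only [pairTerm_apply]
  simp only [pairTerm]
  rw [Finset.sum_congr rfl fun u _ => Finset.sum_comm, Finset.sum_comm]
  refine Finset.sum_congr rfl fun a _ => ?_
  rw [Finset.sum_congr rfl fun u _ => Finset.sum_comm, Finset.sum_comm]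
  refine Finset.sum_congr rfl fun c _ => ?_
  rw [Finset.sum_eq_single (l a), Finset.sum_eq_single (r c), if_pos ⟨rfl, rfl⟩]
  · exact fun c' _ h => if_neg fun h' => h h'.2.symm
  · simp
  · exact fun a' _ h => Finset.sum_eq_zero fun c' _ => if_neg fun h' => h h'.1.symm
  · simp

theorem isOperation_inner (b b' : Bool) (hX : ∀ j, IsOperation 𝒱 (d j) (X j))
    (hg : ∀ j, IsOperation 𝒱 (d j + 1) (g j)) (a : Fin i) (j : Fin (m + 1)) :
    IsOperation 𝒱 ((Fin.cons (∑ j, d (l j) + i - 2) fun j => d (r j) : Fin (m + 1) → ℤ) j + 1)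
      ((Fin.cons (mixedTerm 𝒱 b b' i a (fun j => d (l j)) (X (l a)) fun j => g (l j))
        fun j => g (r j) : Fin (m + 1) → List V → V) j) := by
  refine Fin.cases ?_ (fun j => ?_) j
  · have h := isOperation_mixedTerm b b' a (d := fun j => d (l j)) (g := fun j => g (l j))
      (hX (l a)) fun j _ => hg _
    simp only [Fin.cons_zero]
    convert h using 1
    ring
  · exact hg _

theorem wordLinear_pairTerm (b b' : Bool) (hX : ∀ j, IsOperation 𝒱 (d j) (X j))
    (hg : ∀ j, IsOperation 𝒱 (d j + 1) (g j)) (u v : Fin n) :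
    WordLinear k (pairTerm 𝒱 b b' d X g l r u v) := by
  by_cases h : ∃ a c, l a = u ∧ r c = v
  · obtain ⟨a, c, rfl, rfl⟩ := h
    rw [pairTerm_apply]
    exact (isOperation_mixedTerm b b' c.succ (hX (r c)) fun j _ =>
      isOperation_inner b b' hX hg a j).linear
  · rw [pairTerm_eq_zero b b' fun a c h1 h2 => h ⟨a, c, h1, h2⟩]
    exact wordLinear_zero

theorem wordLinear_commTerm (b b' : Bool) (hX : ∀ j, IsOperation 𝒱 (d j) (X j))
    (hg : ∀ j, IsOperation 𝒱 (d j + 1) (g j)) :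
    WordLinear k (commTerm 𝒱 b b' d X g l r) := by
  refine (isOperation_mixedTerm b b' (0 : Fin (m + 1)) ?_ fun j hj => ?_).linear
  · exact isOperation_algBracket fun j => hX _
  · obtain ⟨j, rfl⟩ := Fin.exists_succ_eq.2 hj
    exact hg _

/-- The argument of the outer bracket taken from `C_A(V)` is either the inner bracket, which then is
a Gerstenhaber bracket, or one of the other arguments. In the latter case the inner bracket also
selects one argument in `C_A(V)`, and the pair of both selections is recorded. -/
theorem mixedSum_cons (b b' : Bool) (hX : ∀ j, IsOperation 𝒱 (d j) (X j))
    (hg : ∀ j, IsOperation 𝒱 (d j + 1) (g j)) :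
    mixedSum 𝒱 b b' (m + 1) (Fin.cons (∑ j, d (l j) + i - 2) fun j => d (r j))
      (Fin.cons (algBracket 𝒱 i (fun j => d (l j)) fun j => X (l j)) fun j => X (r j))
      (Fin.cons (mixedSum 𝒱 b b' i (fun j => d (l j)) (fun j => X (l j)) fun j => g (l j))
        fun j => g (r j)) =
    commTerm 𝒱 b b' d X g l r + ∑ u, ∑ v, pairTerm 𝒱 b b' d X g l r u v := by
  rw [mixedSum, Fin.sum_univ_succ, sum_pairTerm, Finset.sum_comm]
  refine congrArg₂ _ (mixedTerm_congr b b' (0 : Fin (m + 1)) _ _ fun j hj => ?_)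
    (Finset.sum_congr rfl fun c _ => ?_)
  · obtain ⟨j, rfl⟩ := Fin.exists_succ_eq.2 hj
    rfl
  · rw [mixedSum, Fin.cons_succ, mixedTerm_cons_sum b b' c _ (hX _).linear _ _ fun j => (hg _).linear]
    exact Finset.sum_congr rfl fun a _ => (pairTerm_apply b b' a c).symm

theorem ofFn_eq_pair {α β : Fin n} (hαβ : α < β) (hl : StrictMono l)
    (h : Finset.univ.map l = {α, β}) : List.ofFn l = [α, β] := by
  have hi : i = 2 := by
    have := congrArg Finset.card h
    rwa [Finset.card_map, Finset.card_univ, Fintype.card_fin, Finset.card_pair hαβ.ne] at this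
  subst hi
  have h0 : l 0 ∈ ({α, β} : Finset (Fin n)) := by simp [← h]
  have h1 : l 1 ∈ ({α, β} : Finset (Fin n)) := by simp [← h]
  have h2 : l 0 < l 1 := hl (by simp)
  simp only [Finset.mem_insert, Finset.mem_singleton] at h0 h1
  rcases h0 with h0 | h0 <;> rcases h1 with h1 | h1 <;> rw [h0, h1] at h2
  · exact absurd h2 (lt_irrefl _)
  · simp [List.ofFn_succ, h0, ← h1]
  · exact absurd h2 hαβ.not_gt
  · exact absurd h2 (lt_irrefl _)

/-- The contribution of one shuffle to the cancellation. -/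
def shuffleField {M : Type*} [AddCommGroup M] (b b' : Bool) (G : Option (Fin n) → List M → M)
    (α β : Fin n) (X X' : List M → M) (S : Finset (Fin n)) (w : List M) : M :=
  (if S = {α, β} then vectorField b b' G ((({α, β} : Finset (Fin n))ᶜ).map Function.Embedding.some)
    (fun v => ins X X' v - ins X' X v) w else 0) +
  (if α ∈ S ∧ β ∉ S then pairField b b' G α β X X' S w else 0) -
  if β ∈ S ∧ α ∉ S then pairField b b' G β α X' X S w else 0

theorem sum_shuffleField {M : Type*} [AddCommGroup M] [Module k M] (b b' : Bool)
    {G : Option (Fin n) → List M → M} (hG : ∀ j, WordLinear k (G j)) {α β : Fin n} (hαβ : α ≠ β)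
    {X X' : List M → M} (hX : WordLinear k X) (hX' : WordLinear k X') (w : List M) :
    ∑ S, shuffleField b b' G α β X X' S w = 0 := by
  simp only [shuffleField]
  rw [Finset.sum_sub_distrib, Finset.sum_add_distrib, Finset.sum_eq_single {α, β}, if_pos rfl,
    vectorField_commutator_eq_sum hαβ b b' hG hX hX', Finset.sum_filter, Finset.sum_filter]
  · abel
  · exact fun S _ h => if_neg h
  · simp

theorem Represents.add {J : Type*} [LinearOrder J] {p : J → ℤ}
    {F G : List (Multiset J →₀ V) → (Multiset J →₀ V)} {t : SignedMonomial p}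
    {f g : List V → V} (hF : Represents 𝒱 F t f) (hG : Represents 𝒱 G t g) :
    Represents 𝒱 (fun w => F w + G w) t (f + g) := fun L hL hN => by
  dsimp only
  rw [hF L hL hN, hG L hL hN, Pi.add_apply, SignedMonomial.tmul_add]

theorem represents_zero {J : Type*} [LinearOrder J] {p : J → ℤ} (t : SignedMonomial p) :
    Represents 𝒱 (fun _ => 0) t 0 := fun _ _ _ => (SignedMonomial.tmul_zero _).symm

/-- For a given shuffle at most one of the three terms is present: both of `α`, `β` are the inner
arguments, or exactly one of them is inside. -/
theorem represents_shuffleField (b b' : Bool) (σ : Equiv.Perm (Fin n))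
    (hσ : List.ofFn σ = List.ofFn l ++ List.ofFn r) {S : Finset (Fin n)}
    (hl : Finset.univ.map l = S) (hr : Finset.univ.map r = Sᶜ) (hmono : StrictMono l)
    {α β : Fin n} (hαβ : α < β) (hX : ∀ j, IsOperation 𝒱 (d j) (X j))
    (hg : ∀ j, IsOperation 𝒱 (d j + 1) (g j))
    {p : ℕ → ℤ} (hp : ∀ i : Fin n, p i = symbolDegree d α β i)
    {G : Option (Fin n) → List (Multiset ℕ →₀ V) → (Multiset ℕ →₀ V)}
    (hG : ∀ j : Fin n, G (some j) = liftOp p (g j) {(j : ℕ)}) (hG0 : WordLinear k (G none)) :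
    Represents 𝒱 (shuffleField b b' G α β (liftOp p (X α) {(α : ℕ)}) (liftOp p (X β) {(β : ℕ)}) S)
      (List.ofFn fun j : Fin n => symbol p j).prod
      ((pairSum (jacobiExponent d α β) (List.ofFn id)).negOnePow •
        (chiSign σ d * ((i : ℤ) * m).negOnePow) •
        ((if List.ofFn l = [α, β] then commTerm 𝒱 b b' d X g l r else 0) +
          pairTerm 𝒱 b b' d X g l r α β + pairTerm 𝒱 b b' d X g l r β α)) := by
  have hmem : ∀ u, u ∈ S ↔ ∃ a, l a = u := fun u => by simp [← hl]
  have hmem' : ∀ u, u ∉ S ↔ ∃ c, r c = u := fun u => by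
    rw [← Finset.mem_compl, ← hr]; simp
  -- The term with `β` inside is represented with the opposite sign, by the factor `-1` of
  -- `represents_pairField`; this turns the sum into a commutator.
  rw [smul_add, smul_add, smul_add, smul_add, ← sub_neg_eq_add _ (_ • _ • pairTerm _ _ _ _ _ _ _ _ β α)]
  refine Represents.sub (Represents.add ?_ ?_) ?_
  · by_cases h : S = {α, β}
    · have hlist := ofFn_eq_pair hαβ hmono (hl.trans h)
      have hi : i = 2 := by simpa using congrArg List.length hlist
      subst hi
      rw [if_pos hlist]
      simp only [h, if_true]
      have hl0 : l 0 = α := by simpa [List.ofFn_succ] using (List.cons.inj hlist).1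
      have hl1 : l 1 = β := by
        simpa [List.ofFn_succ] using (List.cons.inj (List.cons.inj hlist).2).1
      have R := represents_commutator b b' σ (by rw [hσ, hlist]) (S := Sᶜ) hr hαβ.ne
        (g' := Fin.cons 0 fun j => g (r j)) (fun j => rfl) (hX α) (hX β) hg hp hG hG0
      rw [h] at R
      convert R using 1
      rw [smul_smul, Int.negOnePow_even ((2 : ℕ) * (m : ℤ)) ⟨m, by push_cast; ring⟩, mul_one,
        commTerm]
      have e : ∑ j, d (l j) + (2 : ℕ) - 2 = d α + d β := by
        rw [Fin.sum_univ_two, hl0, hl1]; push_cast; ring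
      rw [e]
      simp only [algBracket, hl0, hl1]
    · have hlist : List.ofFn l ≠ [α, β] := fun e => h <| by
        ext u
        rw [hmem, ← List.mem_ofFn, e]
        simp
      rw [if_neg hlist, smul_zero, smul_zero]
      simp only [h, if_false]
      exact represents_zero _
  · by_cases h : α ∈ S ∧ β ∉ S
    · obtain ⟨⟨a, ha⟩, c, hc⟩ := And.imp (hmem α).1 (hmem' β).1 h
      simp only [h, not_false_eq_true, and_self, if_true]
      have R := represents_pairField b b' σ hσ hl hr hαβ.ne (Or.inl ⟨rfl, rfl⟩) (hX α) (hX β) hg ha hc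
        hp hG hG0
      rw [if_pos rfl, mul_one, ← smul_smul] at R
      have e := pairTerm_apply (𝒱 := 𝒱) (d := d) (X := X) (g := g) (l := l) (r := r) b b' a c
      rw [ha, hc] at e
      rw [e]
      exact R
    · simp only [h, if_false]
      rw [pairTerm_eq_zero b b' fun a c ha hc => h ⟨(hmem α).2 ⟨a, ha⟩, (hmem' β).2 ⟨c, hc⟩⟩,
        smul_zero, smul_zero]
      exact represents_zero _
  · by_cases h : β ∈ S ∧ α ∉ S
    · obtain ⟨⟨a, ha⟩, c, hc⟩ := And.imp (hmem β).1 (hmem' α).1 h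
      simp only [h, not_false_eq_true, and_self, if_true]
      have R := represents_pairField b b' σ hσ hl hr hαβ.ne (Or.inr ⟨rfl, rfl⟩) (hX β) (hX α) hg ha hc
        hp hG hG0
      rw [if_neg hαβ.ne', mul_neg_one, neg_mul, Units.neg_smul, ← smul_smul] at R
      have e := pairTerm_apply (𝒱 := 𝒱) (d := d) (X := X) (g := g) (l := l) (r := r) b b' a c
      rw [ha, hc] at e
      rw [e]
      exact R
    · simp only [h, if_false]
      rw [pairTerm_eq_zero b b' fun a c ha hc => h ⟨(hmem β).2 ⟨a, ha⟩, (hmem' α).2 ⟨c, hc⟩⟩,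
        smul_zero, smul_zero, neg_zero]
      exact represents_zero _

open Classical in
/-- The contributions to the Jacobi identity of two of the arguments cancel. -/
theorem sum_pairTerm_eq_zero (b b' : Bool) {α β : Fin n} (hαβ : α < β)
    (hX : ∀ j, IsOperation 𝒱 (d j) (X j)) (hg : ∀ j, IsOperation 𝒱 (d j + 1) (g j)) :
    ∑ i ∈ Finset.univ.filter (fun i : Fin (n + 1) => 1 ≤ (i : ℕ)),
      ∑ σ : Equiv.Perm (Fin n) with IsShuffle i σ,
        (chiSign σ d * ((i : ℤ) * ((n : ℤ) - i)).negOnePow) •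
        ((if List.ofFn (shuffleLeft i.is_le σ) = [α, β] then
          commTerm 𝒱 b b' d X g (shuffleLeft i.is_le σ) (shuffleRight i.is_le σ) else 0) +
          pairTerm 𝒱 b b' d X g (shuffleLeft i.is_le σ) (shuffleRight i.is_le σ) α β +
          pairTerm 𝒱 b b' d X g (shuffleLeft i.is_le σ) (shuffleRight i.is_le σ) β α) = 0 := by
  refine WordLinear.eq_zero_of_letters (𝒱 := 𝒱) ?_
    (fun i => if hi : i < n then symbolDegree d α β ⟨i, hi⟩ else 0) n fun p hp L hL hN => ?_
  · refine WordLinear.sum _ fun i _ => WordLinear.sum _ fun σ _ => WordLinear.units_smul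
      (WordLinear.add (WordLinear.add ?_ (wordLinear_pairTerm b b' hX hg α β))
        (wordLinear_pairTerm b b' hX hg β α)) _
    split_ifs
    · exact wordLinear_commTerm b b' hX hg
    · exact wordLinear_zero
  · have hp' : ∀ i : Fin n, p i = symbolDegree d α β i := fun i => by
      rw [hp i i.is_lt, dif_pos i.is_lt]
    -- The value at `none` is arbitrary: `pairField` overwrites it and the outer field of the
    -- commutator term does not use it.
    let G : Option (Fin n) → List (Multiset ℕ →₀ V) → (Multiset ℕ →₀ V) := fun o =>
      o.elim (fun _ => 0) fun j => liftOp p (g j) {(j : ℕ)}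
    have hGlin : ∀ j, WordLinear k (G j) := by
      rintro (_ | j)
      · exact wordLinear_zero
      · exact wordLinear_liftOp p (hg j).linear _
    have R := Represents.sum (Finset.univ.filter (fun i : Fin (n + 1) => 1 ≤ (i : ℕ))) fun i _ =>
      Represents.sum (Finset.univ.filter (fun σ : Equiv.Perm (Fin n) => IsShuffle i σ)) fun σ hσ =>
        represents_shuffleField b b' σ (ofFn_shuffle i.is_le σ) rfl (map_shuffleRight i.is_le σ)
          ((isShuffle_iff i.is_le σ).1 (Finset.mem_filter.1 hσ).2).1 hαβ hX hg hp' (G := G)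
          (fun j => rfl) (hGlin none)
    have h := R L hL hN
    dsimp only at h
    -- The represented fields depend on a shuffle only through its subset, and their sum over all
    -- subsets vanishes.
    rw [sum_isShuffle (fun S => shuffleField b b' G α β (liftOp p (X α) {(α : ℕ)})
      (liftOp p (X β) {(β : ℕ)}) S _), sum_shuffleField b b' hGlin hαβ.ne
      (wordLinear_liftOp p (hX α).linear _) (wordLinear_liftOp p (hX β).linear _)] at h
    · simp only [← Finset.smul_sum] at h
      rw [Pi.smul_apply, SignedMonomial.tmul_smul, eq_comm, smul_eq_zero_iff_eq] at h
      convert h using 7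
      rw [Nat.cast_sub (Fin.is_le _)]
    · have h0 : (∅ : Finset (Fin n)) ≠ {α, β} := (Finset.insert_nonempty _ _).ne_empty.symm
      simp [shuffleField, h0]

/-- An inner bracket in `C_A(V)` vanishes unless it has exactly two arguments; hence it is
attributed to exactly one pair. -/
theorem sum_commTerm (b b' : Bool) (hl : StrictMono l) (hg : ∀ j, IsOperation 𝒱 (d j + 1) (g j)) :
    ∑ x : Fin n × Fin n with x.1 < x.2,
      (if List.ofFn l = [x.1, x.2] then commTerm 𝒱 b b' d X g l r else 0) =
    commTerm 𝒱 b b' d X g l r := by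
  by_cases hi : i = 2
  · subst hi
    have e : ∀ x : Fin n × Fin n, List.ofFn l = [x.1, x.2] ↔ x = (l 0, l 1) := by
      rintro ⟨u, v⟩
      simp [List.ofFn_succ, eq_comm]
    simp only [e]
    rw [Finset.sum_ite_eq', if_pos]
    simpa using hl (by simp : (0 : Fin 2) < 1)
  · have h0 : commTerm 𝒱 b b' d X g l r = 0 := by
      funext w
      rw [commTerm, algBracket_of_ne hi]
      exact (isLinearMap_mixedTerm_left (Z := List V → V) (H := fun h => h) b b' 0 _
        (fun w => ⟨fun _ _ => rfl, fun _ _ => rfl⟩) (fun j hj => by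
          obtain ⟨j, rfl⟩ := Fin.exists_succ_eq.2 hj
          exact (hg (r j)).linear) w).map_zero
    simp [h0]

-- Expanding both brackets, the terms are grouped by the unordered pair of arguments selected in
-- `C_A(V)`. Each group vanishes by `sum_pairTerm_eq_zero`.
open Classical in
theorem jacobi_mixedSum (b b' : Bool) (n : ℕ) {d : Fin n → ℤ} {X g : Fin n → List V → V}
    (hX : ∀ j, IsOperation 𝒱 (d j) (X j)) (hg : ∀ j, IsOperation 𝒱 (d j + 1) (g j)) :
    ∑ i ∈ Finset.univ.filter (fun i : Fin (n + 1) => 1 ≤ (i : ℕ)),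
      ∑ σ : Equiv.Perm (Fin n) with IsShuffle i σ,
        (chiSign σ d * ((i : ℤ) * ((n : ℤ) - i)).negOnePow) •
        mixedSum 𝒱 b b' (n - i + 1)
          (Fin.cons (∑ j, d (shuffleLeft i.is_le σ j) + i - 2)
            fun j => d (shuffleRight i.is_le σ j))
          (Fin.cons (algBracket 𝒱 i (fun j => d (shuffleLeft i.is_le σ j))
            fun j => X (shuffleLeft i.is_le σ j)) fun j => X (shuffleRight i.is_le σ j))
          (Fin.cons (mixedSum 𝒱 b b' i (fun j => d (shuffleLeft i.is_le σ j))
            (fun j => X (shuffleLeft i.is_le σ j)) fun j => g (shuffleLeft i.is_le σ j))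
            fun j => g (shuffleRight i.is_le σ j)) = 0 := by
  have h : ∀ i ∈ Finset.univ.filter (fun i : Fin (n + 1) => 1 ≤ (i : ℕ)),
      ∀ σ ∈ Finset.univ.filter (fun σ : Equiv.Perm (Fin n) => IsShuffle i σ), _ = _ :=
    fun i _ σ hσ => congrArg ((chiSign σ d * ((i : ℤ) * ((n : ℤ) - i)).negOnePow) • ·)
      ((mixedSum_cons (l := shuffleLeft i.is_le σ) (r := shuffleRight i.is_le σ) b b' hX hg).trans
      (congrArg₂ (· + ·)
        (sum_commTerm b b' ((isShuffle_iff i.is_le σ).1 (Finset.mem_filter.1 hσ).2).1 hg).symm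
        -- The same argument cannot be selected twice, since the two blocks of a shuffle are
        -- disjoint.
        (sum_sum_eq_sum_lt _ fun u => pairTerm_eq_zero b b' fun a c h1 h2 => by
          have h3 : shuffleRight i.is_le σ c ∈ Finset.univ.map (shuffleRight i.is_le σ) := by simp
          rw [map_shuffleRight, h2, ← h1] at h3
          simp at h3)))
  simp only [← Finset.sum_add_distrib, Finset.smul_sum] at h
  rw [Finset.sum_congr rfl fun i hi => Finset.sum_congr rfl (h i hi),
    Finset.sum_congr rfl fun i _ => Finset.sum_comm, Finset.sum_comm]
  refine Finset.sum_eq_zero fun x hx => ?_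
  refine Eq.trans ?_ (sum_pairTerm_eq_zero b b' (Finset.mem_filter.1 hx).2 hX hg)
  simp only [add_assoc]

end

end Jacobi

/-! ### The Jacobi identity for the Gerstenhaber bracket -/

section

variable {k M : Type*} [CommRing k] [AddCommGroup M] [Module k M]

/-- The commutator of the insertion. -/
def commutatorOp (f g : List M → M) (w : List M) : M := ins f g w - ins g f w

/-- The commutator of a pre-Lie product satisfies the Jacobi identity: after expansion, three
instances of `ins_assoc_symm` cancel all the terms. -/
theorem commutatorOp_jacobi {f g h : List M → M} (hf : WordLinear k f) (hg : WordLinear k g)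
    (hh : WordLinear k h) (w : List M) :
    commutatorOp (commutatorOp f g) h w - commutatorOp (commutatorOp f h) g w + commutatorOp (commutatorOp g h) f w = 0 := by
  have e : ∀ {f g h : List M → M}, WordLinear k h → commutatorOp (commutatorOp f g) h w =
      ins (ins f g) h w - ins (ins g f) h w - (ins h (ins f g) w - ins h (ins g f) w) := by
    intro f g h hh
    rw [commutatorOp]
    exact congrArg₂ _ (ins_sub_left _ _ _ _) (ins_sub_right hh _ _ _)
  rw [e hf, e hg, e hh]
  have h1 := ins_assoc_symm hf g h w
  have h2 := ins_assoc_symm hg f h w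
  have h3 := ins_assoc_symm hh f g w
  rw [sub_eq_iff_eq_add] at h1 h2 h3
  rw [h1, h2, h3]
  abel

end

section

variable {k V : Type*} [Field k] [AddCommGroup V] [Module k V] {𝒱 : ℤ → Submodule k V}
  [DirectSum.Decomposition 𝒱]

theorem insertion_zero_left (e : ℤ) (g : List V → V) : insertion 𝒱 0 e g = 0 := by
  funext w; simp [insertion]

theorem insertion_zero_right {f : List V → V} (hf : WordLinear k f) (e : ℤ) :
    insertion 𝒱 f e 0 = 0 := by
  funext w
  simp only [insertion, Pi.zero_apply]
  exact Finset.sum_eq_zero fun i _ => Finset.sum_eq_zero fun j _ => hf.map_zero _ _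

theorem gerstenhaber_zero_left {g : List V → V} (hg : WordLinear k g) (d e : ℤ) :
    gerstenhaber 𝒱 d 0 e g = 0 := by
  rw [gerstenhaber, insertion_zero_left, insertion_zero_right hg, smul_zero, sub_zero]

theorem gerstenhaber_zero_right {g : List V → V} (hg : WordLinear k g) (d e : ℤ) :
    gerstenhaber 𝒱 d g e 0 = 0 := by
  rw [gerstenhaber, insertion_zero_left, insertion_zero_right hg, smul_zero, sub_zero]

theorem gerstenhaber_symm (d e : ℤ) (f g : List V → V) :
    gerstenhaber 𝒱 e g d f = -(d * e).negOnePow • gerstenhaber 𝒱 d f e g := by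
  rw [gerstenhaber, gerstenhaber, smul_sub, smul_smul, neg_mul, mul_comm e d, Int.units_mul_self,
    Units.neg_smul, Units.neg_smul, one_smul]
  abel

theorem Represents.smul_both {J : Type*} [LinearOrder J] {p : J → ℤ}
    {F : List (Multiset J →₀ V) → (Multiset J →₀ V)} {t : SignedMonomial p}
    {f : List V → V} (hF : Represents 𝒱 F t f) (u : ℤˣ) :
    Represents 𝒱 (fun w => u • F w) t (u • f) := fun L hL hN => by
  dsimp only
  rw [hF L hL hN, Pi.smul_apply, SignedMonomial.tmul_smul]

theorem isShuffle_three (σ : Equiv.Perm (Fin 3)) :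
    IsShuffle 2 σ ↔ σ = 1 ∨ σ = Equiv.swap 1 2 ∨ σ = finRotate 3 := by
  unfold IsShuffle
  revert σ
  decide

-- Here the symbols have the degrees of the arguments themselves. Their rearrangement accounts for
-- the Koszul factor of `χ`, and `sgn(σ)` supplies the signs of the three terms in
-- `commutatorOp_jacobi`.
open Classical in
theorem gerstenhaber_jacobi {d : Fin 3 → ℤ} {X : Fin 3 → List V → V}
    (hX : ∀ j, IsOperation 𝒱 (d j) (X j)) :
    ∑ σ : Equiv.Perm (Fin 3) with IsShuffle 2 σ, chiSign σ d •
      gerstenhaber 𝒱 (d (σ 0) + d (σ 1)) (gerstenhaber 𝒱 (d (σ 0)) (X (σ 0)) (d (σ 1)) (X (σ 1)))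
        (d (σ 2)) (X (σ 2)) = 0 := by
  refine WordLinear.eq_zero_of_letters (𝒱 := 𝒱) (WordLinear.sum _ fun σ _ =>
      (((hX _).gerstenhaber (hX _)).gerstenhaber (hX _)).linear.units_smul _)
    (fun i => if hi : i < 3 then d ⟨i, hi⟩ else 0) 3 fun p hp L hL hN => ?_
  have hp' : ∀ i : Fin 3, p i = d i := fun i => by rw [hp i i.is_lt, dif_pos i.is_lt]
  have hlin := fun j : Fin 3 => wordLinear_liftOp p (hX j).linear {(j : ℕ)}
  have r := fun j : Fin 3 => represents_symbol (𝒱 := 𝒱) (hX j).linear p j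
  have R := Represents.sum (Finset.univ.filter fun σ : Equiv.Perm (Fin 3) => IsShuffle 2 σ)
    fun σ _ => ((represents_gerstenhaber (represents_gerstenhaber (r (σ 0)) (r (σ 1))
      ((symbol_deg _ _).trans (hp' _)) ((symbol_deg _ _).trans (hp' _)) (hX _) (hX _)) (r (σ 2))
      (by rw [SignedMonomial.deg_mul, symbol_deg, symbol_deg, hp', hp'])
      ((symbol_deg _ _).trans (hp' _)) ((hX _).gerstenhaber (hX _)) (hX _)).of_smul
      (t := (List.ofFn fun j : Fin 3 => symbol p j).prod) (u := koszulSign σ d) (fun hN => by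
        have h := SignedMonomial.prod_perm (fun j : Fin 3 => symbol p j) σ hN
        simp only [symbol_deg, hp'] at h
        rw [← h]
        simp [List.ofFn_succ, mul_assoc]) (by
        have h : (symbol p (σ 0) * symbol p (σ 1) * symbol p (σ 2)).supp =
            ∑ j, (symbol p (σ j)).supp := by
          simp [Fin.sum_univ_three, SignedMonomial.supp_mul]
        rw [h, SignedMonomial.supp_prod, List.map_ofFn, List.sum_ofFn]
        exact Equiv.sum_comp σ fun j => (symbol p j).supp)).smul_both (Equiv.Perm.sign σ)
  have h := R L hL hN
  dsimp only at h
  simp only [smul_smul] at h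
  refine h.symm.trans ?_
  have hset : (Finset.univ.filter fun σ : Equiv.Perm (Fin 3) => IsShuffle 2 σ) =
      {1, Equiv.swap 1 2, finRotate 3} := by
    ext σ
    simp [isShuffle_three]
  rw [hset, Finset.sum_insert (by decide), Finset.sum_insert (by decide), Finset.sum_singleton]
  have e := commutatorOp_jacobi (hlin 0) (hlin 1) (hlin 2) (L.map fun x => x.1.tmul x.2)
  rw [sub_eq_add_neg, add_assoc] at e
  rw [← e]
  have s2 : Equiv.Perm.sign (finRotate 3) = 1 := by decide
  rw [map_one, Equiv.Perm.sign_swap (by decide), s2, one_smul, one_smul, Units.neg_smul, one_smul]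
  rfl

theorem algBracket_cons_zero {m : ℕ} (d : Fin (m + 1) → ℤ) {X : Fin m → List V → V}
    (hX : ∀ j, WordLinear k (X j)) : algBracket 𝒱 (m + 1) d (Fin.cons 0 X) = 0 := by
  by_cases h : m = 1
  · subst h
    exact gerstenhaber_zero_left (hX 0) _ _
  · exact algBracket_of_ne (by omega) _ _

-- A nonzero contribution needs two arguments in both the inner and the outer bracket, that is, `n =
-- 3` and `i = 2`.
open Classical in
theorem jacobi_algBracket (n : ℕ) {d : Fin n → ℤ} {X : Fin n → List V → V}
    (hX : ∀ j, IsOperation 𝒱 (d j) (X j)) :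
    ∑ i ∈ Finset.univ.filter (fun i : Fin (n + 1) => 1 ≤ (i : ℕ)),
      ∑ σ : Equiv.Perm (Fin n) with IsShuffle i σ,
        (chiSign σ d * ((i : ℤ) * ((n : ℤ) - i)).negOnePow) •
        algBracket 𝒱 (n - i + 1)
          (Fin.cons (∑ j, d (shuffleLeft i.is_le σ j) + i - 2)
            fun j => d (shuffleRight i.is_le σ j))
          (Fin.cons (algBracket 𝒱 i (fun j => d (shuffleLeft i.is_le σ j))
            fun j => X (shuffleLeft i.is_le σ j)) fun j => X (shuffleRight i.is_le σ j)) = 0 := by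
  have h0 : ∀ (i : Fin (n + 1)) (σ : Equiv.Perm (Fin n)), ((i : ℕ) ≠ 2 ∨ n ≠ 3) →
      algBracket 𝒱 (n - i + 1)
          (Fin.cons (∑ j, d (shuffleLeft i.is_le σ j) + i - 2)
            fun j => d (shuffleRight i.is_le σ j))
          (Fin.cons (algBracket 𝒱 i (fun j => d (shuffleLeft i.is_le σ j))
            fun j => X (shuffleLeft i.is_le σ j)) fun j => X (shuffleRight i.is_le σ j)) = 0 := by
    intro i σ h
    by_cases hi : (i : ℕ) = 2
    · exact algBracket_of_ne (by omega) _ _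
    · rw [algBracket_of_ne hi]
      exact algBracket_cons_zero _ fun j => (hX _).linear
  by_cases hn : n = 3
  · subst hn
    rw [Finset.sum_eq_single (2 : Fin 4)]
    · refine Eq.trans (Finset.sum_congr rfl fun σ _ => ?_) (gerstenhaber_jacobi hX)
      have e1 : (((2 : Fin 4) : ℕ) : ℤ) * (((3 : ℕ) : ℤ) - ((2 : Fin 4) : ℕ)) = 2 := by
        norm_num
      have e2 : ∑ j, d (shuffleLeft (Fin.is_le (2 : Fin 4)) σ j) + ((2 : Fin 4) : ℕ) - 2 =
          d (σ 0) + d (σ 1) := by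
        change ∑ j : Fin 2, d (shuffleLeft (Fin.is_le (2 : Fin 4)) σ j) + ((2 : ℕ) : ℤ) - 2 = _
        rw [Fin.sum_univ_two]
        push_cast
        rw [add_sub_cancel_right]
        rfl
      rw [e1, e2, Int.negOnePow_even 2 ⟨1, rfl⟩, mul_one]
      rfl
    · intro i _ hi
      refine Finset.sum_eq_zero fun σ _ => ?_
      rw [h0 i σ (Or.inl fun h => hi (Fin.ext h)), smul_zero]
    · intro h
      exact absurd (Finset.mem_filter.2 ⟨Finset.mem_univ _, by decide⟩) h
  · exact Finset.sum_eq_zero fun i _ => Finset.sum_eq_zero fun σ _ => by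
      rw [h0 i σ (Or.inr hn), smul_zero]

end

/-! ### Cochains as operations on words -/

section Cochains

variable {k V : Type*} [Field k] [AddCommGroup V] [Module k V] {𝒱 : ℤ → Submodule k V}

theorem ofFn_update {α : Type*} {n : ℕ} (w : Fin n → α) (i : Fin n) (x : α) :
    List.ofFn (Function.update w i x) =
      (List.ofFn w).take i ++ x :: (List.ofFn w).drop (i + 1) := by
  rw [ofFn_eq_map_append (x := w) (q := i) (f := id) (g := id)
    (fun j hj => Function.update_of_ne hj.ne _ _) (fun j hj => Function.update_of_ne hj.ne' _ _)]
  simp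

theorem wordLinear_iff {f : List V → V} : WordLinear k f ↔
    ∀ n : ℕ, ∃ φ : MultilinearMap k (fun _ : Fin n => V) V, ∀ w, f (List.ofFn w) = φ w := by
  constructor
  · refine fun hf n => ⟨⟨fun w => f (List.ofFn w), fun {inst} w i x y => ?_, fun {inst} w i c x => ?_⟩,
      fun w => rfl⟩
    · rw [Subsingleton.elim inst (instDecidableEqFin n)]
      simp only [ofFn_update, (hf _ _).map_add]
    · rw [Subsingleton.elim inst (instDecidableEqFin n)]
      simp only [ofFn_update, (hf _ _).map_smul]
  · intro h u v
    obtain ⟨φ, hφ⟩ := h (u ++ 0 :: v).length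
    let i : Fin (u ++ 0 :: v).length := ⟨u.length, by simp⟩
    have e : ∀ x, u ++ x :: v = List.ofFn (Function.update (u ++ 0 :: v).get i x) := fun x => by
      rw [ofFn_update, List.ofFn_get]
      simp [i, List.drop_append]
    have e' : (fun x => f (u ++ x :: v)) = fun x => φ (Function.update (u ++ 0 :: v).get i x) :=
      funext fun x => by rw [e, hφ]
    rw [e']
    exact ⟨φ.map_update_add _ i, φ.map_update_smul _ i⟩

theorem mem_gradedHom_suspension_iff {S : Set ℕ} {d : ℤ} {f : List V → V} :
    f ∈ gradedHom (suspension 𝒱) (suspension 𝒱) S d ↔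
      IsOperation 𝒱 d f ∧ ∀ w : List V, w.length ∉ S → f w = 0 := by
  constructor
  · rintro ⟨h1, h2, h3⟩
    refine ⟨⟨wordLinear_iff.2 h1, fun L hL => ?_⟩, h2⟩
    have h := h3 L.length (fun i => L[i].2) (fun i => L[i].1) fun i => hL _ (List.getElem_mem _)
    have e1 : L.map Prod.fst = List.ofFn fun i : Fin L.length => L[i].1 :=
      List.ext_getElem (by simp) fun i h1 h2 => by simp
    have e2 : L.map Prod.snd = List.ofFn fun i : Fin L.length => L[i].2 :=
      List.ext_getElem (by simp) fun i h1 h2 => by simp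
    rw [e1, e2, List.sum_ofFn, add_comm]
    exact h
  · rintro ⟨h1, h2⟩
    refine ⟨wordLinear_iff.1 h1.linear, h2, fun n w e h => ?_⟩
    have h3 := h1.mem (List.ofFn fun i => (e i, w i)) (by
      simp only [List.mem_ofFn, forall_exists_index]
      rintro x i rfl
      exact h i)
    rw [List.map_ofFn, List.map_ofFn, List.sum_ofFn, add_comm] at h3
    exact h3

/-- Values in `V` of degree `d` are values in `sV` of degree `d + 1`. Thus the cochains of all five
summands can be treated as operations with values in `sV`. -/
theorem gradedHom_eq (S : Set ℕ) (d : ℤ) :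
    gradedHom (suspension 𝒱) 𝒱 S d = gradedHom (suspension 𝒱) (suspension 𝒱) S (d + 1) := by
  have e : ∀ a : ℤ, suspension 𝒱 (a + (d + 1)) = 𝒱 (a + d) := fun a => by
    rw [suspension]; congr 1; ring
  ext f
  change _ ∧ _ ∧ _ ↔ _ ∧ _ ∧ _
  simp only [e]

theorem mem_gradedHom_iff {S : Set ℕ} {d : ℤ} {f : List V → V} :
    f ∈ gradedHom (suspension 𝒱) 𝒱 S d ↔
      IsOperation 𝒱 (d + 1) f ∧ ∀ w : List V, w.length ∉ S → f w = 0 := by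
  rw [gradedHom_eq, mem_gradedHom_suspension_iff]

theorem mem_AvA_iff {d : ℤ} {x : Summand → List V → V} :
    x ∈ AvA 𝒱 d ↔ IsOperation 𝒱 d (x .alg) ∧ ∀ P, P ≠ .alg →
      IsOperation 𝒱 (d + 1) (x P) ∧ ∀ w : List V, w.length ∉ P.arities → x P w = 0 := by
  rw [AvA, Submodule.mem_pi]
  constructor
  · refine fun h => ⟨(mem_gradedHom_suspension_iff.1 (h .alg trivial)).1, fun P hP => ?_⟩
    have := h P trivial
    cases P
    · exact absurd rfl hP
    all_goals exact mem_gradedHom_iff.1 this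
  · rintro ⟨h1, h2⟩ P -
    cases P
    · exact mem_gradedHom_suspension_iff.2 ⟨h1, fun w hw => absurd trivial hw⟩
    all_goals exact mem_gradedHom_iff.2 (h2 _ (by simp))

open Classical in
/-- The part of an operation on the words with length in `A`. -/
def arityPart (A : Set ℕ) (f : List V → V) (w : List V) : V := if w.length ∈ A then f w else 0

theorem arityPart_of_mem {A : Set ℕ} (f : List V → V) {w : List V} (h : w.length ∈ A) :
    arityPart A f w = f w := if_pos h

theorem arityPart_of_notMem {A : Set ℕ} (f : List V → V) {w : List V} (h : w.length ∉ A) :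
    arityPart A f w = 0 := if_neg h

theorem IsOperation.arityPart {e : ℤ} {f : List V → V} (hf : IsOperation 𝒱 e f) (A : Set ℕ) :
    IsOperation 𝒱 e (arityPart A f) where
  linear u v := by
    by_cases h : u.length + (v.length + 1) ∈ A
    · have e : ∀ x, _root_.arityPart A f (u ++ x :: v) = f (u ++ x :: v) := fun x =>
        arityPart_of_mem f (by simpa using h)
      simp only [e]
      exact hf.linear u v
    · have e : ∀ x, _root_.arityPart A f (u ++ x :: v) = 0 := fun x =>
        arityPart_of_notMem f (by simpa using h)
      simp only [e]
      exact isLinearMap_zero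
  mem L hL := by
    rw [_root_.arityPart]
    split_ifs
    · exact hf.mem L hL
    · exact Submodule.zero_mem _

/-- The summand of the right brackets, for `true`, or of the left brackets. -/
def sideSummand (s : Bool) : Summand := if s then .right else .left

/-- The component of an element of `C_AvA(V)` in `C_r`, for `true`, or in `C_l`. -/
def sidePart (s : Bool) (x : Summand → List V → V) : List V → V :=
  x .const + x .lin + x (sideSummand s)

/-- The side of the brackets with values in a summand. -/
def Summand.side : Summand → Bool
  | .left => false
  | _ => true

section

variable {d : ℤ} {x : Summand → List V → V} (hx : x ∈ AvA 𝒱 d)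
include hx

theorem isOperation_alg_of_mem : IsOperation 𝒱 d (x .alg) := (mem_AvA_iff.1 hx).1

theorem isOperation_of_mem {P : Summand} (hP : P ≠ .alg) : IsOperation 𝒱 (d + 1) (x P) :=
  ((mem_AvA_iff.1 hx).2 P hP).1

theorem isOperation_sidePart (s : Bool) : IsOperation 𝒱 (d + 1) (sidePart s x) :=
  ((isOperation_of_mem hx (by simp)).add (isOperation_of_mem hx (by simp))).add
    (isOperation_of_mem hx (by cases s <;> simp [sideSummand]))

theorem wordLinear_of_mem (P : Summand) : WordLinear k (x P) := by
  by_cases hP : P = .alg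
  · rw [hP]; exact (isOperation_alg_of_mem hx).linear
  · exact (isOperation_of_mem hx hP).linear

end

theorem wordLinear_sidePart {x : Summand → List V → V} (hx : ∀ P, WordLinear k (x P)) (s : Bool) :
    WordLinear k (sidePart s x) := ((hx _).add (hx _)).add (hx _)

variable (𝒱) [DirectSum.Decomposition 𝒱]

/-- The operation `lₙ` on homogeneous elements of `C_AvA(V)`. -/
def totalBracket (n : ℕ) (d : Fin n → ℤ) (x : Fin n → Summand → List V → V) :
    Summand → List V → V
  | .alg => algBracket 𝒱 n d fun i => x i .alg
  | P => arityPart P.arities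
      (mixedSum 𝒱 P.side (!P.side) n d (fun i => x i .alg) fun i => sidePart P.side (x i))

variable {𝒱}

theorem totalBracket_alg {n : ℕ} (d : Fin n → ℤ) (x : Fin n → Summand → List V → V) :
    totalBracket 𝒱 n d x .alg = algBracket 𝒱 n d fun i => x i .alg := rfl

theorem totalBracket_of_ne {n : ℕ} (d : Fin n → ℤ) (x : Fin n → Summand → List V → V)
    {P : Summand} (hP : P ≠ .alg) : totalBracket 𝒱 n d x P = arityPart P.arities
      (mixedSum 𝒱 P.side (!P.side) n d (fun i => x i .alg) fun i => sidePart P.side (x i)) := by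
  cases P
  · exact absurd rfl hP
  all_goals rfl

theorem totalBracket_mem {n : ℕ} {d : Fin n → ℤ} {x : Fin n → Summand → List V → V}
    (hx : ∀ i, x i ∈ AvA 𝒱 (d i)) : totalBracket 𝒱 n d x ∈ AvA 𝒱 (∑ i, d i + n - 2) := by
  rw [mem_AvA_iff]
  refine ⟨isOperation_algBracket fun i => isOperation_alg_of_mem (hx i), fun P hP => ⟨?_, fun w hw => ?_⟩⟩
  · rw [totalBracket_of_ne d x hP]
    have h := (isOperation_mixedSum P.side (!P.side) (fun i => isOperation_alg_of_mem (hx i))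
      fun i => isOperation_sidePart (hx i) P.side).arityPart P.arities
    convert h using 1
    ring
  · rw [totalBracket_of_ne d x hP]
    exact arityPart_of_notMem _ hw

section Linearity

variable {Z : Type*} [AddCommGroup Z] [Module k Z]

theorem isLinearMap_gerstenhaber_left {F : Z → List V → V} (hF : ∀ w, IsLinearMap k fun z => F z w)
    {g : List V → V} (hg : WordLinear k g) (d e : ℤ) (w : List V) :
    IsLinearMap k fun z => gerstenhaber 𝒱 d (F z) e g w :=
  isLinearMap_sub (isLinearMap_insertion_left hF _ _ _)
    (isLinearMap_units_smul (isLinearMap_insertion_right hg hF _ _) _)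

theorem isLinearMap_gerstenhaber_right {F : Z → List V → V} (hF : ∀ w, IsLinearMap k fun z => F z w)
    {g : List V → V} (hg : WordLinear k g) (d e : ℤ) (w : List V) :
    IsLinearMap k fun z => gerstenhaber 𝒱 d g e (F z) w :=
  isLinearMap_sub (isLinearMap_insertion_right hg hF _ _)
    (isLinearMap_units_smul (isLinearMap_insertion_left hF _ _ _) _)

theorem isLinearMap_totalBracket {n : ℕ} (d : Fin n → ℤ) {x : Z → Fin n → Summand → List V → V}
    {i : Fin n} (hi : ∀ P w, IsLinearMap k fun z => x z i P w)
    (hx : ∀ j, j ≠ i → ∀ z, x z j = x 0 j) (hlin : ∀ z j P, WordLinear k (x z j P)) (P : Summand)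
    (w : List V) : IsLinearMap k fun z => totalBracket 𝒱 n d (x z) P w := by
  by_cases hP : P = .alg
  · subst hP
    simp only [totalBracket_alg]
    by_cases hn : n = 2
    · subst hn
      simp only [algBracket]
      by_cases h : i = 0
      · subst h
        simp only [hx 1 (by decide)]
        exact isLinearMap_gerstenhaber_left (hi .alg) (hlin _ _ _) _ _ _
      · have h1 : i = 1 := by omega
        subst h1
        simp only [hx 0 (by decide)]
        exact isLinearMap_gerstenhaber_right (hi .alg) (hlin _ _ _) _ _ _
    · simp only [algBracket_of_ne hn]
      exact isLinearMap_zero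
  · simp only [totalBracket_of_ne _ _ hP]
    by_cases hw : w.length ∈ P.arities
    · simp only [arityPart_of_mem _ hw, mixedSum, Finset.sum_apply]
      refine isLinearMap_sum _ fun a _ => ?_
      by_cases ha : a = i
      · subst ha
        have e : ∀ z, mixedTerm 𝒱 P.side (!P.side) n a d (x z a .alg)
            (fun i => sidePart P.side (x z i)) = mixedTerm 𝒱 P.side (!P.side) n a d (x z a .alg)
            fun i => sidePart P.side (x 0 i) := fun z =>
          mixedTerm_congr _ _ a d _ fun j hj => by rw [hx j hj]
        simp only [e]
        exact isLinearMap_mixedTerm_left _ _ a d (hi .alg)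
          (fun j _ => wordLinear_sidePart (hlin 0 j) _) w
      · simp only [hx a ha]
        exact isLinearMap_mixedTerm_slot _ _ d (hlin 0 a .alg) (Ne.symm ha)
          (g := fun z j => sidePart P.side (x z j))
          (fun w => isLinearMap_add (isLinearMap_add (hi _ w) (hi _ w)) (hi _ w))
          (fun j _ hj z => by rw [hx j hj z]) (fun j _ _ => wordLinear_sidePart (hlin 0 j) _) w
    · simp only [arityPart_of_notMem _ hw]
      exact isLinearMap_zero

end Linearity

theorem isLinearMap_totalBracket_update {n : ℕ} {d : Fin n → ℤ} (x : ∀ i, AvA 𝒱 (d i)) (i : Fin n)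
    (P : Summand) (w : List V) : IsLinearMap k fun z : AvA 𝒱 (d i) =>
      totalBracket 𝒱 n d (fun j => (Function.update x i z j : Summand → List V → V)) P w := by
  refine isLinearMap_totalBracket d (i := i) (fun P w => ?_) (fun j hj z => ?_)
    (fun z j P => wordLinear_of_mem (Function.update x i z j).2 P) P w
  · simp only [Function.update_self]
    exact ⟨fun _ _ => rfl, fun _ _ => rfl⟩
  · rw [Function.update_of_ne hj, Function.update_of_ne hj]

/-- The operation `lₙ` on the components of degrees `d` of `C_AvA(V)`. -/
def bracketMap (𝒱 : ℤ → Submodule k V) [DirectSum.Decomposition 𝒱] (n : ℕ) (d : Fin n → ℤ) :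
    MultilinearMap k (fun i => AvA 𝒱 (d i)) (AvA 𝒱 (∑ i, d i + n - 2)) where
  toFun x := ⟨totalBracket 𝒱 n d fun i => (x i : Summand → List V → V),
    totalBracket_mem fun i => (x i).2⟩
  map_update_add' {inst} x i y z := by
    rw [Subsingleton.elim inst (instDecidableEqFin n)]
    refine Subtype.ext (funext fun P => funext fun w => ?_)
    exact (isLinearMap_totalBracket_update x i P w).map_add y z
  map_update_smul' {inst} x i c y := by
    rw [Subsingleton.elim inst (instDecidableEqFin n)]
    refine Subtype.ext (funext fun P => funext fun w => ?_)
    exact (isLinearMap_totalBracket_update x i P w).map_smul c y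

end Cochains

/-! ### Supports of the brackets -/

section Support

variable {k V : Type*} [Field k] [AddCommGroup V] [Module k V] {𝒱 : ℤ → Submodule k V}
  [DirectSum.Decomposition 𝒱]

theorem right_ne_zero_of_units_smul {u : ℤˣ} {v : V} (h : u • v ≠ 0) : v ≠ 0 := fun h0 =>
  h (by rw [h0, smul_zero])

theorem compTensor_zero (gs : List (ℤ × (List V → V))) (w : List V) :
    compTensor 𝒱 (fun _ => 0) gs w = 0 := by
  rw [compTensor_eq, tensorComp_zero]

theorem compTensor_ofFn_succ (f : List V → V) {n : ℕ} (x : Fin (n + 1) → ℤ × (List V → V))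
    (w : List V) : compTensor 𝒱 f (List.ofFn x) w = ∑ i ∈ Finset.range (w.length + 1),
      compTensor 𝒱 (fun out => f ((x 0).2 ((w.take i).map (twist 𝒱
        ((List.ofFn fun j : Fin n => x j.succ).map Prod.fst).sum)) :: out))
        (List.ofFn fun j : Fin n => x j.succ) (w.drop i) := by
  rw [List.ofFn_succ, compTensor]

/-- The blocks have been twisted by signs and need not concatenate to `w`; only their lengths are
used. -/
theorem exists_blocks {f : List V → V} (hf : WordLinear k f) {n : ℕ} {e : Fin n → ℤ}
    {g : Fin n → List V → V} {w : List V}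
    (h : compTensor 𝒱 f (List.ofFn fun j => (e j, g j)) w ≠ 0) :
    ∃ v : Fin n → List V, ∑ j, (v j).length = w.length ∧ ∀ j, g j (v j) ≠ 0 := by
  induction n generalizing f w with
  | zero =>
    refine ⟨fun j => j.elim0, ?_, fun j => j.elim0⟩
    rw [List.ofFn_zero, compTensor, ne_eq, ite_eq_right_iff, Classical.not_imp] at h
    simp [h.1]
  | succ n ih =>
    rw [compTensor_ofFn_succ] at h
    obtain ⟨i, hi, h⟩ := Finset.exists_ne_zero_of_sum_ne_zero h
    have h0 : (g 0) ((w.take i).map (twist 𝒱 ((List.ofFn fun j : Fin n =>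
        (e j.succ, g j.succ)).map Prod.fst).sum)) ≠ 0 := fun h0 => h <| by
      simp only [h0]
      have e0 : (fun out : List V => f (0 :: out)) = fun _ => 0 :=
        funext fun out => hf.map_zero [] out
      rw [e0, compTensor_zero]
    obtain ⟨v, hv, hg⟩ := ih (hf.cons _) h
    refine ⟨Fin.cons _ v, ?_, Fin.cases h0 hg⟩
    rw [Fin.sum_univ_succ, Fin.cons_zero]
    simp only [Fin.cons_succ, hv, List.length_map, List.length_take, List.length_drop]
    have := Finset.mem_range.1 hi
    omega

/-- A composition depends only on the values of the operations on short words if the others are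
zero on shorter words. -/
theorem compTensor_congr {f : List V → V} (hf : WordLinear k f) {n : ℕ} {e : Fin n → ℤ}
    {g g' : Fin n → List V → V} {lo : Fin n → ℕ} {N : ℕ}
    (hlo : ∀ j v, v.length < lo j → g j v = 0 ∧ g' j v = 0)
    (hg : ∀ j v, v.length + ∑ i, lo i ≤ N + lo j → g j v = g' j v) {w : List V}
    (hw : w.length ≤ N) :
    compTensor 𝒱 f (List.ofFn fun j => (e j, g j)) w =
      compTensor 𝒱 f (List.ofFn fun j => (e j, g' j)) w := by
  induction n generalizing f w N with
  | zero => rfl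
  | succ n ih =>
    rw [compTensor_ofFn_succ, compTensor_ofFn_succ]
    refine Finset.sum_congr rfl fun i hi => ?_
    have hi' : i ≤ w.length := Nat.lt_succ_iff.1 (Finset.mem_range.1 hi)
    have ed : (List.ofFn fun j : Fin n => (e j.succ, g j.succ)).map Prod.fst =
        (List.ofFn fun j : Fin n => (e j.succ, g' j.succ)).map Prod.fst := by
      simp only [List.map_ofFn]; rfl
    simp only [ed]
    generalize hu : (w.take i).map (twist 𝒱 ((List.ofFn fun j : Fin n =>
        (e j.succ, g' j.succ)).map Prod.fst).sum) = u
    have hul : u.length = i := by rw [← hu]; simp [hi']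
    rw [Fin.sum_univ_succ] at hg
    by_cases h1 : i < lo 0
    · obtain ⟨h2, h3⟩ := hlo 0 u (by omega)
      have e0 : (fun out : List V => f (0 :: out)) = fun _ => 0 :=
        funext fun out => hf.map_zero [] out
      rw [h2, h3, e0, compTensor_zero, compTensor_zero]
    by_cases h2 : i + ∑ j : Fin n, lo j.succ ≤ N
    · rw [hg 0 u (by omega)]
      exact ih (N := N - i) (hf.cons _) (fun j => hlo j.succ) (fun j v hv => hg _ _ (by omega))
        (by simp; omega)
    · have hz : ∀ (G : Fin n → List V → V) (y : V), (∀ j v, v.length < lo j.succ → G j v = 0) →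
          compTensor 𝒱 (fun out => f (y :: out)) (List.ofFn fun j => (e j.succ, G j)) (w.drop i) =
            0 := by
        intro G y hG
        by_contra h
        obtain ⟨v, hv, hv'⟩ := exists_blocks (hf.cons _) h
        have : ∑ j : Fin n, lo j.succ ≤ ∑ j, (v j).length :=
          Finset.sum_le_sum fun j _ => not_lt.1 fun h => hv' j (hG j _ h)
        rw [hv, List.length_drop] at this
        omega
      rw [hz _ _ fun j v hv => (hlo j.succ v hv).1, hz _ _ fun j v hv => (hlo j.succ v hv).2]

theorem hole_eq {n : ℕ} (e : Fin n → ℤ) (g : Fin n → List V → V) (q : Fin n) :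
    (fun j => if j = q then ((0 : ℤ), (idWord : List V → V)) else (e j, g j)) =
      fun j => (if j = q then 0 else e j, if j = q then idWord else g j) := by
  funext j
  split_ifs <;> rfl

theorem idWord_eq_zero {v : List V} (h : v.length ≠ 1) : idWord v = 0 := by
  match v with
  | [] => rfl
  | [_] => simp at h
  | _ :: _ :: _ => rfl

theorem truncate_self (b b' : Bool) {n : ℕ} (g : Fin n → List V → V) (q : Fin n) :
    truncate b b' g q q = g q := by simp [truncate]

theorem truncate_nil (b b' : Bool) {n : ℕ} (g : Fin n → List V → V) (q j : Fin n) :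
    truncate b b' g q j [] = g j [] := by
  unfold truncate
  split_ifs <;> simp

theorem emptyPart_ne_zero {b : Bool} {f : List V → V} {v : List V} (h : emptyPart b f v ≠ 0) :
    f v ≠ 0 := by
  unfold emptyPart at h
  split_ifs at h
  · exact absurd rfl h
  · exact h

theorem truncate_ne_zero {b b' : Bool} {n : ℕ} {g : Fin n → List V → V} {q j : Fin n} {v : List V}
    (h : truncate b b' g q j v ≠ 0) : g j v ≠ 0 := by
  unfold truncate at h
  split_ifs at h
  · exact emptyPart_ne_zero h
  · exact emptyPart_ne_zero h
  · exact h

theorem exists_of_insertion_ne_zero {f g : List V → V} (hf : WordLinear k f) {e : ℤ} {w : List V}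
    (h : insertion 𝒱 f e g w ≠ 0) :
    ∃ u v, u.length + v.length = w.length + 1 ∧ f u ≠ 0 ∧ g v ≠ 0 := by
  rw [insertion] at h
  obtain ⟨i, hi, h⟩ := Finset.exists_ne_zero_of_sum_ne_zero h
  obtain ⟨j, hj, h⟩ := Finset.exists_ne_zero_of_sum_ne_zero h
  have := Finset.mem_range.1 hi
  have := Finset.mem_range.1 hj
  refine ⟨_, (w.drop i).take j, ?_, h, fun h0 => h ?_⟩
  · simp
    omega
  · rw [h0, hf.map_zero]

/-- The identity factor consumes one letter, and the insertion produces one more letter for the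
outer operation. The two corrections compensate, so the lengths again add up to that of `w`. -/
theorem exists_of_outerTerm_ne_zero {n : ℕ} {η : ℤ} {h : List V → V} (hh : WordLinear k h)
    {d : Fin n → ℤ} {g : Fin n → List V → V} (hg : ∀ j, WordLinear k (g j)) {q : Fin n} {w : List V}
    (hw : outerTerm 𝒱 η h d g q w ≠ 0) :
    ∃ v : Fin n → List V, ∑ j, (v j).length = w.length ∧ ∀ j, g j (v j) ≠ 0 := by
  rw [outerTerm, hole_eq, Pi.smul_apply] at hw
  obtain ⟨u, v, hl, hu, hv⟩ := exists_of_insertion_ne_zero (hg q) (right_ne_zero_of_units_smul hw)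
  obtain ⟨y, hy, hy'⟩ := exists_blocks hh hv
  -- The word received by the outer operation replaces the letter consumed by the identity factor.
  refine ⟨Function.update y q u, ?_, fun j => ?_⟩
  · have hq : (y q).length = 1 := by
      by_contra h1
      have := hy' q
      rw [if_pos rfl] at this
      exact this (idWord_eq_zero h1)
    rw [← Finset.add_sum_erase _ _ (Finset.mem_univ q)] at hy ⊢
    rw [Function.update_self, Finset.sum_congr rfl fun j hj => by
      rw [Function.update_of_ne (Finset.ne_of_mem_erase hj)]]
    omega
  · by_cases hj : j = q
    · subst hj
      rwa [Function.update_self]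
    · rw [Function.update_of_ne hj]
      simpa [hj] using hy' j

theorem exists_of_signedBracket_ne_zero {b b' : Bool} {n : ℕ} {η : ℤ} {h : List V → V}
    (hh : WordLinear k h) {d : Fin n → ℤ} {g : Fin n → List V → V} (hg : ∀ j, WordLinear k (g j))
    {w : List V} (hw : signedBracket 𝒱 b b' η h d g w ≠ 0) :
    ∃ v : Fin n → List V, ∑ j, (v j).length = w.length ∧ ∀ j, g j (v j) ≠ 0 := by
  have key : ∃ σ : Equiv.Perm (Fin n), ∃ v : Fin n → List V,
      ∑ j, (v j).length = w.length ∧ ∀ j, g (σ j) (v j) ≠ 0 := by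
    rw [signedBracket, Finset.sum_apply] at hw
    obtain ⟨σ, -, hσ⟩ := Finset.exists_ne_zero_of_sum_ne_zero hw
    refine ⟨σ, ?_⟩
    rw [Pi.smul_apply, Pi.sub_apply, Finset.sum_apply] at hσ
    have hσ' := right_ne_zero_of_units_smul hσ
    by_cases h1 : compTensor 𝒱 h (List.ofFn fun j => (d (σ j) + 1, g (σ j))) w = 0
    · rw [h1, zero_sub, neg_ne_zero] at hσ'
      obtain ⟨q, -, hq⟩ := Finset.exists_ne_zero_of_sum_ne_zero hσ'
      obtain ⟨v, hv, hv'⟩ := exists_of_outerTerm_ne_zero hh (fun j => by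
        unfold truncate
        split_ifs
        · exact (hg _).emptyPart _
        · exact (hg _).emptyPart _
        · exact hg _) hq
      exact ⟨v, hv, fun j => truncate_ne_zero (g := g ∘ σ) (hv' j)⟩
    · exact exists_blocks hh h1
  obtain ⟨σ, v, hv, hv'⟩ := key
  refine ⟨v ∘ σ.symm, ?_, fun j => ?_⟩
  · rw [← hv]
    exact Equiv.sum_comp σ.symm fun j => (v j).length
  · simpa using hv' (σ.symm j)

theorem signedBracket_eq_zero {b b' : Bool} {n : ℕ} {η : ℤ} {h : List V → V}
    (hh : WordLinear k h) {d : Fin n → ℤ} {g : Fin n → List V → V} (hg : ∀ j, WordLinear k (g j))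
    (h0 : ∃ j, g j = 0) : signedBracket 𝒱 b b' η h d g = 0 := by
  obtain ⟨j, hj⟩ := h0
  funext w
  by_contra hw
  obtain ⟨v, -, hv⟩ := exists_of_signedBracket_ne_zero hh hg hw
  exact hv j (by rw [hj]; rfl)

/-- The identity factor consumes the only letter available, so all the other inner factors are
evaluated on the empty word, where truncation has no effect. This is why the right and left brackets
agree in low arity. -/
theorem outerTerm_congr_of_length_le_one {b b' c c' : Bool} {n : ℕ} {η : ℤ} {h : List V → V}
    (hh : WordLinear k h) {d : Fin n → ℤ} {g g' : Fin n → List V → V}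
    (hg : ∀ j, WordLinear k (g j)) (hg' : ∀ j, WordLinear k (g' j))
    (he : ∀ j v, v.length ≤ 1 → g j v = g' j v) (q : Fin n) {w : List V} (hw : w.length ≤ 1) :
    outerTerm 𝒱 η h d (truncate b b' g q) q w = outerTerm 𝒱 η h d (truncate c c' g' q) q w := by
  rw [outerTerm, outerTerm, Pi.smul_apply, Pi.smul_apply, truncate_self, truncate_self, hole_eq,
    hole_eq, insertion, insertion]
  refine congrArg _ (Finset.sum_congr rfl fun i hi => Finset.sum_congr rfl fun j hj => ?_)
  have hi' := Finset.mem_range.1 hi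
  have hj' := Finset.mem_range.1 hj
  have hz : ∀ G : Fin n → List V → V, compTensor 𝒱 h
      (List.ofFn fun j => (if j = q then 0 else d j + 1, if j = q then idWord else G j)) [] = 0 := by
    intro G
    by_contra hne
    obtain ⟨v, hv, hv'⟩ := exists_blocks hh hne
    have h1 : (v q).length = 0 := by
      simpa using (Finset.sum_eq_zero_iff.1 hv) q (Finset.mem_univ q)
    have h2 := hv' q
    rw [if_pos rfl] at h2
    exact h2 (idWord_eq_zero (by omega))
  by_cases h0 : j = 0
  · subst h0
    rw [List.take_zero, hz, hz, (hg q).map_zero, (hg' q).map_zero]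
  -- The bound `lo` reserves one letter for the identity factor, which leaves none for the others.
  · rw [he q _ (by simp; omega), compTensor_congr hh (lo := fun j => if j = q then 1 else 0) (N := 1)]
    · intro j v hv
      by_cases hjq : j = q
      · simp only [hjq, if_true] at hv ⊢
        have := idWord_eq_zero (V := V) (v := v) (by omega)
        exact ⟨this, this⟩
      · simp [hjq] at hv
    · intro j v hv
      rw [Finset.sum_ite_eq' Finset.univ q, if_pos (Finset.mem_univ _)] at hv
      by_cases hjq : j = q
      · simp [hjq]
      · simp only [hjq, if_false] at hv ⊢
        have : v = [] := List.length_eq_zero_iff.1 (by omega)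
        subst this
        rw [truncate_nil, truncate_nil, he j [] (by simp)]
    · simp; omega

theorem signedBracket_congr_of_length_le_one {b b' c c' : Bool} {n : ℕ} {η : ℤ} {h : List V → V}
    (hh : WordLinear k h) {d : Fin n → ℤ} {g g' : Fin n → List V → V}
    (hg : ∀ j, WordLinear k (g j)) (hg' : ∀ j, WordLinear k (g' j))
    (he : ∀ j v, v.length ≤ 1 → g j v = g' j v) {w : List V} (hw : w.length ≤ 1) :
    signedBracket 𝒱 b b' η h d g w = signedBracket 𝒱 c c' η h d g' w := by
  rw [signedBracket, signedBracket, Finset.sum_apply, Finset.sum_apply]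
  refine Finset.sum_congr rfl fun σ _ => ?_
  rw [Pi.smul_apply, Pi.smul_apply, Pi.sub_apply, Pi.sub_apply, Finset.sum_apply, Finset.sum_apply,
    Finset.sum_congr rfl fun q _ => outerTerm_congr_of_length_le_one (g := g ∘ σ) (g' := g' ∘ σ) hh
      (fun j => hg _) (fun j => hg' _) (fun j => he _) q hw,
    compTensor_congr hh (lo := fun _ => 0) (N := 1) (by simp)
      (fun j v hv => he (σ j) v (by simpa using hv)) hw]

end Support

/-! ### Comparison of the formulas -/

section Comparison

variable {k V : Type*} [Field k] [AddCommGroup V] [Module k V] {𝒱 : ℤ → Submodule k V}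
  [DirectSum.Decomposition 𝒱]

theorem mixedTerm_congr_of_length_le_one {b b' c c' : Bool} {n : ℕ} {a : Fin n} {d : Fin n → ℤ}
    {h : List V → V} (hh : WordLinear k h) {g g' : Fin n → List V → V}
    (hg : ∀ j, WordLinear k (g j)) (hg' : ∀ j, WordLinear k (g' j))
    (he : ∀ j v, v.length ≤ 1 → g j v = g' j v) {w : List V} (hw : w.length ≤ 1) :
    mixedTerm 𝒱 b b' n a d h g w = mixedTerm 𝒱 c c' n a d h g' w := by
  cases n with
  | zero => exact a.elim0
  | succ n =>
    exact congrArg _ (signedBracket_congr_of_length_le_one hh (fun j => hg _) (fun j => hg' _)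
      (fun j => he _) hw)

theorem outerTerm_eq_zero {n : ℕ} {η : ℤ} {h : List V → V} (hh : WordLinear k h)
    {d : Fin n → ℤ} {g : Fin n → List V → V} (hg : ∀ j, WordLinear k (g j)) {q : Fin n}
    (h0 : ∃ j, g j = 0) : outerTerm 𝒱 η h d g q = 0 := by
  obtain ⟨j, hj⟩ := h0
  funext w
  by_contra hw
  obtain ⟨v, -, hv⟩ := exists_of_outerTerm_ne_zero hh hg hw
  exact hv j (by rw [hj]; rfl)

theorem outerTerm_eq_zero_of_const {n : ℕ} {η : ℤ} {h : List V → V} {d : Fin n → ℤ}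
    {g : Fin n → List V → V} {q : Fin n} (h0 : ∀ v, v ≠ [] → g q v = 0) :
    outerTerm 𝒱 η h d g q = 0 := by
  funext w
  rw [outerTerm, Pi.smul_apply, insertion, Pi.zero_apply]
  refine (congrArg _ ?_).trans (smul_zero _)
  exact Finset.sum_eq_zero fun i _ => Finset.sum_eq_zero fun j _ => h0 _ (by simp)

/-- The least arity of the elements of a summand. -/
def Summand.lowest : Summand → ℕ
  | .lin => 1
  | .right => 2
  | .left => 2
  | _ => 0

section Brackets

variable {n : ℕ} {η : ℤ} {h : List V → V} {c : Fin n → Summand} {d : Fin n → ℤ}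
  {g : Fin n → List V → V} (hh : WordLinear k h) (hg : ∀ j, WordLinear k (g j))
  (hc : ∀ j, c j ≠ .alg) (hs : ∀ j v, v.length ∉ (c j).arities → g j v = 0)
include hh hg hc hs

theorem emptyPart_eq_zero {j : Fin n} (hj : c j ≠ .const) : emptyPart true (g j) = 0 := by
  funext v
  by_cases hv : v = []
  · subst hv
    rw [emptyPart_nil, hs]
    · rfl
    · cases h : c j <;> simp_all [Summand.arities]
  · exact emptyPart_true hv _

theorem emptyPart_eq_self {j : Fin n} (hj : c j = .const) (b : Bool) : emptyPart b (g j) = g j := by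
  cases b
  · exact emptyPart_false _
  · funext v
    by_cases hv : v = []
    · rw [hv, emptyPart_nil]
    · rw [emptyPart_true hv, hs]
      rw [hj]
      simpa [Summand.arities] using hv

theorem wordLinear_truncate_comp (b b' : Bool) (σ : Equiv.Perm (Fin n)) (q j : Fin n) :
    WordLinear k (truncate b b' (g ∘ σ) q j) := by
  unfold truncate
  split_ifs
  · exact (hg _).emptyPart _
  · exact (hg _).emptyPart _
  · exact hg _

theorem outerTerm_eq_zero_of_eq_const (b b' : Bool) {σ : Equiv.Perm (Fin n)} {q : Fin n}
    (hq : c (σ q) = .const) :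
    outerTerm 𝒱 η h (d ∘ σ) (truncate b b' (g ∘ σ) q) q = 0 := by
  refine outerTerm_eq_zero_of_const fun v hv => ?_
  rw [truncate_self]
  refine hs _ _ ?_
  rw [hq]
  simpa [Summand.arities] using hv

/-- Cochains outside `Hom(k, V)` have no empty part, and those in `Hom(k, V)` are equal to theirs.
Truncating the factors before `q` therefore removes exactly the positions preceded by a factor
outside `Hom(k, V)`. Positions with a factor in `Hom(k, V)` vanish since the outer operation
receives a nonempty word. -/
theorem rightBracket_eq : rightBracket 𝒱 η h c d g = signedBracket 𝒱 true false η h d g := by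
  refine Finset.sum_congr rfl fun σ _ => congrArg _ (congrArg _ ?_)
  rw [Finset.sum_filter]
  refine Finset.sum_congr rfl fun q _ => ?_
  split_ifs with h1
  · congr 1
    funext j
    unfold truncate
    split_ifs with h2 h3
    · exact (emptyPart_eq_self hh hg hc hs (h1.2 j h2) true).symm
    · exact (emptyPart_false _).symm
    · rfl
  · by_cases hq : c (σ q) = .const
    · exact (outerTerm_eq_zero_of_eq_const hh hg hc hs _ _ hq).symm
    · have : ∃ j < q, c (σ j) ≠ .const := by
        by_contra! h2
        exact h1 ⟨hq, h2⟩
      obtain ⟨j, hj, hj'⟩ := this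
      refine (outerTerm_eq_zero hh (wordLinear_truncate_comp hh hg hc hs _ _ σ q) ⟨j, ?_⟩).symm
      rw [truncate, if_pos hj]
      exact emptyPart_eq_zero hh hg hc hs hj'

theorem leftBracket_eq : leftBracket 𝒱 η h c d g = signedBracket 𝒱 false true η h d g := by
  refine Finset.sum_congr rfl fun σ _ => congrArg _ (congrArg _ ?_)
  rw [Finset.sum_filter]
  refine Finset.sum_congr rfl fun q _ => ?_
  split_ifs with h1
  · congr 1
    funext j
    unfold truncate
    split_ifs with h2 h3
    · exact (emptyPart_false _).symm
    · exact (emptyPart_eq_self hh hg hc hs (h1.2 j h3) true).symm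
    · rfl
  · by_cases hq : c (σ q) = .const
    · exact (outerTerm_eq_zero_of_eq_const hh hg hc hs _ _ hq).symm
    · have : ∃ j > q, c (σ j) ≠ .const := by
        by_contra! h2
        exact h1 ⟨hq, h2⟩
      obtain ⟨j, hj, hj'⟩ := this
      refine (outerTerm_eq_zero hh (wordLinear_truncate_comp hh hg hc hs _ _ σ q) ⟨j, ?_⟩).symm
      rw [truncate, if_neg (not_lt.2 (le_of_lt hj)), if_pos hj]
      exact emptyPart_eq_zero hh hg hc hs hj'

/-- The lengths of the blocks add up to the length of `w`, and each is at least the lowest arity of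
its cochain; in `Hom(k, V)` and `Hom(sV, V)` there is no other arity. -/
theorem sum_lowest_le {b b' : Bool} {w : List V} (hw : signedBracket 𝒱 b b' η h d g w ≠ 0) :
    ∑ j, (c j).lowest ≤ w.length ∧
      ((∀ j, c j = .const ∨ c j = .lin) → w.length = ∑ j, (c j).lowest) := by
  obtain ⟨v, hv, hv'⟩ := exists_of_signedBracket_ne_zero hh hg hw
  have hm : ∀ j, (v j).length ∈ (c j).arities := fun j => by
    by_contra h
    exact hv' j (hs j _ h)
  rw [← hv]
  refine ⟨Finset.sum_le_sum fun j _ => ?_, fun hcl => Finset.sum_congr rfl fun j _ => ?_⟩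
  · have := hm j
    have := hc j
    cases h : c j <;> simp_all [Summand.arities, Summand.lowest]
  · have := hm j
    rcases hcl j with h | h <;> simp_all [Summand.arities, Summand.lowest]

theorem arityPart_eq_self {b b' : Bool} {A : Set ℕ}
    (hA : ∀ m, ∑ j, (c j).lowest ≤ m → ((∀ j, c j = .const ∨ c j = .lin) →
      m = ∑ j, (c j).lowest) → m ∈ A) :
    arityPart A (signedBracket 𝒱 b b' η h d g) = signedBracket 𝒱 b b' η h d g := by
  funext w
  by_cases hw : signedBracket 𝒱 b b' η h d g w = 0
  · rw [arityPart, hw, ite_self]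
  · obtain ⟨h1, h2⟩ := sum_lowest_le hh hg hc hs hw
    exact arityPart_of_mem _ (hA _ h1 h2)

theorem arityPart_eq_zero {b b' : Bool} {A : Set ℕ}
    (hA : ∀ m, ∑ j, (c j).lowest ≤ m → ((∀ j, c j = .const ∨ c j = .lin) →
      m = ∑ j, (c j).lowest) → m ∉ A) :
    arityPart A (signedBracket 𝒱 b b' η h d g) = 0 := by
  funext w
  by_cases hw : signedBracket 𝒱 b b' η h d g w = 0
  · rw [arityPart, hw, ite_self]; rfl
  · obtain ⟨h1, h2⟩ := sum_lowest_le hh hg hc hs hw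
    exact arityPart_of_notMem _ (hA _ h1 h2)

end Brackets

/-- The components in `C_r`, for `true`, or `C_l` of elements of the summands `c j`. -/
def pureSide (s : Bool) {n : ℕ} (c : Fin n → Summand) (g : Fin n → List V → V) (j : Fin n) :
    List V → V :=
  if c j = .const ∨ c j = .lin ∨ c j = sideSummand s then g j else 0

theorem sum_lowest_eq {n : ℕ} {c : Fin n → Summand} (h : ∀ j, c j = .const ∨ c j = .lin) :
    ∑ j, (c j).lowest = (Finset.univ.filter fun i => c i = .lin).card := by
  rw [Finset.card_filter]
  exact Finset.sum_congr rfl fun j _ => by rcases h j with h | h <;> simp [h, Summand.lowest]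

theorem two_le_sum_lowest {n : ℕ} {c : Fin n → Summand} {j : Fin n} (hc : ∀ j, c j ≠ .alg)
    (h1 : c j ≠ .const) (h2 : c j ≠ .lin) : 2 ≤ ∑ j, (c j).lowest := by
  refine le_trans ?_ (Finset.single_le_sum (f := fun j => (c j).lowest) (by simp) (Finset.mem_univ j))
  have := hc j
  cases h : c j <;> simp_all [Summand.lowest]

/-- The case distinction on summands is a consequence of arities: the bracket is supported in the
arities predicted by `sum_lowest_le`, so extracting the arities of `P` keeps it or kills it. It also
vanishes if some argument has no component on the side of `P`. -/
theorem leadingBracket_eq {n : ℕ} {η : ℤ} {h : List V → V} {c : Fin n → Summand} {d : Fin n → ℤ}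
    {g : Fin n → List V → V} (hh : WordLinear k h) (hg : ∀ j, WordLinear k (g j))
    (hc : ∀ j, c j ≠ .alg) (hs : ∀ j v, v.length ∉ (c j).arities → g j v = 0) {P : Summand}
    (hP : P ≠ .alg) :
    leadingBracket 𝒱 η h c d g P = arityPart P.arities
      (signedBracket 𝒱 P.side (!P.side) η h d (pureSide P.side c g)) := by
  have hlin : ∀ s j, WordLinear k (pureSide s c g j) := fun s j => by
    unfold pureSide
    split_ifs
    · exact hg j
    · exact wordLinear_zero
  have hself : ∀ s, (∀ j, c j = .const ∨ c j = .lin ∨ c j = sideSummand s) →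
      pureSide s c g = g := fun s hs => funext fun j => if_pos (hs j)
  have hzero : ∀ s b b' A, (∃ j, ¬ (c j = .const ∨ c j = .lin ∨ c j = sideSummand s)) →
      arityPart A (signedBracket 𝒱 b b' η h d (pureSide s c g)) = 0 := by
    rintro s b b' A ⟨j, hj⟩
    rw [signedBracket_eq_zero hh (hlin s) ⟨j, if_neg hj⟩]
    funext w
    simp [arityPart]
  rw [leadingBracket, rightBracket_eq hh hg hc hs, leftBracket_eq hh hg hc hs]
  split_ifs with h1 h2 h3 h4 h5
  · have h0 : ∑ j, (c j).lowest = 0 := by simp [h2, Summand.lowest]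
    rw [hself _ fun j => Or.inl (h2 j)]
    cases P
    · exact absurd rfl hP
    · rw [Pi.single_eq_same, arityPart_eq_self hh hg hc hs fun m _ hm => ?_]
      · rfl
      · rw [hm h1, h0]; rfl
    all_goals
      rw [Pi.single_eq_of_ne (by simp), arityPart_eq_zero hh hg hc hs fun m _ hm => ?_]
      rw [hm h1, h0]
      simp [Summand.arities]
  · have h0 : ∑ j, (c j).lowest = 1 := (sum_lowest_eq h1).trans h3
    rw [hself _ fun j => or_assoc.1 (Or.inl (h1 j))]
    cases P
    · exact absurd rfl hP
    case lin =>
      rw [Pi.single_eq_same, arityPart_eq_self hh hg hc hs fun m _ hm => ?_]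
      · rfl
      · rw [hm h1, h0]; rfl
    all_goals
      rw [Pi.single_eq_of_ne (by simp), arityPart_eq_zero hh hg hc hs fun m _ hm => ?_]
      rw [hm h1, h0]
      simp [Summand.arities]
  · have h0 : 2 ≤ ∑ j, (c j).lowest := by
      rw [sum_lowest_eq h1]
      have : (Finset.univ.filter fun i => c i = .lin).card ≠ 0 := fun h0 => h2 fun i => by
        rw [Finset.card_eq_zero, Finset.filter_eq_empty_iff] at h0
        exact (h1 i).resolve_right (h0 (Finset.mem_univ i))
      omega
    rw [hself _ fun j => or_assoc.1 (Or.inl (h1 j)), Pi.add_apply]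
    cases P
    · exact absurd rfl hP
    case right =>
      rw [Pi.single_eq_same, Pi.single_eq_of_ne (by simp), add_zero,
        arityPart_eq_self (A := Summand.right.arities) hh hg hc hs fun m hm _ => h0.trans hm]
      rfl
    case left =>
      rw [Pi.single_eq_same, Pi.single_eq_of_ne (by simp), zero_add,
        arityPart_eq_self (A := Summand.left.arities) hh hg hc hs fun m hm _ => h0.trans hm]
      rfl
    all_goals
      rw [Pi.single_eq_of_ne (by simp), Pi.single_eq_of_ne (by simp), add_zero,
        arityPart_eq_zero hh hg hc hs fun m hm _ => ?_]
      have := h0.trans hm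
      simp [Summand.arities]
      omega
  all_goals
    obtain ⟨j, hj⟩ := not_forall.1 h1
    rw [not_or] at hj
    have h0 : 2 ≤ ∑ j, (c j).lowest := two_le_sum_lowest hc hj.1 hj.2
  · have hleft : ∃ j, ¬ (c j = .const ∨ c j = .lin ∨ c j = sideSummand false) := by
      refine ⟨j, ?_⟩
      rcases h4 j with h | h | h
      · exact absurd h hj.1
      · exact absurd h hj.2
      · simp [h, sideSummand]
    cases P
    · exact absurd rfl hP
    case right =>
      rw [Pi.single_eq_same, hself (Summand.side .right) h4,
        arityPart_eq_self (A := Summand.right.arities) hh hg hc hs fun m hm _ => h0.trans hm]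
      rfl
    case left => rw [Pi.single_eq_of_ne (by simp)]; exact (hzero _ _ _ _ hleft).symm
    all_goals
      rw [Pi.single_eq_of_ne (by simp), hself (Summand.side _) (by exact h4),
        arityPart_eq_zero hh hg hc hs fun m hm _ => ?_]
      have := h0.trans hm
      simp [Summand.arities]
      omega
  · have hright : ∃ j, ¬ (c j = .const ∨ c j = .lin ∨ c j = sideSummand true) := by
      refine ⟨j, ?_⟩
      rcases h5 j with h | h | h
      · exact absurd h hj.1
      · exact absurd h hj.2
      · simp [h, sideSummand]
    cases P
    · exact absurd rfl hP
    case left =>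
      rw [Pi.single_eq_same, hself (Summand.side .left) h5,
        arityPart_eq_self (A := Summand.left.arities) hh hg hc hs fun m hm _ => h0.trans hm]
      rfl
    all_goals
      rw [Pi.single_eq_of_ne (by simp)]; exact (hzero _ _ _ _ hright).symm
  · have hall : ∀ s, ∃ j, ¬ (c j = .const ∨ c j = .lin ∨ c j = sideSummand s) := by
      intro s
      cases s
      · exact not_forall.1 h5
      · exact not_forall.1 h4
    exact (hzero _ _ _ _ (hall _)).symm

end Comparison

/-! ### The operations on `C_AvA(V)` -/

section Operations

variable {k V : Type*} [Field k] [AddCommGroup V] [Module k V] {𝒱 : ℤ → Submodule k V}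

theorem arityPart_sum {ι : Type*} (A : Set ℕ) (s : Finset ι) (f : ι → List V → V) :
    arityPart A (∑ i ∈ s, f i) = ∑ i ∈ s, arityPart A (f i) := by
  funext w
  rw [Finset.sum_apply]
  by_cases h : w.length ∈ A
  · simp only [arityPart_of_mem _ h, Finset.sum_apply]
  · simp only [arityPart_of_notMem _ h, Finset.sum_const_zero]

theorem arityPart_units_smul (A : Set ℕ) (u : ℤˣ) (f : List V → V) :
    arityPart A (u • f) = u • arityPart A f := by
  funext w
  rw [Pi.smul_apply]
  by_cases h : w.length ∈ A
  · simp only [arityPart_of_mem _ h, Pi.smul_apply]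
  · simp only [arityPart_of_notMem _ h, smul_zero]

theorem arityPart_zero (A : Set ℕ) : arityPart A (0 : List V → V) = 0 := by
  funext w
  rw [arityPart, Pi.zero_apply, ite_self]

variable [DirectSum.Decomposition 𝒱]

theorem sidePart_congr_of_length_le_one {d : ℤ} {x : Summand → List V → V} (hx : x ∈ AvA 𝒱 d)
    (s s' : Bool) {v : List V} (hv : v.length ≤ 1) : sidePart s x v = sidePart s' x v := by
  have h : ∀ s, x (sideSummand s) v = 0 := fun s =>
    ((mem_AvA_iff.1 hx).2 _ (by cases s <;> simp [sideSummand])).2 v (by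
      cases s <;> simp [sideSummand, Summand.arities] <;> omega)
  simp only [sidePart, Pi.add_apply, h]

/-- This consistency lets a single component in `Hom(k, V)` and in `Hom(sV, V)` serve both sides. -/
theorem mixedSum_congr_of_length_le_one {n : ℕ} {d : Fin n → ℤ} {x : Fin n → Summand → List V → V}
    (hx : ∀ i, x i ∈ AvA 𝒱 (d i)) (s s' : Bool) {w : List V} (hw : w.length ≤ 1) :
    mixedSum 𝒱 s (!s) n d (fun i => x i .alg) (fun i => sidePart s (x i)) w =
      mixedSum 𝒱 s' (!s') n d (fun i => x i .alg) (fun i => sidePart s' (x i)) w := by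
  rw [mixedSum, mixedSum, Finset.sum_apply, Finset.sum_apply]
  exact Finset.sum_congr rfl fun a _ =>
    mixedTerm_congr_of_length_le_one (isOperation_alg_of_mem (hx a)).linear
      (fun j => (isOperation_sidePart (hx j) s).linear)
      (fun j => (isOperation_sidePart (hx j) s').linear)
      (fun j v hv => sidePart_congr_of_length_le_one (hx j) s s' hv) hw

/-- The arities `0`, `1` and at least `2` exhaust all words, so the three components reassemble to
the full bracket of the side `s`. Hence a nested bracket may be computed inside one side, and the
Jacobi identity reduces to that of `mixedSum`. -/
theorem sidePart_totalBracket {n : ℕ} {d : Fin n → ℤ} {x : Fin n → Summand → List V → V}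
    (hx : ∀ i, x i ∈ AvA 𝒱 (d i)) (s : Bool) :
    sidePart s (totalBracket 𝒱 n d x) =
      mixedSum 𝒱 s (!s) n d (fun i => x i .alg) fun i => sidePart s (x i) := by
  funext w
  have hs : sideSummand s ≠ .alg := by cases s <;> simp [sideSummand]
  have hs' : (sideSummand s).side = s := by cases s <;> rfl
  have ha : (sideSummand s).arities = {n | 2 ≤ n} := by cases s <;> rfl
  rw [sidePart, Pi.add_apply, Pi.add_apply, totalBracket_of_ne _ _ (by simp),
    totalBracket_of_ne _ _ (by simp), totalBracket_of_ne _ _ hs, hs', ha]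
  by_cases h0 : w.length = 0
  · rw [arityPart_of_mem _ (by simp [Summand.arities, h0]),
      arityPart_of_notMem _ (by simp [Summand.arities, h0]), arityPart_of_notMem _ (by simp [h0]),
      add_zero, add_zero]
    exact mixedSum_congr_of_length_le_one hx _ _ (by omega)
  by_cases h1 : w.length = 1
  · rw [arityPart_of_notMem _ (by simp [Summand.arities, h1]),
      arityPart_of_mem _ (by simp [Summand.arities, h1]), arityPart_of_notMem _ (by simp [h1]),
      add_zero, zero_add]
    exact mixedSum_congr_of_length_le_one hx _ _ (by omega)
  · rw [arityPart_of_notMem _ (by simpa [Summand.arities] using h0),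
      arityPart_of_notMem _ (by simpa [Summand.arities] using h1),
      arityPart_of_mem _ (by simp; omega), zero_add, zero_add]

section Pure

variable {n : ℕ} {c : Fin n → Summand} {d : Fin n → ℤ} {x : Fin n → Summand → List V → V}

theorem sidePart_eq_pureSide (hp : ∀ i, ∀ P ≠ c i, x i P = 0) (s : Bool) (j : Fin n) :
    sidePart s (x j) = pureSide s c (fun i => x i (c i)) j := by
  have h := hp j
  cases s <;> cases hc : c j <;> simp_all [sidePart, pureSide, sideSummand]

/-- The sum over all positions of the argument in `C_A(V)` reduces to the position prescribed by the
summands. If the selected argument is not in `C_A(V)`, its component there is zero; if another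
argument is in `C_A(V)`, it has no component on either side. -/
theorem totalBracket_eq_mixedBracket {n : ℕ} {c : Fin (n + 1) → Summand} {d : Fin (n + 1) → ℤ}
    {x : Fin (n + 1) → Summand → List V → V} (hx : ∀ i, x i ∈ AvA 𝒱 (d i))
    (hp : ∀ i, ∀ P ≠ c i, x i P = 0) {P : Summand} (hP : P ≠ .alg) :
    totalBracket 𝒱 (n + 1) d x P = mixedBracket 𝒱 c d (fun i => x i (c i)) P := by
  rw [totalBracket_of_ne d x hP, mixedSum, arityPart_sum, mixedBracket, Finset.sum_apply,
    Finset.sum_filter]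
  refine Finset.sum_congr rfl fun a _ => ?_
  simp only [sidePart_eq_pureSide hp]
  rw [mixedTerm, arityPart_units_smul]
  have hlin : ∀ j, WordLinear k (x j (c j)) := fun j => wordLinear_of_mem (hx j) _
  have hlin' : ∀ j, WordLinear k (pureSide P.side c (fun i => x i (c i)) j) := fun j => by
    unfold pureSide
    split_ifs
    · exact hlin j
    · exact wordLinear_zero
  split_ifs with h
  · rw [Pi.smul_apply, leadingBracket_eq (hlin a) (fun j => hlin _) h.2
      (fun j v hv => ((mem_AvA_iff.1 (hx (a.succAbove j))).2 _ (h.2 j)).2 v hv) hP, h.1]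
    rfl
  · refine (congrArg _ ?_).trans (smul_zero _)
    by_cases ha : c a = .alg
    · have h' : ∃ i, c (a.succAbove i) = .alg := by
        by_contra! h'
        exact h ⟨ha, h'⟩
      obtain ⟨i, hi⟩ := h'
      rw [signedBracket_eq_zero (wordLinear_of_mem (hx a) _) (fun j => hlin' _) ⟨i, ?_⟩,
        arityPart_zero]
      refine if_neg ?_
      rw [hi]
      cases P.side <;> simp [sideSummand]
    · rw [hp a .alg (Ne.symm ha)]
      have h0 : signedBracket 𝒱 P.side (!P.side) (d a - 1) 0 (fun i => d (a.succAbove i))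
          (fun i => pureSide P.side c (fun i => x i (c i)) (a.succAbove i)) = 0 := by
        funext w
        exact (isLinearMap_signedBracket_left (Z := List V → V) (H := fun h => h) _ _ _
          (fun w => ⟨fun _ _ => rfl, fun _ _ => rfl⟩) _ (fun j => hlin' _) w).map_zero
      rw [h0, arityPart_zero]

theorem leadingBracket_alg {n : ℕ} (η : ℤ) (h : List V → V) (c : Fin n → Summand) (d : Fin n → ℤ)
    (g : Fin n → List V → V) : leadingBracket 𝒱 η h c d g .alg = 0 := by
  unfold leadingBracket
  split_ifs <;> simp

theorem mixedBracket_alg {n : ℕ} (c : Fin (n + 1) → Summand) (d : Fin (n + 1) → ℤ)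
    (f : Fin (n + 1) → List V → V) : mixedBracket 𝒱 c d f .alg = 0 := by
  rw [mixedBracket, Finset.sum_apply]
  exact Finset.sum_eq_zero fun j _ => by rw [Pi.smul_apply, leadingBracket_alg, smul_zero]

/-- `l₁` is the case without any `g`: the value of the vector field at `g = 0`. -/
theorem mixedBracket_one (c : Fin 1 → Summand) (d : Fin 1 → ℤ) (f : Fin 1 → List V → V) :
    mixedBracket 𝒱 c d f =
      if c 0 = .alg then Pi.single .const fun w => if w = [] then f 0 [] else 0 else 0 := by
  rw [mixedBracket]
  split_ifs with h
  · rw [Finset.filter_true_of_mem (by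
      intro j _
      rw [Subsingleton.elim (α := Fin 1) j 0]
      exact ⟨h, fun i => i.elim0⟩), Fin.sum_univ_one]
    have e : (d 0 * (∑ i with i < (0 : Fin 1), d i) + ((0 : Fin 1) : ℕ)).negOnePow = 1 := by
      simp
    rw [e, one_smul, leadingBracket, if_pos (fun i => i.elim0), if_pos (fun i => i.elim0)]
    congr 1
    funext w
    simp [rightBracket, epsSign, chiSign, koszulSign, compTensor]
  · rw [Finset.filter_false_of_mem (by
      intro j _
      rw [Subsingleton.elim (α := Fin 1) j 0]
      exact fun h' => h h'.1), Finset.sum_empty]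

theorem totalBracket_eq_averagingBracket (hx : ∀ i, x i ∈ AvA 𝒱 (d i))
    (hp : ∀ i, ∀ P ≠ c i, x i P = 0) :
    totalBracket 𝒱 n d x = averagingBracket 𝒱 n c d fun i => x i (c i) := by
  funext P
  match n with
  | 0 =>
    by_cases hP : P = .alg
    · subst hP; rfl
    · rw [totalBracket_of_ne d x hP, mixedSum, Finset.univ_eq_empty, Finset.sum_empty,
        arityPart_zero]
      rfl
  | 1 =>
    rw [averagingBracket, ← mixedBracket_one (𝒱 := 𝒱) c d fun i => x i (c i)]
    by_cases hP : P = .alg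
    · subst hP
      rw [mixedBracket_alg, totalBracket_alg, algBracket_of_ne (by simp)]
    · exact totalBracket_eq_mixedBracket hx hp hP
  | 2 =>
    rw [averagingBracket]
    have hlin : ∀ i, WordLinear k (x i .alg) := fun i => wordLinear_of_mem (hx i) _
    split_ifs with h
    · by_cases hP : P = .alg
      · subst hP
        rw [Pi.single_eq_same, h.1, h.2]
        rfl
      · rw [Pi.single_eq_of_ne hP, totalBracket_eq_mixedBracket hx hp hP, mixedBracket,
          Finset.filter_false_of_mem, Finset.sum_empty]
        · rfl
        · rintro j - ⟨-, h'⟩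
          refine h' 0 ?_
          have : ∀ i, c i = .alg := fun i => by fin_cases i; exacts [h.1, h.2]
          exact this _
    · by_cases hP : P = .alg
      · subst hP
        rw [mixedBracket_alg, totalBracket_alg]
        rw [not_and_or] at h
        rcases h with h | h
        · rw [algBracket, hp 0 .alg (Ne.symm h)]
          exact gerstenhaber_zero_left (hlin 1) _ _
        · rw [algBracket, hp 1 .alg (Ne.symm h)]
          exact gerstenhaber_zero_right (hlin 0) _ _
      · exact totalBracket_eq_mixedBracket hx hp hP
  | m + 3 =>
    rw [averagingBracket]
    by_cases hP : P = .alg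
    · subst hP
      rw [mixedBracket_alg, totalBracket_alg, algBracket_of_ne (by omega)]
    · exact totalBracket_eq_mixedBracket hx hp hP

end Pure

theorem algBracket_perm {n : ℕ} (σ : Equiv.Perm (Fin n)) (d : Fin n → ℤ) (X : Fin n → List V → V) :
    algBracket 𝒱 n (fun i => d (σ i)) (fun i => X (σ i)) = chiSign σ d • algBracket 𝒱 n d X := by
  by_cases hn : n = 2
  · subst hn
    have hσ : σ = 1 ∨ σ = Equiv.swap 0 1 := by revert σ; decide
    rcases hσ with rfl | rfl
    · have e : chiSign (1 : Equiv.Perm (Fin 2)) d = 1 := by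
        rw [chiSign, koszulSign, Finset.filter_false_of_mem, Finset.prod_empty, map_one, one_mul]
        rintro p - ⟨h1, h2⟩
        exact absurd h1 (not_lt.2 (le_of_lt h2))
      rw [e, one_smul]
      rfl
    · have e : chiSign (Equiv.swap (0 : Fin 2) 1) d = -(d 0 * d 1).negOnePow := by
        have hf : (Finset.univ.filter fun p : Fin 2 × Fin 2 => p.1 < p.2 ∧
            Equiv.swap (0 : Fin 2) 1 p.2 < Equiv.swap (0 : Fin 2) 1 p.1) = {(0, 1)} := by decide
        rw [chiSign, koszulSign, hf, Finset.prod_singleton, Equiv.Perm.sign_swap (by decide),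
          Equiv.swap_apply_left, Equiv.swap_apply_right, neg_one_mul, mul_comm (d 1)]
      rw [e]
      exact gerstenhaber_symm _ _ _ _
  · rw [algBracket_of_ne hn, algBracket_of_ne hn, smul_zero]

theorem mixedSum_perm (b b' : Bool) {n : ℕ} (σ : Equiv.Perm (Fin n)) {d : Fin n → ℤ}
    {X g : Fin n → List V → V} (hX : ∀ j, IsOperation 𝒱 (d j) (X j))
    (hg : ∀ j, IsOperation 𝒱 (d j + 1) (g j)) :
    mixedSum 𝒱 b b' n (fun i => d (σ i)) (fun i => X (σ i)) (fun i => g (σ i)) =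
      chiSign σ d • mixedSum 𝒱 b b' n d X g := by
  rw [mixedSum, mixedSum, Finset.sum_congr rfl fun a _ => mixedTerm_perm b b' σ a (hX (σ a)) hg,
    ← Finset.smul_sum]
  exact congrArg _ (Equiv.sum_comp σ fun a => mixedTerm 𝒱 b b' n a d (X a) g)

theorem totalBracket_perm {n : ℕ} (σ : Equiv.Perm (Fin n)) {d : Fin n → ℤ}
    {x : Fin n → Summand → List V → V} (hx : ∀ i, x i ∈ AvA 𝒱 (d i)) :
    totalBracket 𝒱 n (fun i => d (σ i)) (fun i => x (σ i)) =
      chiSign σ d • totalBracket 𝒱 n d x := by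
  funext P
  rw [Pi.smul_apply]
  by_cases hP : P = .alg
  · subst hP
    exact algBracket_perm σ d fun i => x i .alg
  · rw [totalBracket_of_ne _ _ hP, totalBracket_of_ne _ _ hP, ← arityPart_units_smul]
    congr 1
    exact mixedSum_perm _ _ σ (fun i => isOperation_alg_of_mem (hx i))
      fun i => isOperation_sidePart (hx i) _

-- The component in `C_A(V)` is the Jacobi identity of the Gerstenhaber bracket. Any other component
-- is the arity part of the identity for `mixedSum` on its side, by `sidePart_totalBracket` applied
-- to the inner bracket.
open Classical in
theorem totalBracket_jacobi {n : ℕ} {d : Fin n → ℤ} {x : Fin n → Summand → List V → V}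
    (hx : ∀ i, x i ∈ AvA 𝒱 (d i)) :
    ∑ i ∈ Finset.univ.filter (fun i : Fin (n + 1) => 1 ≤ (i : ℕ)),
      ∑ σ : Equiv.Perm (Fin n) with IsShuffle i σ,
        (chiSign σ d * ((i : ℤ) * ((n : ℤ) - i)).negOnePow) •
        totalBracket 𝒱 (n - i + 1)
          (Fin.cons (∑ j, d (shuffleLeft i.is_le σ j) + i - 2)
            fun j => d (shuffleRight i.is_le σ j))
          (Fin.cons (totalBracket 𝒱 i (fun j => d (shuffleLeft i.is_le σ j))
            fun j => x (shuffleLeft i.is_le σ j)) fun j => x (shuffleRight i.is_le σ j)) = 0 := by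
  have hcons : ∀ {Y : Type _} {m : ℕ} (F : (Summand → List V → V) → Y) (y : Summand → List V → V)
      (z : Fin m → Summand → List V → V),
      (fun j => F ((Fin.cons y z : Fin (m + 1) → Summand → List V → V) j)) =
        Fin.cons (F y) fun j => F (z j) := fun F y z =>
    funext fun j => Fin.cases rfl (fun j => rfl) j
  have hX := fun i => isOperation_alg_of_mem (hx i)
  funext P
  simp only [Finset.sum_apply, Pi.smul_apply]
  by_cases hP : P = .alg
  · subst hP
    refine Eq.trans ?_ (jacobi_algBracket n hX)
    refine Finset.sum_congr rfl fun i _ => Finset.sum_congr rfl fun σ _ => congrArg _ ?_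
    rw [totalBracket_alg, hcons fun y => y .alg]
    rfl
  · refine Eq.trans ?_ ((congrArg (arityPart P.arities) (jacobi_mixedSum P.side (!P.side) n hX
      fun i => isOperation_sidePart (hx i) P.side)).trans (arityPart_zero _))
    rw [arityPart_sum]
    refine Finset.sum_congr rfl fun i _ => ?_
    rw [arityPart_sum]
    refine Finset.sum_congr rfl fun σ _ => ?_
    rw [arityPart_units_smul, totalBracket_of_ne _ _ hP, hcons fun y => y .alg,
      hcons fun y => sidePart P.side y, sidePart_totalBracket fun i => hx _]
    rfl

end Operations

/-! ### The `L∞`-algebra -/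

instance : Fintype Summand where
  elems := {.alg, .const, .lin, .right, .left}
  complete P := by cases P <;> simp

section Main

variable {k V : Type*} [Field k] [AddCommGroup V] [Module k V] {𝒱 : ℤ → Submodule k V}

theorem map_units_smul_int {M N : Type*} [AddCommGroup M] [AddCommGroup N] [Module k M] [Module k N]
    (f : M →ₗ[k] N) (u : ℤˣ) (x : M) : f (u • x) = u • f x := by
  rw [Units.smul_def, Units.smul_def, map_zsmul]

/-- Degrees in the Jacobi and symmetry identities agree only up to a proof of equality; this lemma
transports along it. -/
theorem lof_congr {a b : ℤ} (h : a = b) {y : AvA 𝒱 a} {z : AvA 𝒱 b}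
    (hyz : (y : Summand → List V → V) = z) :
    DirectSum.lof k ℤ (fun d => AvA 𝒱 d) a y = DirectSum.lof k ℤ (fun d => AvA 𝒱 d) b z := by
  subst h
  rw [Subtype.ext hyz]

/-- The component of an element of `C_AvA(V)` in a summand. -/
def summandPart (P : Summand) {d : ℤ} (x : AvA 𝒱 d) : AvA 𝒱 d :=
  ⟨Pi.single P ((x : Summand → List V → V) P), by
    refine Submodule.mem_pi.2 fun Q _ => ?_
    by_cases h : Q = P
    · subst h
      rw [Pi.single_eq_same]
      exact Submodule.mem_pi.1 x.2 Q trivial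
    · rw [Pi.single_eq_of_ne h]
      exact Submodule.zero_mem _⟩

theorem summandPart_of_ne {P Q : Summand} (h : Q ≠ P) {d : ℤ} (x : AvA 𝒱 d) :
    (summandPart P x : Summand → List V → V) Q = 0 := Pi.single_eq_of_ne h _

theorem sum_summandPart {d : ℤ} (x : AvA 𝒱 d) : ∑ P, summandPart P x = x := by
  refine Subtype.ext ?_
  rw [Submodule.coe_sum]
  exact Finset.univ_sum_single (x : Summand → List V → V)

/-- Every element is the sum of its five components, so a multilinear map is determined by its
values on elements of single summands. -/
theorem ext_of_summands {n : ℕ} {d : Fin n → ℤ} {Y : Type*} [AddCommGroup Y] [Module k Y]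
    {f g : MultilinearMap k (fun i => AvA 𝒱 (d i)) Y}
    (h : ∀ (c : Fin n → Summand) (x : ∀ i, AvA 𝒱 (d i)),
      (∀ i, ∀ P ≠ c i, (x i : Summand → List V → V) P = 0) → f x = g x) : f = g := by
  ext x
  have e : x = fun i => ∑ P, summandPart P (x i) := funext fun i => (sum_summandPart (x i)).symm
  rw [e, f.map_sum, g.map_sum]
  exact Finset.sum_congr rfl fun c _ => h c _ fun i P hP => summandPart_of_ne hP _

variable [DirectSum.Decomposition 𝒱]

theorem IsAveragingOperations.apply_lof
    {l : ∀ n : ℕ, MultilinearMap k (fun _ : Fin n => ⨁ d, AvA 𝒱 d) (⨁ d, AvA 𝒱 d)}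
    (hl : IsAveragingOperations 𝒱 l) (n : ℕ) (d : Fin n → ℤ) (x : ∀ i, AvA 𝒱 (d i)) :
    l n (fun i => DirectSum.lof k ℤ (fun d => AvA 𝒱 d) (d i) (x i)) =
      DirectSum.lof k ℤ (fun d => AvA 𝒱 d) _ (bracketMap 𝒱 n d x) := by
  have h : (l n).compLinearMap (fun i => DirectSum.lof k ℤ (fun d => AvA 𝒱 d) (d i)) =
      (DirectSum.lof k ℤ (fun d => AvA 𝒱 d) _).compMultilinearMap (bracketMap 𝒱 n d) := by
    refine ext_of_summands (k := k) (𝒱 := 𝒱) (d := d) (Y := ⨁ d, AvA 𝒱 d) fun c x hx => ?_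
    obtain ⟨y, hy, e⟩ := hl n c d x hx
    refine e.trans (congrArg (DirectSum.lof k ℤ (fun d => AvA 𝒱 d) _) (Subtype.ext ?_))
    rw [hy]
    exact (totalBracket_eq_averagingBracket (fun i => (x i).2) hx).symm
  exact DFunLike.congr_fun h x

variable (𝒱) in
/-- The `n`-th operation on `C_AvA(V)`. -/
def averagingOperation (n : ℕ) :
    MultilinearMap k (fun _ : Fin n => ⨁ d, AvA 𝒱 d) (⨁ d, AvA 𝒱 d) :=
  MultilinearMap.fromDirectSumEquiv fun d : Fin n → ℤ =>
    (DirectSum.lof k ℤ (fun d => AvA 𝒱 d) _).compMultilinearMap (bracketMap 𝒱 n d)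

theorem averagingOperation_lof (n : ℕ) (d : Fin n → ℤ) (x : ∀ i, AvA 𝒱 (d i)) :
    averagingOperation 𝒱 n (fun i => DirectSum.lof k ℤ (fun d => AvA 𝒱 d) (d i) (x i)) =
      DirectSum.lof k ℤ (fun d => AvA 𝒱 d) _ (bracketMap 𝒱 n d x) :=
  MultilinearMap.fromDirectSumEquiv_lof (R := k) (κ := fun _ => ℤ)
    (M := fun _ d => AvA 𝒱 d) _ d x

theorem existsUnique_isAveragingOperations :
    ∃! l : (∀ n : ℕ, MultilinearMap k (fun _ : Fin n => ⨁ d, AvA 𝒱 d) (⨁ d, AvA 𝒱 d)),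
      IsAveragingOperations 𝒱 l := by
  refine ⟨averagingOperation 𝒱, fun n c d x hx => ⟨bracketMap 𝒱 n d x,
    totalBracket_eq_averagingBracket (fun i => (x i).2) hx, averagingOperation_lof n d x⟩,
    fun l hl => funext fun n => ?_⟩
  refine MultilinearMap.directSum_ext fun d => ?_
  ext x : 1
  exact (hl.apply_lof n d x).trans (averagingOperation_lof n d x).symm

theorem IsAveragingOperations.isLInfinityAlgebra
    {l : ∀ n : ℕ, MultilinearMap k (fun _ : Fin n => ⨁ d, AvA 𝒱 d) (⨁ d, AvA 𝒱 d)}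
    (hl : IsAveragingOperations 𝒱 l) : IsLInfinityAlgebra k (fun d => AvA 𝒱 d) l where
  degree n _ d x := ⟨_, (hl.apply_lof n d x).symm⟩
  antisymm n _ d x σ := by
    rw [hl.apply_lof n d x]
    refine (hl.apply_lof n (fun i => d (σ i)) fun i => x (σ i)).trans ?_
    rw [← map_units_smul_int]
    refine lof_congr (by rw [Equiv.sum_comp σ d]) ?_
    refine (totalBracket_perm σ fun i => (x i).2).trans ?_
    exact (map_units_smul_int (AvA 𝒱 (∑ i, d i + n - 2)).subtype (chiSign σ d)
      (bracketMap 𝒱 n d x)).symm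
  jacobi n _ d x := by
    -- Every term lies in the single degree `|x₁| + ⋯ + |xₙ| + n - 3`, so the identity can be
    -- checked in one homogeneous component.
    have key : ∀ (i : Fin (n + 1)) (σ : Equiv.Perm (Fin n)), ∃ y : AvA 𝒱 (∑ j, d j + n - 3),
        l (n - i + 1) (Fin.cons
          (l i fun a : Fin i => DirectSum.lof k ℤ (fun d => AvA 𝒱 d) _ (x (σ (Fin.castLE i.is_le a))))
          fun b : Fin (n - i) =>
            DirectSum.lof k ℤ (fun d => AvA 𝒱 d) _ (x (σ ⟨i + b, by omega⟩))) =
          DirectSum.lof k ℤ (fun d => AvA 𝒱 d) _ y ∧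
        (y : Summand → List V → V) = totalBracket 𝒱 (n - i + 1)
          (Fin.cons (∑ j, d (shuffleLeft i.is_le σ j) + i - 2)
            fun j => d (shuffleRight i.is_le σ j))
          (Fin.cons (totalBracket 𝒱 i (fun j => d (shuffleLeft i.is_le σ j))
            fun j => (x (shuffleLeft i.is_le σ j) : Summand → List V → V))
            fun j => (x (shuffleRight i.is_le σ j) : Summand → List V → V)) := by
      intro i σ
      let D : Fin (n - i + 1) → ℤ := Fin.cons (∑ j, d (shuffleLeft i.is_le σ j) + i - 2)
        fun j => d (shuffleRight i.is_le σ j)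
      let z : ∀ j, AvA 𝒱 (D j) := Fin.cons (bracketMap 𝒱 i (fun j => d (shuffleLeft i.is_le σ j))
        fun j => x (shuffleLeft i.is_le σ j)) fun j => x (shuffleRight i.is_le σ j)
      have hz : (fun j => (z j : Summand → List V → V)) =
          Fin.cons (totalBracket 𝒱 i (fun j => d (shuffleLeft i.is_le σ j))
            fun j => (x (shuffleLeft i.is_le σ j) : Summand → List V → V))
            fun j => (x (shuffleRight i.is_le σ j) : Summand → List V → V) :=
        funext fun j => Fin.cases rfl (fun j => rfl) j
      have hD : ∑ j, D j + ((n - i + 1 : ℕ) : ℤ) - 2 = ∑ j, d j + n - 3 := by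
        have h1 : ∑ j, d j = ∑ j, d (shuffleLeft i.is_le σ j) + ∑ j, d (shuffleRight i.is_le σ j) := by
          rw [← Equiv.sum_comp σ, ← List.sum_ofFn]
          have e : (List.ofFn fun j => d (σ j)) = (List.ofFn σ).map d := by rw [List.map_ofFn]; rfl
          rw [e, ofFn_shuffle i.is_le σ, List.map_append, List.sum_append, List.map_ofFn,
            List.map_ofFn, List.sum_ofFn, List.sum_ofFn]
          rfl
        rw [Fin.sum_univ_succ, h1]
        simp only [D, Fin.cons_zero, Fin.cons_succ]
        push_cast [Nat.cast_sub i.is_le]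
        ring
      refine ⟨⟨bracketMap 𝒱 _ D z, hD ▸ (bracketMap 𝒱 _ D z).2⟩, ?_, ?_⟩
      · refine Eq.trans (congrArg (l (n - i + 1)) (funext fun j => ?_))
          ((hl.apply_lof (n - i + 1) D z).trans (lof_congr hD rfl))
        refine Fin.cases ?_ (fun j => ?_) j
        · exact hl.apply_lof i (fun j => d (shuffleLeft i.is_le σ j))
            fun j => x (shuffleLeft i.is_le σ j)
        · rfl
      · exact congrArg (totalBracket 𝒱 _ D) hz
    choose y hy hy' using key
    simp only [hy, ← map_units_smul_int, ← map_sum]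
    rw [← map_zero (DirectSum.lof k ℤ (fun d => AvA 𝒱 d) (∑ j, d j + n - 3))]
    refine congrArg _ (Subtype.ext ?_)
    refine Eq.trans ?_ (totalBracket_jacobi fun i => (x i).2)
    rw [Submodule.coe_sum]
    refine Finset.sum_congr rfl fun i _ => ?_
    rw [Submodule.coe_sum]
    refine Finset.sum_congr rfl fun σ _ => ?_
    rw [← hy']
    exact map_units_smul_int (AvA 𝒱 _).subtype _ _

end Main

/-- The explicit formulas define one and only one family of multilinear operations on the graded
space `C_AvA(V)`, and these operations form an `L∞`-algebra. -/
theorem mainTheorem1 {k : Type*} [Field k] {V : Type*} [AddCommGroup V] [Module k V]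
    (𝒱 : ℤ → Submodule k V) [DirectSum.Decomposition 𝒱] :
    (∃! l : (∀ n : ℕ, MultilinearMap k (fun _ : Fin n => ⨁ d, AvA 𝒱 d) (⨁ d, AvA 𝒱 d)),
      IsAveragingOperations 𝒱 l) ∧
    ∀ l : (∀ n : ℕ, MultilinearMap k (fun _ : Fin n => ⨁ d, AvA 𝒱 d) (⨁ d, AvA 𝒱 d)),
      IsAveragingOperations 𝒱 l → IsLInfinityAlgebra k (fun d => AvA 𝒱 d) l :=
  ⟨existsUnique_isAveragingOperations, fun _ hl => hl.isLInfinityAlgebra⟩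

end
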